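/- **Setting.** Let $A\in\mathbb R^{d\times n}$ have full row rank, with its columns grouped into $m$ nonempty, nonzero blocks of sizes $n_1,\dots,n_m$, $\sum_i n_i=n\ge 2$, $n_i=O(1)$. Let $\phi(x)=\sum_i\phi_i(x_i)$ be a barrier whose block Hessians are positive definite on their domains; put $H_x=\nabla^2\phi(x)$ (block-diagonal), let $L_x$ be the lower Cholesky factor of $AH_x^{-1}A^\top$, and $\mathcal W=\mathcal W_x=L_x^{-1}AH_x^{-1/2}$. Let $\mathcal T$ be an elimination tree of $A$ of height $\tau$: a rooted tree on the rows $[d]$ in which each vertex precedes its parent and any two rows that are both nonzero in a common block are in ancestor-descendant relation (one vertex has height 1). Let $\Phi\in\mathbb R^{r\times n}$, $r\ge1$, be the sketching matrix, and $\Phi_S$ the matrix $\Phi$ restricted to the columns in $S$. **Balanced sampling tree.** Order the vertices of $\mathcal T$ by heavy-light decomposition (depth-first preorder, a child with the largest subtree first). Let $\mathcal B$ be a complete binary tree whose leaves, in this order, are the vertices of $\mathcal T$ (complete: every inner node has two children, and leaf depths differ by at most one). Under the leaf of vertex $j$ hang a complete binary tree whose leaves are the coordinates of all blocks whose lowest nonzero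 row in $\mathcal T$ is $j$ (nothing if there are none). The result is $\mathcal S$; $\chi(v)\subseteq[n]$ is the set of coordinates at the leaves below $v$. **BalancedSketch.** For $v\in\mathcal B$ let $\overline\chi(v)\subseteq[d]$ be the vertices of $\mathcal T$ whose leaf lies below $v$; let $\mathcal P(i)$ be the path from $i$ to the root of its tree (ends included), $\Lambda(v)=\bigcup_{i\in\overline\chi(v)}\mathcal P(i)\cap\bigcup_{i\notin\overline\chi(v)}\mathcal P(i)$, $\overline\Lambda(v)=\bigcup_{i\in\overline\chi(v)}\mathcal P(i)\setminus\Lambda(v)$, and let $\Lambda^\clubsuit(u)$ be the lowest $v\in\mathcal B$ with $u\in\overline\Lambda(v)$. $I_S$ is the diagonal $0/1$ matrix of $S$. BalancedSketch keeps $x$, $h\in\mathbb R^d$, a counter $\ell$, Cholesky factors $L[0],\dots,L[\ell]$, matrices $J_v$ ($v\in\mathcal S$), and $Z_v$, $y_v^\triangledown$, time stamps $t_v$ ($v\in\mathcal B$). - *Initialize$(x,h)$*: $\ell\leftarrow0$, $L[0]\leftarrow L_x$, $J_v\leftarrow\Phi_{\chi(v)}H_x^{-1/2}A^\top$, $Z_v\leftarrow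 J_vL[0]^{-\top}$, $y_v^\triangledown\leftarrow Z_v(I-I_{\Lambda(v)})h$, $t_v\leftarrow0$. - *Query$(v)$*: if $v\notin\mathcal B$ return $J_vL[\ell]^{-\top}h$. Otherwise set $Z_v\leftarrow Z_v-(L[\ell]^{-1}(L[\ell]-L[t_v])I_{\Lambda(v)}Z_v^\top)^\top$, $y_v^\triangledown\leftarrow Z_v(I-I_{\Lambda(v)})h$, $t_v\leftarrow\ell$, and return $Z_vI_{\Lambda(v)}h+y_v^\triangledown$. - *Update$(x^{\rm new},h^{\rm new})$*: for each changed block $i$ of $x$: replace $x_i$, set $\ell\leftarrow\ell+1$, $L[\ell]\leftarrow L_x$. For all $v\in\mathcal P(\Lambda^\clubsuit(j))$, $j$ the lowest nonzero row of block $i$, set $Z_v\leftarrow Z_v-(L[\ell-1]^{-1}(L[\ell-1]-L[t_v])I_{\Lambda(v)}Z_v^\top)^\top$, then $Z_v\leftarrow Z_v-(L[\ell]^{-1}(L[\ell]-L[\ell-1])Z_v^\top)^\top$, $y_v^\triangledown\leftarrow Z_v(I-I_{\Lambda(v)})h$, $t_v\leftarrow\ell$. If the Hessian of block $i$ changed,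 then at all nodes $v$ above the leaves of its coordinates set $J_v\leftarrow\Phi_{\chi(v)}H_x^{-1/2}A^\top$ and, if $v\in\mathcal B$, $Z_v\leftarrow J_vL[t_v]^{-\top}$, $y_v^\triangledown\leftarrow Z_v(I-I_{\Lambda(v)})h$. Then for each changed coordinate $j$ of $h$ and all $v\in\mathcal P(\Lambda^\clubsuit(j))$, set $y_v^\triangledown\leftarrow y_v^\triangledown+Z_vI_{\{j\}}(h^{\rm new}-h)$; finally $h\leftarrow h^{\rm new}$. **Cost model.** Time is the number of unit-cost steps of a real random access machine: addition, subtraction and comparison of natural numbers, field operations, comparison and square root of real numbers, access to a memory cell, and evaluation of one entry of some $\nabla^2\phi_i(x_i)^{-1/2}$ each cost one step. $A,\Phi,x,h,\mathcal T$, the vertex order and $\mathcal S$ are given in memory; an update is given by the list of the changed blocks of $x$ and coordinates of $h$ with their new values. Constants depend only on $\max_i n_i$. **Theorem.** 1. For every such $A$ and $\mathcal T$ a balanced sampling tree exists. Every balanced sampling tree has height $O(\log n)$ with a universal constant and, after removing the nodes with $\chi(v)=\emptyset$, is a sampling tree of $\mathbb R^n$: every node has at most two children, the root is labelled $[n]$,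 each leaf has a one-element label, and the nonempty labels of the children of an inner node partition its label. 2. There are three fixed programs (the same for all inputs) that implement BalancedSketch on every balanced sampling tree, keeping $x,h,\ell,L[\ell]$, all $J_v$ ($v\in\mathcal S$), and all $Z_v,y^\triangledown_v,t_v$ ($v\in\mathcal B$) in memory cells whose addresses do not change, such that, after Initialize and any sequence of Updates (to points in the domain) and Queries: - Initialize takes $O(n\tau^2r\log n)$ time; - Update$(x^{\rm new},h^{\rm new})$ takes $O(\|x^{\rm new}-x\|_0\,\tau^2r\log n)+O(\|h^{\rm new}-h\|_0\,r\log n)$ time ($O(1)$ if nothing changes), after which the structure refers to $x^{\rm new},h^{\rm new}$; - Query$(v)$, for any node $v$ of $\mathcal S$, takes $O(\tau^2r)$ time and outputs exactly $\Phi_{\chi(v)}\mathcal W_x^\top h$ for the current $x$ and $h$. -/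

import Mathlib

open scoped Matrix

/-! ### Rooted trees -/

/-- A rooted tree on the vertex type `V`, given by its parent map; the root is its own parent. -/
structure ParentTree (V : Type) where
  root : V
  parent : V → V
  parent_root : parent root = root
  reach_root : ∀ v, ∃ k : ℕ, parent^[k] v = root

namespace ParentTree

/-- The vertices on the path from `v` to the root, both included. -/
def path {V : Type} (T : ParentTree V) (v : V) : Set V := {u | ∃ k : ℕ, T.parent^[k] v = u}

/-- The vertices of the subtree rooted at `v`, including `v`. -/
def below {V : Type} (T : ParentTree V) (v : V) : Set V := {u | v ∈ T.path u}

def children {V : Type} (T : ParentTree V) (v : V) : Set V := {c | c ≠ T.root ∧ T.parent c = v}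

/-- The depth of a vertex; the root has depth 1. -/
noncomputable def depth {V : Type} (T : ParentTree V) (v : V) : ℕ := (T.path v).ncard

/-- The height of a tree; a tree on one vertex has height 1. -/
noncomputable def height {V : Type} [Fintype V] (T : ParentTree V) : ℕ := Finset.univ.sup T.depth

open Classical in
/-- A vertex of `s` of largest depth (the root if `s` is empty). -/
noncomputable def low {V : Type} (T : ParentTree V) (s : Set V) : V :=
  if h : ∃ v ∈ s, ∀ u ∈ s, T.depth u ≤ T.depth v then h.choose else T.root

/-- `σ` (from positions to vertices) is the vertex order of a heavy-light decomposition of `T`: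
a depth-first preorder in which every vertex that has children is followed immediately by a heavy
child, that is, by a child whose subtree has the largest number of vertices. -/
structure IsHeavyLightOrder {d : ℕ} (T : ParentTree (Fin d)) (σ : Equiv.Perm (Fin d)) : Prop where
  contiguous : ∀ v, {p | σ p ∈ T.below v}.OrdConnected
  first : ∀ v, ∀ u ∈ T.below v, σ.symm v ≤ σ.symm u
  heavy : ∀ v, (T.children v).Nonempty → ∃ c ∈ T.children v,
    (∀ c₁ ∈ T.children v, (T.below c₁).ncard ≤ (T.below c).ncard) ∧
      (σ.symm c : ℕ) = (σ.symm v : ℕ) + 1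

end ParentTree

/-- The part of a tree that consists of the nodes in `U`, with the labelling `χ` of the nodes by
sets of coordinates, is a sampling tree, and every node has at most `Δ` children. -/
structure IsSamplingTree {V ι : Type} (S : ParentTree V) (U : Set V) (χ : V → Set ι) (Δ : ℕ) :
    Prop where
  root_mem : S.root ∈ U
  parent_mem : ∀ v ∈ U, S.parent v ∈ U
  degree : ∀ v ∈ U, (S.children v ∩ U).ncard ≤ Δ
  root_label : χ S.root = Set.univ
  leaf_label : ∀ v ∈ U, S.children v ∩ U = ∅ → (χ v).ncard = 1
  child_nonempty : ∀ v ∈ U, (χ v).Nonempty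
  child_disjoint : ∀ v ∈ U, (S.children v ∩ U).PairwiseDisjoint χ
  child_union : ∀ v ∈ U, (S.children v ∩ U).Nonempty → ⋃ c ∈ S.children v ∩ U, χ c = χ v

/-! ### Matrices -/

/-- The Hessian matrix of `φ` at `y`. -/
noncomputable def hessian {k : ℕ} (φ : (Fin k → ℝ) → ℝ) (y : Fin k → ℝ) :
    Matrix (Fin k) (Fin k) ℝ :=
  Matrix.of fun p q => iteratedFDeriv ℝ 2 φ y ![Pi.single p 1, Pi.single q 1]

/-- `M ^ (-1/2)` for a positive definite matrix `M`, through the spectral functional calculus. -/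
noncomputable def invSqrt {k : ℕ} (M : Matrix (Fin k) (Fin k) ℝ) : Matrix (Fin k) (Fin k) ℝ :=
  cfc (fun t : ℝ => (Real.sqrt t)⁻¹) M

/-- `L` is the lower Cholesky factor of `M`. -/
def IsCholesky {d : ℕ} (M L : Matrix (Fin d) (Fin d) ℝ) : Prop :=
  (∀ i j, i < j → L i j = 0) ∧ (∀ i, 0 < L i i) ∧ L * Lᵀ = M

/-- The lower Cholesky factor, which exists and is unique for a positive definite matrix. -/
noncomputable def cholesky {d : ℕ} (M : Matrix (Fin d) (Fin d) ℝ) : Matrix (Fin d) (Fin d) ℝ :=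
  Classical.epsilon (IsCholesky M)

/-- The diagonal 0/1 matrix `I_s`; multiplying by it from the right keeps the columns in `s`. -/
noncomputable def coordProj {ι : Type} [DecidableEq ι] (s : Set ι) : Matrix ι ι ℝ :=
  Matrix.diagonal (s.indicator fun _ => 1)

/-! ### The constraint matrix, its blocks, the barrier, and the multiscale basis -/

/-- The fixed data of a convex program with `d` constraints and `m` column blocks: block sizes, the
constraint matrix, whose columns are indexed by pairs (block, coordinate in the block), and a
barrier `φ i` for every block, whose Hessian is positive definite on its domain. -/
structure ConvexData (d m : ℕ) where
  size : Fin m → ℕ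
  size_pos : ∀ i, 0 < size i
  A : Matrix (Fin d) ((i : Fin m) × Fin (size i)) ℝ
  full_rank : A.rank = d
  block_ne_zero : ∀ i, ∃ j k, A j ⟨i, k⟩ ≠ 0
  dom : (i : Fin m) → Set (Fin (size i) → ℝ)
  φ : (i : Fin m) → (Fin (size i) → ℝ) → ℝ
  hessian_posDef : ∀ i, ∀ y ∈ dom i, (hessian (φ i) y).PosDef

namespace ConvexData

abbrev Coord {d m : ℕ} (P : ConvexData d m) : Type := (i : Fin m) × Fin (P.size i)

/-- Vectors in `ℝ^n`, written block by block. -/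
abbrev Point {d m : ℕ} (P : ConvexData d m) : Type := (i : Fin m) → Fin (P.size i) → ℝ

/-- The number of variables `n`. -/
def n {d m : ℕ} (P : ConvexData d m) : ℕ := ∑ i, P.size i

/-- The rows in which block `i` of the constraint matrix is nonzero. -/
def blockRows {d m : ℕ} (P : ConvexData d m) (i : Fin m) : Set (Fin d) :=
  {j | ∃ k, P.A j ⟨i, k⟩ ≠ 0}

/-- The generalized dual graph of the constraint matrix. -/
def dualGraph {d m : ℕ} (P : ConvexData d m) : SimpleGraph (Fin d) where
  Adj u w := u ≠ w ∧ ∃ i, u ∈ P.blockRows i ∧ w ∈ P.blockRows i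
  symm := ⟨fun _ _ h => ⟨h.1.symm, h.2.imp fun _ hi => ⟨hi.2, hi.1⟩⟩⟩
  loopless := ⟨fun _ h => h.1 rfl⟩

/-- `T` is an elimination tree for the row order `0, 1, …, d - 1`: every vertex is eliminated
before its parent, and adjacent vertices of the dual graph are in ancestor-descendant relation.
This covers the tree whose parent map picks the first later neighbour in the filled graph and the
taller trees obtained by recursive vertex separation. -/
def IsEliminationTree {d m : ℕ} (P : ConvexData d m) (T : ParentTree (Fin d)) : Prop :=
  (∀ v, v ≠ T.root → v < T.parent v) ∧
    ∀ u w, P.dualGraph.Adj u w → u ∈ T.path w ∨ w ∈ T.path u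

/-- The lowest vertex of `T` in the nonzero row pattern of block `i`. -/
noncomputable def blockLow {d m : ℕ} (P : ConvexData d m) (T : ParentTree (Fin d)) (i : Fin m) :
    Fin d :=
  T.low (P.blockRows i)

/-- `x` lies in the domain of the barrier. -/
def Feasible {d m : ℕ} (P : ConvexData d m) (x : P.Point) : Prop := ∀ i, x i ∈ P.dom i

/-- The block-diagonal Hessian `H_x` of the barrier `∑ i, φ i (x i)`. -/
noncomputable def H {d m : ℕ} (P : ConvexData d m) (x : P.Point) : Matrix P.Coord P.Coord ℝ :=
  Matrix.blockDiagonal' fun i => hessian (P.φ i) (x i)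

/-- `H_x ^ (-1/2)`, which is block-diagonal as well. -/
noncomputable def HInvSqrt {d m : ℕ} (P : ConvexData d m) (x : P.Point) :
    Matrix P.Coord P.Coord ℝ :=
  Matrix.blockDiagonal' fun i => invSqrt (hessian (P.φ i) (x i))

/-- The lower Cholesky factor `L_x` of `A H_x⁻¹ Aᵀ`. -/
noncomputable def chol {d m : ℕ} (P : ConvexData d m) (x : P.Point) : Matrix (Fin d) (Fin d) ℝ :=
  cholesky (P.A * (P.H x)⁻¹ * P.Aᵀ)

/-- The multiscale basis `W = L_x⁻¹ A H_x ^ (-1/2)`. -/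
noncomputable def W {d m : ℕ} (P : ConvexData d m) (x : P.Point) : Matrix (Fin d) P.Coord ℝ :=
  (P.chol x)⁻¹ * P.A * P.HInvSqrt x

end ConvexData

/-! ### The balanced sampling tree -/

/-- The combinatorial data of a sampling tree with `N` nodes built from an elimination tree on
`Fin d`: an order of the vertices of the elimination tree, a tree, for every vertex of the
elimination tree a leaf of the upper tree `ℬ`, and for every coordinate a leaf of the whole tree. -/
structure TreeData {d m : ℕ} (P : ConvexData d m) (N : ℕ) where
  order : Equiv.Perm (Fin d)
  tree : ParentTree (Fin N)
  rowLeaf : Fin d → Fin N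
  colLeaf : P.Coord → Fin N

namespace TreeData

/-- The nodes of the upper tree `ℬ`: the leaves that belong to the vertices of the elimination tree
and all their ancestors. -/
def upper {d m N : ℕ} {P : ConvexData d m} (S : TreeData P N) : Set (Fin N) :=
  {v | ∃ j, v ∈ S.tree.path (S.rowLeaf j)}

/-- The label of a node of `ℬ`: the vertices of the elimination tree whose leaf lies below it. -/
def rowLabel {d m N : ℕ} {P : ConvexData d m} (S : TreeData P N) (v : Fin N) : Set (Fin d) :=
  {j | v ∈ S.tree.path (S.rowLeaf j)}

/-- The label `χ v` of a node: the coordinates whose leaf lies below it. -/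
def colLabel {d m N : ℕ} {P : ConvexData d m} (S : TreeData P N) (v : Fin N) : Set P.Coord :=
  {c | v ∈ S.tree.path (S.colLeaf c)}

/-- `S` is a balanced sampling tree built from the elimination tree `T`. The upper tree is a
complete binary tree whose leaves, in this order, are the vertices of `T` in heavy-light order; at
the leaf of vertex `j` hangs a complete binary tree whose leaves are the coordinates in the blocks
whose lowest vertex is `j` (nothing, if there are none). In a complete binary tree every node that
is not a leaf has two children, and the depths of any two leaves differ by at most one. -/
structure IsBalanced {d m N : ℕ} {P : ConvexData d m} (S : TreeData P N)
    (T : ParentTree (Fin d)) : Prop where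
  heavyLight : T.IsHeavyLightOrder S.order
  rowLeaf_inj : Function.Injective S.rowLeaf
  rowLeaf_is_leaf : ∀ j, Disjoint (S.tree.children (S.rowLeaf j)) S.upper
  upper_binary : ∀ v ∈ S.upper, v ∉ Set.range S.rowLeaf →
    S.tree.children v ⊆ S.upper ∧ (S.tree.children v).ncard = 2
  upper_complete : ∃ e, ∀ j, S.tree.depth (S.rowLeaf j) = e ∨ S.tree.depth (S.rowLeaf j) = e + 1
  upper_ordered : ∀ v ∈ S.upper, {p | S.order p ∈ S.rowLabel v}.OrdConnected
  colLeaf_inj : Function.Injective S.colLeaf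
  colLeaf_not_upper : ∀ c, S.colLeaf c ∉ S.upper
  colLeaf_below : ∀ c, S.rowLeaf (P.blockLow T c.1) ∈ S.tree.path (S.colLeaf c)
  colLeaf_is_leaf : ∀ c, S.tree.children (S.colLeaf c) = ∅
  attached_root : ∀ j, (S.tree.children (S.rowLeaf j)).ncard ≤ 1
  attached_empty : ∀ j, (∀ i, P.blockLow T i ≠ j) → S.tree.children (S.rowLeaf j) = ∅
  lower_binary : ∀ v, v ∉ S.upper → v ∉ Set.range S.colLeaf → (S.tree.children v).ncard = 2
  lower_complete : ∀ j, ∃ e, ∀ c : P.Coord, P.blockLow T c.1 = j →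
    S.tree.depth (S.colLeaf c) = e ∨ S.tree.depth (S.colLeaf c) = e + 1

/-- `Λ v`: the vertices of the elimination tree that lie both on the path of a vertex in the label
of `v` and on the path of a vertex outside it. -/
def Lam {d m N : ℕ} {P : ConvexData d m} (S : TreeData P N) (T : ParentTree (Fin d)) (v : Fin N) :
    Set (Fin d) :=
  (⋃ i ∈ S.rowLabel v, T.path i) ∩ ⋃ i ∈ (S.rowLabel v)ᶜ, T.path i

/-- `Λbar v`: the columns that are kept up to date at `v`. -/
def LamBar {d m N : ℕ} {P : ConvexData d m} (S : TreeData P N) (T : ParentTree (Fin d))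
    (v : Fin N) : Set (Fin d) :=
  (⋃ i ∈ S.rowLabel v, T.path i) \ S.Lam T v

/-- `Λ♣ u`: the lowest node of `ℬ` at which column `u` is kept up to date. -/
noncomputable def club {d m N : ℕ} {P : ConvexData d m} (S : TreeData P N) (T : ParentTree (Fin d))
    (u : Fin d) : Fin N :=
  S.tree.low {v | v ∈ S.upper ∧ u ∈ S.LamBar T v}

end TreeData

/-! ### The data structure BalancedSketch -/

/-- The members of BalancedSketch: the vectors `x` and `h`, the time counter `ℓ`, the list of
Cholesky factors `L[t]`, and at every node `v` the matrices `J v` and `Z v`, the vector `y▽`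
(here `y v`) and the time stamp `t v`. Only nodes of `ℬ` use `Z`, `y` and `t`. -/
structure Sketch {d m : ℕ} (P : ConvexData d m) (r N : ℕ) where
  x : P.Point
  h : Fin d → ℝ
  ℓ : ℕ
  L : ℕ → Matrix (Fin d) (Fin d) ℝ
  J : Fin N → Matrix (Fin r) (Fin d) ℝ
  Z : Fin N → Matrix (Fin r) (Fin d) ℝ
  y : Fin N → Fin r → ℝ
  t : Fin N → ℕ

/-- What BalancedSketch is built on: the elimination tree, the balanced sampling tree, and the
sketching matrix `Φ`. -/
structure SketchParams {d m : ℕ} (P : ConvexData d m) (r N : ℕ) where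
  T : ParentTree (Fin d)
  S : TreeData P N
  Φ : Matrix (Fin r) P.Coord ℝ

namespace SketchParams

/-- `Φ_{χ v} Wᵀ h`, the sketch at node `v`. -/
noncomputable def sketchAt {d m r N : ℕ} {P : ConvexData d m} (Q : SketchParams P r N)
    (x : P.Point) (h : Fin d → ℝ) (v : Fin N) : Fin r → ℝ :=
  (Q.Φ * coordProj (Q.S.colLabel v) * (P.W x)ᵀ) *ᵥ h

/-- `Φ_{χ v} H_x ^ (-1/2) Aᵀ`. -/
noncomputable def jMatrix {d m r N : ℕ} {P : ConvexData d m} (Q : SketchParams P r N)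
    (x : P.Point) (v : Fin N) : Matrix (Fin r) (Fin d) ℝ :=
  Q.Φ * coordProj (Q.S.colLabel v) * P.HInvSqrt x * P.Aᵀ

/-- `Z_v (I - I_{Λ v}) h`. -/
noncomputable def yDown {d m r N : ℕ} {P : ConvexData d m} (Q : SketchParams P r N)
    (v : Fin N) (Z : Matrix (Fin r) (Fin d) ℝ) (h : Fin d → ℝ) : Fin r → ℝ :=
  (Z * (1 - coordProj (Q.S.Lam Q.T v))) *ᵥ h

/-- The procedure Initialize. -/
noncomputable def start {d m r N : ℕ} {P : ConvexData d m} (Q : SketchParams P r N)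
    (x : P.Point) (h : Fin d → ℝ) : Sketch P r N where
  x := x
  h := h
  ℓ := 0
  L := fun _ => P.chol x
  J := fun v => Q.jMatrix x v
  Z := fun v => Q.jMatrix x v * ((P.chol x)⁻¹)ᵀ
  y := fun v => Q.yDown v (Q.jMatrix x v * ((P.chol x)⁻¹)ᵀ) h
  t := fun _ => 0

/-- `Z_v - (L⁻¹ ΔL Z_vᵀ)ᵀ`. -/
noncomputable def correct {d r : ℕ} (L ΔL : Matrix (Fin d) (Fin d) ℝ)
    (Z : Matrix (Fin r) (Fin d) ℝ) : Matrix (Fin r) (Fin d) ℝ :=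
  Z - (L⁻¹ * ΔL * Zᵀ)ᵀ

open Classical in
/-- The procedure Query: the returned vector and the new state. -/
noncomputable def query {d m r N : ℕ} {P : ConvexData d m} (Q : SketchParams P r N)
    (v : Fin N) (D : Sketch P r N) : (Fin r → ℝ) × Sketch P r N :=
  if v ∈ Q.S.upper then
    let Zv := correct (D.L D.ℓ) ((D.L D.ℓ - D.L (D.t v)) * coordProj (Q.S.Lam Q.T v)) (D.Z v)
    let yv := Q.yDown v Zv D.h
    ((Zv * coordProj (Q.S.Lam Q.T v)) *ᵥ D.h + yv,
      { D with
        Z := Function.update D.Z v Zv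
        y := Function.update D.y v yv
        t := Function.update D.t v D.ℓ })
  else
    ((D.J v * ((D.L D.ℓ)⁻¹)ᵀ) *ᵥ D.h, D)

open Classical in
/-- The procedure UpdateL on the node set `s`; it is called after `ℓ` has been increased. -/
noncomputable def updateL {d m r N : ℕ} {P : ConvexData d m} (Q : SketchParams P r N)
    (s : Set (Fin N)) (D : Sketch P r N) : Sketch P r N :=
  let Znew : Fin N → Matrix (Fin r) (Fin d) ℝ := fun v =>
    correct (D.L D.ℓ) (D.L D.ℓ - D.L (D.ℓ - 1))
      (correct (D.L (D.ℓ - 1))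
        ((D.L (D.ℓ - 1) - D.L (D.t v)) * coordProj (Q.S.Lam Q.T v)) (D.Z v))
  { D with
    Z := fun v => if v ∈ s then Znew v else D.Z v
    y := fun v => if v ∈ s then Q.yDown v (Znew v) D.h else D.y v
    t := fun v => if v ∈ s then D.ℓ else D.t v }

open Classical in
/-- The procedure UpdateH: `D.x` is already the new point and `xold` is the old one. The nodes above
the leaves of the coordinates in the blocks whose Hessian has changed are recomputed. -/
noncomputable def updateH {d m r N : ℕ} {P : ConvexData d m} (Q : SketchParams P r N)
    (xold : P.Point) (D : Sketch P r N) : Sketch P r N :=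
  let s : Set (Fin N) := {v | ∃ i k,
    hessian (P.φ i) (D.x i) ≠ hessian (P.φ i) (xold i) ∧ v ∈ Q.S.tree.path (Q.S.colLeaf ⟨i, k⟩)}
  let Znew : Fin N → Matrix (Fin r) (Fin d) ℝ := fun v => Q.jMatrix D.x v * ((D.L (D.t v))⁻¹)ᵀ
  { D with
    J := fun v => if v ∈ s then Q.jMatrix D.x v else D.J v
    Z := fun v => if v ∈ s ∧ v ∈ Q.S.upper then Znew v else D.Z v
    y := fun v => if v ∈ s ∧ v ∈ Q.S.upper then Q.yDown v (Znew v) D.h else D.y v }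

/-- The procedure UpdateBlock: block `i` of `x` becomes `xi`. -/
noncomputable def updateBlock {d m r N : ℕ} {P : ConvexData d m} (Q : SketchParams P r N)
    (i : Fin m) (xi : Fin (P.size i) → ℝ) (D : Sketch P r N) : Sketch P r N :=
  let xnew : P.Point := Function.update D.x i xi
  let D₁ : Sketch P r N :=
    { D with
      ℓ := D.ℓ + 1
      x := xnew
      L := Function.update D.L (D.ℓ + 1) (P.chol xnew) }
  Q.updateH D.x (Q.updateL (Q.S.tree.path (Q.S.club Q.T (P.blockLow Q.T i))) D₁)

open Classical in
/-- The loop body of Update for coordinate `j` of `h`, which changes from `D.h j` to `hnew j`; the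
member `h` itself is replaced after the loop. -/
noncomputable def updateCoord {d m r N : ℕ} {P : ConvexData d m} (Q : SketchParams P r N)
    (hnew : Fin d → ℝ) (j : Fin d) (D : Sketch P r N) : Sketch P r N :=
  { D with
    y := fun v =>
      if v ∈ Q.S.tree.path (Q.S.club Q.T j) then
        D.y v + (D.Z v * coordProj {j}) *ᵥ (hnew - D.h)
      else D.y v }

/-- The procedure Update, where the lists enumerate the changed blocks of `x` and the changed
coordinates of `h`. -/
noncomputable def update {d m r N : ℕ} {P : ConvexData d m} (Q : SketchParams P r N)
    (xnew : P.Point) (hnew : Fin d → ℝ) (lx : List (Fin m)) (lh : List (Fin d))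
    (D : Sketch P r N) : Sketch P r N :=
  let D₁ := lx.foldl (fun E i => Q.updateBlock i (xnew i) E) D
  let D₂ := lh.foldl (fun E j => Q.updateCoord hnew j E) D₁
  { D₂ with h := hnew }

end SketchParams

/-! ### A real random access machine with unit costs

Programs are finite texts in an imperative language. The memory consists of cells that hold natural
numbers and cells that hold real numbers; a cell is addressed by the number of an array, which is
written in the program, and three indices, which are computed. Natural numbers can be added,
subtracted and compared, real numbers can be added, subtracted, multiplied, divided, compared, and
square roots can be taken. Every operation costs one step. -/

inductive NExp : Type
  | const (c : ℕ)
  | get (a : ℕ) (i j k : NExp)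
  | plus (e f : NExp)
  | minus (e f : NExp)

inductive RExp : Type
  | const (c : ℕ)
  | get (a : ℕ) (i j k : NExp)
  | plus (e f : RExp)
  | minus (e f : RExp)
  | times (e f : RExp)
  | divide (e f : RExp)
  | root (e : RExp)
  | hess (i p q : NExp)

inductive BExp : Type
  | nlt (e f : NExp)
  | rlt (e f : RExp)
  | neg (b : BExp)
  | conj (b c : BExp)

inductive Cmd : Type
  | skip
  | setNat (a : ℕ) (i j k : NExp) (e : NExp)
  | setReal (a : ℕ) (i j k : NExp) (e : RExp)
  | seq (c₁ c₂ : Cmd)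
  | cond (b : BExp) (c₁ c₂ : Cmd)
  | loop (b : BExp) (c : Cmd)

@[ext]
structure Mem where
  nat : ℕ → ℕ → ℕ → ℕ → ℕ
  real : ℕ → ℕ → ℕ → ℕ → ℝ

/-- The barrier oracle: the block number `i`, the coordinates of a point `y` of that block, and two
positions `p`, `q` are mapped to the entry `(p, q)` of `∇²φ_i(y) ^ (-1/2)`. -/
abbrev Oracle : Type := ℕ → (ℕ → ℝ) → ℕ → ℕ → ℝ

namespace NExp

def eval (M : Mem) : NExp → ℕ
  | const c => c
  | get a i j k => M.nat a (i.eval M) (j.eval M) (k.eval M)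
  | plus e f => e.eval M + f.eval M
  | minus e f => e.eval M - f.eval M

def cost : NExp → ℕ
  | const _ => 1
  | get _ i j k => i.cost + j.cost + k.cost + 1
  | plus e f => e.cost + f.cost + 1
  | minus e f => e.cost + f.cost + 1

end NExp

namespace RExp

/-- The oracle is applied to the point that is stored in row `i` of the real array `0`. -/
noncomputable def eval (O : Oracle) (M : Mem) : RExp → ℝ
  | const c => c
  | get a i j k => M.real a (i.eval M) (j.eval M) (k.eval M)
  | plus e f => e.eval O M + f.eval O M
  | minus e f => e.eval O M - f.eval O M
  | times e f => e.eval O M * f.eval O M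
  | divide e f => e.eval O M / f.eval O M
  | root e => Real.sqrt (e.eval O M)
  | hess i p q => O (i.eval M) (fun k => M.real 0 (i.eval M) k 0) (p.eval M) (q.eval M)

def cost : RExp → ℕ
  | const _ => 1
  | get _ i j k => i.cost + j.cost + k.cost + 1
  | plus e f => e.cost + f.cost + 1
  | minus e f => e.cost + f.cost + 1
  | times e f => e.cost + f.cost + 1
  | divide e f => e.cost + f.cost + 1
  | root e => e.cost + 1
  | hess i p q => i.cost + p.cost + q.cost + 1

end RExp

namespace BExp

def eval (O : Oracle) (M : Mem) : BExp → Prop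
  | nlt e f => e.eval M < f.eval M
  | rlt e f => e.eval O M < f.eval O M
  | neg b => ¬ b.eval O M
  | conj b c => b.eval O M ∧ c.eval O M

def cost : BExp → ℕ
  | nlt e f => e.cost + f.cost + 1
  | rlt e f => e.cost + f.cost + 1
  | neg b => b.cost + 1
  | conj b c => b.cost + c.cost + 1

end BExp

namespace Mem

def setNat (M : Mem) (a i j k c : ℕ) : Mem where
  nat := fun a₁ i₁ j₁ k₁ =>
    if a₁ = a ∧ i₁ = i ∧ j₁ = j ∧ k₁ = k then c else M.nat a₁ i₁ j₁ k₁
  real := M.real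

def setReal (M : Mem) (a i j k : ℕ) (c : ℝ) : Mem where
  nat := M.nat
  real := fun a₁ i₁ j₁ k₁ =>
    if a₁ = a ∧ i₁ = i ∧ j₁ = j ∧ k₁ = k then c else M.real a₁ i₁ j₁ k₁

end Mem

/-- `Exec O c M t M₁`: with the oracle `O`, the program `c`, started on the memory `M`, halts after
`t` steps with the memory `M₁`. -/
inductive Exec (O : Oracle) : Cmd → Mem → ℕ → Mem → Prop
  | skip (M : Mem) : Exec O Cmd.skip M 1 M
  | setNat (M : Mem) (a : ℕ) (i j k e : NExp) :
      Exec O (Cmd.setNat a i j k e) M (i.cost + j.cost + k.cost + e.cost + 1)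
        (M.setNat a (i.eval M) (j.eval M) (k.eval M) (e.eval M))
  | setReal (M : Mem) (a : ℕ) (i j k : NExp) (e : RExp) :
      Exec O (Cmd.setReal a i j k e) M (i.cost + j.cost + k.cost + e.cost + 1)
        (M.setReal a (i.eval M) (j.eval M) (k.eval M) (e.eval O M))
  | seq (c₁ c₂ : Cmd) (M₁ M₂ M₃ : Mem) (t₁ t₂ : ℕ) :
      Exec O c₁ M₁ t₁ M₂ → Exec O c₂ M₂ t₂ M₃ → Exec O (Cmd.seq c₁ c₂) M₁ (t₁ + t₂) M₃
  | cond_true (b : BExp) (c₁ c₂ : Cmd) (M M₁ : Mem) (t : ℕ) :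
      b.eval O M → Exec O c₁ M t M₁ → Exec O (Cmd.cond b c₁ c₂) M (b.cost + t + 1) M₁
  | cond_false (b : BExp) (c₁ c₂ : Cmd) (M M₁ : Mem) (t : ℕ) :
      ¬ b.eval O M → Exec O c₂ M t M₁ → Exec O (Cmd.cond b c₁ c₂) M (b.cost + t + 1) M₁
  | loop_stop (b : BExp) (c : Cmd) (M : Mem) :
      ¬ b.eval O M → Exec O (Cmd.loop b c) M (b.cost + 1) M
  | loop_step (b : BExp) (c : Cmd) (M₁ M₂ M₃ : Mem) (t₁ t₂ : ℕ) :
      b.eval O M₁ → Exec O c M₁ t₁ M₂ → Exec O (Cmd.loop b c) M₂ t₂ M₃ →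
        Exec O (Cmd.loop b c) M₁ (b.cost + t₁ + t₂ + 1) M₃

/-! ### Input, output, and the memory representation of BalancedSketch -/

/-- A finite vector as a function on `ℕ` with default value `0`. -/
def pad {α : Type} [Zero α] {k : ℕ} (f : Fin k → α) (i : ℕ) : α :=
  if hi : i < k then f ⟨i, hi⟩ else 0

/-- The oracle that belongs to the barriers of `P`. -/
noncomputable def ConvexData.oracle {d m : ℕ} (P : ConvexData d m) : Oracle := fun i y p q =>
  pad (fun i₁ : Fin m =>
    pad (fun p₁ => pad (invSqrt (hessian (P.φ i₁) fun k => y k) p₁) q) p) i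

namespace SketchParams

/-- The memory on which Initialize is started. Natural arrays: `0` holds the numbers `d`, `m`, `r`,
`N`; `1` the block sizes; `2` and `3` the parents in the elimination tree and in the sampling tree;
`4` and `5` the leaves of the vertices and of the coordinates; `6` the heavy-light order. Real
arrays: `0` holds `x`, `1` holds `h`, `2` holds `A`, `3` holds `Φ`. All other arrays are zero. -/
noncomputable def inputMem {d m r N : ℕ} {P : ConvexData d m} (Q : SketchParams P r N)
    (x : P.Point) (h : Fin d → ℝ) : Mem where
  nat := fun a i j _ => match a with
    | 0 => pad ![d, m, r, N] i
    | 1 => pad P.size i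
    | 2 => pad (fun u => (Q.T.parent u : ℕ)) i
    | 3 => pad (fun v => (Q.S.tree.parent v : ℕ)) i
    | 4 => pad (fun u => (Q.S.rowLeaf u : ℕ)) i
    | 5 => pad (fun b => pad (fun k => (Q.S.colLeaf ⟨b, k⟩ : ℕ)) j) i
    | 6 => pad (fun p => (Q.S.order p : ℕ)) i
    | _ => 0
  real := fun a i j k => match a with
    | 0 => pad (fun b => pad (x b) j) i
    | 1 => pad h i
    | 2 => pad (fun u => pad (fun b => pad (fun l => P.A u ⟨b, l⟩) k) j) i
    | 3 => pad (fun q => pad (fun b => pad (fun l => Q.Φ q ⟨b, l⟩) k) j) i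
    | _ => 0

end SketchParams

namespace Mem

/-- The argument of Query is passed in the natural array `7`. -/
def passQuery {N : ℕ} (M : Mem) (v : Fin N) : Mem where
  nat := Function.update M.nat 7 fun _ _ _ => v
  real := M.real

/-- The arguments of Update are passed as the lists of what changes: the natural array `8` holds the
lengths of the two lists, the natural arrays `9` and `10` hold the lists, and the real arrays `5`
and `6` hold the new values of the listed blocks and coordinates. -/
def passUpdate {d m : ℕ} {P : ConvexData d m} (M : Mem) (xnew : P.Point) (hnew : Fin d → ℝ)
    (lx : List (Fin m)) (lh : List (Fin d)) : Mem where
  nat := fun a i j k => match a with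
    | 8 => pad ![lx.length, lh.length] i
    | 9 => pad (fun s => (lx.get s : ℕ)) i
    | 10 => pad (fun s => (lh.get s : ℕ)) i
    | _ => M.nat a i j k
  real := fun a i j k => match a with
    | 5 => pad (fun s => pad (xnew (lx.get s)) j) i
    | 6 => pad (fun s => hnew (lh.get s)) i
    | _ => M.real a i j k

/-- Query leaves its result in the real array `4`. -/
def output {r : ℕ} (M : Mem) : Fin r → ℝ := fun q => M.real 4 q 0 0

end Mem

structure Cell where
  array : ℕ
  i : ℕ
  j : ℕ
  k : ℕ

/-- The cells in which the members of BalancedSketch are kept. Entries that are always zero may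
share a cell. -/
structure Layout (d m r N : ℕ) where
  x : Fin m → ℕ → Cell
  h : Fin d → Cell
  ℓ : Cell
  L : Fin d → Fin d → Cell
  J : Fin N → Fin r → Fin d → Cell
  Z : Fin N → Fin r → Fin d → Cell
  y : Fin N → Fin r → Cell
  t : Fin N → Cell

def Mem.natAt (M : Mem) (c : Cell) : ℕ := M.nat c.array c.i c.j c.k

def Mem.realAt (M : Mem) (c : Cell) : ℝ := M.real c.array c.i c.j c.k

/-- The memory `M` holds the state `D` in the cells given by the layout: `x`, `h`, `ℓ`, the current
Cholesky factor, `J` at all nodes, and `Z`, `y`, `t` at the nodes of `ℬ`. -/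
structure Layout.Holds {d m r N : ℕ} {P : ConvexData d m} (lay : Layout d m r N)
    (S : TreeData P N) (M : Mem) (D : Sketch P r N) : Prop where
  x_eq : ∀ i (k : Fin (P.size i)), M.realAt (lay.x i k) = D.x i k
  h_eq : ∀ j, M.realAt (lay.h j) = D.h j
  ℓ_eq : M.natAt lay.ℓ = D.ℓ
  L_eq : ∀ i j, M.realAt (lay.L i j) = D.L D.ℓ i j
  J_eq : ∀ v q j, M.realAt (lay.J v q j) = D.J v q j
  Z_eq : ∀ v ∈ S.upper, ∀ q j, M.realAt (lay.Z v q j) = D.Z v q j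
  y_eq : ∀ v ∈ S.upper, ∀ q, M.realAt (lay.y v q) = D.y v q
  t_eq : ∀ v ∈ S.upper, M.natAt (lay.t v) = D.t v

/-- The number of coordinates in which two points differ. -/
noncomputable def ConvexData.diffCount {d m : ℕ} (P : ConvexData d m) (x x₁ : P.Point) : ℕ :=
  {c : P.Coord | x₁ c.1 c.2 ≠ x c.1 c.2}.ncard

/-!
**The tree.** At a level above the leaves of a complete binary tree every node has two children, so
the number of leaves below the root is at least two to the power of the height, up to a constant
factor (`TreeData.two_pow_le_ncard_label`). There are at most `n` rows and `n` coordinates, and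
every node outside the upper tree lies above a coordinate, so the height is `O(log n)`. For the
existence, a depth-first preorder with heavy children first is built by induction on the size of
subtrees, and complete binary trees are stored as heaps (`exists_isBalanced`).

**The data structure.** The rows of a block lie on one path of the elimination tree, so a Cholesky
factor `L` of `A H_x⁻¹ Aᵀ` has column `u` supported on the path of `u` (`PathSupported`), and a
change of block `i` changes only the columns on the path of the lowest row of the block
(`IsEliminationTree.chol_update`). All members of BalancedSketch are controlled by one invariant,
`Z_v L[t_v]ᵀ = J_v` together with `y_v = Z_v (I - I_{Λ v}) h` and the agreement of the columns
outside `Λ v` that matter at `v` with those of the current factor (`SketchParams.Inv`). Every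
correction `Z - (L⁻¹ ΔL Zᵀ)ᵀ` moves this identity from one factor to another
(`SketchParams.correct_mul`), which gives the correctness of Query and Update.

**The programs.** Since the invariant determines `Z_v`, a program need not follow the matrix
formulas: it keeps `B_v`, the columns of `L[t_v]` that matter at `v`, next to `Z_v`, and whenever
the defect of `B_v z = J_v` is supported on one path, for a row `z` of `Z_v`, one triangular solve
along this path, of `O(τ²)` steps, repairs the row (`Runs.correctRow`). Two facts keep the number of
such solves constant at every node:
* the subtrees of the elimination tree are intervals of the heavy-light order, so `Λ v` is covered
  by the paths of the first and the last row below `v` (`Lam_subset`);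
* membership in `Λ v` is decided by comparing the number of rows below `u` with the number of those
  that are also below `v` (`NodeTables.mem_Lam_iff`).

The Cholesky factor changes by rank one terms, each of which is absorbed by plane rotations along a
path (`gram_rotate`, `Runs.rank1`); when a block is replaced its new columns are added before the
old ones are removed, so that the Gram matrix stays positive definite and no pivot vanishes. The
same rotations build the factor from the zero matrix, which is how Initialize works. A change of a
block costs `O(τ² r)` at each of the `O(log n)` nodes above a leaf (`Runs.updBlock`), a change of a
coordinate of `h` costs `O(r)` at each of them (`Runs.updCoord`), and a query concerns one node.

Programs are analysed by the predicate `Runs`, a total correctness triple with a bound for the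
number of steps. The arrays to which a program writes are computed from its text, so that facts on
other arrays carry over without an argument (`Agree`). In `Represents` the memory and a state of
BalancedSketch are related.
-/

/-! ### Paths in rooted trees -/

namespace ParentTree

variable {V : Type} (T : ParentTree V)

theorem mem_path_self (v : V) : v ∈ T.path v := ⟨0, rfl⟩

theorem iterate_mem_path (v : V) (k : ℕ) : T.parent^[k] v ∈ T.path v := ⟨k, rfl⟩

theorem parent_mem_path (v : V) : T.parent v ∈ T.path v := ⟨1, rfl⟩

theorem root_mem_path (v : V) : T.root ∈ T.path v := T.reach_root v

variable {T}

theorem path_trans {u v w : V} (h₁ : w ∈ T.path u) (h₂ : u ∈ T.path v) : w ∈ T.path v := by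
  obtain ⟨k, rfl⟩ := h₁
  obtain ⟨l, rfl⟩ := h₂
  exact ⟨k + l, by rw [Function.iterate_add_apply]⟩

theorem path_subset {u v : V} (h : u ∈ T.path v) : T.path u ⊆ T.path v := fun _ hw =>
  path_trans hw h

/-- Two vertices on one path are comparable. -/
theorem path_chain {u v w : V} (h₁ : u ∈ T.path v) (h₂ : w ∈ T.path v) :
    u ∈ T.path w ∨ w ∈ T.path u := by
  obtain ⟨k, rfl⟩ := h₁
  obtain ⟨l, rfl⟩ := h₂
  rcases le_total k l with h | h
  · right
    exact ⟨l - k, by rw [← Function.iterate_add_apply, Nat.sub_add_cancel h]⟩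
  · left
    exact ⟨k - l, by rw [← Function.iterate_add_apply, Nat.sub_add_cancel h]⟩

variable (T)

theorem iterate_root (k : ℕ) : T.parent^[k] T.root = T.root :=
  Function.iterate_fixed T.parent_root k

theorem path_root : T.path T.root = {T.root} := by
  ext u
  constructor
  · rintro ⟨k, rfl⟩
    exact T.iterate_root k
  · rintro rfl
    exact T.mem_path_self _

variable {T}

/-- A tree has no cycles. -/
theorem not_mem_path_parent {v : V} (hv : v ≠ T.root) : v ∉ T.path (T.parent v) := by
  rintro ⟨k, hk⟩
  rw [← Function.iterate_succ_apply] at hk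
  obtain ⟨l, hl⟩ := T.reach_root v
  have h₁ : T.parent^[(k + 1) * (l + 1)] v = v := by
    rw [Function.iterate_mul]
    exact Function.iterate_fixed hk _
  have h₂ : T.parent^[(k + 1) * (l + 1)] v = T.root := by
    have : (k + 1) * (l + 1) = ((k + 1) * (l + 1) - l) + l := by
      have : l ≤ (k + 1) * (l + 1) := by nlinarith
      omega
    rw [this, Function.iterate_add_apply, hl, T.iterate_root]
  exact hv (h₁.symm.trans h₂)

theorem parent_ne {v : V} (hv : v ≠ T.root) : T.parent v ≠ v := fun h =>
  not_mem_path_parent hv (by rw [h]; exact T.mem_path_self v)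

theorem path_eq_insert (v : V) : T.path v = insert v (T.path (T.parent v)) := by
  ext u
  constructor
  · rintro ⟨k, rfl⟩
    rcases k with _ | k
    · exact Or.inl rfl
    · exact Or.inr ⟨k, by rw [Function.iterate_succ_apply]⟩
  · rintro (rfl | h)
    · exact T.mem_path_self _
    · exact path_trans h (T.parent_mem_path v)

variable (T)

theorem path_finite (v : V) : (T.path v).Finite := by
  obtain ⟨l, hl⟩ := T.reach_root v
  refine Set.Finite.subset ((Finset.range (l + 1)).finite_toSet.image fun k => T.parent^[k] v) ?_
  rintro u ⟨k, rfl⟩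
  rcases le_or_gt k l with h | h
  · exact ⟨k, by simpa using by omega, rfl⟩
  · refine ⟨l, by simp, ?_⟩
    have : k = (k - l) + l := by omega
    rw [this, Function.iterate_add_apply, hl, T.iterate_root]
    exact hl

theorem depth_root : T.depth T.root = 1 := by
  rw [depth, path_root, Set.ncard_singleton]

variable {T}

theorem depth_eq_succ {v : V} (hv : v ≠ T.root) : T.depth v = T.depth (T.parent v) + 1 := by
  rw [depth, path_eq_insert, Set.ncard_insert_of_notMem (not_mem_path_parent hv) (T.path_finite _)]
  rfl

variable (T)

theorem depth_pos (v : V) : 0 < T.depth v :=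
  (Set.ncard_pos (T.path_finite v)).2 ⟨v, T.mem_path_self v⟩

theorem depth_iterate (v : V) (k : ℕ) (hk : k < T.depth v) :
    T.depth (T.parent^[k] v) = T.depth v - k := by
  induction k with
  | zero => rfl
  | succ k ih =>
    rw [Function.iterate_succ_apply']
    have h := ih (by omega)
    have hne : T.parent^[k] v ≠ T.root := fun h' => by
      rw [h', depth_root] at h
      omega
    have := depth_eq_succ hne
    omega

theorem iterate_depth_pred (v : V) : T.parent^[T.depth v - 1] v = T.root := by
  by_contra h
  have h₁ := T.depth_iterate v (T.depth v - 1) (by have := T.depth_pos v; omega)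
  have h₂ := depth_eq_succ h
  have := T.depth_pos (T.parent (T.parent^[T.depth v - 1] v))
  omega

theorem iterate_ne_root {v : V} {k : ℕ} (hk : k + 1 < T.depth v) : T.parent^[k] v ≠ T.root :=
  fun h => by
    have := T.depth_iterate v k (by omega)
    rw [h, depth_root] at this
    omega

theorem mem_path_iff {u v : V} : u ∈ T.path v ↔ ∃ k < T.depth v, T.parent^[k] v = u := by
  constructor
  · rintro ⟨k, rfl⟩
    rcases lt_or_ge k (T.depth v) with h | h
    · exact ⟨k, h, rfl⟩
    · refine ⟨T.depth v - 1, by have := T.depth_pos v; omega, ?_⟩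
      have : k = (k - (T.depth v - 1)) + (T.depth v - 1) := by omega
      rw [this, Function.iterate_add_apply, T.iterate_depth_pred, T.iterate_root]
  · rintro ⟨k, -, rfl⟩
    exact ⟨k, rfl⟩

theorem iterate_injOn {v : V} {k l : ℕ} (hk : k < T.depth v) (hl : l < T.depth v)
    (h : T.parent^[k] v = T.parent^[l] v) : k = l := by
  have h₁ := T.depth_iterate v k hk
  have h₂ := T.depth_iterate v l hl
  rw [h] at h₁
  omega

variable {T}

theorem depth_le_of_mem_path {u v : V} (h : u ∈ T.path v) : T.depth u ≤ T.depth v :=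
  Set.ncard_le_ncard (path_subset h) (T.path_finite v)

theorem eq_of_mem_path_of_depth_le {u v : V} (h : u ∈ T.path v) (hd : T.depth v ≤ T.depth u) :
    u = v := by
  obtain ⟨k, hk, rfl⟩ := T.mem_path_iff.1 h
  rw [T.depth_iterate v k hk] at hd
  have : k = 0 := by omega
  rw [this]
  rfl

theorem eq_of_mem_path_of_depth_eq {u v w : V} (h₁ : u ∈ T.path v) (h₂ : w ∈ T.path v)
    (hd : T.depth u = T.depth w) : u = w := by
  rcases path_chain h₁ h₂ with h | h
  · exact eq_of_mem_path_of_depth_le h hd.ge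
  · exact (eq_of_mem_path_of_depth_le h hd.le).symm

theorem depth_of_mem_children {v c : V} (h : c ∈ T.children v) : T.depth c = T.depth v + 1 := by
  rw [depth_eq_succ h.1, h.2]

theorem mem_path_of_mem_children {v c : V} (h : c ∈ T.children v) : v ∈ T.path c := by
  have := T.parent_mem_path c
  rwa [h.2] at this

/-- The path from `u` to a proper ancestor `v` enters `v` through a child of `v`. -/
theorem exists_child_of_mem_path {u v : V} (h : v ∈ T.path u) (hne : v ≠ u) :
    ∃ c ∈ T.children v, c ∈ T.path u := by
  obtain ⟨k, hk, rfl⟩ := T.mem_path_iff.1 h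
  rcases k with _ | k
  · exact absurd rfl hne
  · exact ⟨T.parent^[k] u, ⟨T.iterate_ne_root hk, by rw [Function.iterate_succ_apply']⟩, k, rfl⟩

theorem child_unique {u v c₁ c₂ : V} (h₁ : c₁ ∈ T.children v) (h₂ : c₂ ∈ T.children v)
    (hu₁ : c₁ ∈ T.path u) (hu₂ : c₂ ∈ T.path u) : c₁ = c₂ :=
  eq_of_mem_path_of_depth_eq hu₁ hu₂ (by rw [depth_of_mem_children h₁, depth_of_mem_children h₂])

theorem below_subset {u v : V} (h : u ∈ T.path v) : T.below v ⊆ T.below u := fun _ hw =>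
  path_trans h hw

theorem depth_le_height [Fintype V] (v : V) : T.depth v ≤ T.height :=
  Finset.le_sup (f := T.depth) (Finset.mem_univ v)

theorem low_mem {s : Set V} [Finite V] (hs : s.Nonempty) :
    T.low s ∈ s ∧ ∀ u ∈ s, T.depth u ≤ T.depth (T.low s) := by
  have h : ∃ v ∈ s, ∀ u ∈ s, T.depth u ≤ T.depth v :=
    Set.exists_max_image s T.depth (Set.toFinite s) hs
  rw [low, dif_pos h]
  exact h.choose_spec

/-- A nonempty set of pairwise comparable vertices lies on the path of its lowest vertex. -/
theorem mem_path_low {s : Set V} [Finite V] (hs : ∀ u ∈ s, ∀ w ∈ s, u ∈ T.path w ∨ w ∈ T.path u)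
    {u : V} (hu : u ∈ s) : u ∈ T.path (T.low s) := by
  obtain ⟨h₁, h₂⟩ := T.low_mem ⟨u, hu⟩
  rcases hs u hu _ h₁ with h | h
  · exact h
  · rw [eq_of_mem_path_of_depth_le h (h₂ u hu)]
    exact T.mem_path_self u

/-- Every vertex has a childless vertex below it. -/
theorem exists_leaf_below [Finite V] (v : V) : ∃ u, v ∈ T.path u ∧ T.children u = ∅ := by
  obtain ⟨u, hu, hmax⟩ := Set.exists_max_image (T.below v) T.depth (Set.toFinite _)
    ⟨v, T.mem_path_self v⟩
  refine ⟨u, hu, Set.eq_empty_of_forall_notMem fun c hc => ?_⟩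
  have h₁ := hmax c (path_trans hu (mem_path_of_mem_children hc))
  rw [depth_of_mem_children hc] at h₁
  omega

end ParentTree

/-! ### Dimensions and row patterns of a convex program -/

namespace ConvexData

variable {d m : ℕ} (P : ConvexData d m)

theorem card_coord : Fintype.card P.Coord = P.n := by
  simp [Coord, n]

theorem d_le_n : d ≤ P.n := by
  rw [← P.card_coord]
  exact P.full_rank.symm.le.trans (Matrix.rank_le_card_width P.A)

variable {P} {T : ParentTree (Fin d)}

/-- The rows of a block lie on one path of the elimination tree. -/
theorem IsEliminationTree.mem_path_blockLow (hT : P.IsEliminationTree T) {i : Fin m} {u : Fin d}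
    (hu : u ∈ P.blockRows i) : u ∈ T.path (P.blockLow T i) := by
  refine ParentTree.mem_path_low (fun u hu w hw => ?_) hu
  by_cases h : u = w
  · left
    rw [h]
    exact T.mem_path_self w
  · exact hT.2 u w ⟨h, i, hu, hw⟩

theorem IsEliminationTree.le_of_mem_path (hT : P.IsEliminationTree T) {u v : Fin d}
    (h : u ∈ T.path v) : v ≤ u := by
  obtain ⟨k, hk, rfl⟩ := T.mem_path_iff.1 h
  clear h
  induction k with
  | zero => exact le_rfl
  | succ k ih =>
    rw [Function.iterate_succ_apply']
    exact (ih (by omega)).trans (hT.1 _ (T.iterate_ne_root hk)).le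

end ConvexData

/-! ### Balanced sampling trees are sampling trees of logarithmic height -/

namespace TreeData

variable {d m N : ℕ} {P : ConvexData d m} {S : TreeData P N} {T : ParentTree (Fin d)}

theorem rowLeaf_mem_upper (S : TreeData P N) (j : Fin d) : S.rowLeaf j ∈ S.upper :=
  ⟨j, S.tree.mem_path_self _⟩

theorem upper_of_mem_path {u v : Fin N} (hv : v ∈ S.upper) (h : u ∈ S.tree.path v) :
    u ∈ S.upper := by
  obtain ⟨j, hj⟩ := hv
  exact ⟨j, ParentTree.path_trans h hj⟩

theorem mem_rowLabel {v : Fin N} {j : Fin d} :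
    j ∈ S.rowLabel v ↔ v ∈ S.tree.path (S.rowLeaf j) := Iff.rfl

theorem mem_colLabel {v : Fin N} {c : P.Coord} :
    c ∈ S.colLabel v ↔ v ∈ S.tree.path (S.colLeaf c) := Iff.rfl

theorem colLabel_mono {u v : Fin N} (h : u ∈ S.tree.path v) : S.colLabel v ⊆ S.colLabel u :=
  fun _ hc => ParentTree.path_trans h hc

theorem rowLabel_mono {u v : Fin N} (h : u ∈ S.tree.path v) : S.rowLabel v ⊆ S.rowLabel u :=
  fun _ hc => ParentTree.path_trans h hc

theorem colLabel_root : S.colLabel S.tree.root = Set.univ :=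
  Set.eq_univ_of_forall fun _ => S.tree.root_mem_path _

theorem rowLabel_root : S.rowLabel S.tree.root = Set.univ :=
  Set.eq_univ_of_forall fun _ => S.tree.root_mem_path _

variable (hS : S.IsBalanced T)
include hS

/-- The leaves of the upper tree are pairwise incomparable. -/
theorem IsBalanced.rowLeaf_eq_of_mem_path {j : Fin d} {v : Fin N} (hv : v ∈ S.upper)
    (h : S.rowLeaf j ∈ S.tree.path v) : S.rowLeaf j = v := by
  by_contra hne
  obtain ⟨c, hc, hcv⟩ := ParentTree.exists_child_of_mem_path h hne
  exact Set.disjoint_left.1 (hS.rowLeaf_is_leaf j) hc (upper_of_mem_path hv hcv)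

theorem IsBalanced.eq_of_rowLeaf_mem_path {i j : Fin d} {v : Fin N}
    (hi : S.rowLeaf i ∈ S.tree.path v) (hj : S.rowLeaf j ∈ S.tree.path v) : i = j := by
  rcases ParentTree.path_chain hi hj with h | h
  · exact hS.rowLeaf_inj (hS.rowLeaf_eq_of_mem_path (S.rowLeaf_mem_upper j) h)
  · exact (hS.rowLeaf_inj (hS.rowLeaf_eq_of_mem_path (S.rowLeaf_mem_upper i) h)).symm

theorem IsBalanced.eq_of_colLeaf_mem_path {c : P.Coord} {v : Fin N}
    (h : S.colLeaf c ∈ S.tree.path v) : S.colLeaf c = v := by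
  by_contra hne
  obtain ⟨w, hw, -⟩ := ParentTree.exists_child_of_mem_path h hne
  rw [hS.colLeaf_is_leaf c] at hw
  exact hw

theorem IsBalanced.colLabel_colLeaf (c : P.Coord) : S.colLabel (S.colLeaf c) = {c} := by
  ext c₁
  constructor
  · intro h
    exact (hS.colLeaf_inj (hS.eq_of_colLeaf_mem_path h)).symm
  · rintro rfl
    exact S.tree.mem_path_self _

theorem IsBalanced.upper_mem_path_colLeaf {c : P.Coord} {v : Fin N} (hv : v ∈ S.upper) :
    v ∈ S.tree.path (S.colLeaf c) ↔ v ∈ S.tree.path (S.rowLeaf (P.blockLow T c.1)) := by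
  constructor
  · intro h
    rcases ParentTree.path_chain h (hS.colLeaf_below c) with h' | h'
    · exact h'
    · rw [hS.rowLeaf_eq_of_mem_path hv h']
      exact S.tree.mem_path_self v
  · exact fun h => ParentTree.path_trans h (hS.colLeaf_below c)

theorem IsBalanced.rowLeaf_mem_path_of_not_upper {c : P.Coord} {v : Fin N} (hv : v ∉ S.upper)
    (h : v ∈ S.tree.path (S.colLeaf c)) : S.rowLeaf (P.blockLow T c.1) ∈ S.tree.path v := by
  rcases ParentTree.path_chain (hS.colLeaf_below c) h with h' | h'
  · exact h'
  · exact absurd (upper_of_mem_path (S.rowLeaf_mem_upper _) h') hv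

/-- Below every node outside the upper tree there is a coordinate. -/
theorem IsBalanced.colLabel_nonempty {v : Fin N} (hv : v ∉ S.upper) :
    (S.colLabel v).Nonempty := by
  obtain ⟨u, hu, hleaf⟩ := S.tree.exists_leaf_below v
  have hu' : u ∉ S.upper := fun h => hv (upper_of_mem_path h hu)
  by_cases h : u ∈ Set.range S.colLeaf
  · obtain ⟨c, rfl⟩ := h
    exact ⟨c, hu⟩
  · have := hS.lower_binary u hu' h
    simp [hleaf] at this

theorem IsBalanced.children_ncard_le_two (v : Fin N) : (S.tree.children v).ncard ≤ 2 := by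
  by_cases hv : v ∈ S.upper
  · by_cases h : v ∈ Set.range S.rowLeaf
    · obtain ⟨j, rfl⟩ := h
      exact (hS.attached_root j).trans (by norm_num)
    · exact (hS.upper_binary v hv h).2.le
  · by_cases h : v ∈ Set.range S.colLeaf
    · obtain ⟨c, rfl⟩ := h
      simp [hS.colLeaf_is_leaf c]
    · exact (hS.lower_binary v hv h).le

theorem IsBalanced.isSamplingTree (hn : 0 < P.n) :
    IsSamplingTree S.tree {v | (S.colLabel v).Nonempty} S.colLabel 2 where
  root_mem := by
    rw [← P.card_coord, Fintype.card_pos_iff] at hn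
    simp only [Set.mem_ofPred_eq, colLabel_root]
    exact Set.univ_nonempty
  parent_mem v hv := Set.Nonempty.mono (colLabel_mono (S.tree.parent_mem_path v)) hv
  degree v _ := (Set.ncard_le_ncard Set.inter_subset_left (Set.toFinite _)).trans
    (hS.children_ncard_le_two v)
  root_label := colLabel_root
  leaf_label v hv h := by
    obtain ⟨c, hc⟩ := hv
    by_cases hvc : v = S.colLeaf c
    · rw [hvc, hS.colLabel_colLeaf, Set.ncard_singleton]
    · obtain ⟨w, hw, hwc⟩ := ParentTree.exists_child_of_mem_path hc hvc
      exact absurd h (Set.Nonempty.ne_empty ⟨w, hw, c, hwc⟩)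
  child_nonempty v hv := hv
  child_disjoint v _ := by
    intro c₁ h₁ c₂ h₂ hne
    refine Set.disjoint_left.2 fun c hc₁ hc₂ => hne ?_
    exact ParentTree.child_unique h₁.1 h₂.1 hc₁ hc₂
  child_union v _ h := by
    ext c
    simp only [Set.mem_iUnion, exists_prop]
    constructor
    · rintro ⟨w, hw, hc⟩
      exact colLabel_mono (ParentTree.mem_path_of_mem_children hw.1) hc
    · intro hc
      by_cases hvc : v = S.colLeaf c
      · obtain ⟨w, hw, -⟩ := h
        rw [hvc, hS.colLeaf_is_leaf] at hw
        exact absurd hw (Set.notMem_empty w)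
      · obtain ⟨w, hw, hwc⟩ := ParentTree.exists_child_of_mem_path hc hvc
        exact ⟨w, ⟨hw, c, hwc⟩, hwc⟩

omit hS in
/-- If every vertex of a class above the level `e` has two children in the class, whose labels are
disjoint subsets of its label, then labels on level `k` have at least `2 ^ (e - k)` elements. -/
theorem two_pow_le_ncard_label {ι : Type} [Finite ι] (χ : Fin N → Set ι) (U : Set (Fin N)) (e : ℕ)
    (hχ : ∀ u v, u ∈ S.tree.path v → χ v ⊆ χ u)
    (hdisj : ∀ v, ∀ c₁ ∈ S.tree.children v, ∀ c₂ ∈ S.tree.children v, c₁ ≠ c₂ →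
      Disjoint (χ c₁) (χ c₂))
    (hne : ∀ v ∈ U, (χ v).Nonempty)
    (htwo : ∀ v ∈ U, S.tree.depth v < e → (S.tree.children v).ncard = 2 ∧ S.tree.children v ⊆ U)
    (v : Fin N) (hv : v ∈ U) : 2 ^ (e - S.tree.depth v) ≤ (χ v).ncard := by
  generalize hk : e - S.tree.depth v = k
  induction k generalizing v with
  | zero => exact (Set.ncard_pos (Set.toFinite _)).2 (hne v hv)
  | succ k ih =>
    obtain ⟨h₂, hU⟩ := htwo v hv (by omega)
    obtain ⟨c₁, c₂, hc, heq⟩ := Set.ncard_eq_two.1 h₂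
    have h₁m : c₁ ∈ S.tree.children v := by simp [heq]
    have h₂m : c₂ ∈ S.tree.children v := by simp [heq]
    have i₁ := ih c₁ (hU h₁m) (by rw [ParentTree.depth_of_mem_children h₁m]; omega)
    have i₂ := ih c₂ (hU h₂m) (by rw [ParentTree.depth_of_mem_children h₂m]; omega)
    have hsub : χ c₁ ∪ χ c₂ ⊆ χ v := Set.union_subset
      (hχ _ _ (ParentTree.mem_path_of_mem_children h₁m))
      (hχ _ _ (ParentTree.mem_path_of_mem_children h₂m))
    have := Set.ncard_le_ncard hsub (Set.toFinite _)
    rw [Set.ncard_union_eq (hdisj v c₁ h₁m c₂ h₂m hc) (Set.toFinite _) (Set.toFinite _)] at this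
    rw [pow_succ]
    omega

theorem IsBalanced.depth_rowLeaf_le (j : Fin d) :
    S.tree.depth (S.rowLeaf j) ≤ Nat.log 2 d + 2 := by
  obtain ⟨e, he⟩ := hS.upper_complete
  have hroot : S.tree.root ∈ S.upper := ⟨j, S.tree.root_mem_path _⟩
  have h := S.two_pow_le_ncard_label S.rowLabel S.upper e (fun _ _ => rowLabel_mono)
    (fun v c₁ h₁ c₂ h₂ hne => Set.disjoint_left.2 fun i hi₁ hi₂ =>
      hne (ParentTree.child_unique h₁ h₂ hi₁ hi₂))
    (fun v hv => hv)
    (fun v hv hd => by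
      have := hS.upper_binary v hv (by
        rintro ⟨i, rfl⟩
        rcases he i with h | h <;> omega)
      exact ⟨this.2, this.1⟩) _ hroot
  rw [S.tree.depth_root, rowLabel_root, Set.ncard_univ, Nat.card_fin] at h
  have := Nat.le_log_of_pow_le (by norm_num) h
  rcases he j with h | h <;> omega

theorem IsBalanced.depth_colLeaf_le (c : P.Coord) :
    S.tree.depth (S.colLeaf c) ≤ Nat.log 2 d + Nat.log 2 P.n + 4 := by
  obtain ⟨e, he⟩ := hS.lower_complete (P.blockLow T c.1)
  set r := S.rowLeaf (P.blockLow T c.1) with hr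
  have hne : r ≠ S.colLeaf c := fun h =>
    hS.colLeaf_not_upper c (h ▸ S.rowLeaf_mem_upper _)
  obtain ⟨w, hw, hwc⟩ := ParentTree.exists_child_of_mem_path (hS.colLeaf_below c) hne
  have hlow : ∀ v, w ∈ S.tree.path v → v ∉ S.upper := fun v hv hvu =>
    Set.disjoint_left.1 (hS.rowLeaf_is_leaf _) hw (upper_of_mem_path hvu hv)
  have h := S.two_pow_le_ncard_label S.colLabel {v | w ∈ S.tree.path v} e
    (fun _ _ => colLabel_mono)
    (fun v c₁ h₁ c₂ h₂ hne => Set.disjoint_left.2 fun i hi₁ hi₂ =>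
      hne (ParentTree.child_unique h₁ h₂ hi₁ hi₂))
    (fun v hv => hS.colLabel_nonempty (hlow v hv))
    (fun v hv hd => by
      refine ⟨hS.lower_binary v (hlow v hv) ?_, fun u hu =>
        ParentTree.path_trans hv (ParentTree.mem_path_of_mem_children hu)⟩
      rintro ⟨c₁, rfl⟩
      have h₁ : r ∈ S.tree.path (S.colLeaf c₁) :=
        ParentTree.path_trans (ParentTree.mem_path_of_mem_children hw) hv
      have := hS.eq_of_rowLeaf_mem_path h₁ (hS.colLeaf_below c₁)
      rcases he c₁ this.symm with h | h <;> omega) w (S.tree.mem_path_self w)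
  have hn : (S.colLabel w).ncard ≤ P.n := by
    rw [← P.card_coord, ← Nat.card_eq_fintype_card]
    exact Set.ncard_le_card _
  have h₁ := Nat.le_log_of_pow_le (by norm_num) (h.trans hn)
  have h₂ := hS.depth_rowLeaf_le (P.blockLow T c.1)
  rw [ParentTree.depth_of_mem_children hw] at h₁
  rcases he c rfl with h | h <;> omega

theorem IsBalanced.height_le : S.tree.height ≤ Nat.log 2 d + Nat.log 2 P.n + 4 := by
  refine Finset.sup_le fun v _ => ?_
  by_cases hv : v ∈ S.upper
  · obtain ⟨j, hj⟩ := hv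
    have := ParentTree.depth_le_of_mem_path hj
    have := hS.depth_rowLeaf_le j
    omega
  · obtain ⟨c, hc⟩ := hS.colLabel_nonempty hv
    exact (ParentTree.depth_le_of_mem_path hc).trans (hS.depth_colLeaf_le c)

theorem IsBalanced.height_le_log (hn : 2 ≤ P.n) : (S.tree.height : ℝ) ≤ 12 * Real.log P.n := by
  have h₁ := hS.height_le
  have h₂ : Nat.log 2 d ≤ Nat.log 2 P.n := Nat.log_mono_right P.d_le_n
  have h₃ : 1 ≤ Nat.log 2 P.n := Nat.le_log_of_pow_le (by norm_num) (by simpa using hn)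
  have h₄ : (S.tree.height : ℝ) ≤ 6 * Nat.log 2 P.n := by
    have : S.tree.height ≤ 6 * Nat.log 2 P.n := by omega
    exact_mod_cast this
  have h₅ : (Nat.log 2 P.n : ℝ) * Real.log 2 ≤ Real.log P.n := by
    rw [← Real.log_pow]
    refine Real.log_le_log (by positivity) ?_
    exact_mod_cast Nat.pow_log_le_self 2 (by omega)
  have h₆ : (1 / 2 : ℝ) ≤ Real.log 2 := by
    have := Real.log_two_gt_d9
    linarith
  have h₇ : (0 : ℝ) ≤ Nat.log 2 P.n := Nat.cast_nonneg _
  nlinarith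

end TreeData

/-! ### Heavy-light orders exist -/

namespace ParentTree

variable {V : Type} {T : ParentTree V}

/-- `l` lists the subtree of `v` in a depth-first preorder with heavy children first. -/
def IsPreorderList (T : ParentTree V) (v : V) (l : List V) : Prop :=
  l.Nodup ∧ (∀ u, u ∈ l ↔ u ∈ T.below v) ∧ (∃ l₁, l = v :: l₁) ∧
    ∀ u ∈ T.below v, ∃ l₁ l₂ l₃, l = l₁ ++ (u :: l₂) ++ l₃ ∧ (∀ w, w ∈ u :: l₂ ↔ w ∈ T.below u) ∧
      ((T.children u).Nonempty → ∃ c l₄, c ∈ T.children u ∧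
        (∀ c₁ ∈ T.children u, (T.below c₁).ncard ≤ (T.below c).ncard) ∧ l₂ = c :: l₄)

theorem mem_below_iff {u v : V} :
    u ∈ T.below v ↔ u = v ∨ ∃ c ∈ T.children v, u ∈ T.below c := by
  constructor
  · intro h
    by_cases hne : v = u
    · exact Or.inl hne.symm
    · obtain ⟨c, hc, hcu⟩ := exists_child_of_mem_path h hne
      exact Or.inr ⟨c, hc, hcu⟩
  · rintro (rfl | ⟨c, hc, hcu⟩)
    · exact T.mem_path_self _
    · exact path_trans (mem_path_of_mem_children hc) hcu

theorem not_mem_below_of_mem_children {v c : V} (h : c ∈ T.children v) : v ∉ T.below c := by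
  intro hv
  have := depth_le_of_mem_path hv
  rw [depth_of_mem_children h] at this
  omega

/-- By induction on the size of the subtree of `v`: the lists of the children, a heavy one first, are
joined. -/
theorem exists_preorderList [Finite V] (T : ParentTree V) (v : V) : ∃ l, T.IsPreorderList v l := by
  classical
  induction hn : (T.below v).ncard using Nat.strong_induction_on generalizing v with
  | _ n ih =>
  have hlt : ∀ c ∈ T.children v, (T.below c).ncard < n := by
    intro c hc
    rw [← hn]
    refine Set.ncard_lt_ncard ⟨below_subset (mem_path_of_mem_children hc), fun h => ?_⟩
      (Set.toFinite _)
    exact not_mem_below_of_mem_children hc (h (T.mem_path_self v))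
  have hf : ∀ c : V, ∃ l, c ∈ T.children v → T.IsPreorderList c l := by
    intro c
    by_cases hc : c ∈ T.children v
    · obtain ⟨l, hl⟩ := ih _ (hlt c hc) c rfl
      exact ⟨l, fun _ => hl⟩
    · exact ⟨[], fun h => absurd h hc⟩
  choose f hf using hf
  -- The children of `v`, a heavy one first.
  obtain ⟨cs, hcs, hnd, hhead⟩ : ∃ cs : List V, (∀ c, c ∈ cs ↔ c ∈ T.children v) ∧ cs.Nodup ∧
      ((T.children v).Nonempty → ∃ c t, cs = c :: t ∧
        ∀ c₁ ∈ T.children v, (T.below c₁).ncard ≤ (T.below c).ncard) := by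
    by_cases hne : (T.children v).Nonempty
    · obtain ⟨c, hc, hmax⟩ := Set.exists_max_image (T.children v) (fun c => (T.below c).ncard)
        (Set.toFinite _) hne
      refine ⟨c :: ((Set.toFinite (T.children v)).toFinset.erase c).toList, fun w => ?_, ?_,
        fun _ => ⟨c, _, rfl, hmax⟩⟩
      · by_cases hw : w = c
        · simp [hw, hc]
        · simp [hw]
      · simp [Finset.nodup_toList]
    · exact ⟨[], fun c => ⟨fun h => by simp at h, fun h => (hne ⟨c, h⟩).elim⟩, List.nodup_nil,
        fun h => absurd h hne⟩
  have hmem : ∀ w, w ∈ cs.flatMap f ↔ ∃ c ∈ T.children v, w ∈ T.below c := by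
    intro w
    rw [List.mem_flatMap]
    constructor
    · rintro ⟨c, hc, hw⟩
      exact ⟨c, (hcs c).1 hc, ((hf c ((hcs c).1 hc)).2.1 w).1 hw⟩
    · rintro ⟨c, hc, hw⟩
      exact ⟨c, (hcs c).2 hc, ((hf c hc).2.1 w).2 hw⟩
  have hall : ∀ w, w ∈ v :: cs.flatMap f ↔ w ∈ T.below v := by
    intro w
    rw [List.mem_cons, hmem, ← mem_below_iff]
  refine ⟨v :: cs.flatMap f, ?_, hall, ⟨_, rfl⟩, ?_⟩
  · rw [List.nodup_cons]
    constructor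
    · rw [hmem]
      rintro ⟨c, hc, hv⟩
      exact not_mem_below_of_mem_children hc hv
    · rw [List.nodup_flatMap]
      refine ⟨fun c hc => (hf c ((hcs c).1 hc)).1, hnd.imp_of_mem ?_⟩
      intro a b ha hb hab w hwa hwb
      have ha' := (hcs a).1 ha
      have hb' := (hcs b).1 hb
      exact hab (child_unique ha' hb' (((hf a ha').2.1 w).1 hwa) (((hf b hb').2.1 w).1 hwb))
  · intro u hu
    rcases mem_below_iff.1 hu with rfl | ⟨c, hc, hcu⟩
    · refine ⟨[], cs.flatMap f, [], by simp, hall, fun hne => ?_⟩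
      obtain ⟨c, t, rfl, hmax⟩ := hhead hne
      have hc : c ∈ T.children u := (hcs c).1 (by simp)
      obtain ⟨l₁, hl₁⟩ := (hf c hc).2.2.1
      exact ⟨c, l₁ ++ t.flatMap f, hc, hmax, by simp [hl₁]⟩
    · obtain ⟨s, t, hst⟩ := List.append_of_mem ((hcs c).2 hc)
      obtain ⟨l₁, l₂, l₃, heq, h₁, h₂⟩ := (hf c hc).2.2.2 u hcu
      refine ⟨v :: (s.flatMap f ++ l₁), l₂, l₃ ++ t.flatMap f, ?_, h₁, h₂⟩
      rw [hst, List.flatMap_append, List.flatMap_cons, heq]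
      simp

theorem getElem_mem_iff_of_nodup {α : Type} {l₁ l₂ l₃ : List α} (h : (l₁ ++ l₂ ++ l₃).Nodup)
    (p : ℕ) (hp : p < (l₁ ++ l₂ ++ l₃).length) :
    (l₁ ++ l₂ ++ l₃)[p] ∈ l₂ ↔ l₁.length ≤ p ∧ p < l₁.length + l₂.length := by
  constructor
  · intro hm
    obtain ⟨q, hq, heq⟩ := List.mem_iff_getElem.1 hm
    have hlt : l₁.length + q < (l₁ ++ l₂ ++ l₃).length := by simp; omega
    have : (l₁ ++ l₂ ++ l₃)[l₁.length + q] = (l₁ ++ l₂ ++ l₃)[p] := by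
      rw [← heq, List.getElem_append_left (by simp; omega), List.getElem_append_right (by omega)]
      simp
    have := (List.Nodup.getElem_inj_iff h).1 this
    omega
  · rintro ⟨h₁, h₂⟩
    have : (l₁ ++ l₂ ++ l₃)[p] = l₂[p - l₁.length]'(by omega) := by
      rw [List.getElem_append_left (by simp; omega), List.getElem_append_right h₁]
    rw [this]
    exact List.getElem_mem _

theorem exists_heavyLightOrder {d : ℕ} (T : ParentTree (Fin d)) :
    ∃ σ : Equiv.Perm (Fin d), T.IsHeavyLightOrder σ := by
  obtain ⟨l, hnd, hall, -, hdec⟩ := T.exists_preorderList T.root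
  have hmem : ∀ u, u ∈ l := fun u => (hall u).2 (T.root_mem_path u)
  have hlen : l.length = d := by
    have := Fintype.card_congr (List.Nodup.getEquivOfForallMemList l hnd hmem)
    simpa using this
  let σ : Equiv.Perm (Fin d) :=
    (finCongr hlen.symm).trans (List.Nodup.getEquivOfForallMemList l hnd hmem)
  have hσ : ∀ p : Fin d, σ p = l[(p : ℕ)]'(by omega) := fun p => rfl
  have hpos : ∀ u : Fin d, ∃ l₁ l₂ : List (Fin d),
      (∀ p : Fin d, σ p ∈ T.below u ↔ l₁.length ≤ p ∧ (p : ℕ) < l₁.length + (u :: l₂).length) ∧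
      (σ.symm u : ℕ) = l₁.length ∧
      ((T.children u).Nonempty → ∃ c ∈ T.children u,
        (∀ c₁ ∈ T.children u, (T.below c₁).ncard ≤ (T.below c).ncard) ∧
          (σ.symm c : ℕ) = l₁.length + 1) := by
    intro u
    obtain ⟨l₁, l₂, l₃, heq, h₁, h₂⟩ := hdec u (T.root_mem_path u)
    have hsymm : ∀ (w : Fin d) (k : ℕ) (hk : k < d), l[k]'(by omega) = w → (σ.symm w : ℕ) = k := by
      intro w k hk hw
      have : σ ⟨k, hk⟩ = w := by rw [hσ]; exact hw
      rw [← this, Equiv.symm_apply_apply]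
    have hl := congrArg List.length heq
    simp only [List.length_append, List.length_cons, hlen] at hl
    refine ⟨l₁, l₂, fun p => ?_, ?_, fun hne => ?_⟩
    · rw [← h₁, hσ]
      subst heq
      exact getElem_mem_iff_of_nodup hnd p _
    · refine hsymm u _ (by omega) ?_
      simp [heq]
    · obtain ⟨c, l₄, hc, hmax, rfl⟩ := h₂ hne
      rw [List.length_cons] at hl
      refine ⟨c, hc, hmax, hsymm c _ (by omega) ?_⟩
      simp [heq]
  refine ⟨σ, ⟨fun v => ?_, fun v u hu => ?_, fun v hne => ?_⟩⟩
  · obtain ⟨l₁, l₂, h, -, -⟩ := hpos v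
    refine ⟨fun p hp q hq s hs => ?_⟩
    simp only [Set.mem_ofPred_eq, h] at hp hq ⊢
    have h₁ : (p : ℕ) ≤ s := hs.1
    have h₂ : (s : ℕ) ≤ q := hs.2
    omega
  · obtain ⟨l₁, l₂, h, h₁, -⟩ := hpos v
    have := (h (σ.symm u)).1 (by simpa using hu)
    rw [Fin.le_def, h₁]
    exact this.1
  · obtain ⟨l₁, l₂, -, h₁, h₂⟩ := hpos v
    obtain ⟨c, hc, hmax, hpc⟩ := h₂ hne
    exact ⟨c, hc, hmax, by rw [hpc, h₁]⟩

end ParentTree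

/-! ### Balanced sampling trees exist -/

namespace ParentTree

/-- The tree carried over along a bijection of the vertex types. -/
def map {V W : Type} (T : ParentTree V) (e : V ≃ W) : ParentTree W where
  root := e T.root
  parent w := e (T.parent (e.symm w))
  parent_root := by simp [T.parent_root]
  reach_root w := by
    obtain ⟨k, hk⟩ := T.reach_root (e.symm w)
    refine ⟨k, ?_⟩
    have : Function.Semiconj e T.parent fun w => e (T.parent (e.symm w)) := fun v => by simp
    rw [← hk, (this.iterate_right k).eq, Equiv.apply_symm_apply]

variable {V W : Type} (T : ParentTree V) (e : V ≃ W)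

theorem mem_path_map {u v : V} : e u ∈ (T.map e).path (e v) ↔ u ∈ T.path v := by
  have : Function.Semiconj e T.parent (T.map e).parent := fun v => by simp [map]
  simp only [path, Set.mem_ofPred_eq, ← (this.iterate_right _).eq, e.injective.eq_iff]

theorem children_map (v : V) : (T.map e).children (e v) = e '' T.children v := by
  ext w
  obtain ⟨u, rfl⟩ := e.surjective w
  simp [children, map]

theorem depth_map (v : V) : (T.map e).depth (e v) = T.depth v := by
  have : (T.map e).path (e v) = e '' T.path v := by
    ext w
    obtain ⟨u, rfl⟩ := e.surjective w
    rw [mem_path_map, e.injective.mem_set_image]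
  rw [depth, this, Set.ncard_image_of_injective _ e.injective]
  rfl

end ParentTree

/-! A complete binary tree with `k` leaves is stored as a heap: its nodes are `0, …, 2 * k - 2`, the
parent of `a` is `(a - 1) / 2`, and the leaves are the nodes `a ≥ k - 1`. -/

/-- The nodes of a heap with `d` leaves, to the `j`-th of which a heap with `c j` leaves is
attached. -/
abbrev HeapNode (d : ℕ) (c : Fin d → ℕ) : Type := Fin (2 * d - 1) ⊕ (j : Fin d) × Fin (2 * c j - 1)

/-- The parent map in which the root of the heap with the number `j` is attached to the node
`leaf j`. -/
def heapParent {d : ℕ} (c : Fin d → ℕ) (leaf : Fin d → Fin (2 * d - 1)) :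
    HeapNode d c → HeapNode d c
  | Sum.inl a => Sum.inl ⟨((a : ℕ) - 1) / 2, by omega⟩
  | Sum.inr ⟨j, a⟩ => if (a : ℕ) = 0 then Sum.inl (leaf j)
      else Sum.inr ⟨j, ⟨((a : ℕ) - 1) / 2, by omega⟩⟩

theorem heapParent_reaches_root {d : ℕ} (c : Fin d → ℕ) (hd : 0 < 2 * d - 1)
    (leaf : Fin d → Fin (2 * d - 1)) (v : HeapNode d c) :
    ∃ k : ℕ, (heapParent c leaf)^[k] v = Sum.inl ⟨0, hd⟩ := by
  have h₁ : ∀ (n : ℕ) (a : Fin (2 * d - 1)), (a : ℕ) = n →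
      ∃ k : ℕ, (heapParent c leaf)^[k] (Sum.inl a) = Sum.inl ⟨0, hd⟩ := by
    intro n
    induction n using Nat.strong_induction_on with
    | _ n ih =>
      intro a ha
      by_cases h : n = 0
      · exact ⟨0, congrArg Sum.inl (Fin.ext (by simp; omega))⟩
      · obtain ⟨k, hk⟩ := ih ((n - 1) / 2) (by omega) ⟨(a - 1) / 2, by omega⟩ (by simp [ha])
        exact ⟨k + 1, by rw [Function.iterate_succ_apply]; exact hk⟩
  rcases v with a | ⟨j, a⟩
  · exact h₁ _ a rfl
  · induction hn : (a : ℕ) using Nat.strong_induction_on generalizing a with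
    | _ n ih =>
      by_cases h : n = 0
      · obtain ⟨k, hk⟩ := h₁ _ (leaf j) rfl
        exact ⟨k + 1, by rw [Function.iterate_succ_apply]; simpa [heapParent, hn, h] using hk⟩
      · obtain ⟨k, hk⟩ := ih ((n - 1) / 2) (by omega) ⟨(a - 1) / 2, by omega⟩ (by simp [hn])
        refine ⟨k + 1, ?_⟩
        rw [Function.iterate_succ_apply]
        simp only [heapParent, hn, h, if_false] at hk ⊢
        exact hk

/-- The tree on `HeapNode d c` with the parent map `heapParent`. -/
def heapTree {d : ℕ} (c : Fin d → ℕ) (hd : 0 < 2 * d - 1) (leaf : Fin d → Fin (2 * d - 1)) :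
    ParentTree (HeapNode d c) where
  root := Sum.inl ⟨0, hd⟩
  parent := heapParent c leaf
  parent_root := congrArg Sum.inl (Fin.ext (by simp))
  reach_root := heapParent_reaches_root c hd leaf

namespace heapTree

variable {d : ℕ} {c : Fin d → ℕ} {hd : 0 < 2 * d - 1} {leaf : Fin d → Fin (2 * d - 1)}

theorem parent_inl (a : Fin (2 * d - 1)) :
    (heapTree c hd leaf).parent (Sum.inl a) = Sum.inl ⟨(a - 1) / 2, by omega⟩ := rfl

theorem parent_inr_zero (j : Fin d) (a : Fin (2 * c j - 1)) (ha : (a : ℕ) = 0) :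
    (heapTree c hd leaf).parent (Sum.inr ⟨j, a⟩) = Sum.inl (leaf j) := by
  simp [heapTree, heapParent, ha]

theorem parent_inr (j : Fin d) (a : Fin (2 * c j - 1)) (ha : (a : ℕ) ≠ 0) :
    (heapTree c hd leaf).parent (Sum.inr ⟨j, a⟩) = Sum.inr ⟨j, ⟨(a - 1) / 2, by omega⟩⟩ := by
  simp [heapTree, heapParent, ha]

theorem inl_ne_root {a : Fin (2 * d - 1)} (ha : (a : ℕ) ≠ 0) :
    (Sum.inl a : HeapNode d c) ≠ (heapTree c hd leaf).root := by
  intro h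
  have := Sum.inl.inj h
  exact ha (by rw [this])

theorem inr_ne_root (x : (j : Fin d) × Fin (2 * c j - 1)) :
    (Sum.inr x : HeapNode d c) ≠ (heapTree c hd leaf).root := Sum.inr_ne_inl

theorem log_succ_div {a : ℕ} (ha : a ≠ 0) :
    Nat.log 2 (a + 1) = Nat.log 2 ((a - 1) / 2 + 1) + 1 := by
  rw [Nat.log_of_one_lt_of_le (by norm_num) (by omega)]
  congr 2
  omega

theorem depth_inl (a : Fin (2 * d - 1)) :
    (heapTree c hd leaf).depth (Sum.inl a) = Nat.log 2 (a + 1) + 1 := by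
  induction hn : (a : ℕ) using Nat.strong_induction_on generalizing a with
  | _ n ih =>
  by_cases h : n = 0
  · have : (Sum.inl a : HeapNode d c) = (heapTree c hd leaf).root := by
      show _ = Sum.inl _
      congr 1
      exact Fin.ext (by simp; omega)
    rw [this, ParentTree.depth_root]
    simp [h]
  · rw [ParentTree.depth_eq_succ (inl_ne_root (by omega)), parent_inl,
      ih ((n - 1) / 2) (by omega) _ (by simp [hn]), log_succ_div h]

theorem depth_inr (j : Fin d) (a : Fin (2 * c j - 1)) :
    (heapTree c hd leaf).depth (Sum.inr ⟨j, a⟩) =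
      (heapTree c hd leaf).depth (Sum.inl (leaf j)) + (Nat.log 2 (a + 1) + 1) := by
  induction hn : (a : ℕ) using Nat.strong_induction_on generalizing a with
  | _ n ih =>
  rw [ParentTree.depth_eq_succ (inr_ne_root _)]
  by_cases h : n = 0
  · rw [parent_inr_zero _ _ (by omega)]
    simp [h]
  · rw [parent_inr _ _ (by omega), ih ((n - 1) / 2) (by omega) _ (by simp [hn]), log_succ_div h]
    omega

theorem leaf_mem_path_inr (j : Fin d) (a : Fin (2 * c j - 1)) :
    (Sum.inl (leaf j) : HeapNode d c) ∈ (heapTree c hd leaf).path (Sum.inr ⟨j, a⟩) := by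
  induction hn : (a : ℕ) using Nat.strong_induction_on generalizing a with
  | _ n ih =>
  have h' := (heapTree c hd leaf).parent_mem_path (Sum.inr ⟨j, a⟩)
  by_cases h : n = 0
  · rwa [parent_inr_zero _ _ (by omega)] at h'
  · rw [parent_inr _ _ (by omega)] at h'
    exact ParentTree.path_trans (ih ((n - 1) / 2) (by omega) _ (by simp [hn])) h'

theorem exists_of_mem_path_inl {a : Fin (2 * d - 1)} {v : HeapNode d c}
    (h : v ∈ (heapTree c hd leaf).path (Sum.inl a)) :
    ∃ b : Fin (2 * d - 1), v = Sum.inl b ∧ ∃ t, ((a : ℕ) + 1) / 2 ^ t = b + 1 := by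
  obtain ⟨k, rfl⟩ := h
  induction k with
  | zero => exact ⟨a, rfl, 0, by simp⟩
  | succ k ih =>
    obtain ⟨b, hb, t, ht⟩ := ih
    rw [Function.iterate_succ_apply', hb, parent_inl]
    refine ⟨_, rfl, ?_⟩
    by_cases h : (b : ℕ) = 0
    · exact ⟨t, by simp [ht, h]⟩
    · refine ⟨t + 1, ?_⟩
      rw [pow_succ, ← Nat.div_div_eq_div_mul, ht]
      simp
      omega

theorem mem_path_inl {a b : Fin (2 * d - 1)} {t : ℕ} (h : ((a : ℕ) + 1) / 2 ^ t = b + 1) :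
    (Sum.inl b : HeapNode d c) ∈ (heapTree c hd leaf).path (Sum.inl a) := by
  induction t generalizing b with
  | zero =>
    have : a = b := Fin.ext (by simpa using h)
    rw [this]
    exact ParentTree.mem_path_self _ _
  | succ t ih =>
    rw [pow_succ, ← Nat.div_div_eq_div_mul] at h
    have hle : ((a : ℕ) + 1) / 2 ^ t ≤ a + 1 := Nat.div_le_self _ _
    have h₁ := ih (b := ⟨((a : ℕ) + 1) / 2 ^ t - 1, by omega⟩) (by simp; omega)
    have h₂ := (heapTree c hd leaf).parent_mem_path
      (Sum.inl ⟨((a : ℕ) + 1) / 2 ^ t - 1, by omega⟩)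
    rw [parent_inl] at h₂
    have h₃ : (⟨(((a : ℕ) + 1) / 2 ^ t - 1 - 1) / 2, by omega⟩ : Fin (2 * d - 1)) = b :=
      Fin.ext (by simp; omega)
    rw [h₃] at h₂
    exact ParentTree.path_trans h₂ h₁

theorem mem_children_inl {a : Fin (2 * d - 1)} {v : HeapNode d c} :
    v ∈ (heapTree c hd leaf).children (Sum.inl a) ↔
      (∃ b : Fin (2 * d - 1), v = Sum.inl b ∧ ((b : ℕ) = 2 * a + 1 ∨ (b : ℕ) = 2 * a + 2)) ∨
      ∃ (j : Fin d) (b : Fin (2 * c j - 1)), v = Sum.inr ⟨j, b⟩ ∧ leaf j = a ∧ (b : ℕ) = 0 := by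
  constructor
  · rintro ⟨hne, hp⟩
    rcases v with b | ⟨j, b⟩
    · left
      refine ⟨b, rfl, ?_⟩
      rw [parent_inl] at hp
      have h₁ := congrArg Fin.val (Sum.inl.inj hp)
      have h₂ : (b : ℕ) ≠ 0 := fun h => hne (by
        show _ = Sum.inl _
        congr 1
        exact Fin.ext (by simpa using h))
      simp at h₁
      omega
    · right
      by_cases h : (b : ℕ) = 0
      · rw [parent_inr_zero _ _ h] at hp
        exact ⟨j, b, rfl, Sum.inl.inj hp, h⟩
      · rw [parent_inr _ _ h] at hp
        exact absurd hp Sum.inr_ne_inl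
  · rintro (⟨b, rfl, hb⟩ | ⟨j, b, rfl, hj, hb⟩)
    · refine ⟨inl_ne_root (by omega), ?_⟩
      rw [parent_inl]
      congr 1
      exact Fin.ext (by simp; omega)
    · exact ⟨inr_ne_root _, by rw [parent_inr_zero _ _ hb, hj]⟩

theorem mem_children_inr {j : Fin d} {a : Fin (2 * c j - 1)} {v : HeapNode d c} :
    v ∈ (heapTree c hd leaf).children (Sum.inr ⟨j, a⟩) ↔
      ∃ b : Fin (2 * c j - 1), v = Sum.inr ⟨j, b⟩ ∧ ((b : ℕ) = 2 * a + 1 ∨ (b : ℕ) = 2 * a + 2) := by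
  constructor
  · rintro ⟨hne, hp⟩
    rcases v with b | ⟨j', b⟩
    · rw [parent_inl] at hp
      exact absurd hp Sum.inl_ne_inr
    · by_cases h : (b : ℕ) = 0
      · rw [parent_inr_zero _ _ h] at hp
        exact absurd hp Sum.inl_ne_inr
      · rw [parent_inr _ _ h] at hp
        have h₁ := Sum.inr.inj hp
        obtain rfl : j' = j := congrArg Sigma.fst h₁
        have h₂ := congrArg Fin.val (eq_of_heq (Sigma.mk.inj h₁).2)
        refine ⟨b, rfl, ?_⟩
        simp at h₂
        omega
  · rintro ⟨b, rfl, hb⟩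
    refine ⟨inr_ne_root _, ?_⟩
    rw [parent_inr _ _ (by omega)]
    congr 2
    exact Fin.ext (by simp; omega)

theorem exists_leaf_mem_path (a : Fin (2 * d - 1)) : ∃ b : Fin (2 * d - 1), d - 1 ≤ (b : ℕ) ∧
    (Sum.inl a : HeapNode d c) ∈ (heapTree c hd leaf).path (Sum.inl b) := by
  induction hn : 2 * d - 1 - (a : ℕ) using Nat.strong_induction_on generalizing a with
  | _ n ih =>
  by_cases h : d - 1 ≤ (a : ℕ)
  · exact ⟨a, h, ParentTree.mem_path_self _ _⟩
  · obtain ⟨b, hb, hp⟩ := ih (2 * d - 1 - (2 * a + 1)) (by omega) ⟨2 * a + 1, by omega⟩ (by simp)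
    refine ⟨b, hb, ParentTree.path_trans (ParentTree.mem_path_of_mem_children ?_) hp⟩
    exact mem_children_inl.2 (Or.inl ⟨_, rfl, Or.inl rfl⟩)

end heapTree

/-- The heap node of the `p`-th leaf from the left, in a heap with `d` leaves: the leaves on the
lowest level come first. -/
def heapLeaf (d p : ℕ) : ℕ :=
  if 2 ^ Nat.log 2 (2 * d - 1) + p < 2 * d then 2 ^ Nat.log 2 (2 * d - 1) + p - 1
  else 2 ^ Nat.log 2 (2 * d - 1) + p - d - 1

theorem le_two_pow_log {d : ℕ} (hd : 0 < d) :
    d ≤ 2 ^ Nat.log 2 (2 * d - 1) ∧ 2 ^ Nat.log 2 (2 * d - 1) ≤ 2 * d - 1 := by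
  have h₁ := Nat.lt_pow_succ_log_self (b := 2) (by norm_num) (2 * d - 1)
  have h₂ := Nat.pow_log_le_self 2 (x := 2 * d - 1) (by omega)
  rw [pow_succ] at h₁
  omega

theorem heapLeaf_bounds {d p : ℕ} (hp : p < d) : d - 1 ≤ heapLeaf d p ∧ heapLeaf d p < 2 * d - 1 := by
  have := le_two_pow_log (d := d) (by omega)
  unfold heapLeaf
  split <;> omega

theorem heapLeaf_inj {d p q : ℕ} (hp : p < d) (hq : q < d) (h : heapLeaf d p = heapLeaf d q) :
    p = q := by
  have := le_two_pow_log (d := d) (by omega)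
  unfold heapLeaf at h
  split at h <;> split at h <;> omega

theorem exists_heapLeaf_eq {d a : ℕ} (h₁ : d - 1 ≤ a) (h₂ : a < 2 * d - 1) :
    ∃ p < d, heapLeaf d p = a := by
  have := le_two_pow_log (d := d) (by omega)
  by_cases h : 2 ^ Nat.log 2 (2 * d - 1) ≤ a + 1
  · refine ⟨a + 1 - 2 ^ Nat.log 2 (2 * d - 1), by omega, ?_⟩
    unfold heapLeaf
    split <;> omega
  · refine ⟨a + 1 + d - 2 ^ Nat.log 2 (2 * d - 1), by omega, ?_⟩
    unfold heapLeaf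
    split <;> omega

/-- A leaf on the lowest level keeps its number, a leaf one level higher is replaced by its left
child; these numbers increase from left to right and lie on one level of the infinite heap. -/
theorem exists_key_heapLeaf {d p : ℕ} (hp : p < d) : ∃ δ f : ℕ, δ ≤ 1 ∧
    f / 2 ^ δ = heapLeaf d p + 1 ∧ 2 ^ Nat.log 2 (2 * d - 1) ≤ f ∧
    f < 2 ^ (Nat.log 2 (2 * d - 1) + 1) ∧
    ((f = 2 ^ Nat.log 2 (2 * d - 1) + p ∧ f < 2 * d ∧ δ = 0) ∨
      (f = 2 * (2 ^ Nat.log 2 (2 * d - 1) + p - d) ∧ 2 * d ≤ f ∧ δ = 1)) := by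
  have := le_two_pow_log (d := d) (by omega)
  have h₁ := Nat.lt_pow_succ_log_self (b := 2) (by norm_num) (2 * d - 1)
  have h₂ : 2 ^ (Nat.log 2 (2 * d - 1) + 1) = 2 * 2 ^ Nat.log 2 (2 * d - 1) := by
    rw [pow_succ]
    ring
  rw [Nat.succ_eq_add_one, h₂] at h₁
  rw [h₂]
  by_cases h : 2 ^ Nat.log 2 (2 * d - 1) + p < 2 * d
  · refine ⟨0, 2 ^ Nat.log 2 (2 * d - 1) + p, by omega, ?_, by omega, by omega, Or.inl ?_⟩
    · rw [heapLeaf, if_pos h]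
      simp
      omega
    · omega
  · refine ⟨1, 2 * (2 ^ Nat.log 2 (2 * d - 1) + p - d), by omega, ?_, by omega, by omega,
      Or.inr ?_⟩
    · rw [heapLeaf, if_neg h]
      simp
      omega
    · omega

theorem log_heapLeaf {d p : ℕ} (hp : p < d) :
    Nat.log 2 (heapLeaf d p + 1) = Nat.log 2 d ∨ Nat.log 2 (heapLeaf d p + 1) = Nat.log 2 d + 1 := by
  obtain ⟨h₁, h₂⟩ := heapLeaf_bounds hp
  have h₃ : Nat.log 2 d ≤ Nat.log 2 (heapLeaf d p + 1) := Nat.log_mono_right (by omega)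
  have h₄ : Nat.log 2 (heapLeaf d p + 1) ≤ Nat.log 2 (d * 2) := Nat.log_mono_right (by omega)
  rw [Nat.log_mul_base (by norm_num) (by omega)] at h₄
  omega

/-- The leaves below a node of a heap are consecutive from left to right. -/
theorem heapLeaf_div_eq {d p q s b t₁ t₂ : ℕ} (hp : p < d) (hs : s < d)
    (hpq : p ≤ q) (hqs : q ≤ s) (h₁ : (heapLeaf d p + 1) / 2 ^ t₁ = b + 1)
    (h₂ : (heapLeaf d s + 1) / 2 ^ t₂ = b + 1) : ∃ t, (heapLeaf d q + 1) / 2 ^ t = b + 1 := by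
  obtain ⟨δ₁, f₁, -, e₁, l₁, u₁, c₁⟩ := exists_key_heapLeaf hp
  obtain ⟨δ₂, f₂, -, e₂, l₂, u₂, c₂⟩ := exists_key_heapLeaf hs
  obtain ⟨δ, f, hδ, e, l, u, c⟩ := exists_key_heapLeaf (p := q) (d := d) (by omega)
  rw [← e₁, Nat.div_div_eq_div_mul, ← pow_add] at h₁
  rw [← e₂, Nat.div_div_eq_div_mul, ← pow_add] at h₂
  have hlog : ∀ g s : ℕ, 2 ^ Nat.log 2 (2 * d - 1) ≤ g → g < 2 ^ (Nat.log 2 (2 * d - 1) + 1) →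
      g / 2 ^ s = b + 1 → s = Nat.log 2 (2 * d - 1) - Nat.log 2 (b + 1) := by
    intro g s hl hu hg
    have h₃ := Nat.log_eq_of_pow_le_of_lt_pow hl hu
    have h₄ : Nat.log 2 (g / 2 ^ s) = Nat.log 2 g - s := Nat.log_div_base_pow 2 g s
    rw [hg, h₃] at h₄
    have h₅ : 2 ^ s ≤ g := by
      by_contra h
      rw [Nat.div_eq_of_lt (by omega)] at hg
      omega
    have h₆ := Nat.le_log_of_pow_le (by norm_num) h₅
    omega
  have k₁ := hlog _ _ l₁ u₁ h₁
  have k₂ := hlog _ _ l₂ u₂ h₂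
  rw [k₁] at h₁
  rw [k₂] at h₂
  have hf : f / 2 ^ (Nat.log 2 (2 * d - 1) - Nat.log 2 (b + 1)) = b + 1 := by
    exact le_antisymm ((Nat.div_le_div_right (by omega : f ≤ f₂)).trans h₂.le)
      (h₁.ge.trans (Nat.div_le_div_right (by omega : f₁ ≤ f)))
  by_cases hz : δ ≤ Nat.log 2 (2 * d - 1) - Nat.log 2 (b + 1)
  · refine ⟨Nat.log 2 (2 * d - 1) - Nat.log 2 (b + 1) - δ, ?_⟩
    rw [← e, Nat.div_div_eq_div_mul, ← pow_add, Nat.add_sub_cancel' hz, hf]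
  · have hz' : Nat.log 2 (2 * d - 1) - Nat.log 2 (b + 1) = 0 := by omega
    rw [hz'] at h₁ h₂ hf
    simp only [pow_zero, Nat.div_one] at h₁ h₂ hf
    omega

theorem exists_isBalanced {d m : ℕ} (P : ConvexData d m) (T : ParentTree (Fin d)) :
    ∃ (N : ℕ) (S : TreeData P N), S.IsBalanced T := by
  classical
  obtain ⟨σ, hσ⟩ := T.exists_heavyLightOrder
  have hd0 : 0 < d := Fin.pos T.root
  have hd : 0 < 2 * d - 1 := by omega
  let leaf : Fin d → Fin (2 * d - 1) := fun j =>
    ⟨heapLeaf d (σ.symm j), (heapLeaf_bounds (σ.symm j).2).2⟩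
  let c : Fin d → ℕ := fun j => Fintype.card {x : P.Coord // P.blockLow T x.1 = j}
  let idx : (x : P.Coord) → Fin (c (P.blockLow T x.1)) := fun x =>
    Fintype.equivFin {y : P.Coord // P.blockLow T y.1 = P.blockLow T x.1} ⟨x, rfl⟩
  let H := heapTree c hd leaf
  let e : HeapNode d c ≃ Fin (Fintype.card (HeapNode d c)) := Fintype.equivFin _
  let col : P.Coord → HeapNode d c := fun x => Sum.inr ⟨P.blockLow T x.1,
    ⟨c (P.blockLow T x.1) - 1 + idx x, by have := (idx x).2; omega⟩⟩
  let S : TreeData P (Fintype.card (HeapNode d c)) :=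
    { order := σ
      tree := H.map e
      rowLeaf := fun j => e (Sum.inl (leaf j))
      colLeaf := fun x => e (col x) }
  have hleaf_inj : ∀ i j, leaf i = leaf j → i = j := fun i j h =>
    σ.symm.injective (Fin.ext (heapLeaf_inj (σ.symm i).2 (σ.symm j).2 (congrArg Fin.val h)))
  have hleaf_surj : ∀ a : Fin (2 * d - 1), d - 1 ≤ (a : ℕ) → ∃ j, leaf j = a := by
    intro a ha
    obtain ⟨p, hp, h⟩ := exists_heapLeaf_eq ha a.2
    exact ⟨σ ⟨p, hp⟩, Fin.ext (by simpa [leaf] using h)⟩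
  have hpath : ∀ u v, e u ∈ S.tree.path (e v) ↔ u ∈ H.path v := fun u v => H.mem_path_map e
  have hchild : ∀ v, S.tree.children (e v) = e '' H.children v := H.children_map e
  have hdepth : ∀ v, S.tree.depth (e v) = H.depth v := H.depth_map e
  have hupper : ∀ v, e v ∈ S.upper ↔ ∃ a, v = Sum.inl a := by
    intro v
    constructor
    · rintro ⟨j, hj⟩
      obtain ⟨b, hb, -⟩ := heapTree.exists_of_mem_path_inl ((hpath _ _).1 hj)
      exact ⟨b, hb⟩
    · rintro ⟨a, rfl⟩
      obtain ⟨b, hb, hab⟩ := heapTree.exists_leaf_mem_path (c := c) (hd := hd) (leaf := leaf) a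
      obtain ⟨j, rfl⟩ := hleaf_surj b hb
      exact ⟨j, (hpath _ _).2 hab⟩
  have hcol : ∀ (j : Fin d) (a : Fin (2 * c j - 1)), c j - 1 ≤ (a : ℕ) →
      ∃ x, col x = Sum.inr ⟨j, a⟩ := by
    intro j a ha
    obtain ⟨⟨x, hx⟩, hxa⟩ := (Fintype.equivFin {x : P.Coord // P.blockLow T x.1 = j}).surjective
      ⟨a - (c j - 1), by have := a.2; show _ < c j; omega⟩
    refine ⟨x, ?_⟩
    subst hx
    have h₁ : (idx x : ℕ) = a - (c (P.blockLow T x.1) - 1) := congrArg Fin.val hxa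
    show Sum.inr _ = Sum.inr _
    congr 2
    exact Fin.ext (by simp [h₁]; omega)
  refine ⟨_, S, ⟨hσ, ?_, ?_, ?_, ?_, ?_, ?_, ?_, ?_, ?_, ?_, ?_, ?_, ?_⟩⟩
  · intro i j h
    exact hleaf_inj i j (Sum.inl.inj (e.injective h))
  · intro j
    rw [show S.rowLeaf j = e (Sum.inl (leaf j)) from rfl, hchild, Set.disjoint_left]
    rintro _ ⟨v, hv, rfl⟩ hu
    obtain ⟨a, rfl⟩ := (hupper v).1 hu
    rcases heapTree.mem_children_inl.1 hv with ⟨b, -, hb⟩ | ⟨j, b, hb, -⟩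
    · have := (heapLeaf_bounds (σ.symm j).2).1
      have := b.2
      simp only [leaf] at hb
      omega
    · exact Sum.inl_ne_inr hb
  · intro w hw hr
    obtain ⟨v, rfl⟩ := e.surjective w
    obtain ⟨a, rfl⟩ := (hupper v).1 hw
    have ha : (a : ℕ) < d - 1 := by
      by_contra h
      obtain ⟨j, hj⟩ := hleaf_surj a (by omega)
      exact hr ⟨j, by rw [← hj]⟩
    have hch : H.children (Sum.inl a) =
        {Sum.inl ⟨2 * a + 1, by omega⟩, Sum.inl ⟨2 * a + 2, by omega⟩} := by
      ext v
      rw [heapTree.mem_children_inl]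
      constructor
      · rintro (⟨b, rfl, hb | hb⟩ | ⟨j, b, -, hj, -⟩)
        · exact Or.inl (congrArg Sum.inl (Fin.ext hb))
        · exact Or.inr (congrArg Sum.inl (Fin.ext hb))
        · have := (heapLeaf_bounds (σ.symm j).2).1
          rw [← hj] at ha
          simp only [leaf] at ha
          omega
      · rintro (rfl | rfl)
        · exact Or.inl ⟨_, rfl, Or.inl rfl⟩
        · exact Or.inl ⟨_, rfl, Or.inr rfl⟩
    rw [hchild, hch]
    constructor
    · rintro _ ⟨v, rfl | rfl, rfl⟩
      · exact (hupper _).2 ⟨_, rfl⟩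
      · exact (hupper _).2 ⟨_, rfl⟩
    · rw [Set.ncard_image_of_injective _ e.injective, Set.ncard_pair]
      intro h
      have := congrArg Fin.val (Sum.inl.inj h)
      simp at this
  · refine ⟨Nat.log 2 d + 1, fun j => ?_⟩
    rw [show S.rowLeaf j = e (Sum.inl (leaf j)) from rfl, hdepth, heapTree.depth_inl]
    have := log_heapLeaf (σ.symm j).2
    simp only [leaf]
    omega
  · intro w hw
    obtain ⟨v, rfl⟩ := e.surjective w
    obtain ⟨a, rfl⟩ := (hupper v).1 hw
    have hiff : ∀ p, S.order p ∈ S.rowLabel (e (Sum.inl a)) ↔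
        ∃ t, (heapLeaf d p + 1) / 2 ^ t = a + 1 := by
      intro p
      have hl : (leaf (σ p) : ℕ) = heapLeaf d p := by simp [leaf]
      rw [TreeData.mem_rowLabel, show S.rowLeaf (S.order p) = e (Sum.inl (leaf (σ p))) from rfl,
        hpath]
      constructor
      · intro h
        obtain ⟨b, hb, t, ht⟩ := heapTree.exists_of_mem_path_inl h
        rw [hl] at ht
        exact ⟨t, by rw [ht, Sum.inl.inj hb]⟩
      · rintro ⟨t, ht⟩
        exact heapTree.mem_path_inl (t := t) (by rw [hl, ht])
    refine ⟨fun p hp s hs q hq => ?_⟩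
    simp only [Set.mem_ofPred_eq, hiff] at hp hs ⊢
    obtain ⟨t₁, h₁⟩ := hp
    obtain ⟨t₂, h₂⟩ := hs
    exact heapLeaf_div_eq p.2 s.2 hq.1 hq.2 h₁ h₂
  · intro x y h
    have h₁ := Sum.inr.inj (e.injective h)
    have h₂ : P.blockLow T x.1 = P.blockLow T y.1 := congrArg Sigma.fst h₁
    have h₃ : (idx x : ℕ) = idx y := by
      have h₄ : (c (P.blockLow T x.1) - 1 + idx x : ℕ) = c (P.blockLow T y.1) - 1 + idx y := by
        have : ∀ (u v : (j : Fin d) × Fin (2 * c j - 1)), u = v → (u.2 : ℕ) = v.2 := by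
          rintro u _ rfl
          rfl
        exact this _ _ h₁
      have hc : c (P.blockLow T x.1) = c (P.blockLow T y.1) := congrArg c h₂
      omega
    have h₅ : ∀ (j : Fin d) (hx : P.blockLow T x.1 = j) (hy : P.blockLow T y.1 = j),
        (idx x : ℕ) = Fintype.equivFin {z : P.Coord // P.blockLow T z.1 = j} ⟨x, hx⟩ ∧
        (idx y : ℕ) = Fintype.equivFin {z : P.Coord // P.blockLow T z.1 = j} ⟨y, hy⟩ := by
      intro j hx hy
      constructor
      · subst hx
        rfl
      · subst hy
        rfl
    obtain ⟨h₆, h₇⟩ := h₅ _ rfl h₂.symm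
    rw [h₆, h₇] at h₃
    have := (Fintype.equivFin _).injective (Fin.ext h₃)
    exact congrArg Subtype.val this
  · intro x hx
    obtain ⟨a, ha⟩ := (hupper _).1 hx
    exact Sum.inr_ne_inl ha
  · intro x
    exact (hpath _ _).2 (heapTree.leaf_mem_path_inr _ _)
  · intro x
    rw [show S.colLeaf x = e (col x) from rfl, hchild, Set.image_eq_empty,
      Set.eq_empty_iff_forall_notMem]
    intro v hv
    obtain ⟨b, -, hb⟩ := heapTree.mem_children_inr.1 hv
    have := b.2
    simp only at hb
    omega
  · intro j
    rw [show S.rowLeaf j = e (Sum.inl (leaf j)) from rfl, hchild,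
      Set.ncard_image_of_injective _ e.injective, Set.ncard_le_one (Set.toFinite _)]
    have h : ∀ v ∈ H.children (Sum.inl (leaf j)), ∃ b : Fin (2 * c j - 1),
        v = Sum.inr ⟨j, b⟩ ∧ (b : ℕ) = 0 := by
      intro v hv
      rcases heapTree.mem_children_inl.1 hv with ⟨b, -, hb⟩ | ⟨i, b, rfl, hi, hb⟩
      · have := (heapLeaf_bounds (σ.symm j).2).1
        have := b.2
        simp only [leaf] at hb
        omega
      · obtain rfl := hleaf_inj _ _ hi
        exact ⟨b, rfl, hb⟩
    intro u hu v hv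
    obtain ⟨b₁, rfl, h₁⟩ := h u hu
    obtain ⟨b₂, rfl, h₂⟩ := h v hv
    congr 2
    exact Fin.ext (by rw [h₁, h₂])
  · intro j hj
    have hc : c j = 0 := Fintype.card_eq_zero_iff.2 ⟨fun x => hj x.1.1 x.2⟩
    rw [show S.rowLeaf j = e (Sum.inl (leaf j)) from rfl, hchild, Set.image_eq_empty,
      Set.eq_empty_iff_forall_notMem]
    intro v hv
    rcases heapTree.mem_children_inl.1 hv with ⟨b, -, hb⟩ | ⟨i, b, rfl, hi, hb⟩
    · have := (heapLeaf_bounds (σ.symm j).2).1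
      have := b.2
      simp only [leaf] at hb
      omega
    · obtain rfl := hleaf_inj _ _ hi
      have := b.2
      omega
  · intro w hw hr
    obtain ⟨v, rfl⟩ := e.surjective w
    rcases v with a | ⟨j, a⟩
    · exact absurd ((hupper _).2 ⟨a, rfl⟩) hw
    have ha : (a : ℕ) < c j - 1 := by
      by_contra h
      obtain ⟨x, hx⟩ := hcol j a (by omega)
      exact hr ⟨x, by rw [← hx]⟩
    have hch : H.children (Sum.inr ⟨j, a⟩) =
        {Sum.inr ⟨j, ⟨2 * a + 1, by omega⟩⟩, Sum.inr ⟨j, ⟨2 * a + 2, by omega⟩⟩} := by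
      ext v
      rw [heapTree.mem_children_inr]
      constructor
      · rintro ⟨b, rfl, hb | hb⟩
        · left
          congr 2
          exact Fin.ext hb
        · right
          show _ = _
          congr 2
          exact Fin.ext hb
      · rintro (rfl | rfl)
        · exact ⟨_, rfl, Or.inl rfl⟩
        · exact ⟨_, rfl, Or.inr rfl⟩
    rw [hchild, hch, Set.ncard_image_of_injective _ e.injective, Set.ncard_pair]
    intro h
    have := congrArg Fin.val (eq_of_heq (Sigma.mk.inj (Sum.inr.inj h)).2)
    simp at this
  · intro j
    refine ⟨H.depth (Sum.inl (leaf j)) + Nat.log 2 (c j) + 1, fun x hx => ?_⟩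
    subst hx
    rw [show S.colLeaf x = e (col x) from rfl, hdepth, heapTree.depth_inr]
    have h₁ := (idx x).2
    have h₃ : Nat.log 2 (c (P.blockLow T x.1)) ≤ Nat.log 2 (c (P.blockLow T x.1) - 1 + idx x + 1) :=
      Nat.log_mono_right (by omega)
    have h₄ : Nat.log 2 (c (P.blockLow T x.1) - 1 + idx x + 1) ≤
        Nat.log 2 (c (P.blockLow T x.1) * 2) := Nat.log_mono_right (by omega)
    rw [Nat.log_mul_base (by norm_num) (by omega)] at h₄
    simp only [H] at *
    omega

/-! ### Cholesky factors along an elimination tree -/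

/-- Column `u` of `L` vanishes outside the path of `u`. -/
def PathSupported {d : ℕ} (T : ParentTree (Fin d)) (L : Matrix (Fin d) (Fin d) ℝ) : Prop :=
  ∀ a u, L a u ≠ 0 → a ∈ T.path u

/-- Every vertex precedes its ancestors. -/
def ParentTree.Increasing {d : ℕ} (T : ParentTree (Fin d)) : Prop :=
  ∀ u v, u ∈ T.path v → v ≤ u

namespace PathSupported

variable {d : ℕ} {T : ParentTree (Fin d)} {L : Matrix (Fin d) (Fin d) ℝ}

theorem eq_zero (hL : PathSupported T L) {a u : Fin d} (h : a ∉ T.path u) : L a u = 0 := by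
  by_contra hne
  exact h (hL a u hne)

theorem lower (hL : PathSupported T L) (hT : T.Increasing) {a u : Fin d} (h : a < u) :
    L a u = 0 := hL.eq_zero fun h' => absurd (hT a u h') (not_le.2 h)

theorem det_eq (hL : PathSupported T L) (hT : T.Increasing) : L.det = ∏ i, L i i :=
  Matrix.det_of_isLowerTriangular L fun _ _ h => hL.lower hT h

theorem isUnit_det (hL : PathSupported T L) (hT : T.Increasing) (hd : ∀ i, L i i ≠ 0) :
    IsUnit L.det := by
  rw [hL.det_eq hT, isUnit_iff_ne_zero]
  exact Finset.prod_ne_zero_iff.2 fun i _ => hd i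

theorem diag_pos_of_posDef (hL : PathSupported T L) (hT : T.Increasing) (h0 : ∀ i, 0 ≤ L i i)
    (hpd : (L * Lᵀ).PosDef) (i : Fin d) : 0 < L i i := by
  refine lt_of_le_of_ne (h0 i) fun h => ?_
  have := hpd.det_pos
  have hz : L.det = 0 := (hL.det_eq hT).trans (Finset.prod_eq_zero (Finset.mem_univ i) h.symm)
  rw [Matrix.det_mul, hz, zero_mul] at this
  exact lt_irrefl _ this

/-- Solutions of triangular systems are supported on the ancestors of the right-hand side. -/
theorem solution_support (hL : PathSupported T L) (hT : T.Increasing) (hd : ∀ i, L i i ≠ 0)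
    {U : Set (Fin d)} (hU : ∀ j ∈ U, T.path j ⊆ U) {z b : Fin d → ℝ} (hz : L *ᵥ z = b)
    (hb : ∀ u ∉ U, b u = 0) (u : Fin d) (hu : u ∉ U) : z u = 0 := by
  induction u using WellFoundedLT.induction with
  | _ u ih =>
  have h := congrFun hz u
  rw [hb u hu, Matrix.mulVec, dotProduct, Finset.sum_eq_single u] at h
  · exact (mul_eq_zero.1 h).resolve_left (hd u)
  · intro j _ hj
    by_cases hp : u ∈ T.path j
    · have hj' : j ∉ U := fun h' => hu (hU j h' hp)
      rw [ih j (lt_of_le_of_ne (hT u j hp) hj) hj', mul_zero]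
    · rw [hL.eq_zero hp, zero_mul]
  · simp

end PathSupported

section Columns

variable {d : ℕ}

/-- Columns of two lower triangular factors agree when the products agree there and only earlier
columns with the same property interfere. -/
theorem lowerTriangular_columns_eq {L L₁ : Matrix (Fin d) (Fin d) ℝ}
    (hL : ∀ i j, i < j → L i j = 0) (hL₁ : ∀ i j, i < j → L₁ i j = 0)
    (hd : ∀ i, 0 < L i i) (hd₁ : ∀ i, 0 < L₁ i i) (F : Set (Fin d))
    (hF : ∀ u ∈ F, ∀ w, w < u → L u w ≠ 0 ∨ L₁ u w ≠ 0 → w ∈ F)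
    (h : ∀ u ∈ F, ∀ a, (L * Lᵀ) a u = (L₁ * L₁ᵀ) a u) (u : Fin d) (hu : u ∈ F) (a : Fin d) :
    L a u = L₁ a u := by
  induction u using WellFoundedLT.induction generalizing a with
  | _ u ih =>
  have key : ∀ a, L a u * L u u = L₁ a u * L₁ u u := by
    intro a
    have h₁ := h u hu a
    simp only [Matrix.mul_apply, Matrix.transpose_apply] at h₁
    rw [← Finset.add_sum_erase _ _ (Finset.mem_univ u),
      ← Finset.add_sum_erase _ _ (Finset.mem_univ u)] at h₁
    have h₂ : ∑ w ∈ Finset.univ.erase u, L a w * L u w =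
        ∑ w ∈ Finset.univ.erase u, L₁ a w * L₁ u w := by
      refine Finset.sum_congr rfl fun w hw => ?_
      rcases lt_or_gt_of_ne (Finset.ne_of_mem_erase hw) with hlt | hgt
      · by_cases hz : L u w ≠ 0 ∨ L₁ u w ≠ 0
        · have hw' := hF u hu w hlt hz
          rw [ih w hlt hw' a, ih w hlt hw' u]
        · rw [not_or, not_not, not_not] at hz
          rw [hz.1, hz.2, mul_zero, mul_zero]
      · rw [hL u w hgt, hL₁ u w hgt, mul_zero, mul_zero]
    rw [h₂] at h₁
    exact add_right_cancel h₁
  have hdiag : L u u = L₁ u u := by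
    have := key u
    exact (mul_self_inj (hd u).le (hd₁ u).le).1 this
  have := key a
  rw [← hdiag] at this
  exact mul_right_cancel₀ (hd u).ne' this

theorem IsCholesky.unique {M L L₁ : Matrix (Fin d) (Fin d) ℝ} (h : IsCholesky M L)
    (h₁ : IsCholesky M L₁) : L = L₁ := by
  ext a u
  refine lowerTriangular_columns_eq h.1 h₁.1 h.2.1 h₁.2.1 Set.univ (fun _ _ _ _ _ => trivial)
    (fun _ _ _ => ?_) u trivial a
  rw [h.2.2, h₁.2.2]

theorem IsCholesky.eq_cholesky {M L : Matrix (Fin d) (Fin d) ℝ} (h : IsCholesky M L) :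
    L = cholesky M := h.unique (Classical.epsilon_spec ⟨L, h⟩)

theorem gram_updateCol (L : Matrix (Fin d) (Fin d) ℝ) (u : Fin d) (x : Fin d → ℝ) (a e : Fin d) :
    (L.updateCol u x * (L.updateCol u x)ᵀ) a e =
      (L * Lᵀ) a e - L a u * L e u + x a * x e := by
  simp only [Matrix.mul_apply, Matrix.transpose_apply]
  rw [← Finset.add_sum_erase _ _ (Finset.mem_univ u),
    ← Finset.add_sum_erase _ (fun w => L a w * L e w) (Finset.mem_univ u)]
  have : ∑ w ∈ Finset.univ.erase u, L.updateCol u x a w * L.updateCol u x e w =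
      ∑ w ∈ Finset.univ.erase u, L a w * L e w :=
    Finset.sum_congr rfl fun w hw => by
      rw [Matrix.updateCol_ne (Finset.ne_of_mem_erase hw),
        Matrix.updateCol_ne (Finset.ne_of_mem_erase hw)]
  rw [this, Matrix.updateCol_self, Matrix.updateCol_self]
  ring

/-- A rotation (circular for `σ = 1`, hyperbolic for `σ = -1`) of column `u` of `L` against `b`
preserves `L Lᵀ + σ b bᵀ`. -/
theorem gram_rotate {L : Matrix (Fin d) (Fin d) ℝ} {u : Fin d} {b : Fin d → ℝ} {σ R : ℝ}
    (hR : R * R = L u u * L u u + σ * (b u * b u)) (hR0 : R ≠ 0) (a e : Fin d) :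
    (L.updateCol u (fun i => L u u / R * L i u + σ * (b u / R) * b i) *
      (L.updateCol u (fun i => L u u / R * L i u + σ * (b u / R) * b i))ᵀ) a e +
      σ * ((L u u / R * b a - b u / R * L a u) * (L u u / R * b e - b u / R * L e u)) =
    (L * Lᵀ) a e + σ * (b a * b e) := by
  rw [gram_updateCol]
  have h₁ : (L u u / R * L a u + σ * (b u / R) * b a) * (L u u / R * L e u + σ * (b u / R) * b e) +
      σ * ((L u u / R * b a - b u / R * L a u) * (L u u / R * b e - b u / R * L e u)) =
      ((L u u * L u u + σ * (b u * b u)) * (L a u * L e u) +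
        σ * ((L u u * L u u + σ * (b u * b u)) * (b a * b e))) / (R * R) := by
    field_simp
    ring
  rw [← hR] at h₁
  have h₂ : (R * R * (L a u * L e u) + σ * (R * R * (b a * b e))) / (R * R) =
      L a u * L e u + σ * (b a * b e) := by
    field_simp
  rw [h₂] at h₁
  linear_combination h₁

end Columns

section Rotation

variable {d : ℕ} {T : ParentTree (Fin d)} {L : Matrix (Fin d) (Fin d) ℝ}

theorem PathSupported.updateCol (hL : PathSupported T L) {u : Fin d} {x : Fin d → ℝ}
    (hx : ∀ a ∉ T.path u, x a = 0) : PathSupported T (L.updateCol u x) := by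
  intro a w h
  by_cases hw : w = u
  · subst hw
    rw [Matrix.updateCol_self] at h
    by_contra h'
    exact h (hx a h')
  · rw [Matrix.updateCol_ne hw] at h
    exact hL a w h

/-- A downdate of a positive definite matrix to a positive definite matrix meets positive pivots. -/
theorem PathSupported.pivot_pos (hL : PathSupported T L) (hT : T.Increasing)
    (h0 : ∀ i, 0 ≤ L i i) {b : Fin d → ℝ} {u : Fin d} (hb : ∀ a ∉ T.path u, b a = 0)
    (hpd : (L * Lᵀ - Matrix.vecMulVec b b).PosDef) : 0 < L u u * L u u - b u * b u := by
  have hLL : (L * Lᵀ).PosDef := by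
    have h₁ : (Matrix.vecMulVec b b).PosSemidef := by
      have := Matrix.posSemidef_vecMulVec_self_star b
      simpa using this
    have := hpd.add_posSemidef h₁
    simpa using this
  have hpos := hL.diag_pos_of_posDef hT h0 hLL
  have hunit := hL.isUnit_det hT fun i => (hpos i).ne'
  let _ := Matrix.invertibleOfIsUnitDet L hunit
  have htri : Matrix.BlockTriangular L OrderDual.toDual := fun i j h => hL.lower hT h
  have hinv := Matrix.blockTriangular_inv_of_blockTriangular htri
  -- Test the quadratic form on row `u` of the inverse.
  set x : Fin d → ℝ := fun i => L⁻¹ u i with hx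
  have hx1 : ∀ i, u < i → x i = 0 := fun i h => hinv h
  have hxL : x ᵥ* L = Pi.single u 1 := by
    ext j
    have : (L⁻¹ * L) u j = (1 : Matrix _ _ ℝ) u j := by rw [Matrix.nonsing_inv_mul L hunit]
    rw [Matrix.mul_apply] at this
    rw [Matrix.vecMul, dotProduct]
    rw [this, Matrix.one_apply, Pi.single_apply]
    simp [eq_comm]
  have hxu : x u * L u u = 1 := by
    have h := congrFun hxL u
    rw [Matrix.vecMul, dotProduct, Finset.sum_eq_single u, Pi.single_eq_same] at h
    · exact h
    · intro i _ hi
      rcases lt_or_gt_of_ne hi with h | h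
      · rw [hL.lower hT h, mul_zero]
      · rw [hx1 i h, zero_mul]
    · simp
  have hxb : x ⬝ᵥ b = x u * b u := by
    rw [dotProduct, Finset.sum_eq_single u]
    · intro i _ hi
      rcases lt_or_gt_of_ne hi with h | h
      · rw [hb i fun h' => absurd (hT i u h') (not_le.2 h), mul_zero]
      · rw [hx1 i h, zero_mul]
    · simp
  have hx0 : x ≠ 0 := fun h => by
    rw [h] at hxu
    simp at hxu
  have := hpd.dotProduct_mulVec_pos hx0
  rw [star_trivial, Matrix.sub_mulVec, dotProduct_sub, ← Matrix.mulVec_mulVec,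
    Matrix.dotProduct_mulVec, hxL, Matrix.mulVec_transpose, hxL, Matrix.vecMulVec_mulVec] at this
  have h₂ : x ⬝ᵥ (MulOpposite.op (b ⬝ᵥ x) • b) = (x u * b u) * (x u * b u) := by
    rw [dotProduct_comm b x, hxb]
    simp [dotProduct_smul, hxb]
  rw [h₂] at this
  simp only [single_one_dotProduct, Pi.single_eq_same] at this
  have h₃ : L u u * L u u - b u * b u =
      (1 - x u * b u * (x u * b u)) * (L u u * L u u) := by
    linear_combination b u * b u * (x u * L u u + 1) * hxu
  rw [h₃]
  exact mul_pos this (mul_pos (hpos u) (hpos u))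

/-- Adding a vector supported on a path to a positive semidefinite matrix keeps the existence of a
path-supported factor. -/
theorem exists_factor_add_vecMulVec (w : Fin d) (L : Matrix (Fin d) (Fin d) ℝ)
    (hL : PathSupported T L) (h0 : ∀ i, 0 ≤ L i i) (b : Fin d → ℝ) (hb : ∀ a ∉ T.path w, b a = 0) :
    ∃ L₁, PathSupported T L₁ ∧ (∀ i, 0 ≤ L₁ i i) ∧
      ∀ a e, (L₁ * L₁ᵀ) a e = (L * Lᵀ) a e + b a * b e := by
  induction hn : T.depth w using Nat.strong_induction_on generalizing w L b with
  | _ n ih =>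
  obtain ⟨L₁, b₁, hL₁, h₁, hb₁, hw, heq⟩ : ∃ (L₁ : Matrix (Fin d) (Fin d) ℝ) (b₁ : Fin d → ℝ),
      PathSupported T L₁ ∧ (∀ i, 0 ≤ L₁ i i) ∧ (∀ a ∉ T.path w, b₁ a = 0) ∧ b₁ w = 0 ∧
      ∀ a e, (L₁ * L₁ᵀ) a e + b₁ a * b₁ e = (L * Lᵀ) a e + b a * b e := by
    by_cases hR : L w w * L w w + b w * b w = 0
    · have : b w = 0 := by nlinarith [mul_self_nonneg (L w w), mul_self_nonneg (b w)]
      exact ⟨L, b, hL, h0, hb, this, fun _ _ => rfl⟩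
    · have hpos : 0 < L w w * L w w + b w * b w :=
        lt_of_le_of_ne (add_nonneg (mul_self_nonneg _) (mul_self_nonneg _)) (Ne.symm hR)
      set R := Real.sqrt (L w w * L w w + b w * b w) with hRdef
      have hRR : R * R = L w w * L w w + 1 * (b w * b w) := by
        rw [one_mul]
        exact Real.mul_self_sqrt hpos.le
      have hRpos : 0 < R := Real.sqrt_pos.2 hpos
      refine ⟨L.updateCol w (fun i => L w w / R * L i w + 1 * (b w / R) * b i),
        fun i => L w w / R * b i - b w / R * L i w, ?_, fun i => ?_, fun a ha => ?_, ?_,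
        fun a e => ?_⟩
      · exact hL.updateCol fun a ha => by rw [hL.eq_zero ha, hb a ha]; ring
      · by_cases hi : i = w
        · subst hi
          rw [Matrix.updateCol_self]
          have : L i i / R * L i i + 1 * (b i / R) * b i = R := by
            field_simp
            linear_combination -hRR
          rw [this]
          exact hRpos.le
        · rw [Matrix.updateCol_ne hi]
          exact h0 i
      · simp only [hL.eq_zero ha, hb a ha]
        ring
      · ring
      · have := gram_rotate (σ := 1) hRR hRpos.ne' a e
        linear_combination this
  by_cases hroot : w = T.root
  · refine ⟨L₁, hL₁, h₁, fun a e => ?_⟩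
    have hz : ∀ a, b₁ a = 0 := by
      intro a
      by_cases ha : a = w
      · rw [ha, hw]
      · exact hb₁ a (by rw [hroot, T.path_root]; rwa [hroot] at ha)
    rw [← heq, hz a, zero_mul, add_zero]
  · obtain ⟨L₂, hL₂, h₂, heq₂⟩ := ih (T.depth (T.parent w))
      (by have := ParentTree.depth_eq_succ hroot; omega) (T.parent w) L₁ hL₁ h₁ b₁ (fun a ha => by
        by_cases haw : a = w
        · rw [haw, hw]
        · refine hb₁ a fun h => ?_
          rw [ParentTree.path_eq_insert] at h
          exact h.elim haw ha) rfl
    exact ⟨L₂, hL₂, h₂, fun a e => by rw [heq₂, heq]⟩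

theorem exists_factor_sum {ι : Type} (s : Finset ι) (g : ι → Fin d → ℝ)
    (low : ι → Fin d) (hg : ∀ c, ∀ a ∉ T.path (low c), g c a = 0) :
    ∃ L, PathSupported T L ∧ (∀ i, 0 ≤ L i i) ∧ ∀ a e, (L * Lᵀ) a e = ∑ c ∈ s, g c a * g c e := by
  classical
  induction s using Finset.induction_on with
  | empty => exact ⟨0, fun a u h => absurd rfl h, fun i => le_rfl, fun a e => by simp⟩
  | insert c s hc ih =>
    obtain ⟨L, hL, h0, heq⟩ := ih
    obtain ⟨L₁, hL₁, h₁, heq₁⟩ := exists_factor_add_vecMulVec (low c) L hL h0 (g c) (hg c)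
    exact ⟨L₁, hL₁, h₁, fun a e => by rw [heq₁, heq, Finset.sum_insert hc]; ring⟩

end Rotation

/-! ### The matrix `A H_x ^ (-1/2)` and its Cholesky factor -/

theorem invSqrt_transpose {k : ℕ} (M : Matrix (Fin k) (Fin k) ℝ) : (invSqrt M)ᵀ = invSqrt M := by
  have h : IsSelfAdjoint (invSqrt M) := cfc_predicate _ _
  have h₁ : (invSqrt M)ᴴ = invSqrt M := h
  rwa [Matrix.conjTranspose_eq_transpose_of_trivial] at h₁

theorem invSqrt_mul_self_mul {k : ℕ} {M : Matrix (Fin k) (Fin k) ℝ} (hM : M.PosDef) :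
    invSqrt M * invSqrt M * M = 1 := by
  have hsa : IsSelfAdjoint M := hM.1
  have hc : ∀ f : ℝ → ℝ, ContinuousOn f (spectrum ℝ M) := fun f =>
    (Matrix.finite_real_spectrum).continuousOn f
  have h₁ : M = cfc (fun t : ℝ => t) M := (cfc_id' ℝ M).symm
  conv_lhs => rw [h₁]
  rw [← h₁, invSqrt, ← cfc_mul _ _ M (hc _) (hc _)]
  conv_lhs => rw [← cfc_id' ℝ M]
  rw [cfc_id' ℝ M, show cfc (fun x : ℝ => (√x)⁻¹ * (√x)⁻¹) M * M =
    cfc (fun x : ℝ => (√x)⁻¹ * (√x)⁻¹) M * cfc (fun t : ℝ => t) M by rw [cfc_id' ℝ M],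
    ← cfc_mul _ _ M (hc _) (hc _), ← cfc_one ℝ M]
  refine cfc_congr fun t ht => ?_
  rw [hM.1.spectrum_real_eq_range_eigenvalues] at ht
  obtain ⟨i, rfl⟩ := ht
  have hpos := hM.eigenvalues_pos i
  have : √(hM.1.eigenvalues i) * √(hM.1.eigenvalues i) = hM.1.eigenvalues i :=
    Real.mul_self_sqrt hpos.le
  show (√(hM.1.eigenvalues i))⁻¹ * (√(hM.1.eigenvalues i))⁻¹ * hM.1.eigenvalues i = 1
  rw [← mul_inv, this]
  exact inv_mul_cancel₀ hpos.ne'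

namespace ConvexData

variable {d m : ℕ} (P : ConvexData d m) {T : ParentTree (Fin d)}

/-- The matrix `A H_x ^ (-1/2)`. -/
noncomputable def G (x : P.Point) : Matrix (Fin d) P.Coord ℝ := P.A * P.HInvSqrt x

theorem HInvSqrt_transpose (x : P.Point) : (P.HInvSqrt x)ᵀ = P.HInvSqrt x := by
  rw [HInvSqrt, Matrix.blockDiagonal'_transpose]
  simp only [invSqrt_transpose]

theorem G_apply (x : P.Point) (u : Fin d) (i : Fin m) (k : Fin (P.size i)) :
    P.G x u ⟨i, k⟩ = ∑ l, P.A u ⟨i, l⟩ * invSqrt (hessian (P.φ i) (x i)) l k := by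
  rw [G, Matrix.mul_apply, Fintype.sum_sigma, Finset.sum_eq_single i]
  · refine Finset.sum_congr rfl fun l _ => ?_
    rw [HInvSqrt, Matrix.blockDiagonal'_apply_eq]
  · intro i₁ _ hi
    refine Finset.sum_eq_zero fun l _ => ?_
    rw [HInvSqrt, Matrix.blockDiagonal'_apply_ne _ _ _ hi, mul_zero]
  · simp

variable {P}

theorem IsEliminationTree.increasing (hT : P.IsEliminationTree T) : T.Increasing := fun _ _ h =>
  hT.le_of_mem_path h

theorem IsEliminationTree.G_eq_zero (hT : P.IsEliminationTree T) (x : P.Point) (u : Fin d)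
    (c : P.Coord) (h : u ∉ T.path (P.blockLow T c.1)) : P.G x u c = 0 := by
  obtain ⟨i, k⟩ := c
  rw [G_apply]
  refine Finset.sum_eq_zero fun l _ => ?_
  have : P.A u ⟨i, l⟩ = 0 := by
    by_contra hne
    exact h (hT.mem_path_blockLow ⟨l, hne⟩)
  rw [this, zero_mul]

theorem HInvSqrt_mul_mul_H {x : P.Point} (hx : P.Feasible x) :
    P.HInvSqrt x * P.HInvSqrt x * P.H x = 1 := by
  rw [HInvSqrt, H, ← Matrix.blockDiagonal'_mul, ← Matrix.blockDiagonal'_mul,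
    ← Matrix.blockDiagonal'_one]
  congr 1
  ext1 i
  exact invSqrt_mul_self_mul (P.hessian_posDef i _ (hx i))

theorem gram_eq {x : P.Point} (hx : P.Feasible x) :
    P.A * (P.H x)⁻¹ * P.Aᵀ = P.G x * (P.G x)ᵀ := by
  rw [Matrix.inv_eq_left_inv (HInvSqrt_mul_mul_H hx), G, Matrix.transpose_mul, HInvSqrt_transpose]
  simp only [Matrix.mul_assoc]

theorem A_vecMul_injective (P : ConvexData d m) : Function.Injective P.A.vecMul := by
  rw [show P.A.vecMul = (fun v => v ᵥ* P.A) from rfl, Matrix.vecMul_injective_iff,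
    linearIndependent_iff_card_eq_finrank_span]
  rw [Fintype.card_fin, Set.finrank, ← Matrix.rank_eq_finrank_span_row, P.full_rank]

theorem gram_posDef {x : P.Point} (hx : P.Feasible x) : (P.G x * (P.G x)ᵀ).PosDef := by
  have h := Matrix.PosDef.mul_conjTranspose_self (P.G x) (by
    intro v w hvw
    refine P.A_vecMul_injective ?_
    have h₁ : (v ᵥ* P.G x) ᵥ* (P.HInvSqrt x * P.H x) = (w ᵥ* P.G x) ᵥ* (P.HInvSqrt x * P.H x) :=
      congrArg (fun y => y ᵥ* (P.HInvSqrt x * P.H x)) hvw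
    have h₂ : P.G x * (P.HInvSqrt x * P.H x) = P.A := by
      rw [G, Matrix.mul_assoc, ← Matrix.mul_assoc (P.HInvSqrt x), HInvSqrt_mul_mul_H hx,
        Matrix.mul_one]
    rwa [Matrix.vecMul_vecMul, Matrix.vecMul_vecMul, h₂] at h₁)
  rwa [Matrix.conjTranspose_eq_transpose_of_trivial] at h

theorem gram_apply (x : P.Point) (a e : Fin d) :
    (P.G x * (P.G x)ᵀ) a e = ∑ c, P.G x a c * P.G x e c := by
  simp [Matrix.mul_apply]

/-- A path-supported factor with nonnegative diagonal is the Cholesky factor. -/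
theorem IsEliminationTree.eq_chol (hT : P.IsEliminationTree T) {x : P.Point} (hx : P.Feasible x)
    {L : Matrix (Fin d) (Fin d) ℝ} (hL : PathSupported T L) (h0 : ∀ i, 0 ≤ L i i)
    (h : L * Lᵀ = P.G x * (P.G x)ᵀ) :
    L = P.chol x ∧ ∀ i, 0 < L i i := by
  have hpos := hL.diag_pos_of_posDef hT.increasing h0 (h ▸ gram_posDef hx)
  refine ⟨IsCholesky.eq_cholesky ⟨fun i j hij => hL.lower hT.increasing hij, hpos, ?_⟩, hpos⟩
  rw [h, gram_eq hx]

theorem IsEliminationTree.chol_spec (hT : P.IsEliminationTree T) {x : P.Point}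
    (hx : P.Feasible x) : PathSupported T (P.chol x) ∧ (∀ i, 0 < P.chol x i i) ∧
      P.chol x * (P.chol x)ᵀ = P.G x * (P.G x)ᵀ := by
  obtain ⟨L, hL, h0, heq⟩ := exists_factor_sum (T := T) Finset.univ (fun c a => P.G x a c)
    (fun c => P.blockLow T c.1) (fun c a ha => hT.G_eq_zero x a c ha)
  have h : L * Lᵀ = P.G x * (P.G x)ᵀ := by
    ext a e
    rw [heq, gram_apply]
  obtain ⟨h₁, h₂⟩ := hT.eq_chol hx hL h0 h
  rw [← h₁]
  exact ⟨hL, h₂, h⟩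

/-- When only block `i` of the point changes, only the columns of the Cholesky factor on the path of
the lowest row of the block change. -/
theorem IsEliminationTree.chol_update (hT : P.IsEliminationTree T) {x x₁ : P.Point}
    (hx : P.Feasible x) (hx₁ : P.Feasible x₁) {i : Fin m} (h : ∀ j, j ≠ i → x₁ j = x j)
    {u : Fin d} (hu : u ∉ T.path (P.blockLow T i)) (a : Fin d) : P.chol x₁ a u = P.chol x a u := by
  obtain ⟨s₁, p₁, g₁⟩ := hT.chol_spec hx₁
  obtain ⟨s₂, p₂, g₂⟩ := hT.chol_spec hx
  refine lowerTriangular_columns_eq (fun i j h => s₁.lower hT.increasing h)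
    (fun i j h => s₂.lower hT.increasing h) p₁ p₂ (T.path (P.blockLow T i))ᶜ ?_ ?_ u hu a
  · intro u hu w _ hw hw'
    have : u ∈ T.path w := hw.elim (s₁ u w) (s₂ u w)
    exact hu (ParentTree.path_trans this hw')
  · intro u hu a
    rw [g₁, g₂, gram_apply, gram_apply]
    refine Finset.sum_congr rfl fun c _ => ?_
    by_cases hc : c.1 = i
    · rw [hT.G_eq_zero x₁ u c (by rw [hc]; exact hu), hT.G_eq_zero x u c (by rw [hc]; exact hu),
        mul_zero, mul_zero]
    · obtain ⟨i₁, k⟩ := c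
      simp only [G_apply, h i₁ hc]

end ConvexData

/-! ### The invariant of BalancedSketch -/

namespace TreeData

variable {d m N : ℕ} {P : ConvexData d m} {S : TreeData P N} {T : ParentTree (Fin d)}

/-- The vertices of the elimination tree on the paths of the rows below `v`; outside these columns
the matrices of a node `v` of the upper tree vanish. -/
def support (S : TreeData P N) (T : ParentTree (Fin d)) (v : Fin N) : Set (Fin d) :=
  {u | ∃ i ∈ S.rowLabel v, u ∈ T.path i}

theorem path_subset_support {v : Fin N} {j : Fin d} (h : j ∈ S.support T v) :
    T.path j ⊆ S.support T v := by
  obtain ⟨i, hi, hj⟩ := h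
  exact fun u hu => ⟨i, hi, ParentTree.path_trans hu hj⟩

theorem mem_Lam {v : Fin N} {u : Fin d} :
    u ∈ S.Lam T v ↔ u ∈ S.support T v ∧ ¬ T.below u ⊆ S.rowLabel v := by
  simp only [Lam, support, Set.mem_inter_iff, Set.mem_iUnion, Set.not_subset, exists_prop,
    Set.mem_compl_iff, Set.mem_ofPred_eq]
  refine and_congr_right fun _ => exists_congr fun i => ?_
  exact and_comm

theorem mem_LamBar {v : Fin N} {u : Fin d} :
    u ∈ S.LamBar T v ↔ T.below u ⊆ S.rowLabel v := by
  have h : u ∈ ⋃ i ∈ S.rowLabel v, T.path i ↔ u ∈ S.support T v := by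
    simp [support]
  rw [LamBar, Set.mem_sdiff, h, mem_Lam]
  constructor
  · rintro ⟨h₁, h₂⟩
    by_contra h₃
    exact h₂ ⟨h₁, h₃⟩
  · exact fun h₁ => ⟨⟨u, h₁ (T.mem_path_self u), T.mem_path_self u⟩, fun h₂ => h₂.2 h₁⟩

theorem mem_path_club {v : Fin N} {j : Fin d} :
    v ∈ S.tree.path (S.club T j) ↔ v ∈ S.upper ∧ T.below j ⊆ S.rowLabel v := by
  have hne : {v | v ∈ S.upper ∧ j ∈ S.LamBar T v}.Nonempty :=
    ⟨S.tree.root, ⟨j, S.tree.root_mem_path _⟩, mem_LamBar.2 (by rw [rowLabel_root]; simp)⟩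
  obtain ⟨⟨h₁, h₂⟩, h₃⟩ := S.tree.low_mem hne
  rw [mem_LamBar] at h₂
  change S.club T j ∈ S.upper at h₁
  change T.below j ⊆ S.rowLabel (S.club T j) at h₂
  constructor
  · exact fun h => ⟨upper_of_mem_path h₁ h, h₂.trans (rowLabel_mono h)⟩
  · rintro ⟨h₄, h₅⟩
    have h₆ := h₃ v ⟨h₄, mem_LamBar.2 h₅⟩
    rcases ParentTree.path_chain (h₅ (T.mem_path_self j)) (h₂ (T.mem_path_self j)) with h | h
    · exact h
    · rw [← ParentTree.eq_of_mem_path_of_depth_le h h₆]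
      exact S.tree.mem_path_self _

end TreeData

theorem mul_coordProj_apply {ι κ : Type} [DecidableEq ι] [Fintype ι] (M : Matrix κ ι ℝ)
    (s : Set ι) (q : κ) (c : ι) :
    (M * coordProj s) q c = M q c * s.indicator (fun _ => (1 : ℝ)) c := by
  rw [coordProj, Matrix.mul_diagonal]

namespace SketchParams

variable {d m r N : ℕ} {P : ConvexData d m} {Q : SketchParams P r N}

theorem jMatrix_eq (Q : SketchParams P r N) (x : P.Point) (v : Fin N) :
    Q.jMatrix x v = Q.Φ * coordProj (Q.S.colLabel v) * (P.G x)ᵀ := by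
  rw [jMatrix, ConvexData.G, Matrix.transpose_mul, P.HInvSqrt_transpose]
  simp only [Matrix.mul_assoc]

theorem jMatrix_apply (Q : SketchParams P r N) (x : P.Point) (v : Fin N) (q : Fin r) (u : Fin d) :
    Q.jMatrix x v q u =
      ∑ c, Q.Φ q c * (Q.S.colLabel v).indicator (fun _ => (1 : ℝ)) c * P.G x u c := by
  rw [jMatrix_eq, Matrix.mul_apply]
  refine Finset.sum_congr rfl fun c _ => ?_
  rw [mul_coordProj_apply, Matrix.transpose_apply]

theorem yDown_apply (Q : SketchParams P r N) (v : Fin N) (Z : Matrix (Fin r) (Fin d) ℝ)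
    (h : Fin d → ℝ) (q : Fin r) :
    Q.yDown v Z h q =
      ∑ u, Z q u * (1 - (Q.S.Lam Q.T v).indicator (fun _ => (1 : ℝ)) u) * h u := by
  rw [yDown, Matrix.mulVec, dotProduct]
  refine Finset.sum_congr rfl fun u _ => ?_
  rw [Matrix.mul_sub, Matrix.mul_one, Matrix.sub_apply, mul_coordProj_apply]
  ring

theorem jMatrix_support (hT : P.IsEliminationTree Q.T) (hS : Q.S.IsBalanced Q.T) (x : P.Point)
    {v : Fin N} (hv : v ∈ Q.S.upper) (q : Fin r) {u : Fin d} (hu : u ∉ Q.S.support Q.T v) :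
    Q.jMatrix x v q u = 0 := by
  rw [jMatrix_apply]
  refine Finset.sum_eq_zero fun c _ => ?_
  by_cases hc : c ∈ Q.S.colLabel v
  · have h₁ := (hS.upper_mem_path_colLeaf hv).1 hc
    rw [hT.G_eq_zero x u c fun h => hu ⟨_, h₁, h⟩, mul_zero]
  · rw [Set.indicator_of_notMem hc, mul_zero, zero_mul]

/-- The invariant of BalancedSketch: `Z_v` is `J_v L[t_v]⁻ᵀ`, where the columns of `L[t_v]` that are
kept up to date at `v` are those of the current Cholesky factor. -/
structure Inv (Q : SketchParams P r N) (D : Sketch P r N) : Prop where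
  feasible : P.Feasible D.x
  L_eq : D.L D.ℓ = P.chol D.x
  J_eq : ∀ v, D.J v = Q.jMatrix D.x v
  supp : ∀ v ∈ Q.S.upper, PathSupported Q.T (D.L (D.t v))
  diag : ∀ v ∈ Q.S.upper, ∀ i, 0 < D.L (D.t v) i i
  t_le : ∀ v ∈ Q.S.upper, D.t v ≤ D.ℓ
  col : ∀ v ∈ Q.S.upper, ∀ u, Q.T.below u ⊆ Q.S.rowLabel v → ∀ a,
    D.L (D.t v) a u = D.L D.ℓ a u
  Z_eq : ∀ v ∈ Q.S.upper, D.Z v * (D.L (D.t v))ᵀ = D.J v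
  y_eq : ∀ v ∈ Q.S.upper, D.y v = Q.yDown v (D.Z v) D.h

theorem mul_transpose_row {B : Matrix (Fin d) (Fin d) ℝ} {Z J : Matrix (Fin r) (Fin d) ℝ}
    (h : Z * Bᵀ = J) (q : Fin r) : B *ᵥ (Z q) = J q := by
  rw [← h]
  ext a
  simp [Matrix.mulVec, Matrix.mul_apply, dotProduct, mul_comm]

/-- The correction `Z - (L⁻¹ ΔL Zᵀ)ᵀ` turns `Z L₀ᵀ = J` into `Z Lᵀ = J`. -/
theorem correct_mul {L L₀ ΔL : Matrix (Fin d) (Fin d) ℝ} {Z J : Matrix (Fin r) (Fin d) ℝ}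
    (hL : IsUnit L.det) (hZ : Z * L₀ᵀ = J) (hΔ : ΔL * Zᵀ = (L - L₀) * Zᵀ) :
    correct L ΔL Z * Lᵀ = J := by
  rw [correct, Matrix.mul_assoc, hΔ, Matrix.transpose_mul, Matrix.sub_mul, Matrix.mul_assoc,
    ← Matrix.transpose_mul, Matrix.mul_nonsing_inv L hL, Matrix.transpose_one, Matrix.mul_one,
    Matrix.transpose_mul, Matrix.transpose_transpose, Matrix.transpose_sub, Matrix.mul_sub, hZ]
  abel

theorem mul_coordProj_mul_transpose {L L₀ : Matrix (Fin d) (Fin d) ℝ}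
    {Z : Matrix (Fin r) (Fin d) ℝ} {s : Set (Fin d)}
    (h : ∀ q u, Z q u ≠ 0 → u ∉ s → ∀ a, L a u = L₀ a u) :
    (L - L₀) * coordProj s * Zᵀ = (L - L₀) * Zᵀ := by
  ext a q
  rw [Matrix.mul_apply, Matrix.mul_apply]
  refine Finset.sum_congr rfl fun u _ => ?_
  rw [mul_coordProj_apply, Matrix.transpose_apply]
  by_cases hz : Z q u = 0
  · rw [hz, mul_zero, mul_zero]
  · by_cases hu : u ∈ s
    · rw [Set.indicator_of_mem hu, mul_one]
    · rw [Matrix.sub_apply, h q u hz hu a, sub_self, zero_mul]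

namespace Inv

variable {D : Sketch P r N}

section

variable (hT : P.IsEliminationTree Q.T) (hS : Q.S.IsBalanced Q.T) (hD : Q.Inv D)
include hT hD

theorem isUnit_det_L : IsUnit (D.L D.ℓ).det := by
  rw [hD.L_eq]
  have h := hT.chol_spec hD.feasible
  exact h.1.isUnit_det hT.increasing fun i => (h.2.1 i).ne'

theorem isUnit_det {v : Fin N} (hv : v ∈ Q.S.upper) : IsUnit (D.L (D.t v)).det :=
  (hD.supp v hv).isUnit_det hT.increasing fun i => (hD.diag v hv i).ne'

include hS in
theorem Z_support {v : Fin N} (hv : v ∈ Q.S.upper) (q : Fin r) {u : Fin d}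
    (hu : u ∉ Q.S.support Q.T v) : D.Z v q u = 0 := by
  refine (hD.supp v hv).solution_support hT.increasing (fun i => (hD.diag v hv i).ne')
    (fun j hj => TreeData.path_subset_support hj) (mul_transpose_row (hD.Z_eq v hv) q)
    (fun u hu => ?_) u hu
  rw [hD.J_eq]
  exact jMatrix_support hT hS _ hv q hu

/-- Query's correction brings `Z_v` up to date. -/
theorem correct_Lam (hS : Q.S.IsBalanced Q.T) {v : Fin N} (hv : v ∈ Q.S.upper) :
    correct (D.L D.ℓ) ((D.L D.ℓ - D.L (D.t v)) * coordProj (Q.S.Lam Q.T v)) (D.Z v) *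
      (D.L D.ℓ)ᵀ = D.J v := by
  refine correct_mul (hD.isUnit_det_L hT) (hD.Z_eq v hv) (mul_coordProj_mul_transpose ?_)
  intro q u hz hu a
  have h₁ : u ∈ Q.S.support Q.T v := by
    by_contra h
    exact hz (hD.Z_support hT hS hv q h)
  rw [TreeData.mem_Lam, not_and, not_not] at hu
  exact (hD.col v hv u (hu h₁) a).symm

end

theorem start (hT : P.IsEliminationTree Q.T) {x : P.Point} (hx : P.Feasible x) (h : Fin d → ℝ) :
    Q.Inv (Q.start x h) where
  feasible := hx
  L_eq := rfl
  J_eq _ := rfl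
  supp _ _ := (hT.chol_spec hx).1
  diag _ _ := (hT.chol_spec hx).2.1
  t_le _ _ := le_rfl
  col _ _ _ _ _ := rfl
  Z_eq v _ := by
    have h := hT.chol_spec hx
    have hu := h.1.isUnit_det hT.increasing fun i => (h.2.1 i).ne'
    show Q.jMatrix x v * ((P.chol x)⁻¹)ᵀ * (P.chol x)ᵀ = Q.jMatrix x v
    rw [Matrix.mul_assoc, ← Matrix.transpose_mul, Matrix.mul_nonsing_inv _ hu,
      Matrix.transpose_one, Matrix.mul_one]
  y_eq _ _ := rfl

variable (hT : P.IsEliminationTree Q.T) (hS : Q.S.IsBalanced Q.T) (hD : Q.Inv D)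
include hT hS hD

theorem query (v : Fin N) : Q.Inv (Q.query v D).2 := by
  by_cases hv : v ∈ Q.S.upper
  · have hq : (Q.query v D).2 = { D with
        Z := Function.update D.Z v (correct (D.L D.ℓ)
          ((D.L D.ℓ - D.L (D.t v)) * coordProj (Q.S.Lam Q.T v)) (D.Z v))
        y := Function.update D.y v (Q.yDown v (correct (D.L D.ℓ)
          ((D.L D.ℓ - D.L (D.t v)) * coordProj (Q.S.Lam Q.T v)) (D.Z v)) D.h)
        t := Function.update D.t v D.ℓ } := by
      rw [SketchParams.query, if_pos hv]
    rw [hq]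
    have hs := hT.chol_spec hD.feasible
    refine ⟨hD.feasible, hD.L_eq, hD.J_eq, fun w hw => ?_, fun w hw => ?_, fun w hw => ?_,
      fun w hw => ?_, fun w hw => ?_, fun w hw => ?_⟩
    all_goals
      by_cases hwv : w = v
      · subst hwv
        first
          | (simp only [Function.update_self]; done)
          | simp only [Function.update_self]
        first
          | done
          | (rw [hD.L_eq]; exact hs.1)
          | (rw [hD.L_eq]; exact hs.2.1)
          | exact le_rfl
          | exact fun _ _ _ => trivial
          | exact hD.correct_Lam hT hS hw
      · simp only [Function.update_of_ne hwv]
        first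
          | exact hD.supp w hw
          | exact hD.diag w hw
          | exact hD.t_le w hw
          | exact hD.col w hw
          | exact hD.Z_eq w hw
          | exact hD.y_eq w hw
  · rw [SketchParams.query, if_neg hv]
    exact hD

omit hT hS in
theorem sketchAt_eq (v : Fin N) : Q.sketchAt D.x D.h v = (D.J v * ((D.L D.ℓ)⁻¹)ᵀ) *ᵥ D.h := by
  rw [sketchAt, hD.J_eq, hD.L_eq, jMatrix, ConvexData.W, Matrix.transpose_mul, Matrix.transpose_mul,
    P.HInvSqrt_transpose]
  simp only [Matrix.mul_assoc]

/-- Query is correct: after the correction `Z_v = J_v L_x⁻ᵀ`, which is `Φ_{χ v} Wᵀ`. -/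
theorem query_fst (v : Fin N) : (Q.query v D).1 = Q.sketchAt D.x D.h v := by
  rw [hD.sketchAt_eq]
  by_cases hv : v ∈ Q.S.upper
  · rw [SketchParams.query, if_pos hv]
    have h := hD.correct_Lam hT hS hv
    show (_ * coordProj (Q.S.Lam Q.T v)) *ᵥ D.h + (_ * (1 - coordProj (Q.S.Lam Q.T v))) *ᵥ D.h = _
    rw [← Matrix.add_mulVec, ← Matrix.mul_add, add_sub_cancel, Matrix.mul_one, ← h,
      Matrix.mul_assoc, ← Matrix.transpose_mul, Matrix.nonsing_inv_mul _ (hD.isUnit_det_L hT),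
      Matrix.transpose_one, Matrix.mul_one]
  · rw [SketchParams.query, if_neg hv]

/-- UpdateBlock keeps the invariant. The nodes on the path of `Λ♣` are those at which the changed
columns are kept up to date, and they are moved to the new factor; at all other nodes none of the
changed columns is claimed to be current. -/
theorem updateBlock {i : Fin m} {xi : Fin (P.size i) → ℝ} (hxi : xi ∈ P.dom i) :
    Q.Inv (Q.updateBlock i xi D) := by
  classical
  set E := Q.updateBlock i xi D with hE
  set j := P.blockLow Q.T i with hj
  have hEx : E.x = Function.update D.x i xi := rfl
  have hEL : E.L = Function.update D.L (D.ℓ + 1) (P.chol E.x) := rfl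
  have hEℓ : E.ℓ = D.ℓ + 1 := rfl
  have hEt : ∀ v, E.t v = if v ∈ Q.S.tree.path (Q.S.club Q.T j) then D.ℓ + 1 else D.t v :=
    fun _ => rfl
  have hfeas : P.Feasible E.x := by
    intro i₁
    rw [hEx]
    by_cases h : i₁ = i
    · subst h
      rwa [Function.update_self]
    · rw [Function.update_of_ne h]
      exact hD.feasible i₁
  have hs := hT.chol_spec hfeas
  have hLnew : E.L (D.ℓ + 1) = P.chol E.x := by rw [hEL, Function.update_self]
  have hLold : ∀ t, t ≤ D.ℓ → E.L t = D.L t := fun t ht => by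
    rw [hEL, Function.update_of_ne (by omega)]
  have hJ : ∀ v, E.J v = Q.jMatrix E.x v := by
    intro v
    by_cases hv : ∃ i₁ k, hessian (P.φ i₁) (E.x i₁) ≠ hessian (P.φ i₁) (D.x i₁) ∧
        v ∈ Q.S.tree.path (Q.S.colLeaf ⟨i₁, k⟩)
    · exact if_pos hv
    · refine (if_neg hv).trans ?_
      show D.J v = _
      rw [hD.J_eq]
      ext q u
      rw [jMatrix_apply, jMatrix_apply]
      refine Finset.sum_congr rfl fun c _ => ?_
      by_cases hc : c ∈ Q.S.colLabel v
      · obtain ⟨i₁, k⟩ := c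
        have : hessian (P.φ i₁) (E.x i₁) = hessian (P.φ i₁) (D.x i₁) := by
          by_contra h
          exact hv ⟨i₁, k, h, hc⟩
        rw [P.G_apply, P.G_apply, this]
      · rw [Set.indicator_of_notMem hc, mul_zero, zero_mul, zero_mul]
  have hupper : ∀ v ∈ Q.S.tree.path (Q.S.club Q.T j), v ∈ Q.S.upper := fun v hv =>
    (TreeData.mem_path_club.1 hv).1
  have hsupp : ∀ v ∈ Q.S.upper, PathSupported Q.T (E.L (E.t v)) := by
    intro v hv
    rw [hEt]
    split
    · rw [hLnew]
      exact hs.1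
    · rw [hLold _ (hD.t_le v hv)]
      exact hD.supp v hv
  have hdiag : ∀ v ∈ Q.S.upper, ∀ i, 0 < E.L (E.t v) i i := by
    intro v hv
    rw [hEt]
    split
    · rw [hLnew]
      exact hs.2.1
    · rw [hLold _ (hD.t_le v hv)]
      exact hD.diag v hv
  -- The state before the rows of the changed block are recomputed.
  set F := Q.updateL (Q.S.tree.path (Q.S.club Q.T j))
    { D with
      ℓ := D.ℓ + 1
      x := Function.update D.x i xi
      L := Function.update D.L (D.ℓ + 1) (P.chol (Function.update D.x i xi)) } with hF
  have hFZ : ∀ v ∈ Q.S.upper, F.Z v * (E.L (E.t v))ᵀ = D.J v := by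
    intro v hv
    by_cases hc : v ∈ Q.S.tree.path (Q.S.club Q.T j)
    · have h₁ : F.Z v = correct (E.L (D.ℓ + 1)) (E.L (D.ℓ + 1) - E.L (D.ℓ + 1 - 1))
          (correct (E.L (D.ℓ + 1 - 1))
            ((E.L (D.ℓ + 1 - 1) - E.L (D.t v)) * coordProj (Q.S.Lam Q.T v)) (D.Z v)) := if_pos hc
      rw [h₁, hEt, if_pos hc, Nat.add_sub_cancel, hLold D.ℓ le_rfl, hLold _ (hD.t_le v hv)]
      refine correct_mul ?_ (hD.correct_Lam hT hS hv) rfl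
      rw [hLnew]
      exact hs.1.isUnit_det hT.increasing fun i => (hs.2.1 i).ne'
    · rw [show F.Z v = D.Z v from if_neg hc, hEt, if_neg hc, hLold _ (hD.t_le v hv)]
      exact hD.Z_eq v hv
  have hFy : ∀ v ∈ Q.S.upper, F.y v = Q.yDown v (F.Z v) D.h := by
    intro v hv
    by_cases hc : v ∈ Q.S.tree.path (Q.S.club Q.T j)
    · have h₁ : F.y v = Q.yDown v (correct (E.L (D.ℓ + 1)) (E.L (D.ℓ + 1) - E.L (D.ℓ + 1 - 1))
          (correct (E.L (D.ℓ + 1 - 1))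
            ((E.L (D.ℓ + 1 - 1) - E.L (D.t v)) * coordProj (Q.S.Lam Q.T v)) (D.Z v))) D.h :=
        if_pos hc
      rw [h₁]
      congr 1
      exact (if_pos hc).symm
    · rw [show F.Z v = D.Z v from if_neg hc, show F.y v = D.y v from if_neg hc]
      exact hD.y_eq v hv
  refine ⟨hfeas, by rw [hEℓ, hLnew], hJ, hsupp, hdiag, fun v hv => ?_, fun v hv u hu a => ?_,
    fun v hv => ?_, fun v hv => ?_⟩
  · rw [hEt, hEℓ]
    split
    · exact le_rfl
    · exact (hD.t_le v hv).trans (Nat.le_succ _)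
  · rw [hEt, hEℓ]
    split
    · rfl
    · rename_i hc
      rw [hLold _ (hD.t_le v hv), hLnew, hD.col v hv u hu, hD.L_eq]
      refine (hT.chol_update hD.feasible hfeas (i := i) (fun i₁ h => ?_) ?_ a).symm
      · rw [hEx, Function.update_of_ne h]
      · intro h
        exact hc (TreeData.mem_path_club.2 ⟨hv, (ParentTree.below_subset h).trans hu⟩)
  · by_cases hc : (∃ i₁ k, hessian (P.φ i₁) (E.x i₁) ≠ hessian (P.φ i₁) (D.x i₁) ∧
        v ∈ Q.S.tree.path (Q.S.colLeaf ⟨i₁, k⟩))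
    · rw [show E.Z v = Q.jMatrix E.x v * ((E.L (E.t v))⁻¹)ᵀ from if_pos ⟨hc, hv⟩, hJ,
        Matrix.mul_assoc, ← Matrix.transpose_mul, Matrix.mul_nonsing_inv, Matrix.transpose_one,
        Matrix.mul_one]
      exact (hsupp v hv).isUnit_det hT.increasing fun i => (hdiag v hv i).ne'
    · rw [show E.Z v = F.Z v from if_neg fun h => hc h.1, show E.J v = D.J v from if_neg hc]
      exact hFZ v hv
  · by_cases hc : (∃ i₁ k, hessian (P.φ i₁) (E.x i₁) ≠ hessian (P.φ i₁) (D.x i₁) ∧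
        v ∈ Q.S.tree.path (Q.S.colLeaf ⟨i₁, k⟩))
    · rw [show E.Z v = Q.jMatrix E.x v * ((E.L (E.t v))⁻¹)ᵀ from if_pos ⟨hc, hv⟩]
      exact if_pos ⟨hc, hv⟩
    · rw [show E.Z v = F.Z v from if_neg fun h => hc h.1,
        show E.y v = F.y v from if_neg fun h => hc h.1]
      exact hFy v hv

/-- One step of the loop over the changed coordinates of `h`: `h₁` is the vector in which the
coordinates handled so far have been replaced. -/
theorem updateCoord_y {hnew h₁ : Fin d → ℝ} {j : Fin d} {y : Fin N → Fin r → ℝ} {v : Fin N}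
    (hv : v ∈ Q.S.upper) (hj : h₁ j = D.h j) (hy : y v = Q.yDown v (D.Z v) h₁) :
    (Q.updateCoord hnew j { D with y := y }).y v =
      Q.yDown v (D.Z v) (Function.update h₁ j (hnew j)) := by
  classical
  have hsplit : Q.yDown v (D.Z v) (Function.update h₁ j (hnew j)) =
      Q.yDown v (D.Z v) h₁ + fun q => D.Z v q j *
        (1 - (Q.S.Lam Q.T v).indicator (fun _ => (1 : ℝ)) j) * (hnew j - D.h j) := by
    ext q
    rw [Pi.add_apply, yDown_apply, yDown_apply, ← Finset.add_sum_erase _ _ (Finset.mem_univ j),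
      ← Finset.add_sum_erase _ (fun u => D.Z v q u *
        (1 - (Q.S.Lam Q.T v).indicator (fun _ => (1 : ℝ)) u) * h₁ u) (Finset.mem_univ j)]
    rw [Function.update_self, ← hj]
    have : ∀ u ∈ Finset.univ.erase j, D.Z v q u *
        (1 - (Q.S.Lam Q.T v).indicator (fun _ => (1 : ℝ)) u) *
          Function.update h₁ j (hnew j) u =
        D.Z v q u * (1 - (Q.S.Lam Q.T v).indicator (fun _ => (1 : ℝ)) u) * h₁ u := fun u hu => by
      rw [Function.update_of_ne (Finset.ne_of_mem_erase hu)]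
    rw [Finset.sum_congr rfl this]
    ring
  rw [hsplit, ← hy]
  by_cases hc : v ∈ Q.S.tree.path (Q.S.club Q.T j)
  · refine (if_pos hc).trans ?_
    show y v + (D.Z v * coordProj {j}) *ᵥ (hnew - D.h) = _
    congr 1
    ext q
    have hnot : j ∉ Q.S.Lam Q.T v := fun h =>
      (TreeData.mem_Lam.1 h).2 (TreeData.mem_path_club.1 hc).2
    rw [Set.indicator_of_notMem hnot, Matrix.mulVec, dotProduct, Finset.sum_eq_single j]
    · rw [mul_coordProj_apply, Set.indicator_of_mem (Set.mem_singleton j), Pi.sub_apply, sub_zero]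
    · intro u _ hu
      rw [mul_coordProj_apply, Set.indicator_of_notMem (by simpa using hu), mul_zero, zero_mul]
    · simp
  · refine (if_neg hc).trans ?_
    show y v = _
    rw [eq_comm, add_eq_left]
    ext q
    show _ = (0 : ℝ)
    by_cases hsup : j ∈ Q.S.support Q.T v
    · have : j ∈ Q.S.Lam Q.T v := TreeData.mem_Lam.2 ⟨hsup, fun h =>
        hc (TreeData.mem_path_club.2 ⟨hv, h⟩)⟩
      rw [Set.indicator_of_mem this, sub_self, mul_zero, zero_mul]
    · rw [hD.Z_support hT hS hv q hsup, zero_mul, zero_mul]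

theorem foldl_updateBlock {xnew : P.Point} (hx : P.Feasible xnew) (lx : List (Fin m)) :
    Q.Inv (lx.foldl (fun E i => Q.updateBlock i (xnew i) E) D) ∧
      (∀ i, (lx.foldl (fun E i => Q.updateBlock i (xnew i) E) D).x i =
        if i ∈ lx then xnew i else D.x i) ∧
      (lx.foldl (fun E i => Q.updateBlock i (xnew i) E) D).h = D.h := by
  induction lx using List.reverseRecOn with
  | nil => exact ⟨hD, fun i => by simp, rfl⟩
  | append_singleton l i ih =>
    rw [List.foldl_append, List.foldl_cons, List.foldl_nil]
    refine ⟨ih.1.updateBlock hT hS (hx i), fun i₁ => ?_, ih.2.2⟩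
    show Function.update (β := fun i => Fin (P.size i) → ℝ) _ i (xnew i) i₁ = _
    by_cases h : i₁ = i
    · subst h
      simp
    · rw [Function.update_of_ne h, ih.2.1]
      simp [h]

theorem foldl_updateCoord {hnew : Fin d → ℝ} (lh : List (Fin d)) (hnd : lh.Nodup) :
    ∃ y : Fin N → Fin r → ℝ,
      lh.foldl (fun E j => Q.updateCoord hnew j E) D = { D with y := y } ∧
      ∀ v ∈ Q.S.upper, y v = Q.yDown v (D.Z v) fun j => if j ∈ lh then hnew j else D.h j := by
  induction lh using List.reverseRecOn with
  | nil => exact ⟨D.y, rfl, fun v hv => by simpa using hD.y_eq v hv⟩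
  | append_singleton l j ih =>
    rw [List.nodup_append] at hnd
    obtain ⟨y, hE, hy⟩ := ih hnd.1
    have hj : j ∉ l := fun h => hnd.2.2 j h j (by simp) rfl
    rw [List.foldl_append, List.foldl_cons, List.foldl_nil, hE]
    refine ⟨(Q.updateCoord hnew j { D with y := y }).y, rfl, fun v hv => ?_⟩
    rw [hD.updateCoord_y hT hS hv (h₁ := fun j => if j ∈ l then hnew j else D.h j) (by simp [hj])
      (hy v hv)]
    congr 1
    ext u
    by_cases hu : u = j
    · subst hu
      simp
    · rw [Function.update_of_ne hu]
      simp [hu]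

theorem update {xnew : P.Point} {hnew : Fin d → ℝ} {lx : List (Fin m)} {lh : List (Fin d)}
    (hx : P.Feasible xnew) (hlx : ∀ i, i ∈ lx ↔ xnew i ≠ D.x i) (hnd : lh.Nodup)
    (hlh : ∀ j, j ∈ lh ↔ hnew j ≠ D.h j) :
    Q.Inv (Q.update xnew hnew lx lh D) ∧ (Q.update xnew hnew lx lh D).x = xnew := by
  obtain ⟨h₁, h₂, h₃⟩ := hD.foldl_updateBlock hT hS hx lx
  set E := lx.foldl (fun E i => Q.updateBlock i (xnew i) E) D with hE
  obtain ⟨y, hy, hyv⟩ := h₁.foldl_updateCoord hT hS lh hnd (hnew := hnew)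
  have hu : Q.update xnew hnew lx lh D = { E with y := y, h := hnew } := by
    show { (lh.foldl (fun E j => Q.updateCoord hnew j E) E) with h := hnew } = _
    rw [hy]
  have hhnew : (fun j => if j ∈ lh then hnew j else E.h j) = hnew := by
    ext j
    split
    · rfl
    · rename_i hj
      rw [hlh, not_not] at hj
      rw [h₃, hj]
  rw [hhnew] at hyv
  rw [hu]
  refine ⟨⟨h₁.feasible, h₁.L_eq, h₁.J_eq, h₁.supp, h₁.diag, h₁.t_le, h₁.col, h₁.Z_eq, hyv⟩, ?_⟩
  ext1 i
  show E.x i = xnew i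
  rw [h₂]
  split
  · rfl
  · rename_i hi
    rw [hlx, not_not] at hi
    exact hi.symm

end Inv

end SketchParams

/-! ### Reasoning about programs -/

namespace Cmd

/-- The natural arrays to which a program may write. -/
def natWrites : Cmd → List ℕ
  | skip => []
  | setNat a _ _ _ _ => [a]
  | setReal _ _ _ _ _ => []
  | seq c₁ c₂ => c₁.natWrites ++ c₂.natWrites
  | cond _ c₁ c₂ => c₁.natWrites ++ c₂.natWrites
  | loop _ c => c.natWrites

/-- The real arrays to which a program may write. -/
def realWrites : Cmd → List ℕ
  | skip => []
  | setNat _ _ _ _ _ => []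
  | setReal a _ _ _ _ => [a]
  | seq c₁ c₂ => c₁.realWrites ++ c₂.realWrites
  | cond _ c₁ c₂ => c₁.realWrites ++ c₂.realWrites
  | loop _ c => c.realWrites

/-- A program without loops. -/
def loopFree : Cmd → Bool
  | skip => true
  | setNat _ _ _ _ _ => true
  | setReal _ _ _ _ _ => true
  | seq c₁ c₂ => c₁.loopFree && c₂.loopFree
  | cond _ c₁ c₂ => c₁.loopFree && c₂.loopFree
  | loop _ _ => false

open Classical in
/-- The memory after running a program without loops. -/
noncomputable def den (O : Oracle) : Cmd → Mem → Mem
  | skip, M => M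
  | setNat a i j k e, M => M.setNat a (i.eval M) (j.eval M) (k.eval M) (e.eval M)
  | setReal a i j k e, M => M.setReal a (i.eval M) (j.eval M) (k.eval M) (e.eval O M)
  | seq c₁ c₂, M => c₂.den O (c₁.den O M)
  | cond b c₁ c₂, M => if b.eval O M then c₁.den O M else c₂.den O M
  | loop _ _, M => M

/-- A bound for the number of steps of a program without loops. -/
def steps : Cmd → ℕ
  | skip => 1
  | setNat _ i j k e => i.cost + j.cost + k.cost + e.cost + 1
  | setReal _ i j k e => i.cost + j.cost + k.cost + e.cost + 1
  | seq c₁ c₂ => c₁.steps + c₂.steps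
  | cond b c₁ c₂ => b.cost + max c₁.steps c₂.steps + 1
  | loop _ _ => 0

end Cmd

namespace Mem

@[simp] theorem setNat_real (M : Mem) (a i j k c : ℕ) : (M.setNat a i j k c).real = M.real := rfl

@[simp] theorem setReal_nat (M : Mem) (a i j k : ℕ) (c : ℝ) : (M.setReal a i j k c).nat = M.nat :=
  rfl

@[simp] theorem setNat_nat_ne (M : Mem) {a b : ℕ} {i j k c : ℕ} (h : b ≠ a := by decide) :
    (M.setNat a i j k c).nat b = M.nat b := by
  funext i₁ j₁ k₁
  simp [setNat, h]

@[simp] theorem setReal_real_ne (M : Mem) {a b : ℕ} {i j k : ℕ} {c : ℝ} (h : b ≠ a := by decide) :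
    (M.setReal a i j k c).real b = M.real b := by
  funext i₁ j₁ k₁
  simp [setReal, h]

@[simp] theorem setNat_nat_self (M : Mem) (a i j k c i₁ j₁ k₁ : ℕ) :
    (M.setNat a i j k c).nat a i₁ j₁ k₁ =
      if i₁ = i ∧ j₁ = j ∧ k₁ = k then c else M.nat a i₁ j₁ k₁ := by
  simp [setNat]

@[simp] theorem setReal_real_self (M : Mem) (a i j k : ℕ) (c : ℝ) (i₁ j₁ k₁ : ℕ) :
    (M.setReal a i j k c).real a i₁ j₁ k₁ =
      if i₁ = i ∧ j₁ = j ∧ k₁ = k then c else M.real a i₁ j₁ k₁ := by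
  simp [setReal]

end Mem

/-- The memory `M1` differs from `M` at most in the arrays to which the program `c` writes. -/
structure Agree (c : Cmd) (M M1 : Mem) : Prop where
  nat : ∀ a (_ : a ∉ c.natWrites := by decide), M1.nat a = M.nat a
  real : ∀ a (_ : a ∉ c.realWrites := by decide), M1.real a = M.real a

theorem Agree.refl (c : Cmd) (M : Mem) : Agree c M M := ⟨fun _ _ => rfl, fun _ _ => rfl⟩

theorem Agree.trans {c : Cmd} {M1 M2 M3 : Mem} (h : Agree c M1 M2) (h₁ : Agree c M2 M3) :
    Agree c M1 M3 :=
  ⟨fun a ha => (h₁.nat a ha).trans (h.nat a ha), fun a ha => (h₁.real a ha).trans (h.real a ha)⟩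

theorem Agree.mono {c c₁ : Cmd} {M M1 : Mem} (h : Agree c M M1)
    (hn : ∀ a ∈ c.natWrites, a ∈ c₁.natWrites) (hr : ∀ a ∈ c.realWrites, a ∈ c₁.realWrites) :
    Agree c₁ M M1 :=
  ⟨fun a ha => h.nat a fun h' => ha (hn a h'), fun a ha => h.real a fun h' => ha (hr a h')⟩

theorem Agree.nat_eq {c : Cmd} {M M1 : Mem} {a i j k n : ℕ} (h : Agree c M M1)
    (hn : M.nat a i j k = n) (ha : a ∉ c.natWrites := by decide) : M1.nat a i j k = n := by
  rw [h.nat a ha, hn]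

theorem Agree.real_eq {c : Cmd} {M M1 : Mem} {a i j k : ℕ} {z : ℝ} (h : Agree c M M1)
    (hn : M.real a i j k = z) (ha : a ∉ c.realWrites := by decide) : M1.real a i j k = z := by
  rw [h.real a ha, hn]

theorem Exec.agree {O : Oracle} {c : Cmd} {M M1 : Mem} {t : ℕ} (h : Exec O c M t M1) :
    Agree c M M1 := by
  induction h with
  | skip M => exact Agree.refl _ _
  | setNat M a i j k e =>
    refine ⟨fun b hb => M.setNat_nat_ne ?_, fun _ _ => rfl⟩
    simpa [Cmd.natWrites] using hb
  | setReal M a i j k e =>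
    refine ⟨fun _ _ => rfl, fun b hb => M.setReal_real_ne ?_⟩
    simpa [Cmd.realWrites] using hb
  | seq c₁ c₂ M1 M2 M3 t₁ t₂ _ _ ih₁ ih₂ =>
    exact (ih₁.mono (by simp +contextual [Cmd.natWrites]) (by simp +contextual [Cmd.realWrites])).trans
      (ih₂.mono (by simp +contextual [Cmd.natWrites]) (by simp +contextual [Cmd.realWrites]))
  | cond_true b c₁ c₂ M M1 t _ _ ih =>
    exact ih.mono (by simp +contextual [Cmd.natWrites]) (by simp +contextual [Cmd.realWrites])
  | cond_false b c₁ c₂ M M1 t _ _ ih =>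
    exact ih.mono (by simp +contextual [Cmd.natWrites]) (by simp +contextual [Cmd.realWrites])
  | loop_stop b c M => exact Agree.refl _ _
  | loop_step b c M1 M2 M3 t₁ t₂ _ _ _ ih₁ ih₂ => exact Agree.trans ⟨fun a ha => ih₁.nat a ha, fun a ha => ih₁.real a ha⟩ ih₂

/-- Started on `M`, the program `c` halts within `B` steps on a memory that satisfies `R`. -/
def Runs (O : Oracle) (c : Cmd) (M : Mem) (B : ℕ) (R : Mem → Prop) : Prop :=
  ∃ t M1, Exec O c M t M1 ∧ t ≤ B ∧ R M1

namespace Runs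

variable {O : Oracle} {M : Mem} {R R₁ : Mem → Prop}

theorem mono {c : Cmd} {B B₁ : ℕ} (h : Runs O c M B R) (hB : B ≤ B₁)
    (hR : ∀ M1, Agree c M M1 → R M1 → R₁ M1) : Runs O c M B₁ R₁ := by
  obtain ⟨t, M1, he, ht, hR₁⟩ := h
  exact ⟨t, M1, he, ht.trans hB, hR M1 he.agree hR₁⟩

theorem le {c : Cmd} {B B₁ : ℕ} (h : Runs O c M B R) (hB : B ≤ B₁) : Runs O c M B₁ R :=
  h.mono hB fun _ _ h => h

theorem seq {c₁ c₂ : Cmd} {B₁ B₂ : ℕ}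
    (h : Runs O c₁ M B₁ fun M1 => Agree c₁ M M1 → Runs O c₂ M1 B₂ R) :
    Runs O (Cmd.seq c₁ c₂) M (B₁ + B₂) R := by
  obtain ⟨t₁, M1, he₁, ht₁, h₁⟩ := h
  obtain ⟨t₂, M2, he₂, ht₂, h₂⟩ := h₁ he₁.agree
  exact ⟨t₁ + t₂, M2, Exec.seq _ _ _ _ _ _ _ he₁ he₂, Nat.add_le_add ht₁ ht₂, h₂⟩

theorem block_of_loopFree (O : Oracle) {c : Cmd} (hc : c.loopFree = true) (M : Mem) :
    ∃ t, t ≤ c.steps ∧ Exec O c M t (c.den O M) := by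
  induction c generalizing M with
  | skip => exact ⟨1, le_rfl, Exec.skip M⟩
  | setNat a i j k e => exact ⟨_, le_rfl, Exec.setNat M a i j k e⟩
  | setReal a i j k e => exact ⟨_, le_rfl, Exec.setReal M a i j k e⟩
  | seq c₁ c₂ ih₁ ih₂ =>
    simp only [Cmd.loopFree, Bool.and_eq_true] at hc
    obtain ⟨t₁, h₁, e₁⟩ := ih₁ hc.1 M
    obtain ⟨t₂, h₂, e₂⟩ := ih₂ hc.2 (c₁.den O M)
    exact ⟨t₁ + t₂, Nat.add_le_add h₁ h₂, Exec.seq _ _ _ _ _ _ _ e₁ e₂⟩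
  | cond b c₁ c₂ ih₁ ih₂ =>
    simp only [Cmd.loopFree, Bool.and_eq_true] at hc
    by_cases hb : b.eval O M
    · obtain ⟨t₁, h₁, e₁⟩ := ih₁ hc.1 M
      refine ⟨b.cost + t₁ + 1, ?_, ?_⟩
      · have := le_max_left c₁.steps c₂.steps
        simp only [Cmd.steps]
        omega
      · rw [Cmd.den, if_pos hb]
        exact Exec.cond_true _ _ _ _ _ _ hb e₁
    · obtain ⟨t₁, h₁, e₁⟩ := ih₂ hc.2 M
      refine ⟨b.cost + t₁ + 1, ?_, ?_⟩
      · have := le_max_right c₁.steps c₂.steps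
        simp only [Cmd.steps]
        omega
      · rw [Cmd.den, if_neg hb]
        exact Exec.cond_false _ _ _ _ _ _ hb e₁
  | loop b c _ => simp [Cmd.loopFree] at hc

theorem block {c : Cmd} {B : ℕ} (h : R (c.den O M)) (hB : c.steps ≤ B := by decide)
    (hc : c.loopFree = true := by rfl) : Runs O c M B R := by
  obtain ⟨t, ht, he⟩ := block_of_loopFree O hc M
  exact ⟨t, _, he, ht.trans hB, h⟩

theorem cond_true {b : BExp} {c₁ c₂ : Cmd} {B : ℕ} (hb : b.eval O M) (h : Runs O c₁ M B R) :
    Runs O (Cmd.cond b c₁ c₂) M (b.cost + B + 1) R := by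
  obtain ⟨t, M1, he, ht, hR⟩ := h
  exact ⟨b.cost + t + 1, M1, Exec.cond_true _ _ _ _ _ _ hb he, by omega, hR⟩

theorem cond_false {b : BExp} {c₁ c₂ : Cmd} {B : ℕ} (hb : ¬ b.eval O M) (h : Runs O c₂ M B R) :
    Runs O (Cmd.cond b c₁ c₂) M (b.cost + B + 1) R := by
  obtain ⟨t, M1, he, ht, hR⟩ := h
  exact ⟨b.cost + t + 1, M1, Exec.cond_false _ _ _ _ _ _ hb he, by omega, hR⟩

end Runs

/-- A natural number variable is the cell `0, 0, 0` of an array of its own. -/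
def NExp.var (a : ℕ) : NExp := NExp.get a (NExp.const 0) (NExp.const 0) (NExp.const 0)

/-- A real variable is the cell `0, 0, 0` of an array of its own. -/
def RExp.var (a : ℕ) : RExp := RExp.get a (NExp.const 0) (NExp.const 0) (NExp.const 0)

/-- Assignment to a natural number variable. -/
def Cmd.assign (a : ℕ) (e : NExp) : Cmd :=
  Cmd.setNat a (NExp.const 0) (NExp.const 0) (NExp.const 0) e

/-- Assignment to a real variable. -/
def Cmd.assignReal (a : ℕ) (e : RExp) : Cmd :=
  Cmd.setReal a (NExp.const 0) (NExp.const 0) (NExp.const 0) e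

/-- `for x = 0, …, e - 1 do c`. -/
def Cmd.forLoop (x : ℕ) (e : NExp) (c : Cmd) : Cmd :=
  Cmd.seq (Cmd.assign x (NExp.const 0))
    (Cmd.loop (BExp.nlt (NExp.var x) e)
      (Cmd.seq c (Cmd.assign x (NExp.plus (NExp.var x) (NExp.const 1)))))

/-- `for x = 0, …, dep[w] - 1 do u := tab[w][x]; c`. -/
def Cmd.forTable (dep tab x u : ℕ) (w : NExp) (c : Cmd) : Cmd :=
  Cmd.forLoop x (NExp.get dep w (NExp.const 0) (NExp.const 0))
    (Cmd.seq (Cmd.assign u (NExp.get tab w (NExp.var x) (NExp.const 0))) c)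

section Simp

variable (M : Mem) (O : Oracle)

@[simp] theorem NExp.eval_const (c : ℕ) : (NExp.const c).eval M = c := rfl
@[simp] theorem NExp.eval_get (a : ℕ) (i j k : NExp) :
    (NExp.get a i j k).eval M = M.nat a (i.eval M) (j.eval M) (k.eval M) := rfl
@[simp] theorem NExp.eval_plus (e f : NExp) : (e.plus f).eval M = e.eval M + f.eval M := rfl
@[simp] theorem NExp.eval_minus (e f : NExp) : (e.minus f).eval M = e.eval M - f.eval M := rfl
@[simp] theorem NExp.eval_var (a : ℕ) : (NExp.var a).eval M = M.nat a 0 0 0 := rfl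

@[simp] theorem RExp.eval_const (c : ℕ) : (RExp.const c).eval O M = c := rfl
@[simp] theorem RExp.eval_get (a : ℕ) (i j k : NExp) :
    (RExp.get a i j k).eval O M = M.real a (i.eval M) (j.eval M) (k.eval M) := rfl
@[simp] theorem RExp.eval_plus (e f : RExp) : (e.plus f).eval O M = e.eval O M + f.eval O M := rfl
@[simp] theorem RExp.eval_minus (e f : RExp) : (e.minus f).eval O M = e.eval O M - f.eval O M := rfl
@[simp] theorem RExp.eval_times (e f : RExp) : (e.times f).eval O M = e.eval O M * f.eval O M := rfl
@[simp] theorem RExp.eval_divide (e f : RExp) : (e.divide f).eval O M = e.eval O M / f.eval O M :=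
  rfl
@[simp] theorem RExp.eval_root (e : RExp) : e.root.eval O M = Real.sqrt (e.eval O M) := rfl
@[simp] theorem RExp.eval_hess (i p q : NExp) : (RExp.hess i p q).eval O M =
    O (i.eval M) (fun k => M.real 0 (i.eval M) k 0) (p.eval M) (q.eval M) := rfl
@[simp] theorem RExp.eval_var (a : ℕ) : (RExp.var a).eval O M = M.real a 0 0 0 := rfl

@[simp] theorem BExp.eval_nlt (e f : NExp) : (BExp.nlt e f).eval O M ↔ e.eval M < f.eval M :=
  Iff.rfl
@[simp] theorem BExp.eval_rlt (e f : RExp) : (BExp.rlt e f).eval O M ↔ e.eval O M < f.eval O M :=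
  Iff.rfl
@[simp] theorem BExp.eval_neg (b : BExp) : b.neg.eval O M ↔ ¬ b.eval O M := Iff.rfl
@[simp] theorem BExp.eval_conj (b c : BExp) : (b.conj c).eval O M ↔ b.eval O M ∧ c.eval O M :=
  Iff.rfl

@[simp] theorem Cmd.den_skip : Cmd.skip.den O M = M := rfl
@[simp] theorem Cmd.den_setNat (a : ℕ) (i j k e : NExp) : (Cmd.setNat a i j k e).den O M =
    M.setNat a (i.eval M) (j.eval M) (k.eval M) (e.eval M) := rfl
@[simp] theorem Cmd.den_setReal (a : ℕ) (i j k : NExp) (e : RExp) :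
    (Cmd.setReal a i j k e).den O M =
      M.setReal a (i.eval M) (j.eval M) (k.eval M) (e.eval O M) := rfl
@[simp] theorem Cmd.den_assign (a : ℕ) (e : NExp) :
    (Cmd.assign a e).den O M = M.setNat a 0 0 0 (e.eval M) := rfl
@[simp] theorem Cmd.den_assignReal (a : ℕ) (e : RExp) :
    (Cmd.assignReal a e).den O M = M.setReal a 0 0 0 (e.eval O M) := rfl
@[simp] theorem Cmd.den_seq (c₁ c₂ : Cmd) : (Cmd.seq c₁ c₂).den O M = c₂.den O (c₁.den O M) := rfl
open Classical in
@[simp] theorem Cmd.den_cond (b : BExp) (c₁ c₂ : Cmd) : (Cmd.cond b c₁ c₂).den O M =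
    if b.eval O M then c₁.den O M else c₂.den O M := rfl

variable (a x dep tab u : ℕ) (i j k e w : NExp) (f : RExp) (b : BExp) (c c₁ c₂ : Cmd)

@[simp] theorem Cmd.natWrites_assign : (Cmd.assign a e).natWrites = [a] := rfl
@[simp] theorem Cmd.natWrites_forLoop :
    (Cmd.forLoop x e c).natWrites = x :: (c.natWrites ++ [x]) := rfl
@[simp] theorem Cmd.natWrites_forTable : (Cmd.forTable dep tab x u w c).natWrites =
    x :: u :: (c.natWrites ++ [x]) := rfl

@[simp] theorem Cmd.realWrites_forLoop :
    (Cmd.forLoop x e c).realWrites = c.realWrites ++ [] := rfl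
@[simp] theorem Cmd.realWrites_forTable :
    (Cmd.forTable dep tab x u w c).realWrites = c.realWrites ++ [] := rfl

end Simp

namespace Runs

variable {O : Oracle} {M : Mem}

theorem assign {x : ℕ} {e : NExp} {R : Mem → Prop} (h : R (M.setNat x 0 0 0 (e.eval M))) :
    Runs O (Cmd.assign x e) M (e.cost + 4) R :=
  block h (by simp only [Cmd.assign, Cmd.steps, NExp.cost]; omega)

/-- The rule for counted loops: `I k` is the invariant after `k` rounds. -/
theorem forLoop {x : ℕ} {e : NExp} {c : Cmd} {n B : ℕ} (I : ℕ → Mem → Prop)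
    (hx : x ∉ c.natWrites)
    (he : ∀ M1, Agree (Cmd.forLoop x e c) M M1 → e.eval M1 = n)
    (h0 : I 0 M)
    (hs : ∀ k M1, k < n → Agree (Cmd.forLoop x e c) M M1 → M1.nat x 0 0 0 = k → I k M1 →
      Runs O c M1 B (I (k + 1)))
    (hI : ∀ k M1 l, I k M1 → I k (M1.setNat x 0 0 0 l) := by
      intro k M1 l h
      first
        | exact h
        | simpa using h) :
    Runs O (Cmd.forLoop x e c) M (n * (B + e.cost + 16) + e.cost + 11) (I n) := by
  have key : ∀ (j : ℕ) (k : ℕ) (M1 : Mem), j + k = n → Agree (Cmd.forLoop x e c) M M1 →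
      M1.nat x 0 0 0 = k → I k M1 →
      Runs O (Cmd.loop (BExp.nlt (NExp.var x) e)
        (Cmd.seq c (Cmd.assign x (NExp.plus (NExp.var x) (NExp.const 1))))) M1
        (j * (B + e.cost + 16) + e.cost + 6) (I n) := by
    intro j
    induction j with
    | zero =>
      intro k M1 hk ha hx₁ hI₁
      refine ⟨_, M1, Exec.loop_stop _ _ _ ?_, ?_, ?_⟩
      · rw [BExp.eval_nlt, he M1 ha, NExp.eval_var, hx₁]
        omega
      · simp only [BExp.cost, NExp.cost, NExp.var]
        omega
      · rwa [show k = n by omega] at hI₁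
    | succ j ih =>
      intro k M1 hk ha hx₁ hI₁
      obtain ⟨t, M2, e₂, ht, hI₂⟩ := hs k M1 (by omega) ha hx₁ hI₁
      have ha2 : Agree (Cmd.forLoop x e c) M1 M2 := e₂.agree.mono
        (fun a h => by simp [h]) (fun a h => by simp [h])
      have hx₂ : M2.nat x 0 0 0 = k := by rw [e₂.agree.nat x hx, hx₁]
      have e₃ := Exec.setNat (O := O) M2 x (NExp.const 0) (NExp.const 0) (NExp.const 0)
        (NExp.plus (NExp.var x) (NExp.const 1))
      have ha3 : Agree (Cmd.forLoop x e c) M2 (M2.setNat x 0 0 0 (k + 1)) := by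
        refine ⟨fun a h => M2.setNat_nat_ne ?_, fun _ _ => rfl⟩
        rintro rfl
        simp at h
      have hM : M2.setNat x ((NExp.const 0).eval M2) ((NExp.const 0).eval M2)
          ((NExp.const 0).eval M2) ((NExp.plus (NExp.var x) (NExp.const 1)).eval M2) =
          M2.setNat x 0 0 0 (k + 1) := by
        simp [hx₂]
      rw [hM] at e₃
      obtain ⟨t₄, M4, e₄, ht₄, h₄⟩ := ih (k + 1) (M2.setNat x 0 0 0 (k + 1)) (by omega)
        ((ha.trans ha2).trans ha3) (by simp) (hI _ _ _ hI₂)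
      refine ⟨_, M4, Exec.loop_step _ _ _ _ _ _ _ ?_ (Exec.seq _ _ _ _ _ _ _ e₂ e₃) e₄, ?_, h₄⟩
      · rw [BExp.eval_nlt, he M1 ha, NExp.eval_var, hx₁]
        omega
      · simp only [BExp.cost, NExp.cost, NExp.var]
        rw [add_mul]
        omega
  have h := seq (c₁ := Cmd.assign x (NExp.const 0)) (B₁ := 5) (assign (O := O) (M := M)
    (R := fun M1 => Agree (Cmd.assign x (NExp.const 0)) M M1 →
      Runs O (Cmd.loop (BExp.nlt (NExp.var x) e)
        (Cmd.seq c (Cmd.assign x (NExp.plus (NExp.var x) (NExp.const 1))))) M1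
        (n * (B + e.cost + 16) + e.cost + 6) (I n))
    fun ha => key n 0 _ rfl
      (ha.mono (fun a h => by simpa using Or.inl h) fun a h => absurd h List.not_mem_nil) (by simp)
      (hI _ _ _ h0))
  exact h.le (by omega)

theorem forTable {dep tab x u : ℕ} {w : NExp} {c : Cmd} {W n B : ℕ} {p : ℕ → ℕ}
    (I : ℕ → Mem → Prop)
    (hn : dep ∉ (Cmd.forTable dep tab x u w c).natWrites ∧
      tab ∉ (Cmd.forTable dep tab x u w c).natWrites ∧ x ∉ u :: c.natWrites)
    (hw : ∀ M1, Agree (Cmd.forTable dep tab x u w c) M M1 → w.eval M1 = W)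
    (hdep : M.nat dep W 0 0 = n) (hp : ∀ k < n, M.nat tab W k 0 = p k)
    (h0 : I 0 M)
    (hs : ∀ k M1, k < n → Agree (Cmd.forTable dep tab x u w c) M M1 → M1.nat u 0 0 0 = p k →
      I k M1 → Runs O c M1 B (I (k + 1)))
    (hI : ∀ k M1 l, I k M1 → I k (M1.setNat x 0 0 0 l) := by
      intro k M1 l h
      first
        | exact h
        | simpa using h)
    (hI₁ : ∀ k M1 l, I k M1 → I k (M1.setNat u 0 0 0 l) := by
      intro k M1 l h
      first
        | exact h
        | simpa using h) :
    Runs O (Cmd.forTable dep tab x u w c) M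
      (n * (B + 2 * w.cost + 40) + w.cost + 20) (I n) := by
  refine (forLoop (n := n) (B := B + w.cost + 10) I hn.2.2 (fun M1 ha => ?_) h0
    (fun k M1 hk ha hx h => ?_) hI).le ?_
  · have ha' : Agree (Cmd.forTable dep tab x u w c) M M1 := ha
    rw [NExp.eval_get, hw M1 ha', ha'.nat dep hn.1]
    exact hdep
  · have ha' : Agree (Cmd.forTable dep tab x u w c) M M1 := ha
    refine (seq (B₁ := w.cost + 10) (B₂ := B) (block (fun ha1 => ?_)
      (by simp only [Cmd.assign, Cmd.steps, NExp.cost, NExp.var]; omega))).le (by omega)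
    · have hval : (NExp.get tab w (NExp.var x) (NExp.const 0)).eval M1 = p k := by
        rw [NExp.eval_get, hw M1 ha', ha'.nat tab hn.2.1, NExp.eval_var, hx, NExp.eval_const]
        exact hp k hk
      rw [Cmd.den_assign, hval] at ha1 ⊢
      refine hs k _ hk (ha'.trans ⟨fun a h => ha1.nat a ?_, fun a h => ha1.real a List.not_mem_nil⟩)
        (by simp) (hI₁ _ _ _ h)
      simp only [Cmd.natWrites_forTable, List.mem_cons, not_or, Cmd.natWrites_assign] at h ⊢
      exact ⟨h.2.1, List.not_mem_nil⟩
  · simp only [NExp.cost]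
    have : n * (B + w.cost + 10 + (w.cost + 1 + 1 + 1) + 16) ≤ n * (B + 2 * w.cost + 40) :=
      Nat.mul_le_mul_left n (by omega)
    omega

end Runs

/-! ### Memory layout and tables -/

/-! Natural arrays besides those of the input: `11` marks the nodes of the upper tree, `12` and `13`
hold the numbers of rows that are below `u` and, for `12`, also below `v`; `14` and `15` hold the
first and the last row below `v`; `16` the lowest row of a block; `17` the row below whose leaf a
node outside the upper tree hangs; `18` and `19` the paths and depths of the elimination tree, `20`
and `21` those of the leaves of the sampling tree; `23` the time stamps and `24` the time counter.
The arrays from `30` on are variables: `30` is the vertex whose path is worked on, `31` a node,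
`32` a row of the sketch or a row of `A`, `33` a block, `34` a coordinate in the block, `35` the node whose matrix
is used to solve a triangular system.

Real arrays besides those of the input: `7` holds the columns of the factor `L[t_v]` that matter at
the node `v`, and the current factor at the place of the node `N`; `8`, `9`, `10` hold `J`, `Z` and
`y`; `11` is a work vector that is zero between procedures, `12` the solution of a triangular
system, `13` a column of `A H_x ^ (-1/2)`; `14` a sign and `15` a factor. -/

section Programs

open NExp

namespace ParentTree

variable {V : Type} (T : ParentTree V)

open Classical in
/-- The restriction of a vector to the first `k` vertices on the path of `w`. -/
noncomputable def cut (w : V) (k : ℕ) (z : V → ℝ) : V → ℝ := fun u =>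
  if ∃ i < k, T.parent^[i] w = u then z u else 0

theorem cut_zero (w : V) (z : V → ℝ) : T.cut w 0 z = 0 := by
  funext u
  simp [cut]

theorem cut_depth {w : V} {z : V → ℝ} (hz : ∀ u ∉ T.path w, z u = 0) :
    T.cut w (T.depth w) z = z := by
  funext u
  by_cases hu : u ∈ T.path w
  · exact if_pos (T.mem_path_iff.1 hu)
  · exact (if_neg fun h => hu (T.mem_path_iff.2 h)).trans (hz u hu).symm

theorem not_exists_lt_iterate {w : V} {k : ℕ} (hk : k < T.depth w) :
    ¬ ∃ i < k, T.parent^[i] w = T.parent^[k] w := by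
  rintro ⟨i, hi, h⟩
  have := T.iterate_injOn (hi.trans hk) hk h
  omega

theorem exists_lt_succ_iff {w u : V} {k : ℕ} :
    (∃ i < k + 1, T.parent^[i] w = u) ↔ (∃ i < k, T.parent^[i] w = u) ∨ T.parent^[k] w = u := by
  constructor
  · rintro ⟨i, hi, h⟩
    rcases Nat.lt_succ_iff_lt_or_eq.1 hi with h' | rfl
    · exact Or.inl ⟨i, h', h⟩
    · exact Or.inr h
  · rintro (⟨i, hi, h⟩ | h)
    · exact ⟨i, by omega, h⟩
    · exact ⟨k, by omega, h⟩

theorem cut_succ [DecidableEq V] {w : V} {k : ℕ} (z : V → ℝ) :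
    T.cut w (k + 1) z = Function.update (T.cut w k z) (T.parent^[k] w) (z (T.parent^[k] w)) := by
  funext u
  by_cases hu : u = T.parent^[k] w
  · subst hu
    rw [Function.update_self, cut, if_pos ⟨k, by omega, rfl⟩]
  · rw [Function.update_of_ne hu]
    have h : (∃ i < k + 1, T.parent^[i] w = u) ↔ ∃ i < k, T.parent^[i] w = u := by
      rw [exists_lt_succ_iff, or_iff_left (Ne.symm hu)]
    by_cases h₁ : ∃ i < k, T.parent^[i] w = u
    · exact (if_pos (h.2 h₁)).trans (if_pos h₁).symm
    · exact (if_neg fun h₂ => h₁ (h.1 h₂)).trans (if_neg h₁).symm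

theorem cut_iterate {w : V} {k : ℕ} (hk : k < T.depth w) (z : V → ℝ) :
    T.cut w k z (T.parent^[k] w) = 0 := by
  rw [cut, if_neg (T.not_exists_lt_iterate hk)]

theorem height_pos {d : ℕ} (T : ParentTree (Fin d)) : 0 < T.height :=
  (T.depth_pos T.root).trans_le (depth_le_height T.root)

end ParentTree

namespace Mem

/-- A real array as a vector. -/
def vec {d : ℕ} (M : Mem) (a : ℕ) : Fin d → ℝ := fun u => M.real a u 0 0

/-- The plane with the number `v` of a real array as a matrix. -/
def mat {k d : ℕ} (M : Mem) (a v : ℕ) : Matrix (Fin k) (Fin d) ℝ := fun i j => M.real a v i j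

theorem vec_setReal {d : ℕ} (M : Mem) (a : ℕ) (u : Fin d) (c : ℝ) :
    ((M.setReal a u 0 0 c).vec a : Fin d → ℝ) = Function.update (M.vec a) u c := by
  funext w
  by_cases hw : w = u
  · subst hw
    simp [vec]
  · have : (w : ℕ) ≠ u := fun h => hw (Fin.ext h)
    simp [vec, hw, this]

theorem vec_congr {d : ℕ} {M M1 : Mem} {a : ℕ} (h : M1.real a = M.real a) :
    (M1.vec a : Fin d → ℝ) = M.vec a := by
  unfold vec
  rw [h]

theorem mat_congr {k d : ℕ} {M M1 : Mem} {a v : ℕ} (h : M1.real a v = M.real a v) :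
    (M1.mat a v : Matrix (Fin k) (Fin d) ℝ) = M.mat a v := by
  unfold mat
  rw [h]

end Mem

variable {d m r N : ℕ} {P : ConvexData d m} {Q : SketchParams P r N}

/-- The part of the input that the procedures read. -/
structure InputTables (Q : SketchParams P r N) (M : Mem) : Prop where
  d_eq : M.nat 0 0 0 0 = d
  m_eq : M.nat 0 1 0 0 = m
  r_eq : M.nat 0 2 0 0 = r
  N_eq : M.nat 0 3 0 0 = N
  size : ∀ i : Fin m, M.nat 1 i 0 0 = P.size i
  rowLeaf : ∀ j : Fin d, M.nat 4 j 0 0 = Q.S.rowLeaf j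
  colLeaf : ∀ i (k : Fin (P.size i)), M.nat 5 i k 0 = Q.S.colLeaf ⟨i, k⟩
  A : ∀ (u : Fin d) i (k : Fin (P.size i)), M.real 2 u i k = P.A u ⟨i, k⟩
  Φ : ∀ (q : Fin r) i (k : Fin (P.size i)), M.real 3 q i k = Q.Φ q ⟨i, k⟩

/-- The table of the paths of the elimination tree. -/
structure PathTables (Q : SketchParams P r N) (M : Mem) : Prop where
  depth : ∀ u : Fin d, M.nat 19 u 0 0 = Q.T.depth u
  path : ∀ u : Fin d, ∀ k < Q.T.depth u, M.nat 18 u k 0 = (Q.T.parent^[k] u : ℕ)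

/-- The table of the paths of the leaves of the sampling tree. -/
structure LeafTables (Q : SketchParams P r N) (M : Mem) : Prop where
  depth_row : ∀ j : Fin d, M.nat 21 (Q.S.rowLeaf j) 0 0 = Q.S.tree.depth (Q.S.rowLeaf j)
  path_row : ∀ j : Fin d, ∀ k < Q.S.tree.depth (Q.S.rowLeaf j),
    M.nat 20 (Q.S.rowLeaf j) k 0 = (Q.S.tree.parent^[k] (Q.S.rowLeaf j) : ℕ)
  depth_col : ∀ c : P.Coord, M.nat 21 (Q.S.colLeaf c) 0 0 = Q.S.tree.depth (Q.S.colLeaf c)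
  path_col : ∀ c : P.Coord, ∀ k < Q.S.tree.depth (Q.S.colLeaf c),
    M.nat 20 (Q.S.colLeaf c) k 0 = (Q.S.tree.parent^[k] (Q.S.colLeaf c) : ℕ)

/-- The tables that describe the position of the nodes of the sampling tree relative to the
elimination tree. -/
structure NodeTables (Q : SketchParams P r N) (M : Mem) : Prop where
  upper : ∀ v : Fin N, 0 < M.nat 11 v 0 0 ↔ v ∈ Q.S.upper
  cnt : ∀ (v : Fin N) (u : Fin d), M.nat 12 v u 0 = (Q.S.rowLabel v ∩ Q.T.below u).ncard
  belowCard : ∀ u : Fin d, M.nat 13 u 0 0 = (Q.T.below u).ncard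
  first : ∀ v ∈ Q.S.upper, ∃ j ∈ Q.S.rowLabel v, M.nat 14 v 0 0 = (j : ℕ) ∧
    ∃ l ∈ Q.S.rowLabel v, M.nat 15 v 0 0 = (l : ℕ) ∧
    Q.S.Lam Q.T v ⊆ Q.T.path j ∪ Q.T.path l
  low : ∀ i : Fin m, M.nat 16 i 0 0 = P.blockLow Q.T i
  hang : ∀ v ∉ Q.S.upper, ∃ j : Fin d, M.nat 17 v 0 0 = (j : ℕ) ∧
    ∀ c ∈ Q.S.colLabel v, P.blockLow Q.T c.1 = j

/-- The part of the memory that does not change after the initialization. -/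
structure Tables (Q : SketchParams P r N) (M : Mem) : Prop extends
  InputTables Q M, PathTables Q M, LeafTables Q M, NodeTables Q M

theorem InputTables.congr {M M1 : Mem} (h : InputTables Q M)
    (hn : ∀ a ∈ [0, 1, 4, 5], M1.nat a = M.nat a)
    (hr : ∀ a ∈ [2, 3], M1.real a = M.real a) : InputTables Q M1 where
  d_eq := by rw [hn 0 (by decide)]; exact h.d_eq
  m_eq := by rw [hn 0 (by decide)]; exact h.m_eq
  r_eq := by rw [hn 0 (by decide)]; exact h.r_eq
  N_eq := by rw [hn 0 (by decide)]; exact h.N_eq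
  size := by rw [hn 1 (by decide)]; exact h.size
  rowLeaf := by rw [hn 4 (by decide)]; exact h.rowLeaf
  colLeaf := by rw [hn 5 (by decide)]; exact h.colLeaf
  A := by rw [hr 2 (by decide)]; exact h.A
  Φ := by rw [hr 3 (by decide)]; exact h.Φ

theorem PathTables.congr {M M1 : Mem} (h : PathTables Q M)
    (hn : ∀ a ∈ [18, 19], M1.nat a = M.nat a) : PathTables Q M1 where
  depth := by rw [hn 19 (by decide)]; exact h.depth
  path := by rw [hn 18 (by decide)]; exact h.path

theorem LeafTables.congr {M M1 : Mem} (h : LeafTables Q M)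
    (hn : ∀ a ∈ [20, 21], M1.nat a = M.nat a) : LeafTables Q M1 where
  depth_row := by rw [hn 21 (by decide)]; exact h.depth_row
  path_row := by rw [hn 20 (by decide)]; exact h.path_row
  depth_col := by rw [hn 21 (by decide)]; exact h.depth_col
  path_col := by rw [hn 20 (by decide)]; exact h.path_col

theorem NodeTables.congr {M M1 : Mem} (h : NodeTables Q M)
    (hn : ∀ a ∈ [11, 12, 13, 14, 15, 16, 17], M1.nat a = M.nat a) : NodeTables Q M1 where
  upper := by rw [hn 11 (by decide)]; exact h.upper
  cnt := by rw [hn 12 (by decide)]; exact h.cnt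
  belowCard := by rw [hn 13 (by decide)]; exact h.belowCard
  first := by rw [hn 14 (by decide), hn 15 (by decide)]; exact h.first
  low := by rw [hn 16 (by decide)]; exact h.low
  hang := by rw [hn 17 (by decide)]; exact h.hang

theorem Tables.congr {M M1 : Mem} (h : Tables Q M)
    (hn : ∀ a ∈ [0, 1, 4, 5, 11, 12, 13, 14, 15, 16, 17, 18, 19, 20, 21], M1.nat a = M.nat a)
    (hr : ∀ a ∈ [2, 3], M1.real a = M.real a) : Tables Q M1 where
  toInputTables := h.toInputTables.congr (fun a ha => hn a (by revert a; decide)) hr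
  toPathTables := h.toPathTables.congr fun a ha => hn a (by revert a; decide)
  toLeafTables := h.toLeafTables.congr fun a ha => hn a (by revert a; decide)
  toNodeTables := h.toNodeTables.congr fun a ha => hn a (by revert a; decide)

theorem Tables.of_agree {M M1 : Mem} {c : Cmd} (h : Tables Q M) (ha : Agree c M M1)
    (hn : ∀ a ∈ [0, 1, 4, 5, 11, 12, 13, 14, 15, 16, 17, 18, 19, 20, 21], a ∉ c.natWrites := by decide)
    (hr : ∀ a ∈ [2, 3], a ∉ c.realWrites := by decide) : Tables Q M1 :=
  h.congr (fun a h => ha.nat a (hn a h)) fun a h => ha.real a (hr a h)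

theorem PathTables.of_agree {M M1 : Mem} {c : Cmd} (h : PathTables Q M) (ha : Agree c M M1)
    (hn : ∀ a ∈ [18, 19], a ∉ c.natWrites := by decide) : PathTables Q M1 :=
  h.congr fun a h => ha.nat a (hn a h)

theorem InputTables.of_agree {M M1 : Mem} {c : Cmd} (h : InputTables Q M) (ha : Agree c M M1)
    (hn : ∀ a ∈ [0, 1, 4, 5], a ∉ c.natWrites := by decide) (hr : ∀ a ∈ [2, 3], a ∉ c.realWrites := by decide) :
    InputTables Q M1 :=
  h.congr (fun a h => ha.nat a (hn a h)) fun a h => ha.real a (hr a h)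

/-- The test whether column `u` belongs to `Λ v`. -/
theorem NodeTables.mem_Lam_iff {M : Mem} (h : NodeTables Q M) (v : Fin N) (u : Fin d) :
    u ∈ Q.S.Lam Q.T v ↔ 0 < M.nat 12 v u 0 ∧ M.nat 12 v u 0 < M.nat 13 u 0 0 := by
  rw [h.cnt, h.belowCard, TreeData.mem_Lam, Set.ncard_pos (Set.toFinite _)]
  refine and_congr ?_ ⟨fun h₁ => ?_, fun h₁ h₂ => ?_⟩
  · exact ⟨fun ⟨i, h₁, h₂⟩ => ⟨i, h₁, h₂⟩, fun ⟨i, h₁, h₂⟩ => ⟨i, h₁, h₂⟩⟩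
  · refine Set.ncard_lt_ncard ⟨Set.inter_subset_right, fun h₂ => h₁ fun i hi => (h₂ hi).1⟩
      (Set.toFinite _)
  · rw [Set.inter_eq_right.2 h₂] at h₁
    exact lt_irrefl _ h₁

/-- The test whether column `u` is kept up to date at `v`. -/
theorem NodeTables.below_subset_iff {M : Mem} (h : NodeTables Q M) (v : Fin N) (u : Fin d) :
    Q.T.below u ⊆ Q.S.rowLabel v ↔ ¬ M.nat 12 v u 0 < M.nat 13 u 0 0 := by
  rw [h.cnt, h.belowCard]
  constructor
  · intro h₂
    rw [Set.inter_eq_right.2 h₂]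
    exact lt_irrefl _
  · intro h₁ i hi
    have := Set.eq_of_subset_of_ncard_le (Set.inter_subset_right (s := Q.S.rowLabel v))
      (not_lt.1 h₁) (Set.toFinite _)
    rw [← this] at hi
    exact hi.1

namespace Runs

variable {O : Oracle} {M : Mem}

/-- The rule for loops along a path of the elimination tree. -/
theorem forPath (tab : PathTables Q M) {x u v : ℕ} {c : Cmd} {w : Fin d} {B : ℕ}
    (I : ℕ → Mem → Prop)
    (hn : 19 ∉ (Cmd.forTable 19 18 x u (NExp.var v) c).natWrites ∧
      18 ∉ (Cmd.forTable 19 18 x u (NExp.var v) c).natWrites ∧ x ∉ u :: c.natWrites)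
    (hv : v ∉ (Cmd.forTable 19 18 x u (NExp.var v) c).natWrites)
    (hw : M.nat v 0 0 0 = w)
    (h0 : I 0 M)
    (hs : ∀ k M1, k < Q.T.depth w → Agree (Cmd.forTable 19 18 x u (NExp.var v) c) M M1 →
      M1.nat u 0 0 0 = (Q.T.parent^[k] w : ℕ) → I k M1 → Runs O c M1 B (I (k + 1)))
    (hI : ∀ k M1 l, I k M1 → I k (M1.setNat x 0 0 0 l) := by
      intro k M1 l h
      first
        | exact h
        | simpa using h)
    (hI₁ : ∀ k M1 l, I k M1 → I k (M1.setNat u 0 0 0 l) := by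
      intro k M1 l h
      first
        | exact h
        | simpa using h) :
    Runs O (Cmd.forTable 19 18 x u (NExp.var v) c) M (Q.T.height * (B + 72))
      (I (Q.T.depth w)) := by
  refine (forTable (W := (w : ℕ)) (B := B) I hn (fun M1 ha => ?_) (tab.depth w) (tab.path w) h0 hs
    hI hI₁).le ?_
  · rw [eval_var, ha.nat v hv, hw]
  · have h₁ : Q.T.depth w ≤ Q.T.height := ParentTree.depth_le_height w
    have h₂ := Q.T.height_pos
    have h₃ : Q.T.depth w * (B + 2 * (NExp.var v).cost + 40) ≤ Q.T.height * (B + 48) :=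
      Nat.mul_le_mul h₁ (by simp only [NExp.var, NExp.cost]; omega)
    have h₄ : (NExp.var v).cost = 4 := rfl
    have h₅ : Q.T.height * (B + 72) = Q.T.height * (B + 48) + Q.T.height * 24 := by ring
    omega

/-- The rule for loops along a path that replace the entries of a vector one by one. -/
theorem forPathMap {α : Type} (tab : PathTables Q M) {x u v : ℕ} {c : Cmd} {w : Fin d} {B : ℕ}
    (g : (ℕ → ℕ → ℕ → ℕ → ℝ) → Fin d → α) (F : Fin d → α → α)
    (K : (ℕ → ℕ → ℕ → ℕ → ℝ) → Prop)
    (hn : 19 ∉ (Cmd.forTable 19 18 x u (NExp.var v) c).natWrites ∧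
      18 ∉ (Cmd.forTable 19 18 x u (NExp.var v) c).natWrites ∧ x ∉ u :: c.natWrites)
    (hv : v ∉ (Cmd.forTable 19 18 x u (NExp.var v) c).natWrites)
    (hw : M.nat v 0 0 0 = w)
    (hK : K M.real)
    (hs : ∀ (a : Fin d) M1, a ∈ Q.T.path w →
      Agree (Cmd.forTable 19 18 x u (NExp.var v) c) M M1 → M1.nat u 0 0 0 = (a : ℕ) →
      g M1.real a = g M.real a → K M1.real →
      Runs O c M1 B fun M2 =>
        g M2.real = Function.update (g M1.real) a (F a (g M1.real a)) ∧ K M2.real) :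
    Runs O (Cmd.forTable 19 18 x u (NExp.var v) c) M (Q.T.height * (B + 72)) fun M1 =>
      (∀ a, (a ∈ Q.T.path w → g M1.real a = F a (g M.real a)) ∧
        (a ∉ Q.T.path w → g M1.real a = g M.real a)) ∧ K M1.real := by
  refine (forPath tab (fun k M1 => (∀ a, ((∃ i < k, Q.T.parent^[i] w = a) →
      g M1.real a = F a (g M.real a)) ∧ ((¬ ∃ i < k, Q.T.parent^[i] w = a) →
      g M1.real a = g M.real a)) ∧ K M1.real) hn hv hw ⟨fun a => ⟨?_, fun _ => rfl⟩, hK⟩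
      (fun k M1 hk ha hu hI => ?_) (fun _ _ _ h => h) (fun _ _ _ h => h)).mono le_rfl
    (fun M1 _ h => ⟨fun a => ?_, h.2⟩)
  · rintro ⟨i, hi, -⟩
    omega
  · have hold := (hI.1 (Q.T.parent^[k] w)).2 (Q.T.not_exists_lt_iterate hk)
    refine (hs _ M1 (Q.T.iterate_mem_path w k) ha hu hold hI.2).mono le_rfl
      fun M2 _ h => ⟨fun a => ?_, h.2⟩
    rw [h.1]
    by_cases hak : a = Q.T.parent^[k] w
    · subst hak
      rw [Function.update_self, hold]
      exact ⟨fun _ => rfl, fun h' => absurd ⟨k, by omega, rfl⟩ h'⟩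
    · rw [Function.update_of_ne hak]
      have : (∃ i < k + 1, Q.T.parent^[i] w = a) ↔ ∃ i < k, Q.T.parent^[i] w = a := by
        rw [Q.T.exists_lt_succ_iff, or_iff_left (Ne.symm hak)]
      rw [this]
      exact hI.1 a
  · rw [Q.T.mem_path_iff]
    exact h.1 a

end Runs

/-! ### Solving with a factor along a path -/

/-- The entry `u` of a vector, where `u` is a variable. -/
def RExp.at1 (a u : ℕ) : RExp := RExp.get a (NExp.var u) (NExp.const 0) (NExp.const 0)

/-- The entry `(u, w)` of a matrix with the number `v`, where `v`, `u`, `w` are variables. -/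
def RExp.at3 (a v u w : ℕ) : RExp := RExp.get a (NExp.var v) (NExp.var u) (NExp.var w)

/-- Assignment to the entry `u` of a vector, where `u` is a variable. -/
def Cmd.set1 (a u : ℕ) (e : RExp) : Cmd :=
  Cmd.setReal a (NExp.var u) (NExp.const 0) (NExp.const 0) e

/-- Assignment to an entry of a matrix; its number and the indices are variables. -/
def Cmd.set3 (a v u w : ℕ) (e : RExp) : Cmd :=
  Cmd.setReal a (NExp.var v) (NExp.var u) (NExp.var w) e

section Simp

variable (O : Oracle) (M : Mem) (a u v w : ℕ) (e : RExp)

@[simp] theorem RExp.eval_at1 :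
    (RExp.at1 a u).eval O M = M.real a (M.nat u 0 0 0) 0 0 := rfl

@[simp] theorem RExp.eval_at3 : (RExp.at3 a v u w).eval O M =
    M.real a (M.nat v 0 0 0) (M.nat u 0 0 0) (M.nat w 0 0 0) := rfl

@[simp] theorem Cmd.den_set1 : (Cmd.set1 a u e).den O M =
    M.setReal a (M.nat u 0 0 0) 0 0 (e.eval O M) := rfl

@[simp] theorem Cmd.den_set3 : (Cmd.set3 a v u w e).den O M =
    M.setReal a (M.nat v 0 0 0) (M.nat u 0 0 0) (M.nat w 0 0 0) (e.eval O M) := rfl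

end Simp

/-- Solves `B z = b` along the path of the vertex in variable `30`, where `B` is the matrix with the
number in variable `35`; the right hand side `b` becomes zero. -/
def Cmd.solve : Cmd :=
  .forTable 19 18 36 37 (.var 30) (.seq
    (.set1 12 37 (.divide (.at1 11 37) (.at3 7 35 37 37)))
    (.forTable 19 18 38 39 (.var 37)
      (.set1 11 39 (.minus (.at1 11 39) (.times (.at3 7 35 39 37) (.at1 12 37))))))

theorem ParentTree.cut_succ_update {V : Type} [DecidableEq V] (T : ParentTree V) {w : V} {k : ℕ}
    (hk : k < T.depth w) (z : V → ℝ) (c : ℝ) :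
    T.cut w (k + 1) (Function.update z (T.parent^[k] w) c) =
      T.cut w k z + Pi.single (T.parent^[k] w) c := by
  funext u
  rw [cut_succ, Pi.add_apply]
  by_cases hu : u = T.parent^[k] w
  · subst hu
    rw [Function.update_self, Function.update_self, T.cut_iterate hk, Pi.single_eq_same, zero_add]
  · rw [Function.update_of_ne hu, Pi.single_eq_of_ne hu, add_zero]
    unfold cut
    rw [Function.update_of_ne hu]

/-- The columns in `U` of the matrix `B` are those of a nonsingular factor. -/
def GoodColumns {d : ℕ} (T : ParentTree (Fin d)) (U : Set (Fin d)) (B : Matrix (Fin d) (Fin d) ℝ) :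
    Prop :=
  ∀ u ∈ U, (∀ a ∉ T.path u, B a u = 0) ∧ B u u ≠ 0

variable {O : Oracle} {M : Mem}

/-- Back substitution works along the path alone: the solution is supported there, since the columns
of the factor are supported on paths. -/
theorem Runs.solve (tab : PathTables Q M) {w : Fin d} {n : ℕ} (hw : M.nat 30 0 0 0 = w)
    (hn : M.nat 35 0 0 0 = n) (hcol : GoodColumns Q.T (Q.T.path w) (M.mat 7 n))
    (hb : ∀ a ∉ Q.T.path w, (M.vec 11 : Fin d → ℝ) a = 0) :
    Runs O Cmd.solve M (Q.T.height * (Q.T.height * 200 + 200)) fun M1 =>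
      (M1.vec 11 : Fin d → ℝ) = 0 ∧ ∃ z : Fin d → ℝ, (∀ u ∉ Q.T.path w, z u = 0) ∧
        (M.mat 7 n : Matrix (Fin d) (Fin d) ℝ) *ᵥ z = M.vec 11 ∧
        ∀ u ∈ Q.T.path w, M1.real 12 u 0 0 = z u := by
  set B : Matrix (Fin d) (Fin d) ℝ := M.mat 7 n with hB
  refine (forPath (B := Q.T.height * 200 + 100) tab (fun k M1 =>
    (∀ a, (M1.vec 11 : Fin d → ℝ) a ≠ 0 → a ∈ Q.T.path w ∧ Q.T.depth a + k ≤ Q.T.depth w) ∧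
    B *ᵥ (Q.T.cut w k (M1.vec 12)) + M1.vec 11 = M.vec 11) (by decide) (by decide) hw ⟨?_, ?_⟩
    (fun k M1 hk ha hu hI => ?_)).mono (Nat.mul_le_mul_left _ (by omega)) (fun M1 _ h => ⟨?_, ?_⟩)
  · intro a h
    have : a ∈ Q.T.path w := not_not.1 fun h' => h (hb a h')
    exact ⟨this, by simpa using ParentTree.depth_le_of_mem_path this⟩
  · rw [ParentTree.cut_zero, Matrix.mulVec_zero, zero_add]
  · set u := Q.T.parent^[k] w with hu'
    have huw : u ∈ Q.T.path w := Q.T.iterate_mem_path w k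
    have hdu : Q.T.depth u + k = Q.T.depth w := by
      have := Q.T.depth_iterate w k hk
      rw [← hu'] at this
      omega
    have hBM : ∀ a e : Fin d, M1.real 7 n a e = B a e := fun a e => by
      rw [ha.real 7]; rfl
    have hn₁ : M1.nat 35 0 0 0 = n := ha.nat_eq hn
    refine (seq (B₁ := 30) (B₂ := Q.T.height * (60 + 72)) (block
      fun ha1 => ?_)).le (by omega)
    rw [Cmd.den_set1, hu, RExp.eval_divide, RExp.eval_at1, RExp.eval_at3, hu, hn₁, hBM] at ha1 ⊢
    set c : ℝ := M1.real 11 u 0 0 / B u u with hc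
    refine (forPathMap (Q := Q) (w := u) (B := 60) ((tab.of_agree ha).of_agree ha1
      (by decide)) (fun R a => R 11 a 0 0) (fun a y => y - B a u * c) (fun _ => True) (by decide)
      (by decide) (by simpa using hu) trivial ?_).mono le_rfl fun M2 ha2 h => ?_
    · intro a M2 hau ha2 ha' _ _
      refine block ⟨?_, trivial⟩
      have h₁ : M2.nat 37 0 0 0 = (u : ℕ) := by
        rw [ha2.nat 37]
        simpa using hu
      have h₂ : M2.nat 35 0 0 0 = n := by rw [ha2.nat 35]; simpa using hn₁
      have h₃ : M2.real 7 n a u = B a u := by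
        rw [ha2.real 7]
        simpa using hBM a u
      have h₄ : M2.real 12 u 0 0 = c := by
        rw [ha2.real 12]
        simp
      rw [Cmd.den_set1, ha', RExp.eval_minus, RExp.eval_times, RExp.eval_at1, RExp.eval_at3,
        RExp.eval_at1, h₁, h₂, ha', h₃, h₄]
      exact M2.vec_setReal 11 a _
    · have h11 : (M2.vec 11 : Fin d → ℝ) = M1.vec 11 - c • B.col u := by
        funext a
        simp only [Pi.sub_apply, Pi.smul_apply, Matrix.col_apply, smul_eq_mul]
        by_cases hau : a ∈ Q.T.path u
        · have := (h.1 a).1 hau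
          rw [Mem.setReal_real_ne _] at this
          rw [mul_comm c]
          exact this
        · have := (h.1 a).2 hau
          rw [Mem.setReal_real_ne _] at this
          rw [(hcol u huw).1 a hau, mul_zero, sub_zero]
          exact this
      have h12 : (M2.vec 12 : Fin d → ℝ) = Function.update (M1.vec 12) u c := by
        rw [Mem.vec_congr (ha2.real 12), Mem.vec_setReal]
      refine ⟨fun a ha' => ?_, ?_⟩
      · rw [h11] at ha'
        simp only [Pi.sub_apply, Pi.smul_apply, Matrix.col_apply, smul_eq_mul] at ha'
        have hau : a ≠ u := by
          rintro rfl
          apply ha'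
          rw [hc, div_mul_cancel₀ _ (hcol _ huw).2]
          exact sub_self _
        have hle : a ∈ Q.T.path w ∧ Q.T.depth a + k ≤ Q.T.depth w := by
          by_cases h0 : (M1.vec 11 : Fin d → ℝ) a = 0
          · have hp : a ∈ Q.T.path u := not_not.1 fun h' => ha' (by
              rw [h0, (hcol u huw).1 a h', mul_zero, sub_zero])
            have := ParentTree.depth_le_of_mem_path hp
            exact ⟨ParentTree.path_trans hp huw, by omega⟩
          · exact hI.1 a h0
        refine ⟨hle.1, ?_⟩
        have : Q.T.depth a ≠ Q.T.depth u := fun h' =>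
          hau (ParentTree.eq_of_mem_path_of_depth_eq hle.1 huw h')
        omega
      · rw [h12, hu', ParentTree.cut_succ_update _ hk, ← hu', Matrix.mulVec_add,
          Matrix.mulVec_single, h11, ← hI.2]
        have : (MulOpposite.op c • B.col u) = c • B.col u := by
          funext a
          simp [mul_comm]
        rw [this]
        abel
  · funext a
    by_contra h'
    have := (h.1 a h').2
    have := Q.T.depth_pos a
    omega
  · refine ⟨Q.T.cut w (Q.T.depth w) (M1.vec 12), fun u hu => ?_, ?_, fun u hu => ?_⟩
    · exact if_neg fun h' => hu (Q.T.mem_path_iff.2 h')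
    · have h0 : (M1.vec 11 : Fin d → ℝ) = 0 := by
        funext a
        by_contra h'
        have := (h.1 a h').2
        have := Q.T.depth_pos a
        omega
      rw [← h.2, h0, add_zero]
    · exact (if_pos ((Q.T.mem_path_iff).1 hu)).symm

/-! ### Corrections of one row of `Z` -/

/-- The entry `(v, q)` of an array of vectors. -/
def Mem.row {d : ℕ} (M : Mem) (a v q : ℕ) : Fin d → ℝ := fun u => M.real a v q u

theorem Mem.row_congr {d : ℕ} {M M1 : Mem} {a v q : ℕ} (h : M1.real a v q = M.real a v q) :
    (M1.row a v q : Fin d → ℝ) = M.row a v q := by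
  unfold row
  rw [h]

theorem Mem.row_setReal {d : ℕ} (M : Mem) (a v q : ℕ) (u : Fin d) (c : ℝ) :
    ((M.setReal a v q u c).row a v q : Fin d → ℝ) = Function.update (M.row a v q) u c := by
  funext w
  by_cases hw : w = u
  · subst hw
    simp [row]
  · have : (w : ℕ) ≠ u := fun h => hw (Fin.ext h)
    simp [row, hw, this]

/-- The test whether the column in variable `37` belongs to `Λ` of the node in variable `31`. -/
def BExp.inLam : BExp :=
  .conj (.nlt (.const 0) (.get 12 (.var 31) (.var 37) (.const 0)))
    (.nlt (.get 12 (.var 31) (.var 37) (.const 0)) (.get 13 (.var 37) (.const 0) (.const 0)))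

/-- Adds the multiple `f z` of the vector `z` to row `q` of `Z_v` and adjusts the entry of `y`. -/
def Cmd.addZ : Cmd :=
  .forTable 19 18 36 37 (.var 30) (.seq
    (.set3 9 31 32 37 (.plus (.at3 9 31 32 37) (.times (.var 15) (.at1 12 37))))
    (.cond .inLam .skip (.setReal 10 (.var 31) (.var 32) (.const 0)
      (.plus (.get 10 (.var 31) (.var 32) (.const 0))
        (.times (.times (.var 15) (.at1 12 37)) (.at1 1 37))))))

/-- Replaces row `q` of `Z_v` by the solution for a right hand side changed by `f b`. -/
def Cmd.correctRow : Cmd := .seq .solve .addZ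

/-- The value of an entry of `y` at the node `v` that belongs to the row `z` of `Z_v`. -/
noncomputable def SketchParams.lamSum (Q : SketchParams P r N) (v : Fin N) (h z : Fin d → ℝ) : ℝ :=
  ∑ u, z u * (1 - (Q.S.Lam Q.T v).indicator (fun _ => (1 : ℝ)) u) * h u

theorem SketchParams.lamSum_add_single (Q : SketchParams P r N) (v : Fin N) (h z : Fin d → ℝ)
    (u : Fin d) (c : ℝ) : Q.lamSum v h (z + Pi.single u c) =
      Q.lamSum v h z + c * (1 - (Q.S.Lam Q.T v).indicator (fun _ => (1 : ℝ)) u) * h u := by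
  unfold lamSum
  simp only [Pi.add_apply, add_mul, Finset.sum_add_distrib]
  congr 1
  rw [Finset.sum_eq_single u]
  · rw [Pi.single_eq_same]
  · intro a _ ha
    rw [Pi.single_eq_of_ne ha, zero_mul, zero_mul]
  · intro h
    exact absurd (Finset.mem_univ u) h

/-- Row `q` of `Z_v` and the entry `q` of `y_v` are consistent with `Z_v Bᵀ = J`. -/
structure RowInv (Q : SketchParams P r N) (M : Mem) (v : Fin N) (q : ℕ)
    (B : Matrix (Fin d) (Fin d) ℝ) (J : Fin d → ℝ) : Prop where
  supp : ∀ u ∉ Q.S.support Q.T v, (M.row 9 v q : Fin d → ℝ) u = 0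
  eq : B *ᵥ (M.row 9 v q) = J
  y : M.real 10 v q 0 = Q.lamSum v (M.vec 1) (M.row 9 v q)

/-- Apart from row `q` of the node `v`, the arrays `8`, `9`, `10` agree. -/
def SameRows (v q : ℕ) (M M1 : Mem) : Prop :=
  ∀ a, (a = 8 ∨ a = 9 ∨ a = 10) → ∀ v₁ q₁, (v₁ ≠ v ∨ q₁ ≠ q) → M1.real a v₁ q₁ = M.real a v₁ q₁

theorem SameRows.refl (v q : ℕ) (M : Mem) : SameRows v q M M := fun _ _ _ _ _ => rfl

theorem SameRows.trans {v q : ℕ} {M M1 M2 : Mem} (h : SameRows v q M M1) (h₁ : SameRows v q M1 M2) :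
    SameRows v q M M2 :=
  fun a ha v₁ q₁ hne => (h₁ a ha v₁ q₁ hne).trans (h a ha v₁ q₁ hne)

theorem Mem.setReal_other_row (M : Mem) (a b v q u : ℕ) (c : ℝ) {v₁ q₁ : ℕ} (h : v₁ ≠ v ∨ q₁ ≠ q) :
    (M.setReal a v q u c).real b v₁ q₁ = M.real b v₁ q₁ := by
  funext w
  simp only [setReal]
  rw [if_neg]
  rintro ⟨-, h₁, h₂, -⟩
  exact h.elim (fun h' => h' h₁) fun h' => h' h₂

theorem SameRows.setReal (M : Mem) (a v q u : ℕ) (c : ℝ) : SameRows v q M (M.setReal a v q u c) :=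
  fun _ _ _ _ h => M.setReal_other_row a _ v q u c h

theorem BExp.eval_inLam (tab : NodeTables Q M) {v : Fin N} {u : Fin d}
    (hv : M.nat 31 0 0 0 = v) (hu : M.nat 37 0 0 0 = u) :
    BExp.inLam.eval O M ↔ u ∈ Q.S.Lam Q.T v := by
  rw [tab.mem_Lam_iff]
  simp [BExp.inLam, hv, hu]

theorem Runs.addZ (tab : Tables Q M) {w : Fin d} {v : Fin N} {q : ℕ} {f : ℝ} {z : Fin d → ℝ}
    (hw : M.nat 30 0 0 0 = w) (hv : M.nat 31 0 0 0 = v) (hq : M.nat 32 0 0 0 = q)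
    (hf : M.real 15 0 0 0 = f) (hz : ∀ u ∈ Q.T.path w, M.real 12 u 0 0 = z u)
    (hz₀ : ∀ u ∉ Q.T.path w, z u = 0)
    (hy : M.real 10 v q 0 = Q.lamSum v (M.vec 1) (M.row 9 v q)) :
    Runs O Cmd.addZ M (Q.T.height * 250) fun M1 =>
      (M1.row 9 v q : Fin d → ℝ) = M.row 9 v q + f • z ∧
      M1.real 10 v q 0 = Q.lamSum v (M.vec 1) (M1.row 9 v q) ∧ SameRows v q M M1 := by
  refine (forPath (B := 140) tab.toPathTables (fun k M1 =>
    (M1.row 9 v q : Fin d → ℝ) = M.row 9 v q + f • Q.T.cut w k z ∧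
      M1.real 10 v q 0 = Q.lamSum v (M.vec 1) (M1.row 9 v q) ∧ SameRows v q M M1)
    (by decide) (by decide) hw ⟨?_, hy, SameRows.refl _ _ _⟩
    (fun k M1 hk ha hu hI => ?_)).mono (Nat.mul_le_mul_left _ (by omega)) (fun M1 _ h => ?_)
  · rw [ParentTree.cut_zero, smul_zero, add_zero]
  · set u := Q.T.parent^[k] w with hu'
    have huw : u ∈ Q.T.path w := Q.T.iterate_mem_path w k
    have hv₁ : M1.nat 31 0 0 0 = v := ha.nat_eq hv
    have hq₁ : M1.nat 32 0 0 0 = q := ha.nat_eq hq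
    have hf₁ : M1.real 15 0 0 0 = f := ha.real_eq hf
    have hz₁ : M1.real 12 u 0 0 = z u := by rw [ha.real 12]; exact hz u huw
    have hh₁ : M1.real 1 u 0 0 = (M.vec 1 : Fin d → ℝ) u := by rw [ha.real 1]; rfl
    set M2 := M1.setReal 9 v q u (M1.real 9 v q u + f * z u) with hM2
    have hrow : (M2.row 9 v q : Fin d → ℝ) = M1.row 9 v q + Pi.single u (f * z u) := by
      rw [hM2, Mem.row_setReal]
      funext a
      by_cases hau : a = u
      · subst hau
        rw [Function.update_self, Pi.add_apply, Pi.single_eq_same]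
        rfl
      · rw [Function.update_of_ne hau, Pi.add_apply, Pi.single_eq_of_ne hau, add_zero]
    have hcut : M.row 9 v q + f • Q.T.cut w (k + 1) z =
        M1.row 9 v q + Pi.single u (f * z u) := by
      have := Q.T.cut_succ_update hk z (z u)
      rw [← hu', Function.update_eq_self] at this
      rw [this, hI.1, smul_add, add_assoc]
      congr 2
      rw [← Pi.single_smul, smul_eq_mul]
    have h10 : M2.real 10 v q 0 = Q.lamSum v (M.vec 1) (M1.row 9 v q) := by
      rw [hM2, Mem.setReal_real_ne _]
      exact hI.2.1
    have hs₂ : SameRows v q M M2 := hI.2.2.trans (SameRows.setReal _ _ _ _ _ _)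
    refine seq (B₁ := 40) (B₂ := 100) (block fun ha1 => ?_)
    rw [Cmd.den_set3, hu, hv₁, hq₁, RExp.eval_plus, RExp.eval_times, RExp.eval_at3, RExp.eval_var,
      RExp.eval_at1, hv₁, hq₁, hu, hf₁, hz₁, ← hM2] at ha1 ⊢
    have tab2 : NodeTables Q M2 := tab.toNodeTables.congr fun a h => by
      rw [hM2, Mem.setReal_nat]
      exact ha.nat a (by revert a; decide)
    have hind := BExp.eval_inLam (O := O) tab2 (v := v) (u := u) (by simpa [hM2] using hv₁)
      (by simpa [hM2] using hu)
    by_cases hL : u ∈ Q.S.Lam Q.T v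
    · refine (cond_true (B := 1) (hind.2 hL) (block ?_)).le (by decide)
      refine ⟨hrow.trans hcut.symm, ?_, hs₂⟩
      rw [Cmd.den_skip, h10, hrow, Q.lamSum_add_single, Set.indicator_of_mem hL, sub_self, mul_zero,
        zero_mul, add_zero]
    · refine (cond_false (B := 60) (fun h => hL (hind.1 h)) (block ?_)).le
        (by decide)
      have e₁ : M2.nat = M1.nat := rfl
      have e₂ : M2.real 15 0 0 0 = f := by rw [hM2, Mem.setReal_real_ne _, hf₁]
      have e₃ : M2.real 12 u 0 0 = z u := by rw [hM2, Mem.setReal_real_ne _, hz₁]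
      have e₄ : M2.real 1 u 0 0 = (M.vec 1 : Fin d → ℝ) u := by
        rw [hM2, Mem.setReal_real_ne _, hh₁]
      simp only [Cmd.den_setReal, eval_var, eval_const, e₁, hv₁, hq₁, RExp.eval_plus,
        RExp.eval_get, RExp.eval_times, RExp.eval_var, RExp.eval_at1, hu, e₂, e₃, e₄]
      have hrow₂ : ∀ c, ((M2.setReal 10 v q 0 c).row 9 v q : Fin d → ℝ) = M2.row 9 v q := fun c =>
        Mem.row_congr (by rw [Mem.setReal_real_ne _])
      refine ⟨?_, ?_, hs₂.trans (SameRows.setReal _ _ _ _ _ _)⟩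
      · rw [hrow₂, hrow, hcut]
      · rw [hrow₂, hrow, Q.lamSum_add_single, Set.indicator_of_notMem hL, ← h10]
        simp
  · rw [ParentTree.cut_depth _ hz₀] at h
    exact h

/-- One row of `Z_v` is corrected by a solution along the path of `w`. The system is solved with the
matrix number `n`, which has to agree with `B` on this path. -/
theorem Runs.correctRow (tab : Tables Q M) {w : Fin d} {v : Fin N} {q n : ℕ} {f : ℝ}
    {B : Matrix (Fin d) (Fin d) ℝ} {J : Fin d → ℝ}
    (hw : M.nat 30 0 0 0 = w) (hv : M.nat 31 0 0 0 = v) (hq : M.nat 32 0 0 0 = q)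
    (hn : M.nat 35 0 0 0 = n) (hf : M.real 15 0 0 0 = f)
    (hcol : GoodColumns Q.T (Q.T.path w) (M.mat 7 n))
    (hB : ∀ u ∈ Q.T.path w, ∀ a, B a u = (M.mat 7 n : Matrix (Fin d) (Fin d) ℝ) a u)
    (hb : ∀ a ∉ Q.T.path w, (M.vec 11 : Fin d → ℝ) a = 0)
    (hwv : Q.T.path w ⊆ Q.S.support Q.T v) (hrow : RowInv Q M v q B J) :
    Runs O Cmd.correctRow M (Q.T.height * (Q.T.height * 200 + 500)) fun M1 =>
      (M1.vec 11 : Fin d → ℝ) = 0 ∧ RowInv Q M1 v q B (J + f • M.vec 11) ∧ SameRows v q M M1 := by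
  refine (seq (B₂ := Q.T.height * 250) ((Runs.solve tab.toPathTables hw hn hcol hb).mono le_rfl
    fun M1 ha ⟨h₁, z, hz₀, hz, hz₁⟩ _ => ?_)).le (by
      rw [← Nat.mul_add]
      exact Nat.mul_le_mul_left _ (by omega))
  have e9 : (M1.row 9 v q : Fin d → ℝ) = M.row 9 v q :=
    Mem.row_congr (by rw [ha.real 9])
  have e1 : (M1.vec 1 : Fin d → ℝ) = M.vec 1 := Mem.vec_congr (ha.real 1)
  refine (Runs.addZ (tab.of_agree ha) (v := v) (q := q) (f := f) (z := z)
    (ha.nat_eq hw) (ha.nat_eq hv)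
    (ha.nat_eq hq) (ha.real_eq hf) hz₁ hz₀
    ?_).mono le_rfl fun M2 ha2 ⟨h₂, h₃, h₄⟩ => ⟨?_, ⟨?_, ?_, ?_⟩, ?_⟩
  · rw [ha.real 10, e9, e1]
    exact hrow.y
  · rw [Mem.vec_congr (ha2.real 11), h₁]
  · intro u hu
    rw [h₂, e9, Pi.add_apply, hrow.supp u hu, Pi.smul_apply, hz₀ u fun h => hu (hwv h), smul_zero,
      add_zero]
  · rw [h₂, e9, Matrix.mulVec_add, hrow.eq, Matrix.mulVec_smul, ← hz]
    congr 2
    funext a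
    rw [Matrix.mulVec, Matrix.mulVec, dotProduct, dotProduct]
    refine Finset.sum_congr rfl fun u _ => ?_
    by_cases hu : u ∈ Q.T.path w
    · rw [hB u hu a]
    · rw [hz₀ u hu, mul_zero, mul_zero]
  · rw [h₃, Mem.vec_congr (ha2.real 1)]
  · refine SameRows.trans (fun a h v₁ q₁ _ => ?_) h₄
    rcases h with rfl | rfl | rfl
    · rw [ha.real 8]
    · rw [ha.real 9]
    · rw [ha.real 10]

/-! ### Bringing the columns of a node up to date -/

/-- Adds `(B - B_v) z` to the work vector, where `B` is the matrix with the number in variable `35`,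
`z` is a row of `Z_v`, and only the columns on the path of the vertex in variable `30` count. -/
def Cmd.addDefect : Cmd :=
  .forTable 19 18 36 37 (.var 30) (.forTable 19 18 38 39 (.var 37)
    (.set1 11 39 (.plus (.at1 11 39)
      (.times (.minus (.at3 7 35 39 37) (.at3 7 31 39 37)) (.at3 9 31 32 37)))))

/-- Copies the columns on a path from the matrix in variable `35` to that in variable `31`. -/
def Cmd.copyColumns : Cmd :=
  .forTable 19 18 36 37 (.var 30) (.forTable 19 18 38 39 (.var 37)
    (.set3 7 31 39 37 (.at3 7 35 39 37)))

/-- Brings the columns on the path of the vertex in variable `30` up to date at the node in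
variable `31`. -/
def Cmd.pass : Cmd :=
  .seq (.assign 35 (.get 0 (.const 3) (.const 0) (.const 0)))
    (.seq
      (.forLoop 32 (.get 0 (.const 2) (.const 0) (.const 0))
        (.seq .addDefect (.seq (.assignReal 15 (.minus (.const 0) (.const 1))) .correctRow)))
      .copyColumns)

/-- The rule for counted loops with a short expression for the number of rounds. -/
theorem Runs.forCount {x : ℕ} {e : NExp} {c : Cmd} {n B : ℕ} (I : ℕ → Mem → Prop)
    (hx : x ∉ c.natWrites) (hc : e.cost ≤ 20)
    (he : ∀ M1, Agree (Cmd.forLoop x e c) M M1 → e.eval M1 = n)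
    (h0 : I 0 M)
    (hs : ∀ k M1, k < n → Agree (Cmd.forLoop x e c) M M1 → M1.nat x 0 0 0 = k → I k M1 →
      Runs O c M1 B (I (k + 1)))
    (hI : ∀ k M1 l, I k M1 → I k (M1.setNat x 0 0 0 l) := by
      intro k M1 l h
      first
        | exact h
        | simpa using h) :
    Runs O (Cmd.forLoop x e c) M (n * (B + 36) + 31) (I n) := by
  refine (forLoop I hx he h0 hs hI).le ?_
  have := Nat.mul_le_mul_left n (show B + e.cost + 16 ≤ B + 36 by omega)
  omega

theorem Runs.addDefect (tab : PathTables Q M) {w : Fin d} {v q n : ℕ}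
    (hw : M.nat 30 0 0 0 = w) (hv : M.nat 31 0 0 0 = v) (hq : M.nat 32 0 0 0 = q)
    (hn : M.nat 35 0 0 0 = n)
    (hv₁ : GoodColumns Q.T (Q.T.path w) (M.mat 7 v))
    (hn₁ : GoodColumns Q.T (Q.T.path w) (M.mat 7 n))
    (hb : (M.vec 11 : Fin d → ℝ) = 0) :
    Runs O Cmd.addDefect M (Q.T.height * (Q.T.height * 200 + 72)) fun M1 =>
      (M1.vec 11 : Fin d → ℝ) = (M.mat 7 n - M.mat 7 v : Matrix (Fin d) (Fin d) ℝ) *ᵥ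
        Q.T.cut w (Q.T.depth w) (M.row 9 v q) := by
  refine (forPath (B := Q.T.height * 200) tab (fun k M1 =>
    (M1.vec 11 : Fin d → ℝ) = (M.mat 7 n - M.mat 7 v : Matrix (Fin d) (Fin d) ℝ) *ᵥ
        Q.T.cut w k (M.row 9 v q)) (by decide) (by decide) hw ?_
    (fun k M1 hk ha hu hI => ?_)).mono le_rfl (fun M1 _ h => h)
  · rw [ParentTree.cut_zero, Matrix.mulVec_zero, hb]
  · set u := Q.T.parent^[k] w with hu'
    have huw : u ∈ Q.T.path w := Q.T.iterate_mem_path w k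
    refine (forPathMap (Q := Q) (w := u) (B := 60) (tab.of_agree ha)
      (fun R a => R 11 a 0 0) (fun a y => y + (M.real 7 n a u - M.real 7 v a u) * M.real 9 v q u)
      (fun _ => True) (by decide) (by decide) hu trivial ?_).mono
      (Nat.mul_le_mul_left _ (by omega)) fun M2 ha2 h => ?_
    · intro a M2 hau ha2 ha' _ _
      refine block ⟨?_, trivial⟩
      have h₁ : M2.nat 37 0 0 0 = (u : ℕ) := ha2.nat_eq hu
      have h₂ : M2.nat 35 0 0 0 = n := by
        rw [ha2.nat 35, ha.nat 35]; exact hn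
      have h₃ : M2.nat 31 0 0 0 = v := by
        rw [ha2.nat 31, ha.nat 31]; exact hv
      have h₄ : M2.nat 32 0 0 0 = q := by
        rw [ha2.nat 32, ha.nat 32]; exact hq
      have h₅ : M2.real 7 = M.real 7 := by rw [ha2.real 7, ha.real 7]
      have h₆ : M2.real 9 = M.real 9 := by rw [ha2.real 9, ha.real 9]
      rw [Cmd.den_set1, ha', RExp.eval_plus, RExp.eval_times, RExp.eval_minus, RExp.eval_at1,
        RExp.eval_at3, RExp.eval_at3, RExp.eval_at3, h₁, h₂, h₃, h₄, ha', h₅, h₆]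
      exact M2.vec_setReal 11 a _
    · have hc := Q.T.cut_succ_update hk (M.row 9 v q) (M.real 9 v q u)
      have hc' : Function.update (M.row 9 v q) (Q.T.parent^[k] w) (M.real 9 v q u) =
          M.row 9 v q := Function.update_eq_self (α := Fin d) u (M.row 9 v q)
      rw [hc'] at hc
      rw [hc, Matrix.mulVec_add, ← hI, ← hu', Matrix.mulVec_single]
      funext a
      simp only [Pi.add_apply, Pi.smul_apply, Matrix.col_apply, Matrix.sub_apply,
        MulOpposite.smul_eq_mul_unop, MulOpposite.unop_op]
      by_cases hau : a ∈ Q.T.path u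
      · exact (h.1 a).1 hau
      · have h₁ := (hv₁ u huw).1 a hau
        have h₂ := (hn₁ u huw).1 a hau
        rw [h₁, h₂, sub_zero, zero_mul, add_zero]
        exact (h.1 a).2 hau

/-- The loop that copies columns. No column has to be well-formed; only entries on the path of the
index of a column are copied. -/
theorem Runs.copyColumns (tab : PathTables Q M) {w : Fin d} {v n : ℕ} (hne : n ≠ v)
    (hw : M.nat 30 0 0 0 = w) (hv : M.nat 31 0 0 0 = v) (hn : M.nat 35 0 0 0 = n) :
    Runs O Cmd.copyColumns M (Q.T.height * (Q.T.height * 200 + 72)) fun M1 =>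
      (∀ u : Fin d, (u ∈ Q.T.path w → ∀ a ∈ Q.T.path u, M1.real 7 v a u = M.real 7 n a u) ∧
        (u ∈ Q.T.path w → ∀ a : Fin d, a ∉ Q.T.path u → M1.real 7 v a u = M.real 7 v a u) ∧
        (u ∉ Q.T.path w → ∀ a, M1.real 7 v a u = M.real 7 v a u)) ∧
      ∀ v₁ ≠ v, M1.real 7 v₁ = M.real 7 v₁ := by
  refine (forPath (B := Q.T.height * 200) tab (fun k M1 =>
    (∀ u : Fin d, ((∃ i < k, Q.T.parent^[i] w = u) → ∀ a ∈ Q.T.path u,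
        M1.real 7 v a u = M.real 7 n a u) ∧
      (∀ a : Fin d, a ∉ Q.T.path u → M1.real 7 v a u = M.real 7 v a u) ∧
      ((¬ ∃ i < k, Q.T.parent^[i] w = u) → ∀ a, M1.real 7 v a u = M.real 7 v a u)) ∧
    ∀ v₁ ≠ v, M1.real 7 v₁ = M.real 7 v₁) (by decide) (by decide) hw ⟨fun u => ⟨?_, ?_, ?_⟩, ?_⟩
    (fun k M1 hk ha hu hI => ?_)).mono le_rfl (fun M1 _ h => ?_)
  · rintro ⟨i, hi, -⟩
    omega
  · exact fun _ _ => rfl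
  · exact fun _ _ => rfl
  · exact fun _ _ => rfl
  · set u := Q.T.parent^[k] w with hu'
    refine (forPathMap (Q := Q) (w := u) (B := 60) (tab.of_agree ha)
      (fun R a => R 7 v a u) (fun a y => M.real 7 n a u)
      (fun R => ∀ v₁ a₁ u₁ : ℕ, (v₁ ≠ v ∨ u₁ ≠ (u : ℕ)) → R 7 v₁ a₁ u₁ = M1.real 7 v₁ a₁ u₁)
      (by decide) (by decide) hu (fun _ _ _ _ => rfl) ?_).mono
      (Nat.mul_le_mul_left _ (by omega)) fun M2 ha2 h => ?_
    · intro a M2 hau ha2 ha' _ hK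
      have h₁ : M2.nat 37 0 0 0 = (u : ℕ) := ha2.nat_eq hu
      have h₂ : M2.nat 35 0 0 0 = n := by
        rw [ha2.nat 35, ha.nat 35]; exact hn
      have h₃ : M2.nat 31 0 0 0 = v := by
        rw [ha2.nat 31, ha.nat 31]; exact hv
      have h₄ : M2.real 7 n a u = M.real 7 n a u := by
        rw [hK n a u (Or.inl hne), hI.2 n hne]
      refine block ⟨?_, ?_⟩
      · rw [Cmd.den_set3, ha', RExp.eval_at3, h₁, h₂, h₃, ha', h₄]
        funext e
        by_cases he : e = a
        · subst he
          simp
        · have : (e : ℕ) ≠ a := fun h => he (Fin.ext h)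
          simp [he, this]
      · intro v₁ a₁ u₁ hne₁
        rw [Cmd.den_set3, h₁, h₃, Mem.setReal_real_self, if_neg, hK v₁ a₁ u₁ hne₁]
        rintro ⟨h, -, h'⟩
        exact hne₁.elim (fun h₁ => h₁ h) fun h₁ => h₁ h'
    · refine ⟨fun e => ?_, fun v₁ hne₁ => ?_⟩
      · by_cases he : e = u
        · rw [he]
          refine ⟨fun _ a hau => (h.1 a).1 hau, fun a hau => ?_, fun h' => ?_⟩
          · have := (h.1 a).2 hau
            rw [this, (hI.1 u).2.1 a hau]
          · exact absurd ⟨k, by omega, hu'.symm⟩ h'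
        · have hiff : (∃ i < k + 1, Q.T.parent^[i] w = e) ↔ ∃ i < k, Q.T.parent^[i] w = e := by
            rw [Q.T.exists_lt_succ_iff, or_iff_left (Ne.symm he)]
          have he' : ∀ a, M2.real 7 v a e = M1.real 7 v a e := fun a =>
            h.2 v a e (Or.inr fun h => he (Fin.ext h))
          rw [hiff]
          exact ⟨fun h₁ a hae => (he' a).trans ((hI.1 e).1 h₁ a hae),
            fun a hae => (he' a).trans ((hI.1 e).2.1 a hae),
            fun h₁ a => (he' a).trans ((hI.1 e).2.2 h₁ a)⟩
      · rw [← hI.2 v₁ hne₁]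
        funext a e
        exact h.2 v₁ a e (Or.inl hne₁)
  · refine ⟨fun u => ?_, h.2⟩
    rw [Q.T.mem_path_iff]
    exact ⟨(h.1 u).1, fun _ => (h.1 u).2.1, (h.1 u).2.2⟩

/-- The memory at the node `v` of the upper tree: the columns of its factor that count are
well-formed, and `Z_v` and `y_v` are consistent with it. -/
structure NodeInv (Q : SketchParams P r N) (M : Mem) (v : Fin N) : Prop where
  good : GoodColumns Q.T (Q.S.support Q.T v) (M.mat 7 v)
  row : ∀ q : Fin r, RowInv Q M v q (M.mat 7 v) (M.row 8 v q)

/-- Apart from the node `v`, the arrays `7`, `8`, `9`, `10` agree. -/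
def SameNodes (v : ℕ) (M M1 : Mem) : Prop :=
  ∀ a, (a = 7 ∨ a = 8 ∨ a = 9 ∨ a = 10) → ∀ v₁, v₁ ≠ v → M1.real a v₁ = M.real a v₁

theorem SameNodes.refl (v : ℕ) (M : Mem) : SameNodes v M M := fun _ _ _ _ => rfl

theorem SameNodes.trans {v : ℕ} {M M1 M2 : Mem} (h : SameNodes v M M1) (h₁ : SameNodes v M1 M2) :
    SameNodes v M M2 :=
  fun a ha v₁ hne => (h₁ a ha v₁ hne).trans (h a ha v₁ hne)

theorem SameRows.sameNodes {v q : ℕ} {M M1 : Mem} (h : SameRows v q M M1)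
    (h7 : ∀ v₁ ≠ v, M1.real 7 v₁ = M.real 7 v₁) : SameNodes v M M1 := by
  rintro a (rfl | ha) v₁ hne
  · exact h7 v₁ hne
  · funext q₁
    exact h a ha v₁ q₁ (Or.inl hne)

theorem RowInv.congr {M1 : Mem} {v : Fin N} {q : ℕ} {B B₁ : Matrix (Fin d) (Fin d) ℝ}
    {J J₁ : Fin d → ℝ} (h : RowInv Q M v q B J) (h9 : M1.real 9 v q = M.real 9 v q)
    (h10 : M1.real 10 v q 0 = M.real 10 v q 0) (h1 : M1.real 1 = M.real 1)
    (hB : ∀ u ∈ Q.S.support Q.T v, ∀ a, B₁ a u = B a u) (hJ : J₁ = J) :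
    RowInv Q M1 v q B₁ J₁ where
  supp := by rw [Mem.row_congr h9]; exact h.supp
  eq := by
    rw [Mem.row_congr h9, hJ, ← h.eq]
    funext a
    rw [Matrix.mulVec, Matrix.mulVec, dotProduct, dotProduct]
    refine Finset.sum_congr rfl fun u _ => ?_
    by_cases hu : u ∈ Q.S.support Q.T v
    · rw [hB u hu a]
    · rw [h.supp u hu, mul_zero, mul_zero]
  y := by rw [h10, Mem.row_congr h9, Mem.vec_congr h1]; exact h.y

theorem NodeInv.congr {M1 : Mem} {v : Fin N} (h : NodeInv Q M v)
    (hr : ∀ a, (a = 7 ∨ a = 8 ∨ a = 9 ∨ a = 10) → M1.real a v = M.real a v)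
    (h1 : M1.real 1 = M.real 1) : NodeInv Q M1 v where
  good := by rw [Mem.mat_congr (hr 7 (by simp))]; exact h.good
  row := fun q => (h.row q).congr (by rw [hr 9 (by simp)]) (by rw [hr 10 (by simp)]) h1
    (by rw [Mem.mat_congr (hr 7 (by simp))]; exact fun _ _ _ => rfl)
    (Mem.row_congr (by rw [hr 8 (by simp)]))

theorem NodeInv.of_sameNodes {M1 : Mem} {v : Fin N} {n : ℕ} (h : NodeInv Q M v)
    (hs : SameNodes n M M1) (hne : (v : ℕ) ≠ n) (h1 : M1.real 1 = M.real 1) : NodeInv Q M1 v :=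
  h.congr (fun a ha => hs a ha v hne) h1

open Classical in
/-- The defect that arises from replacing the columns on the path of `w` is supported on this path,
so one solve with the current factor for each row of `Z_v` repairs it. -/
theorem Runs.pass (tab : Tables Q M) {w : Fin d} {v : Fin N}
    (hw : M.nat 30 0 0 0 = w) (hv : M.nat 31 0 0 0 = v)
    (hL : GoodColumns Q.T (Q.T.path w) (M.mat 7 N))
    (hb : (M.vec 11 : Fin d → ℝ) = 0)
    (hwv : Q.T.path w ⊆ Q.S.support Q.T v) (hrow : NodeInv Q M v) :
    Runs O Cmd.pass M (r * (Q.T.height * (Q.T.height * 1000 + 1000)) + 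
        Q.T.height * (Q.T.height * 1000 + 1000)) fun M1 =>
      (M1.vec 11 : Fin d → ℝ) = 0 ∧ NodeInv Q M1 v ∧ SameNodes v M M1 ∧
      ∀ u ∈ Q.S.support Q.T v, ∀ a : Fin d, M1.real 7 v a u =
        if u ∈ Q.T.path w then M.real 7 N a u else M.real 7 v a u := by
  have hτ := Q.T.height_pos
  have hNv : N ≠ v := (v.2).ne'
  set B' : Matrix (Fin d) (Fin d) ℝ := Matrix.of fun a u =>
    if u ∈ Q.T.path w then M.real 7 N a u else M.real 7 v a u with hB'
  refine (seq (B₁ := 20) (B₂ := r * (Q.T.height * (Q.T.height * 400 + 700) + 60) + 31 +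
    Q.T.height * (Q.T.height * 200 + 72))
    (block fun ha0 => ?_)).le ?_
  swap
  · generalize Q.T.height = τ at hτ ⊢
    have h1 : r * (τ * (τ * 400 + 700) + 60) ≤ r * (τ * (τ * 1000 + 1000)) :=
      Nat.mul_le_mul_left _ (by nlinarith)
    have h2 : τ * (τ * 200 + 72) + 51 ≤ τ * (τ * 1000 + 1000) := by nlinarith
    omega
  rw [Cmd.den_assign, eval_get, eval_const, eval_const, tab.N_eq] at ha0 ⊢
  set M0 := M.setNat 35 0 0 0 N with hM0
  have tab0 : Tables Q M0 := tab.of_agree ha0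
  have hreal : M0.real = M.real := rfl
  refine seq (B₁ := r * (Q.T.height * (Q.T.height * 400 + 700) + 60) + 31) ((forCount (n := r)
    (B := Q.T.height * (Q.T.height * 400 + 700) + 24)
    (fun k M1 => (M1.vec 11 : Fin d → ℝ) = 0 ∧ SameNodes v M M1 ∧ ∀ q : Fin r,
      RowInv Q M1 v q (if (q : ℕ) < k then B' else M.mat 7 v) (M.row 8 v q))
    (by decide) (by decide) (fun M1 ha => ?_) ?_ (fun k M1 hk ha hk₁ hI => ?_)
      (fun k M1 l h => ⟨h.1, h.2.1, fun q => (h.2.2 q).congr rfl rfl rfl (fun _ _ _ => rfl) rfl⟩)).mono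
    le_rfl fun M1 ha hI ha' => ?_)
  · rw [eval_get, ha.nat 0]
    exact tab0.r_eq
  · exact ⟨hb, SameNodes.refl _ _, fun q => (hrow.row q).congr rfl rfl rfl
      (by simp) rfl⟩
  · have hq := (hI.2.2 ⟨k, hk⟩)
    rw [if_neg (lt_irrefl _)] at hq
    have e7 : M1.real 7 = M.real 7 := by rw [ha.real 7, hreal]
    have e7v : (M1.mat 7 v : Matrix (Fin d) (Fin d) ℝ) = M.mat 7 v := Mem.mat_congr (by rw [e7])
    have e7N : (M1.mat 7 N : Matrix (Fin d) (Fin d) ℝ) = M.mat 7 N := Mem.mat_congr (by rw [e7])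
    have n30 : M1.nat 30 0 0 0 = w := ha.nat_eq hw
    have n31 : M1.nat 31 0 0 0 = v := ha.nat_eq hv
    have n35 : M1.nat 35 0 0 0 = N := by rw [ha.nat 35]; simp [hM0]
    have hgv : GoodColumns Q.T (Q.T.path w) (M.mat 7 v) := fun u hu => hrow.good u (hwv hu)
    refine (seq (B₁ := Q.T.height * (Q.T.height * 200 + 72)) (B₂ := 20 + Q.T.height *
      (Q.T.height * 200 + 500)) ((Runs.addDefect (q := k) (tab0.toPathTables.of_agree ha)
      n30 n31 hk₁ n35 (by rw [e7v]; exact hgv) (by rw [e7N]; exact hL) hI.1).mono le_rfl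
      fun M2 ha2 h₂ _ => ?_)).le (by nlinarith)
    rw [e7v, e7N] at h₂
    have hdef : (M2.vec 11 : Fin d → ℝ) = B' *ᵥ (M1.row 9 v k) -
        (M.mat 7 v : Matrix (Fin d) (Fin d) ℝ) *ᵥ (M1.row 9 v k) := by
      rw [h₂, ← Matrix.sub_mulVec]
      funext a
      rw [Matrix.mulVec, Matrix.mulVec, dotProduct, dotProduct]
      refine Finset.sum_congr rfl fun u _ => ?_
      rw [Matrix.sub_apply, Matrix.sub_apply, hB', Matrix.of_apply]
      by_cases hu : u ∈ Q.T.path w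
      · rw [if_pos hu]
        congr 1
        exact if_pos (Q.T.mem_path_iff.1 hu)
      · rw [if_neg hu]
        have : Q.T.cut w (Q.T.depth w) (M1.row 9 v k) u = 0 :=
          if_neg fun h => hu (Q.T.mem_path_iff.2 h)
        rw [this, mul_zero]
        exact (mul_eq_zero_of_left (sub_self _) _).symm
    have hsupp : ∀ a ∉ Q.T.path w, (M2.vec 11 : Fin d → ℝ) a = 0 := by
      intro a haw
      rw [h₂, Matrix.mulVec, dotProduct]
      refine Finset.sum_eq_zero fun u _ => ?_
      by_cases hu : u ∈ Q.T.path w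
      · have hau : a ∉ Q.T.path u := fun h => haw (ParentTree.path_trans h hu)
        rw [Matrix.sub_apply, (hL u hu).1 a hau, (hgv u hu).1 a hau, sub_self, zero_mul]
      · have : Q.T.cut w (Q.T.depth w) (M1.row 9 v k) u = 0 :=
          if_neg fun h => hu (Q.T.mem_path_iff.2 h)
        rw [this, mul_zero]
    refine seq (B₁ := 20) (block fun ha3 => ?_)
    rw [Cmd.den_assignReal, RExp.eval_minus, RExp.eval_const, RExp.eval_const] at ha3 ⊢
    have ha3' := ha3
    set M3 := M2.setReal 15 0 0 0 (((0 : ℕ) : ℝ) - ((1 : ℕ) : ℝ)) with hM3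
    have f7 : M3.real 7 = M.real 7 := by
      rw [hM3, Mem.setReal_real_ne _, ha2.real 7, e7]
    have f11 : (M3.vec 11 : Fin d → ℝ) = M2.vec 11 := Mem.vec_congr (ha3.real 11)
    have f7N : (M3.mat 7 N : Matrix (Fin d) (Fin d) ℝ) = M.mat 7 N := Mem.mat_congr (by rw [f7])
    have f9 : M3.real 9 = M1.real 9 := by rw [ha3.real 9, ha2.real 9]
    have f10 : M3.real 10 = M1.real 10 := by rw [ha3.real 10, ha2.real 10]
    have f8 : M3.real 8 = M1.real 8 := by rw [ha3.real 8, ha2.real 8]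
    have hn₃ : ∀ a, a ∉ Cmd.addDefect.natWrites → M3.nat a = M1.nat a := fun a h => ha2.nat a h
    refine (Runs.correctRow (n := N) (q := k) (v := v) (B := B')
      (J := M.row 8 v k + (B' *ᵥ (M1.row 9 v k) -
        (M.mat 7 v : Matrix (Fin d) (Fin d) ℝ) *ᵥ (M1.row 9 v k))) (f := -1)
      (((tab0.of_agree ha).of_agree ha2).of_agree
        ha3 (by decide) (by decide)) (w := w) (by rw [hn₃ 30 (by decide)]; exact n30)
      (by rw [hn₃ 31 (by decide)]; exact n31) (by rw [hn₃ 32 (by decide)]; exact hk₁)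
      (by rw [hn₃ 35 (by decide)]; exact n35) (by rw [hM3]; simp) (by rw [f7N]; exact hL)
      (fun u hu a => by rw [f7N]; exact if_pos hu) (by rw [f11]; exact hsupp) hwv
      ⟨?_, ?_, ?_⟩).mono le_rfl fun M4 ha4 h₄ => ⟨h₄.1, ?_, fun q => ?_⟩
    · rw [Mem.row_congr (M := M1) (by rw [f9])]
      exact hq.supp
    · rw [Mem.row_congr (M := M1) (by rw [f9])]
      have := hq.eq
      simp only at this
      rw [this]
      abel
    · rw [f10, Mem.row_congr (M := M1) (by rw [f9]), Mem.vec_congr (ha3.real 1),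
        Mem.vec_congr (ha2.real 1)]
      exact hq.y
    · refine hI.2.1.trans (SameNodes.trans ?_ (h₄.2.2.sameNodes fun v₁ _ => ?_))
      · rintro a (rfl | rfl | rfl | rfl) v₁ _
        · rw [f7, e7]
        · rw [f8]
        · rw [f9]
        · rw [f10]
      · rw [ha4.real 7]
    · rcases lt_trichotomy (q : ℕ) k with h | h | h
      · rw [if_pos (by omega)]
        refine (hI.2.2 q).congr ?_ ?_ ?_ (by rw [if_pos h]; exact fun _ _ _ => rfl) rfl
        · rw [h₄.2.2 9 (by simp) v q (Or.inr h.ne), f9]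
        · rw [h₄.2.2 10 (by simp) v q (Or.inr h.ne), f10]
        · rw [ha4.real 1, ha3.real 1, ha2.real 1]
      · rw [if_pos (by omega), h]
        refine h₄.2.1.congr rfl rfl rfl (fun _ _ _ => rfl) ?_
        rw [f11, hdef, neg_one_smul]
        abel
      · rw [if_neg (by omega)]
        refine (hI.2.2 q).congr ?_ ?_ ?_ (by rw [if_neg (by omega)]; exact fun _ _ _ => rfl) rfl
        · rw [h₄.2.2 9 (by simp) v q (Or.inr h.ne'), f9]
        · rw [h₄.2.2 10 (by simp) v q (Or.inr h.ne'), f10]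
        · rw [ha4.real 1, ha3.real 1, ha2.real 1]
  · have e7 : M1.real 7 = M.real 7 := by rw [ha.real 7, hreal]
    refine (Runs.copyColumns (n := N) (v := v) (w := w) (tab0.toPathTables.of_agree ha)
      hNv (ha.nat_eq hw) (ha.nat_eq hv)
      (by rw [ha.nat 35]; simp [hM0])).mono le_rfl fun M2 ha2 h₂ => ?_
    rw [e7] at h₂
    have hcol : ∀ u ∈ Q.S.support Q.T v, ∀ a : Fin d, M2.real 7 v a u = B' a u := by
      intro u hu a
      rw [hB', Matrix.of_apply]
      by_cases huw : u ∈ Q.T.path w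
      · rw [if_pos huw]
        by_cases hau : a ∈ Q.T.path u
        · exact (h₂.1 u).1 huw a hau
        · rw [(h₂.1 u).2.1 huw a hau]
          exact ((hrow.good u hu).1 a hau).trans ((hL u huw).1 a hau).symm
      · rw [if_neg huw]
        exact (h₂.1 u).2.2 huw a
    refine ⟨?_, ⟨fun u hu => ?_, fun q => ?_⟩, hI.2.1.trans ?_, hcol⟩
    · rw [Mem.vec_congr (ha2.real 11)]
      exact hI.1
    · have hc : ∀ a, (M2.mat 7 v : Matrix (Fin d) (Fin d) ℝ) a u = B' a u := hcol u hu
      simp only [hc, hB', Matrix.of_apply]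
      by_cases huw : u ∈ Q.T.path w
      · simp only [if_pos huw]
        exact hL u huw
      · simp only [if_neg huw]
        exact hrow.good u hu
    · have := hI.2.2 q
      rw [if_pos q.2] at this
      refine this.congr (by rw [ha2.real 9]) (by rw [ha2.real 10])
        (ha2.real 1) hcol (Mem.row_congr ?_)
      rw [ha2.real 8, ha.real 8, hreal]
    · rintro a (rfl | rfl | rfl | rfl) v₁ hne
      · rw [h₂.2 v₁ hne, e7]
      · rw [ha2.real 8]
      · rw [ha2.real 9]
      · rw [ha2.real 10]

/-! ### Adding and removing columns of `A H_x ^ (-1/2)` -/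

/-- Computes the column of `A H_x ^ (-1/2)` with the block in variable `33` and the position in
variable `34` on the path of the vertex in variable `30`. -/
def Cmd.colG : Cmd :=
  .forTable 19 18 36 37 (.var 30) (.seq (.set1 13 37 (.const 0))
    (.forLoop 38 (.get 1 (.var 33) (.const 0) (.const 0))
      (.set1 13 37 (.plus (.at1 13 37)
        (.times (.at3 2 37 33 38) (.hess (.var 33) (.var 38) (.var 34)))))))

/-- Loads the work vector with the computed column. -/
def Cmd.loadG : Cmd := .forTable 19 18 36 37 (.var 30) (.set1 11 37 (.at1 13 37))

/-- Changes the factor with the number in variable `35` so that its Gram matrix grows by `σ b bᵀ`,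
by one plane rotation for each column on the path of the vertex in variable `30`. -/
def Cmd.rank1 : Cmd :=
  .forTable 19 18 36 37 (.var 30) (.seq
    (.assignReal 16 (.root (.plus (.times (.at3 7 35 37 37) (.at3 7 35 37 37))
      (.times (.var 14) (.times (.at1 11 37) (.at1 11 37))))))
    (.cond (.rlt (.const 0) (.var 16))
      (.seq (.seq (.assignReal 17 (.divide (.at3 7 35 37 37) (.var 16)))
          (.assignReal 18 (.divide (.at1 11 37) (.var 16))))
        (.forTable 19 18 38 39 (.var 37) (.seq (.assignReal 19 (.at3 7 35 39 37)) (.seq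
          (.set3 7 35 39 37 (.plus (.times (.var 17) (.var 19))
            (.times (.times (.var 14) (.var 18)) (.at1 11 39))))
          (.set1 11 39 (.minus (.times (.var 17) (.at1 11 39)) (.times (.var 18) (.var 19))))))))
      .skip))

theorem pad_fin {α : Type} [Zero α] {k : ℕ} (f : Fin k → α) (i : Fin k) : pad f i = f i := by
  rw [pad, dif_pos i.2]

theorem ConvexData.oracle_apply (P : ConvexData d m) (i : Fin m) (y : ℕ → ℝ)
    (p q : Fin (P.size i)) :
    P.oracle i y p q = invSqrt (hessian (P.φ i) fun k => y k) p q := by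
  rw [ConvexData.oracle, pad_fin, pad_fin, pad_fin]

theorem Runs.colG (tab : Tables Q M) {w : Fin d} {i : Fin m} {k : Fin (P.size i)} {K : ℕ}
    (hK : P.size i ≤ K) {x : P.Point} (hx : ∀ l : Fin (P.size i), M.real 0 i l 0 = x i l)
    (hw : M.nat 30 0 0 0 = w) (hi : M.nat 33 0 0 0 = i) (hk : M.nat 34 0 0 0 = k) :
    Runs P.oracle Cmd.colG M (Q.T.height * (K * 100 + 150)) fun M1 =>
      ∀ u ∈ Q.T.path w, M1.real 13 u 0 0 = P.G x u ⟨i, k⟩ := by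
  refine (forPathMap (Q := Q) (w := w) (B := K * 100 + 70) tab.toPathTables
    (fun R a => R 13 a 0 0) (fun a _ => P.G x a ⟨i, k⟩) (fun _ => True) (by decide) (by decide)
    hw trivial ?_).mono (Nat.mul_le_mul_left _ (by omega)) fun M1 _ h u hu => (h.1 u).1 hu
  intro a M1 haw ha hu _ _
  set f : ℕ → ℝ := pad fun l => P.A a ⟨i, l⟩ * invSqrt (hessian (P.φ i) (x i)) l k with hf
  refine (seq (B₁ := 20) (block fun ha1 => ?_)).le
    (show 20 + (P.size i * (60 + 36) + 31) ≤ _ by nlinarith)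
  rw [Cmd.den_set1, hu, RExp.eval_const, Nat.cast_zero] at ha1 ⊢
  set M2 := M1.setReal 13 a 0 0 0 with hM2
  have hn : M2.nat = M1.nat := rfl
  refine (forCount (n := P.size i) (B := 60) (fun j M3 => (fun e : Fin d => M3.real 13 e 0 0) =
    Function.update (fun e : Fin d => M1.real 13 e 0 0) a (∑ l ∈ Finset.range j, f l))
    (by decide) (by decide) (fun M3 ha3 => ?_) ?_ (fun j M3 hj ha3 hj₃ hI => ?_)).mono le_rfl
    fun M3 ha3 h => ⟨?_, trivial⟩
  · rw [eval_get, ha3.nat 1, hn, ha.nat 1, eval_var,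
      ha3.nat 33, hn, ha.nat 33, hi]
    exact tab.size i
  · rw [Finset.range_zero, Finset.sum_empty]
    exact M1.vec_setReal 13 a 0
  · have h37 : M3.nat 37 0 0 0 = (a : ℕ) := ha3.nat_eq hu
    have h33 : M3.nat 33 0 0 0 = (i : ℕ) := by
      rw [ha3.nat 33, hn, ha.nat 33]; exact hi
    have h34 : M3.nat 34 0 0 0 = (k : ℕ) := by
      rw [ha3.nat 34, hn, ha.nat 34]; exact hk
    have h2 : M3.real 2 a i j = P.A a ⟨i, ⟨j, hj⟩⟩ := by
      rw [ha3.real 2, ha1.real 2, ha.real 2]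
      exact tab.A a i ⟨j, hj⟩
    have h0 : (fun l : Fin (P.size i) => M3.real 0 i l 0) = x i := by
      funext l
      rw [ha3.real 0, ha1.real 0, ha.real 0]
      exact hx l
    have hf' : f j = P.A a ⟨i, ⟨j, hj⟩⟩ * invSqrt (hessian (P.φ i) (x i)) ⟨j, hj⟩ k :=
      pad_fin _ ⟨j, hj⟩
    have h13 : M3.real 13 a 0 0 = ∑ l ∈ Finset.range j, f l := by
      have := congrFun hI a
      rwa [Function.update_self] at this
    refine block ?_
    rw [Cmd.den_set1, h37, RExp.eval_plus, RExp.eval_times, RExp.eval_at1, RExp.eval_at3,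
      RExp.eval_hess, eval_var, eval_var, eval_var, h37, h33, h34, hj₃, h2, h13]
    have ho := P.oracle_apply i (fun l => M3.real 0 i l 0) ⟨j, hj⟩ k
    rw [h0] at ho
    simp only at ho
    rw [ho, ← hf', ← Finset.sum_range_succ]
    refine (M3.vec_setReal 13 a _).trans ?_
    have hI' : (M3.vec 13 : Fin d → ℝ) = Function.update (fun e : Fin d => M1.real 13 e 0 0) a
      (∑ l ∈ Finset.range j, f l) := hI
    rw [hI', Function.update_idem]
  · refine Eq.trans h ?_
    congr 1
    rw [P.G_apply, Finset.sum_range]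
    refine Finset.sum_congr rfl fun l _ => pad_fin _ l

theorem Runs.loadG (tab : PathTables Q M) {w : Fin d} (hw : M.nat 30 0 0 0 = w) {g : Fin d → ℝ}
    (hg : ∀ u ∈ Q.T.path w, M.real 13 u 0 0 = g u) (hg₀ : ∀ u ∉ Q.T.path w, g u = 0)
    (hb : (M.vec 11 : Fin d → ℝ) = 0) :
    Runs O Cmd.loadG M (Q.T.height * 150) fun M1 => (M1.vec 11 : Fin d → ℝ) = g := by
  refine (forPathMap (Q := Q) (w := w) (B := 60) tab
    (fun R a => R 11 a 0 0) (fun a _ => g a) (fun _ => True) (by decide) (by decide)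
    hw trivial ?_).mono (Nat.mul_le_mul_left _ (by omega)) fun M1 _ h => ?_
  · intro a M1 haw ha hu _ _
    refine block ⟨?_, trivial⟩
    rw [Cmd.den_set1, RExp.eval_at1, hu, ha.real 13, hg a haw]
    exact M1.vec_setReal 11 a _
  · funext u
    by_cases hu : u ∈ Q.T.path w
    · exact (h.1 u).1 hu
    · rw [hg₀ u hu]
      exact ((h.1 u).2 hu).trans (congrFun hb u)

/-- The pivots do not vanish for `σ = -1` because the target is positive definite; for `σ = 1` a column
with a vanishing pivot needs no rotation. -/
theorem Runs.rank1 (hT : Q.T.Increasing) (tab : PathTables Q M) {w : Fin d} {n : ℕ} {σ : ℝ}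
    (hw : M.nat 30 0 0 0 = w) (hn : M.nat 35 0 0 0 = n) (hσ : M.real 14 0 0 0 = σ)
    {L S : Matrix (Fin d) (Fin d) ℝ} {b : Fin d → ℝ} (hL : M.mat 7 n = L) (hb : M.vec 11 = b)
    (hLp : PathSupported Q.T L) (hL₀ : ∀ i, 0 ≤ L i i) (hbw : ∀ a ∉ Q.T.path w, b a = 0)
    (hS : ∀ a e, (L * Lᵀ) a e + σ * (b a * b e) = S a e)
    (hpos : σ = 1 ∨ σ = -1 ∧ S.PosDef) :
    Runs O Cmd.rank1 M (Q.T.height * (Q.T.height * 300 + 300)) fun M1 =>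
      PathSupported Q.T (M1.mat 7 n) ∧ (∀ i : Fin d, 0 ≤ M1.real 7 n i i) ∧
      (M1.mat 7 n : Matrix (Fin d) (Fin d) ℝ) * (M1.mat 7 n)ᵀ = S ∧
      (M1.vec 11 : Fin d → ℝ) = 0 ∧ ∀ v ≠ n, M1.real 7 v = M.real 7 v := by
  refine (forPath (B := Q.T.height * 200 + 200) tab (fun k M1 =>
    ∃ (L₁ : Matrix (Fin d) (Fin d) ℝ) (b₁ : Fin d → ℝ), M1.mat 7 n = L₁ ∧ M1.vec 11 = b₁ ∧
      PathSupported Q.T L₁ ∧ (∀ i, 0 ≤ L₁ i i) ∧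
      (∀ a, b₁ a ≠ 0 → a ∈ Q.T.path w ∧ Q.T.depth a + k ≤ Q.T.depth w) ∧
      (∀ a e, (L₁ * L₁ᵀ) a e + σ * (b₁ a * b₁ e) = S a e) ∧
      ∀ v ≠ n, M1.real 7 v = M.real 7 v) (by decide) (by decide) hw
    ⟨L, b, hL, hb, hLp, hL₀, fun a h => ?_, hS, fun _ _ => rfl⟩
    (fun k M1 hk ha hu hI => ?_)).mono (Nat.mul_le_mul_left _ (by omega)) (fun M1 _ h => ?_)
  · have : a ∈ Q.T.path w := not_not.1 fun h' => h (hbw a h')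
    exact ⟨this, by simpa using ParentTree.depth_le_of_mem_path this⟩
  · set u := Q.T.parent^[k] w with hu'
    have huw : u ∈ Q.T.path w := Q.T.iterate_mem_path w k
    have hdu : Q.T.depth u + k = Q.T.depth w := by
      have := Q.T.depth_iterate w k hk
      rw [← hu'] at this
      omega
    obtain ⟨L₁, b₁, hL₁, hb₁, hp, h0, hbs, hg, hother⟩ := hI
    have hLc : ∀ a e : Fin d, M1.real 7 n a e = L₁ a e := fun a e => by rw [← hL₁]; rfl
    have hbc : ∀ a : Fin d, M1.real 11 a 0 0 = b₁ a := fun a => by rw [← hb₁]; rfl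
    have hbu : ∀ a ∉ Q.T.path u, b₁ a = 0 := by
      intro a hau
      by_contra h
      obtain ⟨h₁, h₂⟩ := hbs a h
      rcases ParentTree.path_chain h₁ huw with h₃ | h₃
      · exact hau h₃
      · have := ParentTree.eq_of_mem_path_of_depth_le h₃ (by omega)
        rw [this] at hau
        exact hau (Q.T.mem_path_self a)
    have hstep : ∀ a, a ≠ u → (a ∈ Q.T.path w ∧ Q.T.depth a + k ≤ Q.T.depth w) →
        a ∈ Q.T.path w ∧ Q.T.depth a + (k + 1) ≤ Q.T.depth w := by
      rintro a hau ⟨h₁, h₂⟩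
      have : Q.T.depth a ≠ Q.T.depth u := fun h' =>
        hau (ParentTree.eq_of_mem_path_of_depth_eq h₁ huw h')
      exact ⟨h₁, by omega⟩
    set X := L₁ u u * L₁ u u + σ * (b₁ u * b₁ u) with hX
    have hX₀ : 0 ≤ X ∧ (X = 0 → b₁ u = 0) := by
      rcases hpos with rfl | ⟨rfl, hpd⟩
      · have h₁ := mul_self_nonneg (L₁ u u)
        have h₂ := mul_self_nonneg (b₁ u)
        refine ⟨by rw [hX]; linarith, fun h => ?_⟩
        have : b₁ u * b₁ u = 0 := by rw [hX] at h; linarith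
        exact mul_self_eq_zero.1 this
      · have := hp.pivot_pos hT h0 hbu (by
          convert hpd using 1
          ext a e
          rw [← hg a e, Matrix.sub_apply, Matrix.vecMulVec_apply]
          ring)
        have h₁ : 0 < X := by rw [hX]; linarith
        exact ⟨h₁.le, fun h => absurd h h₁.ne'⟩
    have h35 : M1.nat 35 0 0 0 = n := ha.nat_eq hn
    have h14 : M1.real 14 0 0 0 = σ := ha.real_eq hσ
    refine (seq (B₁ := 60) (block fun ha1 => ?_)).le
      (show 60 + (Q.T.height * 200 + 140) ≤ _ by omega)
    rw [Cmd.den_assignReal, RExp.eval_root, RExp.eval_plus, RExp.eval_times, RExp.eval_times,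
      RExp.eval_times, RExp.eval_at3, RExp.eval_at1, RExp.eval_var, h35, hu, h14, hLc, hbc,
      ← hX] at ha1 ⊢
    set R := Real.sqrt X with hR
    have hRR : R * R = X := Real.mul_self_sqrt hX₀.1
    by_cases hR₀ : 0 < R
    · refine (cond_true (B := Q.T.height * 200 + 100) (by simpa using hR₀) ?_).le
        (by simp only [BExp.cost, RExp.cost, RExp.var, NExp.cost]; omega)
      refine (seq (B₁ := 100) (block fun ha2 => ?_)).le (Nat.add_comm _ _).le
      have e16 : (M1.setReal 16 0 0 0 R).real 16 0 0 0 = R := by simp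
      have e7 : (M1.setReal 16 0 0 0 R).real 7 = M1.real 7 := Mem.setReal_real_ne _
      have e11 : (M1.setReal 16 0 0 0 R).real 11 = M1.real 11 :=
        Mem.setReal_real_ne _
      have e₁ : ((M1.setReal 16 0 0 0 R).setReal 17 0 0 0 (L₁ u u / R)).real 16 0 0 0 = R := by
        simp
      have e₂ : ((M1.setReal 16 0 0 0 R).setReal 17 0 0 0 (L₁ u u / R)).real 11 = M1.real 11 := by
        simp
      simp only [Cmd.den_seq, Cmd.den_assignReal, RExp.eval_divide, RExp.eval_at3, RExp.eval_at1,
        RExp.eval_var, Mem.setReal_nat, h35, hu, e16, e7, hLc, e₁, e₂, hbc] at ha2 ⊢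
      set M2 := ((M1.setReal 16 0 0 0 R).setReal 17 0 0 0 (L₁ u u / R)).setReal 18 0 0 0
        (b₁ u / R) with hM2
      have f7 : M2.real 7 = M1.real 7 := by simp [hM2]
      have f11 : M2.real 11 = M1.real 11 := by simp [hM2]
      have f14 : M2.real 14 = M1.real 14 := by simp [hM2]
      have f17 : M2.real 17 0 0 0 = L₁ u u / R := by simp [hM2]
      have f18 : M2.real 18 0 0 0 = b₁ u / R := by simp [hM2]
      have fn : M2.nat = M1.nat := rfl
      refine (forPathMap (Q := Q) (w := u) (B := 100)
        (((tab.of_agree ha).of_agree ha1).of_agree ha2)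
        (fun R a => (R 7 n a u, R 11 a 0 0))
        (fun a y => (L₁ u u / R * y.1 + σ * (b₁ u / R) * y.2, L₁ u u / R * y.2 - b₁ u / R * y.1))
        (fun R => ∀ v₁ a₁ u₁ : ℕ, (v₁ ≠ n ∨ u₁ ≠ (u : ℕ)) → R 7 v₁ a₁ u₁ = M1.real 7 v₁ a₁ u₁)
        (by decide) (by decide) hu (fun _ _ _ _ => by rw [f7]) ?_).mono
        (Nat.mul_le_mul_left _ (by omega)) fun M3 ha3 h => ?_
      · intro a M3 hau ha3 ha' _ hK
        have g37 : M3.nat 37 0 0 0 = (u : ℕ) := ha3.nat_eq hu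
        have g35 : M3.nat 35 0 0 0 = n := ha3.nat_eq h35
        have g14 : M3.real 14 0 0 0 = σ := by rw [ha3.real 14, f14]; exact h14
        have g17 : M3.real 17 0 0 0 = L₁ u u / R := ha3.real_eq f17
        have g18 : M3.real 18 0 0 0 = b₁ u / R := ha3.real_eq f18
        refine block ⟨?_, ?_⟩
        · simp only [Cmd.den_seq, Cmd.den_assignReal, Cmd.den_set1, Cmd.den_set3, RExp.eval_at3,
            RExp.eval_at1, RExp.eval_plus, RExp.eval_minus, RExp.eval_times, RExp.eval_var,
            Mem.setReal_nat, g35, ha', g37]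
          funext e
          by_cases he : e = a
          · subst he
            simp [g14, g17, g18]
          · have : (e : ℕ) ≠ a := fun h => he (Fin.ext h)
            simp [he, this]
        · intro v₁ a₁ u₁ hne
          rw [← hK v₁ a₁ u₁ hne]
          simp only [Cmd.den_seq, Cmd.den_assignReal, Cmd.den_set1, Cmd.den_set3, RExp.eval_at3,
            RExp.eval_at1, RExp.eval_plus, RExp.eval_minus, RExp.eval_times, RExp.eval_var,
            Mem.setReal_nat, g35, ha', g37]
          rw [Mem.setReal_real_ne _, Mem.setReal_real_self, if_neg,
            Mem.setReal_real_ne _]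
          rintro ⟨h, -, h'⟩
          exact hne.elim (fun h₁ => h₁ h) fun h₁ => h₁ h'
      · rw [f7, f11] at h
        have hpair : ∀ a : Fin d, M3.real 7 n a u = L₁ u u / R * L₁ a u + σ * (b₁ u / R) * b₁ a ∧
            M3.real 11 a 0 0 = L₁ u u / R * b₁ a - b₁ u / R * L₁ a u := by
          intro a
          by_cases hau : a ∈ Q.T.path u
          · have h₁ := (h.1 a).1 hau
            rw [hLc, hbc] at h₁
            exact Prod.ext_iff.1 h₁
          · have h₁ := (h.1 a).2 hau
            rw [hLc, hbc] at h₁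
            have h₂ := Prod.ext_iff.1 h₁
            simp only at h₂
            rw [h₂.1, h₂.2, hp.eq_zero hau, hbu a hau]
            simp
        set col : Fin d → ℝ := fun i => L₁ u u / R * L₁ i u + σ * (b₁ u / R) * b₁ i with hcol
        have hrot := gram_rotate (L := L₁) (u := u) (b := b₁) (σ := σ) (R := R)
          (hRR.trans hX) hR₀.ne'
        refine ⟨L₁.updateCol u col, fun a => L₁ u u / R * b₁ a - b₁ u / R * L₁ a u, ?_, ?_,
          hp.updateCol fun a hau => ?_, fun i => ?_, fun a hne => ?_, fun a e => ?_, fun v hv => ?_⟩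
        · ext a e
          by_cases he : e = u
          · rw [he, Matrix.updateCol_self]
            exact (hpair a).1
          · rw [Matrix.updateCol_ne he, ← hLc]
            exact h.2 n a e (Or.inr fun h => he (Fin.ext h))
        · funext a
          exact (hpair a).2
        · simp only [hcol]
          rw [hp.eq_zero hau, hbu a hau]
          simp
        · by_cases hi : i = u
          · rw [hi, Matrix.updateCol_self]
            have : col u = R := by
              simp only [hcol]
              rw [div_mul_eq_mul_div, mul_div_assoc', div_mul_eq_mul_div, ← add_div,
                div_eq_iff hR₀.ne', hRR, hX]
              ring
            rw [this]
            exact hR₀.le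
          · rw [Matrix.updateCol_ne hi]
            exact h0 i
        · have hau : a ≠ u := by
            rintro rfl
            apply hne
            simp only
            ring
          refine hstep a hau ?_
          by_cases hba : b₁ a = 0
          · have hp' : a ∈ Q.T.path u := not_not.1 fun h' => hne (by
              simp only
              rw [hba, hp.eq_zero h', mul_zero, mul_zero, sub_zero])
            have := ParentTree.depth_le_of_mem_path hp'
            exact ⟨ParentTree.path_trans hp' huw, by omega⟩
          · exact hbs a hba
        · rw [← hg a e]
          exact hrot a e
        · rw [← hother v hv]
          funext a e
          exact h.2 v a e (Or.inl hv)
    · refine (cond_false (B := 1) (by simpa using hR₀) (block ?_)).le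
        (by simp only [BExp.cost, RExp.cost, RExp.var, NExp.cost]; omega)
      have hR' : R = 0 := le_antisymm (not_lt.1 hR₀) (Real.sqrt_nonneg _)
      have hbu₀ : b₁ u = 0 := hX₀.2 (by rw [← hRR, hR', mul_zero])
      refine ⟨L₁, b₁, ?_, ?_, hp, h0, fun a h => hstep a ?_ (hbs a h), hg, ?_⟩
      · rw [← hL₁]
        exact Mem.mat_congr (by simp)
      · rw [← hb₁]
        exact Mem.vec_congr (by simp)
      · rintro rfl
        exact h hbu₀
      · simpa using hother
  · obtain ⟨L₁, b₁, rfl, hb₁, hp, h0, hbs, hg, hother⟩ := h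
    have hzero : b₁ = 0 := by
      funext a
      by_contra h'
      have := (hbs a h').2
      have := Q.T.depth_pos a
      omega
    refine ⟨hp, h0, ?_, hb₁.trans hzero, hother⟩
    ext a e
    have := hg a e
    rw [hzero] at this
    simpa using this

/-- Changes the current factor by the columns of `A H_x ^ (-1/2)` of the block in variable `33`,
which are added or removed according to the sign in the real variable `14`. -/
def Cmd.cholTerm : Cmd :=
  .seq (.assign 30 (.get 16 (.var 33) (.const 0) (.const 0)))
    (.seq (.assign 35 (.get 0 (.const 3) (.const 0) (.const 0)))
      (.forLoop 34 (.get 1 (.var 33) (.const 0) (.const 0)) (.seq .colG (.seq .loadG .rank1))))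

/-- Adds a multiple of the computed column to row `q` of `J_v`. -/
def Cmd.addJ : Cmd :=
  .forTable 19 18 36 37 (.var 30)
    (.set3 8 31 32 37 (.plus (.at3 8 31 32 37) (.times (.var 15) (.at1 13 37))))

/-- Adds the term of the computed column to `J_v`, and corrects `Z_v` and `y_v` if `v` is a node of
the upper tree. -/
def Cmd.addCol : Cmd :=
  .forLoop 32 (.get 0 (.const 2) (.const 0) (.const 0))
    (.seq (.assignReal 15 (.times (.var 14) (.at3 3 32 33 34))) (.seq .addJ
      (.cond (.nlt (.const 0) (.get 11 (.var 31) (.const 0) (.const 0)))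
        (.seq .loadG (.seq (.assign 35 (.var 31)) .correctRow)) .skip)))

/-- Adds or removes the terms of the block in variable `33` at all nodes above its coordinates. -/
def Cmd.blockTerm : Cmd :=
  .seq (.assign 30 (.get 16 (.var 33) (.const 0) (.const 0)))
    (.forLoop 34 (.get 1 (.var 33) (.const 0) (.const 0)) (.seq .colG
      (.forTable 21 20 40 31 (.get 5 (.var 33) (.var 34) (.const 0)) .addCol)))

theorem posDef_of_add_sum {S : Matrix (Fin d) (Fin d) ℝ} (hS : S.PosDef) {ι : Type} (s : Finset ι)
    (g : ι → Fin d → ℝ) : (S + ∑ l ∈ s, Matrix.vecMulVec (g l) (g l)).PosDef :=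
  hS.add_posSemidef (Matrix.posSemidef_sum s fun l _ => by
    simpa using Matrix.posSemidef_vecMulVec_self_star (g l))

theorem Runs.cholTerm (hT : P.IsEliminationTree Q.T) (tab : Tables Q M) {i : Fin m} {K : ℕ}
    (hK : P.size i ≤ K) {x : P.Point} (hx : ∀ l : Fin (P.size i), M.real 0 i l 0 = x i l) {σ : ℝ}
    (hi : M.nat 33 0 0 0 = i) (hσ : M.real 14 0 0 0 = σ)
    {L S : Matrix (Fin d) (Fin d) ℝ} (hL : M.mat 7 N = L) (hb : (M.vec 11 : Fin d → ℝ) = 0)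
    (hLp : PathSupported Q.T L) (hL₀ : ∀ i, 0 ≤ L i i)
    (hS : L * Lᵀ + σ • ∑ k, Matrix.vecMulVec (fun u => P.G x u ⟨i, k⟩) (fun u => P.G x u ⟨i, k⟩) = S)
    (hpos : σ = 1 ∨ σ = -1 ∧ S.PosDef) :
    Runs P.oracle Cmd.cholTerm M (K * (Q.T.height * (Q.T.height * 300 + K * 100 + 700)) + 100)
      fun M1 =>
      PathSupported Q.T (M1.mat 7 N) ∧ (∀ i : Fin d, 0 ≤ M1.real 7 N i i) ∧
      (M1.mat 7 N : Matrix (Fin d) (Fin d) ℝ) * (M1.mat 7 N)ᵀ = S ∧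
      (M1.vec 11 : Fin d → ℝ) = 0 ∧ ∀ v ≠ N, M1.real 7 v = M.real 7 v := by
  have hτ := Q.T.height_pos
  set w := P.blockLow Q.T i with hw
  set g : ℕ → Fin d → ℝ := pad fun k u => P.G x u ⟨i, k⟩ with hg
  have hgk : ∀ k (hk : k < P.size i), g k = fun u => P.G x u ⟨i, ⟨k, hk⟩⟩ := fun k hk =>
    pad_fin _ ⟨k, hk⟩
  set Sk : ℕ → Matrix (Fin d) (Fin d) ℝ := fun k =>
    L * Lᵀ + σ • ∑ l ∈ Finset.range k, Matrix.vecMulVec (g l) (g l) with hSk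
  have hSn : Sk (P.size i) = S := by
    rw [← hS, hSk]
    simp only
    rw [Finset.sum_range]
    congr 3
    funext k
    rw [hgk k k.2]
  have hsucc : ∀ k a e, Sk k a e + σ * (g k a * g k e) = Sk (k + 1) a e := by
    intro k a e
    simp only [hSk, Finset.sum_range_succ, Matrix.add_apply, Matrix.smul_apply,
      Matrix.vecMulVec_apply, smul_eq_mul]
    ring
  have hposk : ∀ k ≤ P.size i, σ = 1 ∨ σ = -1 ∧ (Sk k).PosDef := by
    intro k hk
    refine hpos.imp id fun h => ⟨h.1, ?_⟩
    have : Sk k = S + ∑ l ∈ Finset.Ico k (P.size i), Matrix.vecMulVec (g l) (g l) := by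
      rw [← hSn]
      simp only [hSk, h.1]
      rw [← Finset.sum_range_add_sum_Ico _ hk, neg_one_smul, neg_one_smul, neg_add]
      abel
    rw [this]
    exact posDef_of_add_sum h.2 _ _
  refine (seq (B₁ := 20) (B₂ := 20 + (K * (Q.T.height * (Q.T.height * 300 + K * 100 + 600) + 36) + 31))
    (block fun ha0 => ?_)).le (by
      have : K * (Q.T.height * (Q.T.height * 300 + K * 100 + 600) + 36) ≤
        K * (Q.T.height * (Q.T.height * 300 + K * 100 + 700)) := Nat.mul_le_mul_left _ (by nlinarith)
      omega)
  rw [Cmd.den_assign, eval_get, eval_var, eval_const, hi, tab.low] at ha0 ⊢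
  refine seq (B₁ := 20) (block fun ha1 => ?_)
  rw [Cmd.den_assign, eval_get, eval_const, eval_const] at ha1 ⊢
  have tab0 := tab.of_agree ha0
  rw [tab0.N_eq] at ha1 ⊢
  set M2 := (M.setNat 30 0 0 0 w).setNat 35 0 0 0 N with hM2
  have tab2 : Tables Q M2 := tab0.of_agree ha1
  have h30 : M2.nat 30 0 0 0 = w := by simp [hM2]
  have h35 : M2.nat 35 0 0 0 = N := by simp [hM2]
  have h33 : M2.nat 33 0 0 0 = i := by simpa [hM2] using hi
  refine (forCount (n := P.size i) (B := Q.T.height * (Q.T.height * 300 + K * 100 + 600))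
    (fun k M3 => PathSupported Q.T (M3.mat 7 N) ∧ (∀ i : Fin d, 0 ≤ M3.real 7 N i i) ∧
      (M3.mat 7 N : Matrix (Fin d) (Fin d) ℝ) * (M3.mat 7 N)ᵀ = Sk k ∧
      (M3.vec 11 : Fin d → ℝ) = 0 ∧ ∀ v ≠ N, M3.real 7 v = M.real 7 v) (by decide) (by decide)
    (fun M3 ha => ?_) ?_ (fun k M3 hk ha hk₁ hI => ?_)).mono
      (Nat.add_le_add_right (Nat.mul_le_mul_right _ hK) _)
      fun M3 _ h => by rwa [hSn] at h
  · rw [eval_get, ha.nat 1, eval_var, ha.nat 33, h33]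
    exact tab2.size i
  · have : (M2.mat 7 N : Matrix (Fin d) (Fin d) ℝ) = L := hL
    refine ⟨by rw [this]; exact hLp, fun i => ?_, ?_, hb, fun _ _ => rfl⟩
    · have h := hL₀ i
      rwa [← hL] at h
    · simp [hSk, this]
  · have tab3 := tab2.of_agree ha
    refine (seq (B₁ := Q.T.height * (K * 100 + 150)) (B₂ := Q.T.height * 150 + Q.T.height *
      (Q.T.height * 300 + 300)) ((Runs.colG tab3 (w := w) (i := i) (k := ⟨k, hk⟩) hK (x := x)
      (by rw [ha.real 0]; exact hx) (ha.nat_eq h30)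
      (ha.nat_eq h33) hk₁).mono le_rfl
      fun M4 ha4 h₄ _ => ?_)).le (by nlinarith)
    refine seq ((Runs.loadG (w := w) (g := g k) (tab3.toPathTables.of_agree ha4)
      (by rw [ha4.nat 30, ha.nat 30]; exact h30)
      (fun u hu => by rw [hgk k hk]; exact h₄ u hu)
      (fun u hu => by rw [hgk k hk]; exact hT.G_eq_zero x u ⟨i, ⟨k, hk⟩⟩ hu)
      (by rw [Mem.vec_congr (ha4.real 11)]; exact hI.2.2.2.1)).mono le_rfl
      fun M5 ha5 h₅ _ => ?_)
    have e7 : M5.real 7 = M3.real 7 := by rw [ha5.real 7, ha4.real 7]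
    have e7' : (M5.mat 7 N : Matrix (Fin d) (Fin d) ℝ) = M3.mat 7 N := Mem.mat_congr (by rw [e7])
    refine (Runs.rank1 (Q := Q) (w := w) (n := N) (σ := σ) (L := M3.mat 7 N) (S := Sk (k + 1))
      (b := g k) hT.increasing
      ((tab3.toPathTables.of_agree ha4).of_agree ha5)
      (by rw [ha5.nat 30, ha4.nat 30, ha.nat 30]; exact h30)
      (by rw [ha5.nat 35, ha4.nat 35, ha.nat 35]; exact h35)
      (by rw [ha5.real 14, ha4.real 14, ha.real 14]; exact hσ)
      e7' h₅ hI.1 hI.2.1 ?_ ?_ (hposk _ hk)).mono le_rfl fun M6 _ h => ?_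
    · intro a haw
      rw [hgk k hk]
      exact hT.G_eq_zero x a ⟨i, ⟨k, hk⟩⟩ haw
    · intro a e
      rw [hI.2.2.1]
      exact hsucc k a e
    · refine ⟨h.1, h.2.1, h.2.2.1, h.2.2.2.1, fun v hv => ?_⟩
      rw [h.2.2.2.2 v hv, e7, hI.2.2.2.2 v hv]

theorem Runs.addJ (tab : PathTables Q M) {w : Fin d} {v q : ℕ} {f : ℝ} {g : Fin d → ℝ}
    (hw : M.nat 30 0 0 0 = w) (hv : M.nat 31 0 0 0 = v) (hq : M.nat 32 0 0 0 = q)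
    (hf : M.real 15 0 0 0 = f)
    (hg : ∀ u ∈ Q.T.path w, M.real 13 u 0 0 = g u) (hg₀ : ∀ u ∉ Q.T.path w, g u = 0) :
    Runs O Cmd.addJ M (Q.T.height * 150) fun M1 =>
      (M1.row 8 v q : Fin d → ℝ) = M.row 8 v q + f • g ∧
      ∀ v₁ q₁, (v₁ ≠ v ∨ q₁ ≠ q) → M1.real 8 v₁ q₁ = M.real 8 v₁ q₁ := by
  refine (forPathMap (Q := Q) (w := w) (B := 60) tab
    (fun R a => R 8 v q a) (fun a y => y + f * g a)
    (fun R => ∀ v₁ q₁, (v₁ ≠ v ∨ q₁ ≠ q) → R 8 v₁ q₁ = M.real 8 v₁ q₁) (by decide) (by decide)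
    hw (fun _ _ _ => rfl) ?_).mono (Nat.mul_le_mul_left _ (by omega)) fun M1 _ h => ⟨?_, h.2⟩
  · intro a M1 haw ha hu _ hK
    have h31 : M1.nat 31 0 0 0 = v := ha.nat_eq hv
    have h32 : M1.nat 32 0 0 0 = q := ha.nat_eq hq
    refine block ?_
    rw [Cmd.den_set3, RExp.eval_plus, RExp.eval_times, RExp.eval_at1, RExp.eval_at3, RExp.eval_var,
      hu, h31, h32, ha.real 13, ha.real 15, hf, hg a haw]
    exact ⟨M1.row_setReal 8 v q a _, fun v₁ q₁ hne => by
      rw [M1.setReal_other_row 8 8 v q a _ hne, hK v₁ q₁ hne]⟩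
  · funext u
    rw [Pi.add_apply, Pi.smul_apply, smul_eq_mul]
    by_cases hu : u ∈ Q.T.path w
    · exact (h.1 u).1 hu
    · rw [hg₀ u hu, mul_zero, add_zero]
      exact (h.1 u).2 hu

open Classical in
theorem Runs.addCol (tab : Tables Q M) {w : Fin d} {v : Fin N} {i : Fin m} {k : Fin (P.size i)}
    {σ : ℝ} {g : Fin d → ℝ} (hw : M.nat 30 0 0 0 = w) (hv : M.nat 31 0 0 0 = v)
    (hi : M.nat 33 0 0 0 = i) (hk : M.nat 34 0 0 0 = k) (hσ : M.real 14 0 0 0 = σ)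
    (hg : ∀ u ∈ Q.T.path w, M.real 13 u 0 0 = g u) (hg₀ : ∀ u ∉ Q.T.path w, g u = 0)
    (hb : (M.vec 11 : Fin d → ℝ) = 0)
    (hwv : v ∈ Q.S.upper → Q.T.path w ⊆ Q.S.support Q.T v)
    (hrow : v ∈ Q.S.upper → NodeInv Q M v) :
    Runs O Cmd.addCol M (r * (Q.T.height * (Q.T.height * 200 + 1000)) + 31) fun M1 =>
      (M1.vec 11 : Fin d → ℝ) = 0 ∧ (v ∈ Q.S.upper → NodeInv Q M1 v) ∧ SameNodes v M M1 ∧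
      ∀ q : Fin r, (M1.row 8 v q : Fin d → ℝ) = M.row 8 v q + (σ * Q.Φ q ⟨i, k⟩) • g := by
  have hτ := Q.T.height_pos
  refine (forCount (n := r) (B := Q.T.height * (Q.T.height * 200 + 800) + 100)
    (fun j M1 => (M1.vec 11 : Fin d → ℝ) = 0 ∧ (v ∈ Q.S.upper → NodeInv Q M1 v) ∧
      SameNodes v M M1 ∧ ∀ q : Fin r, (M1.row 8 v q : Fin d → ℝ) = M.row 8 v q +
        if (q : ℕ) < j then (σ * Q.Φ q ⟨i, k⟩) • g else 0) (by decide) (by decide)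
    (fun M1 ha => ?_) ⟨hb, hrow, SameNodes.refl _ _, by simp⟩ (fun j M1 hj ha hj₁ hI => ?_)
    (fun j M1 l h => ⟨h.1, fun hv => (h.2.1 hv).congr (fun _ _ => rfl) rfl, h.2.2⟩)).mono
    (Nat.add_le_add_right (Nat.mul_le_mul_left r (by nlinarith)) _)
    fun M1 _ h => ⟨h.1, h.2.1, h.2.2.1, fun q => ?_⟩
  · rw [eval_get, ha.nat 0]
    exact tab.r_eq
  · have tab1 := tab.of_agree ha
    have h31 : M1.nat 31 0 0 0 = v := ha.nat_eq hv
    set f : ℝ := σ * Q.Φ ⟨j, hj⟩ ⟨i, k⟩ with hf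
    refine (seq (B₁ := 40) (B₂ := Q.T.height * 150 + (Q.T.height * 150 + (20 + Q.T.height *
      (Q.T.height * 200 + 500)) + 40)) (block fun ha2 => ?_)).le (by nlinarith)
    have hΦ : M1.real 3 j i k = Q.Φ ⟨j, hj⟩ ⟨i, k⟩ := tab1.Φ ⟨j, hj⟩ i k
    rw [Cmd.den_assignReal, RExp.eval_times, RExp.eval_var, RExp.eval_at3, hj₁,
      ha.nat 33, ha.nat 34, hi, hk, hΦ, ha.real 14, hσ,
      ← hf] at ha2 ⊢
    set M2 := M1.setReal 15 0 0 0 f with hM2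
    have tab2 := tab1.of_agree ha2
    have r₂ : ∀ a, a ≠ 15 → M2.real a = M1.real a := fun a h => Mem.setReal_real_ne _ h
    refine seq (B₁ := Q.T.height * 150) ((Runs.addJ (Q := Q) (w := w) (v := v) (q := j) (f := f) (g := g)
      tab2.toPathTables
      (by rw [hM2, Mem.setReal_nat, ha.nat 30]; exact hw) h31 hj₁
      (by simp [hM2]) (by rw [r₂ 13 (by decide), ha.real 13]; exact hg) hg₀).mono le_rfl
      fun M3 ha3 h₃ _ => ?_)
    have tab3 := tab2.of_agree ha3
    have n₃ : ∀ a, a ≠ 36 → a ≠ 37 → M3.nat a = M1.nat a := fun a h h' => by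
      rw [ha3.nat a (by simp [Cmd.addJ, h, h', Cmd.set3, Cmd.natWrites]), hM2, Mem.setReal_nat]
    have r₃ : ∀ a, a ≠ 8 → a ≠ 15 → M3.real a = M1.real a := fun a h h' => by
      rw [ha3.real a (by simp [Cmd.addJ, h, Cmd.set3, Cmd.realWrites]), r₂ a h']
    have h11 : (M3.vec 11 : Fin d → ℝ) = 0 := by
      rw [Mem.vec_congr (r₃ 11 (by decide) (by decide))]; exact hI.1
    rw [r₂ 8 (by decide)] at h₃
    have h8 : (M3.row 8 v j : Fin d → ℝ) = M1.row 8 v j + f • g := by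
      rw [h₃.1, Mem.row_congr (M := M1) (by rw [r₂ 8 (by decide)])]
    have hs₃ : SameNodes v M1 M3 := by
      rintro a (rfl | rfl | rfl | rfl) v₁ hne
      · rw [r₃ 7 (by decide) (by decide)]
      · funext q₁
        exact h₃.2 v₁ q₁ (Or.inl hne)
      · rw [r₃ 9 (by decide) (by decide)]
      · rw [r₃ 10 (by decide) (by decide)]
    -- Whatever follows does not write to `J`.
    have hJ : ∀ M4 : Mem, M4.real 8 = M3.real 8 → ∀ q : Fin r, (M4.row 8 v q : Fin d → ℝ) =
        M.row 8 v q + if (q : ℕ) < j + 1 then (σ * Q.Φ q ⟨i, k⟩) • g else 0 := by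
      intro M4 h₄ q
      rw [Mem.row_congr (M := M3) (by rw [h₄])]
      by_cases hq : (q : ℕ) = j
      · have hq' : q = ⟨j, hj⟩ := Fin.ext hq
        have := hI.2.2.2 q
        rw [hq, if_neg (lt_irrefl _), add_zero] at this
        rw [hq, h8, if_pos (Nat.lt_succ_self j), this, hf, hq']
      · rw [Mem.row_congr (M := M1) (h₃.2 v q (Or.inr hq)), hI.2.2.2 q]
        congr 1
        have : (q : ℕ) < j + 1 ↔ (q : ℕ) < j := by omega
        simp only [this]
    have hup : (BExp.nlt (.const 0) (.get 11 (.var 31) (.const 0) (.const 0))).eval O M3 ↔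
        v ∈ Q.S.upper := by
      rw [← tab3.upper v, BExp.eval_nlt, eval_get, eval_var,
        n₃ 31 (by decide) (by decide), h31]
      rfl
    by_cases hu : v ∈ Q.S.upper
    · refine (cond_true (B := Q.T.height * 150 + (20 + Q.T.height * (Q.T.height * 200 + 500)))
        (hup.2 hu) ?_).le (by simp only [BExp.cost, NExp.cost, NExp.var]; omega)
      refine seq ((Runs.loadG (Q := Q) (w := w) (g := g) tab3.toPathTables
        (by rw [n₃ 30 (by decide) (by decide), ha.nat 30]; exact hw)
        (by rw [r₃ 13 (by decide) (by decide), ha.real 13]; exact hg) hg₀ h11).mono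
        le_rfl fun M4 ha4 h₄ _ => ?_)
      refine seq (B₁ := 20) (block fun ha5 => ?_)
      have h31₄ : M4.nat 31 0 0 0 = v := by
        rw [ha4.nat 31, n₃ 31 (by decide) (by decide), h31]
      rw [Cmd.den_assign, eval_var, h31₄] at ha5 ⊢
      set M5 := M4.setNat 35 0 0 0 v with hM5
      have tab5 := (tab3.of_agree ha4).of_agree ha5
      have r₅ : ∀ a, a ≠ 8 → a ≠ 15 → a ≠ 11 → M5.real a = M1.real a := fun a h h' h'' => by
        rw [hM5, Mem.setNat_real, ha4.real a (by simp [Cmd.loadG, h'', Cmd.set1, Cmd.realWrites]), r₃ a h h']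
      have e7 : (M5.mat 7 v : Matrix (Fin d) (Fin d) ℝ) = M1.mat 7 v :=
        Mem.mat_congr (by rw [r₅ 7 (by decide) (by decide) (by decide)])
      have e8 : M5.real 8 = M3.real 8 := ha4.real 8
      have hN := hI.2.1 hu
      refine (Runs.correctRow (n := v) (q := j) (v := v) (w := w) (B := M1.mat 7 v)
        (J := M1.row 8 v j) (f := f) tab5 (by
          rw [hM5, Mem.setNat_nat_ne _, ha4.nat 30,
            n₃ 30 (by decide) (by decide), ha.nat 30]; exact hw)
        (by rw [hM5, Mem.setNat_nat_ne _]; exact h31₄)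
        (by rw [hM5, Mem.setNat_nat_ne _, ha4.nat 32,
            n₃ 32 (by decide) (by decide)]; exact hj₁)
        (by simp [hM5]) (by
          rw [hM5, Mem.setNat_real, ha4.real 15, ha3.real 15]
          simp [hM2])
        (by rw [e7]; exact fun u h => hN.good u (hwv hu h)) (by rw [e7]; exact fun _ _ _ => rfl)
        (by rw [show (M5.vec 11 : Fin d → ℝ) = g from h₄]; exact hg₀) (hwv hu)
        ((hN.row ⟨j, hj⟩).congr (by rw [r₅ 9 (by decide) (by decide) (by decide)])
          (by rw [r₅ 10 (by decide) (by decide) (by decide)])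
          (r₅ 1 (by decide) (by decide) (by decide)) (fun _ _ _ => rfl) rfl)).mono le_rfl
        fun M6 ha6 h₆ => ⟨h₆.1, fun _ => ⟨?_, fun q => ?_⟩, ?_, ?_⟩
      · rw [Mem.mat_congr (M := M5) (by rw [ha6.real 7]), e7]
        exact hN.good
      · have e7₆ : (M6.mat 7 v : Matrix (Fin d) (Fin d) ℝ) = M1.mat 7 v := by
          rw [Mem.mat_congr (M := M5) (by rw [ha6.real 7]), e7]
        have e8₆ : M6.real 8 = M3.real 8 := by rw [ha6.real 8, e8]
        by_cases hq : (q : ℕ) = j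
        · rw [hq]
          refine h₆.2.1.congr rfl rfl rfl (by rw [e7₆]; exact fun _ _ _ => rfl) ?_
          rw [Mem.row_congr (M := M3) (by rw [e8₆]), h8]
          exact congrArg (fun z => M1.row 8 v j + f • z) h₄.symm
        · refine (hN.row q).congr ?_ ?_ ?_ (by rw [e7₆]; exact fun _ _ _ => rfl) ?_
          · rw [h₆.2.2 9 (by simp) v q (Or.inr hq), r₅ 9 (by decide) (by decide) (by decide)]
          · rw [h₆.2.2 10 (by simp) v q (Or.inr hq), r₅ 10 (by decide) (by decide) (by decide)]
          · rw [ha6.real 1, r₅ 1 (by decide) (by decide) (by decide)]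
          · exact Mem.row_congr (by rw [e8₆, h₃.2 v q (Or.inr hq)])
      · refine hI.2.2.1.trans (hs₃.trans (SameNodes.trans ?_ (h₆.2.2.sameNodes fun v₁ _ => by
          rw [ha6.real 7])))
        rintro a h v₁ -
        rw [hM5, Mem.setNat_real]
        rcases h with rfl | rfl | rfl | rfl <;> rw [ha4.real _]
      · exact hJ M6 (by rw [ha6.real 8, e8])
    · refine (cond_false (B := 1) (fun h => hu (hup.1 h)) (block ?_)).le
        (by simp only [BExp.cost, NExp.cost, NExp.var]; omega)
      exact ⟨h11, fun h => absurd h hu, hI.2.2.1.trans hs₃, hJ M3 rfl⟩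
  · rw [h.2.2.2 q, if_pos q.2]

/-- The rule for loops along the path of a leaf of the sampling tree. -/
theorem Runs.forLeaf {leaf : Fin N} (hdep : M.nat 21 leaf 0 0 = Q.S.tree.depth leaf)
    (hpath : ∀ k < Q.S.tree.depth leaf, M.nat 20 leaf k 0 = (Q.S.tree.parent^[k] leaf : ℕ))
    {x u : ℕ} {e : NExp} {c : Cmd} {B : ℕ} (I : ℕ → Mem → Prop)
    (hn : 21 ∉ (Cmd.forTable 21 20 x u e c).natWrites ∧
      20 ∉ (Cmd.forTable 21 20 x u e c).natWrites ∧ x ∉ u :: c.natWrites)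
    (hc : e.cost ≤ 12)
    (hw : ∀ M1, Agree (Cmd.forTable 21 20 x u e c) M M1 → e.eval M1 = leaf)
    (h0 : I 0 M)
    (hs : ∀ k M1, k < Q.S.tree.depth leaf → Agree (Cmd.forTable 21 20 x u e c) M M1 →
      M1.nat u 0 0 0 = (Q.S.tree.parent^[k] leaf : ℕ) → I k M1 → Runs O c M1 B (I (k + 1)))
    (hI : ∀ k M1 l, I k M1 → I k (M1.setNat x 0 0 0 l) := by
      intro k M1 l h
      first
        | exact h
        | simpa using h)
    (hI₁ : ∀ k M1 l, I k M1 → I k (M1.setNat u 0 0 0 l) := by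
      intro k M1 l h
      first
        | exact h
        | simpa using h) :
    Runs O (Cmd.forTable 21 20 x u e c) M (Q.S.tree.height * (B + 100))
      (I (Q.S.tree.depth leaf)) := by
  refine (forTable (W := (leaf : ℕ)) (B := B) I hn hw hdep hpath h0 hs hI hI₁).le ?_
  have h₁ : Q.S.tree.depth leaf ≤ Q.S.tree.height := ParentTree.depth_le_height leaf
  have h₂ := Q.S.tree.height_pos
  have h₃ : Q.S.tree.depth leaf * (B + 2 * e.cost + 40) ≤ Q.S.tree.height * (B + 64) :=
    Nat.mul_le_mul h₁ (by omega)
  have h₅ : Q.S.tree.height * (B + 100) = Q.S.tree.height * (B + 64) + Q.S.tree.height * 36 := by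
    ring
  omega

/-- The effect of a block on the matrices `J_v`. -/
theorem Runs.blockTerm (hT : P.IsEliminationTree Q.T) (hS : Q.S.IsBalanced Q.T) (tab : Tables Q M)
    {i : Fin m} {K : ℕ} (hK : P.size i ≤ K) {x : P.Point}
    (hx : ∀ l : Fin (P.size i), M.real 0 i l 0 = x i l) {σ : ℝ}
    (hi : M.nat 33 0 0 0 = i) (hσ : M.real 14 0 0 0 = σ) (hb : (M.vec 11 : Fin d → ℝ) = 0)
    (hrow : ∀ v ∈ Q.S.upper, NodeInv Q M v) :
    Runs P.oracle Cmd.blockTerm M (K * (Q.T.height * (K * 100 + 150) + 36 + Q.S.tree.height *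
        (r * (Q.T.height * (Q.T.height * 200 + 1000)) + 131)) + 51) fun M1 =>
      (M1.vec 11 : Fin d → ℝ) = 0 ∧ (∀ v ∈ Q.S.upper, NodeInv Q M1 v) ∧
      ∀ (v : Fin N) (q : Fin r) (u : Fin d), M1.real 8 v q u = M.real 8 v q u +
        σ * ∑ k : Fin (P.size i), Q.Φ q ⟨i, k⟩ *
          (Q.S.colLabel v).indicator (fun _ => (1 : ℝ)) ⟨i, k⟩ * P.G x u ⟨i, k⟩ := by
  set w := P.blockLow Q.T i with hw
  set g : Fin N → Fin r → Fin d → ℕ → ℝ := fun v q u => pad fun k => Q.Φ q ⟨i, k⟩ *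
    (Q.S.colLabel v).indicator (fun _ => (1 : ℝ)) ⟨i, k⟩ * P.G x u ⟨i, k⟩ with hg
  set B := Q.T.height * (K * 100 + 150) + Q.S.tree.height *
        (r * (Q.T.height * (Q.T.height * 200 + 1000)) + 131) with hB
  refine (seq (B₁ := 20) (B₂ := P.size i * (B + 36) + 31)
    (block fun ha0 => ?_)).le (by
      have : P.size i * (B + 36) ≤ K * (Q.T.height * (K * 100 + 150) + 36 + Q.S.tree.height *
        (r * (Q.T.height * (Q.T.height * 200 + 1000)) + 131)) :=
        Nat.mul_le_mul hK (by rw [hB]; omega)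
      omega)
  rw [Cmd.den_assign, eval_get, eval_var, eval_const, hi, tab.low] at ha0 ⊢
  set M0 := M.setNat 30 0 0 0 w with hM0
  have tab0 := tab.of_agree ha0
  have h30 : M0.nat 30 0 0 0 = w := by simp [hM0]
  have h33 : M0.nat 33 0 0 0 = i := by simpa [hM0] using hi
  refine (forCount (n := P.size i) (B := B)
    (fun k M1 => (M1.vec 11 : Fin d → ℝ) = 0 ∧ (∀ v ∈ Q.S.upper, NodeInv Q M1 v) ∧
      ∀ (v : Fin N) (q : Fin r) (u : Fin d), M1.real 8 v q u = M.real 8 v q u +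
        σ * ∑ l ∈ Finset.range k, g v q u l) (by decide) (by decide)
    (fun M1 ha => ?_) ?_ (fun k M1 hk ha hk₁ hI => ?_)
    (fun j M1 l h => ⟨h.1, fun v hv => (h.2.1 v hv).congr (fun _ _ => rfl) rfl, h.2.2⟩)).mono
    le_rfl fun M1 _ h => ⟨h.1, h.2.1, fun v q u => ?_⟩
  · rw [eval_get, ha.nat 1, eval_var, ha.nat 33, h33]
    exact tab0.size i
  · refine ⟨hb, fun v hv => (hrow v hv).congr (fun _ _ => rfl) rfl, fun v q u => ?_⟩
    rw [Finset.range_zero, Finset.sum_empty, mul_zero, add_zero]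
    rfl
  · have tab1 := tab0.of_agree ha
    set c : P.Coord := ⟨i, ⟨k, hk⟩⟩ with hc
    refine seq ((Runs.colG tab1 (w := w) (i := i) (k := ⟨k, hk⟩) hK (x := x)
      (by rw [ha.real 0]; exact hx) (ha.nat_eq h30)
      (ha.nat_eq h33) hk₁).mono le_rfl
      fun M2 ha2 h₂ _ => ?_)
    have tab2 := tab1.of_agree ha2
    have n33 : M2.nat 33 0 0 0 = i := by
      rw [ha2.nat 33, ha.nat 33]; exact h33
    have n34 : M2.nat 34 0 0 0 = k := ha2.nat_eq hk₁
    have hgk : ∀ v q u, g v q u k = Q.Φ q c *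
        (Q.S.colLabel v).indicator (fun _ => (1 : ℝ)) c * P.G x u c := fun v q u =>
      pad_fin (fun k : Fin (P.size i) => Q.Φ q ⟨i, k⟩ *
        (Q.S.colLabel v).indicator (fun _ => (1 : ℝ)) ⟨i, k⟩ * P.G x u ⟨i, k⟩) ⟨k, hk⟩
    refine (forLeaf (Q := Q) (leaf := Q.S.colLeaf c)
      (B := r * (Q.T.height * (Q.T.height * 200 + 1000)) + 31) (tab2.depth_col c) (tab2.path_col c)
      (fun j M3 => (M3.vec 11 : Fin d → ℝ) = 0 ∧ (∀ v ∈ Q.S.upper, NodeInv Q M3 v) ∧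
        (∀ v : Fin N, (∃ l < j, Q.S.tree.parent^[l] (Q.S.colLeaf c) = v) → ∀ q : Fin r,
          (M3.row 8 v q : Fin d → ℝ) = M2.row 8 v q + (σ * Q.Φ q c) • fun u => P.G x u c) ∧
        ∀ v : Fin N, (¬ ∃ l < j, Q.S.tree.parent^[l] (Q.S.colLeaf c) = v) →
          M3.real 8 v = M2.real 8 v)
      (by decide) (by decide) (fun M3 ha3 => ?_) ⟨?_, fun v hv => ?_, ?_, fun _ _ => rfl⟩
      (fun j M3 hj ha3 hv hI₃ => ?_)
      (fun j M1 l h => ⟨h.1, fun v hv => (h.2.1 v hv).congr (fun _ _ => rfl) rfl, h.2.2⟩)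
      (fun j M1 l h => ⟨h.1, fun v hv => (h.2.1 v hv).congr (fun _ _ => rfl) rfl, h.2.2⟩)).mono
      le_rfl fun M3 ha3 h => ⟨h.1, h.2.1, fun v q u => ?_⟩
    · rw [eval_get, ha3.nat 5, eval_var, eval_var,
        ha3.nat 33, ha3.nat 34, n33, n34]
      exact tab2.colLeaf i ⟨k, hk⟩
    · rw [Mem.vec_congr (ha2.real 11)]
      exact hI.1
    · refine (hI.2.1 v hv).congr (fun a h => ?_) (ha2.real 1)
      rcases h with rfl | rfl | rfl | rfl <;> rw [ha2.real _]
    · rintro v ⟨l, hl, -⟩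
      omega
    · set v := Q.S.tree.parent^[j] (Q.S.colLeaf c) with hv'
      have hvp : v ∈ Q.S.tree.path (Q.S.colLeaf c) := Q.S.tree.iterate_mem_path _ j
      have tab3 := tab2.of_agree ha3
      refine (Runs.addCol (w := w) (v := v) (i := i) (k := ⟨k, hk⟩) (σ := σ)
        (g := fun u => P.G x u c) tab3
        (by rw [ha3.nat 30, ha2.nat 30, ha.nat 30]; exact h30)
        hv (ha3.nat_eq n33) (ha3.nat_eq n34)
        (by rw [ha3.real 14, ha2.real 14, ha.real 14]; exact hσ)
        (by rw [ha3.real 13]; exact h₂)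
        (fun u hu => hT.G_eq_zero x u c hu) hI₃.1 (fun hu => ?_) (hI₃.2.1 v)).mono le_rfl
        fun M4 ha4 h₄ => ⟨h₄.1, fun v₁ hv₁ => ?_, fun v₁ hv₁ q => ?_, fun v₁ hv₁ => ?_⟩
      · exact TreeData.path_subset_support ⟨w, TreeData.mem_rowLabel.2
          ((hS.upper_mem_path_colLeaf (c := c) hu).1 hvp), Q.T.mem_path_self w⟩
      · by_cases he : v₁ = v
        · rw [he] at hv₁ ⊢
          exact h₄.2.1 hv₁
        · exact (hI₃.2.1 v₁ hv₁).of_sameNodes h₄.2.2.1 (fun h => he (Fin.ext h))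
            (ha4.real 1)
      · by_cases he : v₁ = v
        · have hne := Q.S.tree.not_exists_lt_iterate hj
          rw [he, h₄.2.2.2 q, Mem.row_congr (M := M2) (by rw [hI₃.2.2.2 v hne])]
        · rw [Mem.row_congr (M := M3) (by rw [h₄.2.2.1 8 (by simp) v₁ fun h => he (Fin.ext h)])]
          refine hI₃.2.2.1 v₁ ?_ q
          rw [Q.S.tree.exists_lt_succ_iff] at hv₁
          exact hv₁.resolve_right fun h => he (h.symm.trans hv'.symm)
      · rw [Q.S.tree.exists_lt_succ_iff, not_or] at hv₁
        rw [h₄.2.2.1 8 (by simp) v₁ fun h => hv₁.2 (hv'.symm.trans (Fin.ext h).symm),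
          hI₃.2.2.2 v₁ hv₁.1]
    · rw [Finset.sum_range_succ, hgk, mul_add, ← add_assoc, ← hI.2.2 v q u]
      have e8 : M2.real 8 = M1.real 8 := ha2.real 8
      by_cases hv : v ∈ Q.S.tree.path (Q.S.colLeaf c)
      · have := congrFun (h.2.2.1 v ((Q.S.tree.mem_path_iff).1 hv) q) u
        rw [Set.indicator_of_mem (TreeData.mem_colLabel.2 hv), mul_one]
        refine this.trans ?_
        rw [Pi.add_apply, Pi.smul_apply, smul_eq_mul, ← mul_assoc, Mem.row_congr (M := M1)
          (by rw [e8])]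
        rfl
      · rw [h.2.2.2 v fun h' => hv (Q.S.tree.mem_path_iff.2 h'), e8,
          Set.indicator_of_notMem fun h' => hv (TreeData.mem_colLabel.1 h')]
        simp
  · rw [h.2.2 v q u, Finset.sum_range]
    congr 3
    funext k
    exact pad_fin _ k

/-! ### The memory representation and Query -/

/-- The memory `M` represents the state `D`, apart from `Z` and `y`, which are determined by the
other members. -/
structure Represents (Q : SketchParams P r N) (M : Mem) (D : Sketch P r N) : Prop where
  inv : Q.Inv D
  tables : Tables Q M
  x : ∀ i (k : Fin (P.size i)), M.real 0 i k 0 = D.x i k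
  h : (M.vec 1 : Fin d → ℝ) = D.h
  ℓ : M.nat 24 0 0 0 = D.ℓ
  L : M.mat 7 N = D.L D.ℓ
  J : ∀ (v : Fin N) (q : Fin r), M.row 8 v q = D.J v q
  t : ∀ v ∈ Q.S.upper, M.nat 23 v 0 0 = D.t v
  node : ∀ v ∈ Q.S.upper, NodeInv Q M v
  col : ∀ v ∈ Q.S.upper, ∀ u ∈ Q.S.support Q.T v, ∀ a : Fin d, M.real 7 v a u = D.L (D.t v) a u
  work : (M.vec 11 : Fin d → ℝ) = 0

/-- The cells in which the members of BalancedSketch are kept. -/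
def sketchLayout (d m r N : ℕ) : Layout d m r N where
  x := fun i k => ⟨0, i, k, 0⟩
  h := fun j => ⟨1, j, 0, 0⟩
  ℓ := ⟨24, 0, 0, 0⟩
  L := fun i j => ⟨7, N, i, j⟩
  J := fun v q j => ⟨8, v, q, j⟩
  Z := fun v q j => ⟨9, v, q, j⟩
  y := fun v q => ⟨10, v, q, 0⟩
  t := fun v => ⟨23, v, 0, 0⟩

theorem Matrix.mul_inv_transpose_row {L : Matrix (Fin d) (Fin d) ℝ} (hL : IsUnit L.det)
    {J : Matrix (Fin r) (Fin d) ℝ} {q : Fin r} {z : Fin d → ℝ} (h : L *ᵥ z = J q) :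
    (J * (L⁻¹)ᵀ) q = z := by
  have : z = L⁻¹ *ᵥ J q := by
    rw [← h, Matrix.mulVec_mulVec, Matrix.nonsing_inv_mul L hL, Matrix.one_mulVec]
  rw [this]
  ext a
  simp [Matrix.mulVec, Matrix.mul_apply, dotProduct, mul_comm]

theorem mulVec_congr_columns {B B₁ : Matrix (Fin d) (Fin d) ℝ} {U : Set (Fin d)}
    (hB : ∀ u ∈ U, ∀ a, B a u = B₁ a u) {z : Fin d → ℝ} (hz : ∀ u ∉ U, z u = 0) :
    B *ᵥ z = B₁ *ᵥ z := by
  funext a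
  rw [Matrix.mulVec, Matrix.mulVec, dotProduct, dotProduct]
  refine Finset.sum_congr rfl fun u _ => ?_
  by_cases hu : u ∈ U
  · rw [hB u hu a]
  · rw [hz u hu, mul_zero, mul_zero]

namespace Represents

variable {D : Sketch P r N}

/-- The matrix `Z_v` in memory is the unique solution of `Z L[t_v]ᵀ = J_v`. -/
theorem Z_eq (hT : P.IsEliminationTree Q.T) (h : Represents Q M D) {v : Fin N}
    (hv : v ∈ Q.S.upper) (q : Fin r) : M.row 9 v q = D.Z v q := by
  have hdet := h.inv.isUnit_det hT hv
  have h₁ := ((h.node v hv).row q).eq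
  rw [h.J, mulVec_congr_columns (B := M.mat 7 v) (B₁ := D.L (D.t v)) (h.col v hv) ((h.node v hv).row q).supp] at h₁
  rw [← Matrix.mul_inv_transpose_row hdet h₁,
    ← Matrix.mul_inv_transpose_row hdet (SketchParams.mul_transpose_row (h.inv.Z_eq v hv) q)]

theorem holds (hT : P.IsEliminationTree Q.T) (h : Represents Q M D) :
    (sketchLayout d m r N).Holds Q.S M D where
  x_eq := h.x
  h_eq := fun j => congrFun h.h j
  ℓ_eq := h.ℓ
  L_eq := fun i j => congrFun (congrFun h.L i) j
  J_eq := fun v q j => congrFun (h.J v q) j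
  Z_eq := fun v hv q j => congrFun (h.Z_eq hT hv q) j
  y_eq := fun v hv q => by
    rw [h.inv.y_eq v hv, SketchParams.yDown_apply, ← h.h, ← h.Z_eq hT hv q]
    exact ((h.node v hv).row q).y
  t_eq := h.t

theorem good (hT : P.IsEliminationTree Q.T) (h : Represents Q M D) (U : Set (Fin d)) :
    GoodColumns Q.T U (M.mat 7 N) := by
  have hs := hT.chol_spec h.inv.feasible
  rw [h.L, h.inv.L_eq]
  exact fun u _ => ⟨fun a ha => hs.1.eq_zero ha, (hs.2.1 u).ne'⟩

end Represents

/-- Brings the columns in `Λ` up to date at the node in variable `31`. -/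
def Cmd.refresh : Cmd :=
  .seq (.assign 30 (.get 14 (.var 31) (.const 0) (.const 0))) (.seq .pass
    (.seq (.assign 30 (.get 15 (.var 31) (.const 0) (.const 0))) .pass))

/-- Since `Λ v` is covered by two paths, two passes bring the node `v` up to date. -/
theorem Runs.refresh (tab : Tables Q M) {v : Fin N} (hvu : v ∈ Q.S.upper)
    (hv : M.nat 31 0 0 0 = v) (hL : GoodColumns Q.T Set.univ (M.mat 7 N))
    (hb : (M.vec 11 : Fin d → ℝ) = 0) (hrow : NodeInv Q M v) :
    Runs O Cmd.refresh M ((r + 1) * (Q.T.height * (Q.T.height * 2100 + 2100))) fun M1 =>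
      (M1.vec 11 : Fin d → ℝ) = 0 ∧ NodeInv Q M1 v ∧ SameNodes v M M1 ∧
      ∀ u ∈ Q.S.support Q.T v, (∀ a : Fin d, M1.real 7 v a u = M.real 7 N a u) ∨
        u ∉ Q.S.Lam Q.T v ∧ ∀ a : Fin d, M1.real 7 v a u = M.real 7 v a u := by
  have hτ := Q.T.height_pos
  obtain ⟨j, hj, hj14, l, hl, hl15, hΛ⟩ := tab.first v hvu
  have hsup : ∀ j ∈ Q.S.rowLabel v, Q.T.path j ⊆ Q.S.support Q.T v := fun j hj u hu =>
    ⟨j, hj, hu⟩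
  have hNv : N ≠ v := (v.2).ne'
  refine (seq (B₁ := 20) (B₂ := (r * (Q.T.height * (Q.T.height * 1000 + 1000)) +
    Q.T.height * (Q.T.height * 1000 + 1000)) + (20 + (r * (Q.T.height * (Q.T.height * 1000 + 1000)) +
    Q.T.height * (Q.T.height * 1000 + 1000)))) (block fun ha0 => ?_)).le
    (by generalize Q.T.height = τ at *; nlinarith [Nat.mul_le_mul_left r
          (show τ * (τ * 2000 + 2000) ≤ τ * (τ * 2100 + 2100) by nlinarith)])
  rw [Cmd.den_assign, eval_get, eval_var, eval_const, hv, hj14] at ha0 ⊢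
  set M0 := M.setNat 30 0 0 0 j with hM0
  have tab0 := tab.of_agree ha0
  refine seq ((Runs.pass tab0 (w := j) (v := v) (by simp [hM0]) (by simpa [hM0] using hv)
    (fun u _ => hL u trivial) hb (hsup j hj) (hrow.congr (fun _ _ => rfl) rfl)).mono le_rfl
    fun M1 ha1 h₁ _ => ?_)
  have tab1 := tab0.of_agree ha1
  have h31 : M1.nat 31 0 0 0 = v := by
    rw [ha1.nat 31]
    simpa [hM0] using hv
  refine seq (B₁ := 20) (block fun ha2 => ?_)
  have h15 : M1.nat 15 v 0 0 = l := by
    rw [ha1.nat 15]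
    simpa [hM0] using hl15
  rw [Cmd.den_assign, eval_get, eval_var, eval_const, h31, h15] at ha2 ⊢
  set M2 := M1.setNat 30 0 0 0 l with hM2
  have tab2 := tab1.of_agree ha2
  have e7 : M2.real 7 N = M.real 7 N := h₁.2.2.1 7 (by simp) N hNv
  refine (Runs.pass tab2 (w := l) (v := v) (by simp [hM2]) (by simpa [hM2] using h31)
    (by rw [Mem.mat_congr e7]; exact fun u _ => hL u trivial) h₁.1 (hsup l hl)
    (h₁.2.1.congr (fun _ _ => rfl) rfl)).mono le_rfl
    fun M3 ha3 h₃ => ⟨h₃.1, h₃.2.1, SameNodes.trans h₁.2.2.1 h₃.2.2.1, fun u hu => ?_⟩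
  have c₁ := h₁.2.2.2 u hu
  have c₃ := h₃.2.2.2 u hu
  by_cases hul : u ∈ Q.T.path l
  · left
    intro a
    rw [c₃ a, if_pos hul, e7]
  · by_cases huj : u ∈ Q.T.path j
    · left
      intro a
      rw [c₃ a, if_neg hul]
      refine (c₁ a).trans ?_
      rw [if_pos huj]
      rfl
    · right
      refine ⟨fun h => (hΛ h).elim huj hul, fun a => ?_⟩
      rw [c₃ a, if_neg hul]
      refine (c₁ a).trans ?_
      rw [if_neg huj]
      rfl

/-- Marks the products `Z h` for the columns in `Λ` on a path in the work vector. -/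
def Cmd.loadLam : Cmd :=
  .forTable 19 18 36 37 (.var 30) (.cond .inLam (.set1 11 37 (.times (.at3 9 31 32 37) (.at1 1 37)))
    .skip)

/-- Moves the entries of the work vector on a path to the output. -/
def Cmd.drain : Cmd :=
  .forTable 19 18 36 37 (.var 30) (.seq (.set1 4 32 (.plus (.at1 4 32) (.at1 11 37)))
    (.set1 11 37 (.const 0)))

/-- The output of Query at a node of the upper tree. The work vector prevents that the columns
that lie on both paths are counted twice. -/
def Cmd.outUpper : Cmd :=
  .forLoop 32 (.get 0 (.const 2) (.const 0) (.const 0))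
    (.seq (.set1 4 32 (.get 10 (.var 31) (.var 32) (.const 0)))
      (.seq (.assign 30 (.get 14 (.var 31) (.const 0) (.const 0))) (.seq .loadLam
        (.seq (.assign 30 (.get 15 (.var 31) (.const 0) (.const 0))) (.seq .loadLam
          (.seq .drain (.seq (.assign 30 (.get 14 (.var 31) (.const 0) (.const 0))) .drain)))))))

/-- The output of Query at a node outside the upper tree. -/
def Cmd.outLower : Cmd :=
  .seq (.assign 30 (.get 17 (.var 31) (.const 0) (.const 0)))
    (.seq (.assign 35 (.get 0 (.const 3) (.const 0) (.const 0)))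
      (.forLoop 32 (.get 0 (.const 2) (.const 0) (.const 0))
        (.seq (.forTable 19 18 36 37 (.var 30) (.set1 11 37 (.at3 8 31 32 37)))
          (.seq .solve (.seq (.set1 4 32 (.const 0))
            (.forTable 19 18 36 37 (.var 30)
              (.set1 4 32 (.plus (.at1 4 32) (.times (.at1 12 37) (.at1 1 37))))))))))

/-- The program for Query. At a node of the upper tree the time stamp is renewed as well. -/
def Cmd.queryProg : Cmd :=
  .seq (.assign 31 (.get 7 (.const 0) (.const 0) (.const 0)))
    (.cond (.nlt (.const 0) (.get 11 (.var 31) (.const 0) (.const 0)))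
      (.seq .refresh (.seq (.setNat 23 (.var 31) (.const 0) (.const 0) (.var 24)) .outUpper))
      .outLower)

open Classical in
theorem Runs.loadLam (tab : Tables Q M) {w : Fin d} {v : Fin N} {q : ℕ}
    (hw : M.nat 30 0 0 0 = w) (hv : M.nat 31 0 0 0 = v) (hq : M.nat 32 0 0 0 = q) :
    Runs O Cmd.loadLam M (Q.T.height * 150) fun M1 => ∀ u, (M1.vec 11 : Fin d → ℝ) u =
      if u ∈ Q.T.path w ∧ u ∈ Q.S.Lam Q.T v then M.real 9 v q u * M.real 1 u 0 0
      else M.real 11 u 0 0 := by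
  refine (forPathMap (Q := Q) (w := w) (B := 70) tab.toPathTables
    (fun R a => R 11 a 0 0) (fun u y => if u ∈ Q.S.Lam Q.T v then
      M.real 9 v q u * M.real 1 u 0 0 else y) (fun _ => True) (by decide) (by decide)
    hw trivial ?_).mono (Nat.mul_le_mul_left _ (by omega)) fun M1 _ h u => ?_
  · intro a M1 haw ha hu _ _
    have h31 : M1.nat 31 0 0 0 = v := ha.nat_eq hv
    have h32 : M1.nat 32 0 0 0 = q := ha.nat_eq hq
    have hind := BExp.eval_inLam (O := O) (tab.of_agree ha).toNodeTables
      (v := v) (u := a) h31 hu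
    refine block ⟨?_, trivial⟩
    rw [Cmd.den_cond, Cmd.den_set1, hu, RExp.eval_times, RExp.eval_at3, RExp.eval_at1, h31, h32, hu,
      ha.real 9, ha.real 1, Cmd.den_skip]
    by_cases hL : a ∈ Q.S.Lam Q.T v
    · rw [if_pos (hind.2 hL), if_pos hL]
      exact M1.vec_setReal 11 a _
    · rw [if_neg fun h => hL (hind.1 h), if_neg hL]
      exact (Function.update_eq_self a _).symm
  · by_cases hu : u ∈ Q.T.path w
    · refine ((h.1 u).1 hu).trans ?_
      simp only [hu, true_and]
    · refine ((h.1 u).2 hu).trans ?_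
      rw [if_neg fun h => hu h.1]

theorem Runs.drain (tab : PathTables Q M) {w : Fin d} {q : ℕ}
    (hw : M.nat 30 0 0 0 = w) (hq : M.nat 32 0 0 0 = q) :
    Runs O Cmd.drain M (Q.T.height * 150) fun M1 =>
      M1.real 4 q 0 0 + ∑ u, (M1.vec 11 : Fin d → ℝ) u =
        M.real 4 q 0 0 + ∑ u, (M.vec 11 : Fin d → ℝ) u ∧
      (∀ u, (M1.vec 11 : Fin d → ℝ) u = 0 ∨
        u ∉ Q.T.path w ∧ (M1.vec 11 : Fin d → ℝ) u = M.real 11 u 0 0) ∧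
      ∀ q₁ ≠ q, M1.real 4 q₁ = M.real 4 q₁ := by
  refine (forPathMap (Q := Q) (w := w) (B := 70) tab
    (fun R a => R 11 a 0 0) (fun u y => 0) (fun R =>
      R 4 q 0 0 + ∑ u : Fin d, R 11 u 0 0 = M.real 4 q 0 0 + ∑ u, (M.vec 11 : Fin d → ℝ) u ∧
      ∀ q₁ ≠ q, R 4 q₁ = M.real 4 q₁) (by decide) (by decide)
    hw ⟨rfl, fun _ _ => rfl⟩ ?_).mono (Nat.mul_le_mul_left _ (by omega))
      fun M1 _ h => ⟨h.2.1, fun u => ?_, h.2.2⟩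
  · intro a M1 haw ha hu _ hK
    have h32 : M1.nat 32 0 0 0 = q := ha.nat_eq hq
    have h11 : ∀ c, ((((M1.setReal 4 q 0 0 c).setReal 11 a 0 0 0).vec 11) : Fin d → ℝ) =
        Function.update (M1.vec 11) a 0 := fun c => by
      rw [Mem.vec_setReal, Mem.vec_congr (Mem.setReal_real_ne _)]
    refine block ?_
    simp only [Cmd.den_seq, Cmd.den_set1, h32, RExp.eval_plus, RExp.eval_at1, RExp.eval_const,
      Mem.setReal_nat, hu, Nat.cast_zero]
    refine ⟨h11 _, ?_, fun q₁ hne => ?_⟩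
    · have e : ∑ u : Fin d, ((M1.setReal 4 q 0 0 (M1.real 4 q 0 0 + M1.real 11 a 0 0)).setReal 11 a
          0 0 0).real 11 u 0 0 = ∑ u : Fin d, M1.real 11 u 0 0 - M1.real 11 a 0 0 := by
        have h₁ := fun u => congrFun (h11 (M1.real 4 q 0 0 + M1.real 11 a 0 0)) u
        refine (Finset.sum_congr rfl fun u _ => h₁ u).trans ?_
        rw [Finset.sum_update_of_mem (Finset.mem_univ a), zero_add, eq_sub_iff_add_eq,
          ← Finset.erase_eq]
        exact Finset.sum_erase_add _ (fun u : Fin d => M1.real 11 u 0 0) (Finset.mem_univ a)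
      rw [e, Mem.setReal_real_ne _, Mem.setReal_real_self, if_pos ⟨rfl, rfl, rfl⟩,
        ← hK.1]
      ring
    · rw [Mem.setReal_real_ne _, ← hK.2 q₁ hne]
      funext j k
      rw [Mem.setReal_real_self, if_neg fun h => hne h.1]
  · by_cases hu : u ∈ Q.T.path w
    · exact Or.inl ((h.1 u).1 hu)
    · exact Or.inr ⟨hu, (h.1 u).2 hu⟩

theorem Runs.outUpper (tab : Tables Q M) {v : Fin N} (hvu : v ∈ Q.S.upper)
    (hv : M.nat 31 0 0 0 = v) (hb : (M.vec 11 : Fin d → ℝ) = 0)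
    (hy : ∀ q : Fin r, M.real 10 v q 0 = Q.lamSum v (M.vec 1) (M.row 9 v q)) :
    Runs O Cmd.outUpper M (r * (Q.T.height * 600 + 200) + 31) fun M1 =>
      (M1.vec 11 : Fin d → ℝ) = 0 ∧
      ∀ q : Fin r, M1.real 4 q 0 0 = ∑ u, (M.row 9 v q : Fin d → ℝ) u * (M.vec 1 : Fin d → ℝ) u := by
  obtain ⟨j, -, hj14, l, -, hl15, hΛ⟩ := tab.first v hvu
  refine (forCount (n := r) (B := Q.T.height * 600 + 150) (fun k M1 => (M1.vec 11 : Fin d → ℝ) = 0 ∧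
      ∀ q : Fin r, (q : ℕ) < k → M1.real 4 q 0 0 =
        ∑ u, (M.row 9 v q : Fin d → ℝ) u * (M.vec 1 : Fin d → ℝ) u)
    (by decide) (by decide) (fun M1 ha => ?_) ⟨hb, fun q h => absurd h (Nat.not_lt_zero _)⟩
    (fun k M1 hk ha hk₁ hI => ?_)).mono
    (Nat.add_le_add_right (Nat.mul_le_mul_left r (by omega)) _) fun M1 _ h =>
      ⟨h.1, fun q => h.2 q q.2⟩
  · rw [eval_get, ha.nat 0]
    exact tab.r_eq
  · have h31 : M1.nat 31 0 0 0 = v := ha.nat_eq hv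
    have h14 : M1.nat 14 v 0 0 = j := ha.nat_eq hj14
    have h15 : M1.nat 15 v 0 0 = l := ha.nat_eq hl15
    refine (seq (B₁ := 40) (B₂ := 20 + (Q.T.height * 150 + (20 + (Q.T.height * 150 +
      (Q.T.height * 150 + (20 + Q.T.height * 150)))))) (block fun ha1 => ?_)).le
      (by omega)
    rw [Cmd.den_set1, hk₁, RExp.eval_get, eval_var, eval_var, eval_const, h31,
      hk₁] at ha1 ⊢
    set M2 := M1.setReal 4 k 0 0 (M1.real 10 v k 0) with hM2
    refine seq (B₁ := 20) (block fun ha2 => ?_)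
    rw [Cmd.den_assign, eval_get, eval_var, eval_const, hM2, Mem.setReal_nat, h31,
      h14, ← hM2] at ha2 ⊢
    set M3 := M2.setNat 30 0 0 0 j with hM3
    have tab3 := ((tab.of_agree ha).of_agree ha1
      (by decide)).of_agree ha2
    have n₃ : ∀ a, a ≠ 30 → M3.nat a = M1.nat a := fun a h => Mem.setNat_nat_ne _ h
    have r₃ : ∀ a, a ≠ 4 → M3.real a = M1.real a := fun a h => Mem.setReal_real_ne _ h
    refine seq ((Runs.loadLam tab3 (w := j) (v := v) (q := k) (by simp [hM3])
      (by rw [n₃ 31 (by decide)]; exact h31) (by rw [n₃ 32 (by decide)]; exact hk₁)).mono le_rfl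
      fun M4 ha4 h₄ _ => ?_)
    refine seq (B₁ := 20) (block fun ha5 => ?_)
    rw [Cmd.den_assign, eval_get, eval_var, eval_const, ha4.nat 31,
      n₃ 31 (by decide), h31, ha4.nat 15, n₃ 15 (by decide), h15] at ha5 ⊢
    set M5 := M4.setNat 30 0 0 0 l with hM5
    have tab5 := (tab3.of_agree ha4).of_agree ha5
    have n₅ : ∀ a, a ≠ 30 → a ≠ 36 → a ≠ 37 → M5.nat a = M1.nat a := fun a h h' h'' => by
      rw [hM5, Mem.setNat_nat_ne _ h, ha4.nat a (by simp [Cmd.loadLam, Cmd.set1, h', h'', Cmd.natWrites]), n₃ a h]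
    have r₅ : ∀ a, a ≠ 4 → a ≠ 11 → M5.real a = M1.real a := fun a h h' => by
      rw [hM5, Mem.setNat_real, ha4.real a (by simp [Cmd.loadLam, Cmd.set1, h', Cmd.realWrites]), r₃ a h]
    refine seq ((Runs.loadLam tab5 (w := l) (v := v) (q := k) (by simp [hM5])
      (by rw [n₅ 31 (by decide) (by decide) (by decide)]; exact h31)
      (by rw [n₅ 32 (by decide) (by decide) (by decide)]; exact hk₁)).mono le_rfl
      fun M6 ha6 h₆ _ => ?_)
    have tab6 := tab5.of_agree ha6
    have n32₆ : M6.nat 32 0 0 0 = k := by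
      rw [ha6.nat 32, n₅ 32 (by decide) (by decide) (by decide)]
      exact hk₁
    have h4₆ : M6.real 4 = M2.real 4 := by
      rw [ha6.real 4, hM5, Mem.setNat_real, ha4.real 4, hM3,
        Mem.setNat_real]
    -- The work vector now holds the products of the columns in `Λ`.
    have h11 : ∀ u, (M6.vec 11 : Fin d → ℝ) u = (Q.S.Lam Q.T v).indicator
        (fun u => (M.row 9 v k : Fin d → ℝ) u * (M.vec 1 : Fin d → ℝ) u) u := by
      intro u
      have h9 : M1.real 9 = M.real 9 := ha.real 9
      have h1 : M1.real 1 = M.real 1 := ha.real 1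
      have h0 : M3.real 11 u 0 0 = 0 := by rw [r₃ 11 (by decide)]; exact congrFun hI.1 u
      have e₅ : M5.real 11 u 0 0 = (M4.vec 11 : Fin d → ℝ) u := rfl
      rw [h₆, e₅, h₄, r₅ 9 (by decide) (by decide), r₅ 1 (by decide) (by decide),
        r₃ 9 (by decide), r₃ 1 (by decide), h9, h1, h0]
      by_cases hu : u ∈ Q.S.Lam Q.T v
      · rw [Set.indicator_of_mem hu]
        by_cases hul : u ∈ Q.T.path l
        · rw [if_pos ⟨hul, hu⟩]
          rfl
        · rw [if_neg fun h => hul h.1, if_pos ⟨(hΛ hu).resolve_right hul, hu⟩]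
          rfl
      · rw [Set.indicator_of_notMem hu, if_neg fun h => hu h.2, if_neg fun h => hu h.2]
    refine seq ((Runs.drain tab6.toPathTables (w := l) (q := k)
      (by rw [ha6.nat 30]; simp [hM5]) n32₆).mono le_rfl fun M7 ha7 h₇ _ => ?_)
    refine seq (B₁ := 20) (block fun ha8 => ?_)
    have h31₇ : M7.nat 31 0 0 0 = v := by
      rw [ha7.nat 31, ha6.nat 31, n₅ 31 (by decide) (by decide) (by decide)]
      exact h31
    have h14₇ : M7.nat 14 v 0 0 = j := by
      rw [ha7.nat 14, ha6.nat 14, n₅ 14 (by decide) (by decide) (by decide)]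
      exact h14
    rw [Cmd.den_assign, eval_get, eval_var, eval_const, h31₇, h14₇] at ha8 ⊢
    set M8 := M7.setNat 30 0 0 0 j with hM8
    refine (Runs.drain ((tab6.of_agree ha7).of_agree ha8
      (by decide)).toPathTables (w := j) (q := k) (by simp [hM8])
      (by rw [hM8, Mem.setNat_nat_ne _, ha7.nat 32]; exact n32₆)).mono le_rfl
      fun M9 ha9 h₉ => ?_
    have h0 : (M9.vec 11 : Fin d → ℝ) = 0 := by
      funext u
      rcases h₉.2.1 u with h | ⟨huj, h⟩
      · exact h
      · rw [h]
        rcases h₇.2.1 u with h' | ⟨hul, h'⟩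
        · exact h'
        · refine h'.trans ((h11 u).trans (Set.indicator_of_notMem (fun hu => ?_) _))
          exact (hΛ hu).elim huj hul
    refine ⟨h0, fun q hq => ?_⟩
    by_cases hqk : (q : ℕ) = k
    · have hs : M9.real 4 k 0 0 = M6.real 4 k 0 0 + ∑ u, (M6.vec 11 : Fin d → ℝ) u := by
        rw [← h₇.1]
        refine Eq.trans ?_ h₉.1
        rw [h0]
        simp
      have h4 : M6.real 4 k 0 0 = Q.lamSum v (M.vec 1) (M.row 9 v k) := by
        rw [h4₆, hM2, Mem.setReal_real_self, if_pos ⟨rfl, rfl, rfl⟩, ha.real 10]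
        have := hy q
        rwa [hqk] at this
      rw [hqk, hs, h4, SketchParams.lamSum, ← Finset.sum_add_distrib]
      refine Finset.sum_congr rfl fun u _ => ?_
      rw [h11]
      by_cases hu : u ∈ Q.S.Lam Q.T v
      · rw [Set.indicator_of_mem hu, Set.indicator_of_mem hu]
        ring
      · rw [Set.indicator_of_notMem hu, Set.indicator_of_notMem hu]
        ring
    · rw [h₉.2.2 q hqk, hM8, Mem.setNat_real, h₇.2.2 q hqk, h4₆, ← hI.2 q (by omega), hM2,
        Mem.setReal_real_self, if_neg fun h => hqk h.1]

theorem Runs.outLower (tab : Tables Q M) {v : Fin N} {w : Fin d}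
    (hv : M.nat 31 0 0 0 = v) (hw : M.nat 17 v 0 0 = w) (hb : (M.vec 11 : Fin d → ℝ) = 0)
    (hL : GoodColumns Q.T (Q.T.path w) (M.mat 7 N))
    (hJ : ∀ q : Fin r, ∀ u ∉ Q.T.path w, (M.row 8 v q : Fin d → ℝ) u = 0) :
    Runs O Cmd.outLower M (r * (Q.T.height * (Q.T.height * 200 + 600) + 100) + 100) fun M1 =>
      (M1.vec 11 : Fin d → ℝ) = 0 ∧ ∀ q : Fin r, ∃ z : Fin d → ℝ,
        (M.mat 7 N : Matrix (Fin d) (Fin d) ℝ) *ᵥ z = M.row 8 v q ∧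
        M1.real 4 q 0 0 = ∑ u, z u * (M.vec 1 : Fin d → ℝ) u := by
  refine (seq (B₁ := 20) (B₂ := 20 + (r * (Q.T.height * (Q.T.height * 200 + 600) + 100) + 31))
    (block fun ha0 => ?_)).le (by omega)
  rw [Cmd.den_assign, eval_get, eval_var, eval_const, hv, hw] at ha0 ⊢
  refine seq (B₁ := 20) (block fun ha1 => ?_)
  have tab0 := tab.of_agree ha0
  rw [Cmd.den_assign, eval_get, eval_const, eval_const, tab0.N_eq] at ha1 ⊢
  set M2 := (M.setNat 30 0 0 0 w).setNat 35 0 0 0 N with hM2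
  have tab2 := tab0.of_agree ha1
  have h30 : M2.nat 30 0 0 0 = w := by simp [hM2]
  have h35 : M2.nat 35 0 0 0 = N := by simp [hM2]
  have h31 : M2.nat 31 0 0 0 = v := by simpa [hM2] using hv
  refine (forCount (n := r) (B := Q.T.height * (Q.T.height * 200 + 600) + 50)
    (fun k M1 => (M1.vec 11 : Fin d → ℝ) = 0 ∧ ∀ q : Fin r, (q : ℕ) < k → ∃ z : Fin d → ℝ,
        (M.mat 7 N : Matrix (Fin d) (Fin d) ℝ) *ᵥ z = M.row 8 v q ∧
        M1.real 4 q 0 0 = ∑ u, z u * (M.vec 1 : Fin d → ℝ) u)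
    (by decide) (by decide) (fun M1 ha => ?_) ?_
    (fun k M1 hk ha hk₁ hI => ?_)).mono
    (Nat.add_le_add_right (Nat.mul_le_mul_left r (by omega)) _) fun M1 _ h =>
      ⟨h.1, fun q => h.2 q q.2⟩
  · rw [eval_get, ha.nat 0]
    exact tab2.r_eq
  · exact ⟨hb, fun q h => absurd h (Nat.not_lt_zero _)⟩
  · have tab3 := tab2.of_agree ha
    have g30 : M1.nat 30 0 0 0 = w := ha.nat_eq h30
    have g31 : M1.nat 31 0 0 0 = v := ha.nat_eq h31
    have g35 : M1.nat 35 0 0 0 = N := ha.nat_eq h35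
    have e7 : M1.real 7 = M.real 7 := ha.real 7
    have e8 : M1.real 8 = M.real 8 := ha.real 8
    have e1 : M1.real 1 = M.real 1 := ha.real 1
    refine (seq (B₁ := Q.T.height * 132) (B₂ := Q.T.height * (Q.T.height * 200 + 200) + (20 +
      Q.T.height * 132)) ((forPathMap (Q := Q) (w := w) (B := 60) tab3.toPathTables
      (fun R a => R 11 a 0 0) (fun u _ => M.real 8 v k u) (fun _ => True) (by decide) (by decide)
      g30 trivial fun a M2 haw ha2 hu _ _ => ?_).mono le_rfl fun M2 ha2 h₂ _ => ?_)).le (by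
        have : Q.T.height * (Q.T.height * 200 + 600) =
          Q.T.height * (Q.T.height * 200 + 200) + Q.T.height * 400 := by ring
        omega)
    · have f31 : M2.nat 31 0 0 0 = v := ha2.nat_eq g31
      have f32 : M2.nat 32 0 0 0 = k := ha2.nat_eq hk₁
      refine block ⟨?_, trivial⟩
      rw [Cmd.den_set1, RExp.eval_at3, hu, f31, f32, ha2.real 8, e8]
      exact M2.vec_setReal 11 a _
    · have h11 : (M2.vec 11 : Fin d → ℝ) = M.row 8 v k := by
        funext u
        by_cases hu : u ∈ Q.T.path w
        · exact (h₂.1 u).1 hu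
        · exact ((h₂.1 u).2 hu).trans ((congrFun hI.1 u).trans (hJ ⟨k, hk⟩ u hu).symm)
      have e7₂ : (M2.mat 7 N : Matrix (Fin d) (Fin d) ℝ) = M.mat 7 N :=
        Mem.mat_congr (by rw [ha2.real 7, e7])
      have tab4 := tab3.toPathTables.of_agree ha2
      refine seq ((Runs.solve tab4 (w := w) (n := N) (ha2.nat_eq g30)
        (ha2.nat_eq g35) (by rw [e7₂]; exact hL)
        (by rw [h11]; exact hJ ⟨k, hk⟩)).mono le_rfl fun M3 ha3 ⟨h₃, z, hz₀, hz, hz₁⟩ _ => ?_)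
      have tab5 := tab4.of_agree ha3
      have k32 : M3.nat 32 0 0 0 = k := by
        rw [ha3.nat 32, ha2.nat 32]; exact hk₁
      refine seq (B₁ := 20) (block fun ha4 => ?_)
      rw [Cmd.den_set1, k32, RExp.eval_const, Nat.cast_zero] at ha4 ⊢
      set M4 := M3.setReal 4 k 0 0 0 with hM4
      refine (forPath (Q := Q) (w := w) (B := 60) (tab5.of_agree ha4) (fun j M5 =>
        M5.real 4 k 0 0 = ∑ u, Q.T.cut w j z u * (M.vec 1 : Fin d → ℝ) u ∧
        ∀ q ≠ k, M5.real 4 q = M3.real 4 q) (by decide) (by decide)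
        (by rw [hM4, Mem.setReal_nat, ha3.nat 30, ha2.nat 30]; exact g30)
        ⟨by rw [ParentTree.cut_zero]; simp [hM4], fun q hq => ?_⟩
        fun j M5 hj ha5 hu hI₅ => ?_).mono le_rfl fun M5 ha5 h₅ => ⟨?_, fun q hq => ?_⟩
      · funext a b
        rw [hM4, Mem.setReal_real_self, if_neg fun h => hq h.1]
      · set u := Q.T.parent^[j] w with hu'
        have hc := Q.T.cut_succ_update hj z (z u)
        rw [← hu', Function.update_eq_self] at hc
        have i32 : M5.nat 32 0 0 0 = k := ha5.nat_eq k32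
        have i12 : M5.real 12 u 0 0 = z u := by
          rw [ha5.real 12, hM4, Mem.setReal_real_ne _]
          exact hz₁ u (Q.T.iterate_mem_path w j)
        have i1 : M5.real 1 u 0 0 = (M.vec 1 : Fin d → ℝ) u := by
          rw [ha5.real 1, ha4.real 1, ha3.real 1,
            ha2.real 1, e1]
          rfl
        refine block ?_
        rw [Cmd.den_set1, RExp.eval_plus, RExp.eval_times, RExp.eval_at1, RExp.eval_at1,
          RExp.eval_at1, i32, hu, i12, i1, hI₅.1]
        refine ⟨?_, fun q hq => ?_⟩
        · rw [Mem.setReal_real_self, if_pos ⟨rfl, rfl, rfl⟩, hc]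
          simp only [Pi.add_apply, add_mul, Finset.sum_add_distrib]
          congr 1
          rw [Finset.sum_eq_single u]
          · rw [Pi.single_eq_same]
          · intro a _ ha
            rw [Pi.single_eq_of_ne ha, zero_mul]
          · intro h
            exact absurd (Finset.mem_univ u) h
        · rw [← hI₅.2 q hq]
          funext a b
          rw [Mem.setReal_real_self, if_neg fun h => hq h.1]
      · rw [Mem.vec_congr (ha5.real 11), Mem.vec_congr (ha4.real 11), h₃]
      · by_cases hqk : (q : ℕ) = k
        · refine ⟨z, ?_, ?_⟩
          · rw [← e7₂, hz, h11, hqk]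
          · rw [hqk, h₅.1, ParentTree.cut_depth _ hz₀]
        · obtain ⟨z', hz', hz''⟩ := hI.2 q (by omega)
          refine ⟨z', hz', ?_⟩
          rw [h₅.2 q hqk, ha3.real 4, ha2.real 4, hz'']

theorem Represents.congr {D : Sketch P r N} {M1 : Mem} (h : Represents Q M D)
    (hn : ∀ a ∈ [0, 1, 4, 5, 11, 12, 13, 14, 15, 16, 17, 18, 19, 20, 21, 23, 24],
      M1.nat a = M.nat a)
    (hr : ∀ a ∈ [0, 1, 2, 3, 7, 8, 9, 10], M1.real a = M.real a)
    (hw : (M1.vec 11 : Fin d → ℝ) = 0) : Represents Q M1 D where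
  inv := h.inv
  tables := h.tables.congr (fun a ha => hn a (by revert a; decide)) fun a ha =>
    hr a (by revert a; decide)
  x := by rw [hr 0 (by decide)]; exact h.x
  h := by rw [Mem.vec_congr (hr 1 (by decide))]; exact h.h
  ℓ := by rw [hn 24 (by decide)]; exact h.ℓ
  L := by rw [Mem.mat_congr (M := M) (by rw [hr 7 (by decide)])]; exact h.L
  J := fun v q => by rw [Mem.row_congr (M := M) (by rw [hr 8 (by decide)])]; exact h.J v q
  t := by rw [hn 23 (by decide)]; exact h.t
  node := fun v hv => (h.node v hv).congr
    (fun a ha => by rcases ha with rfl | rfl | rfl | rfl <;> rw [hr _ (by decide)])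
    (hr 1 (by decide))
  col := by rw [hr 7 (by decide)]; exact h.col
  work := hw

theorem Runs.query (hT : P.IsEliminationTree Q.T) (hS : Q.S.IsBalanced Q.T) {D : Sketch P r N}
    (h : Represents Q M D) (v : Fin N) :
    Runs O Cmd.queryProg (M.passQuery v) ((r + 1) * (Q.T.height * (Q.T.height * 4000 + 4000)))
      fun M1 => M1.output = Q.sketchAt D.x D.h v ∧ Represents Q M1 (Q.query v D).2 := by
  have hτ := Q.T.height_pos
  have h₀ : Represents Q (M.passQuery v) D := h.congr (fun a ha => by
    refine Function.update_of_ne ?_ _ _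
    rintro rfl
    revert ha
    decide) (fun a _ => rfl) h.work
  have h7 : (M.passQuery v).nat 7 0 0 0 = v := by simp [Mem.passQuery]
  refine (seq (B₁ := 20) (B₂ := 40 + ((r + 1) * (Q.T.height * (Q.T.height * 2100 + 2100)) + (60 +
    (r * (Q.T.height * (Q.T.height * 200 + 600) + 200) + 100))))
    (block fun ha0 => ?_)).le (by
      generalize Q.T.height = τ at *
      have h₁ : r * (τ * (τ * 200 + 600) + 200) ≤ r * (τ * (τ * 1000 + 1000)) :=
        Nat.mul_le_mul_left _ (by nlinarith)
      nlinarith [Nat.zero_le (r * τ), Nat.zero_le (r * (τ * τ)), Nat.zero_le (τ * τ)])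
  rw [Cmd.den_assign, eval_get, eval_const, h7] at ha0 ⊢
  set M0 := (M.passQuery v).setNat 31 0 0 0 v with hM0
  have r₀ : Represents Q M0 D := h₀.congr (fun a ha => Mem.setNat_nat_ne _ (by
    rintro rfl
    revert ha
    decide)) (fun a _ => rfl) h.work
  have h31 : M0.nat 31 0 0 0 = v := by simp [hM0]
  have hup : (BExp.nlt (.const 0) (.get 11 (.var 31) (.const 0) (.const 0))).eval O M0 ↔
      v ∈ Q.S.upper := by
    rw [← r₀.tables.upper v, BExp.eval_nlt, eval_get, eval_var, h31]
    rfl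
  have hdet := h.inv.isUnit_det_L hT
  have houtput : ∀ (M1 : Mem), (∀ q : Fin r, ∃ z : Fin d → ℝ, D.L D.ℓ *ᵥ z = D.J v q ∧
      M1.real 4 q 0 0 = ∑ u, z u * D.h u) → M1.output = Q.sketchAt D.x D.h v := by
    intro M1 h₁
    funext q
    obtain ⟨z, hz, hz₁⟩ := h₁ q
    rw [h.inv.sketchAt_eq v, Matrix.mulVec, Matrix.mul_inv_transpose_row hdet hz]
    exact hz₁
  by_cases hu : v ∈ Q.S.upper
  · refine (cond_true (B := (r + 1) * (Q.T.height * (Q.T.height * 2100 + 2100)) + (60 +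
      (r * (Q.T.height * 600 + 200) + 31))) (hup.2 hu) ?_).le ?_
    swap
    · have : r * (Q.T.height * 600 + 200) ≤ r * (Q.T.height * (Q.T.height * 200 + 600) + 200) :=
        Nat.mul_le_mul_left _ (by nlinarith)
      simp only [BExp.cost, NExp.cost, NExp.var]
      omega
    refine seq ((Runs.refresh r₀.tables hu h31 (r₀.good hT _) r₀.work (r₀.node v hu)).mono le_rfl
      fun M1 ha1 ⟨hw₁, hn₁, hs₁, hc₁⟩ _ => ?_)
    have tab1 := r₀.tables.of_agree ha1
    have h31₁ : M1.nat 31 0 0 0 = v := ha1.nat_eq h31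
    have h24₁ : M1.nat 24 0 0 0 = D.ℓ := by rw [ha1.nat 24]; exact r₀.ℓ
    refine seq (B₁ := 60) (block fun ha2 => ?_)
    rw [Cmd.den_setNat, eval_var, eval_var, eval_const, h31₁, h24₁] at ha2 ⊢
    set M2 := M1.setNat 23 v 0 0 D.ℓ with hM2
    have tab2 := tab1.of_agree ha2
    have hcol : ∀ u ∈ Q.S.support Q.T v, ∀ a : Fin d, M2.real 7 v a u = D.L D.ℓ a u := by
      intro u hu' a
      rcases hc₁ u hu' with h₁ | ⟨h₁, h₂⟩
      · refine (h₁ a).trans ?_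
        rw [← r₀.L]
        rfl
      · refine (h₂ a).trans ?_
        rw [r₀.col v hu u hu' a]
        refine h.inv.col v hu u ?_ a
        by_contra h₃
        exact h₁ (TreeData.mem_Lam.2 ⟨hu', h₃⟩)
    have hJ₂ : ∀ q : Fin r, M2.row 8 v q = D.J v q := fun q => by
      rw [← r₀.J v q]
      exact Mem.row_congr (by rw [hM2, Mem.setNat_real, ha1.real 8])
    have h1₂ : (M2.vec 1 : Fin d → ℝ) = D.h := by
      rw [← r₀.h]
      exact Mem.vec_congr (ha1.real 1)
    refine (Runs.outUpper tab2 hu (by simpa [hM2] using h31₁) hw₁ fun q => (hn₁.row q).y).mono le_rfl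
      fun M3 ha3 ⟨hw₃, ho₃⟩ => ⟨houtput M3 fun q => ⟨M2.row 9 v q, ?_, ?_⟩, ?_⟩
    · have := (hn₁.row q).eq
      rw [mulVec_congr_columns (B := M1.mat 7 v) (B₁ := D.L D.ℓ) hcol (hn₁.row q).supp] at this
      exact this.trans (hJ₂ q)
    · rw [ho₃, h1₂]
    · have hD : (Q.query v D).2 =
          { D with
            Z := Function.update D.Z v (SketchParams.correct (D.L D.ℓ)
              ((D.L D.ℓ - D.L (D.t v)) * coordProj (Q.S.Lam Q.T v)) (D.Z v))
            y := Function.update D.y v (Q.yDown v (SketchParams.correct (D.L D.ℓ)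
              ((D.L D.ℓ - D.L (D.t v)) * coordProj (Q.S.Lam Q.T v)) (D.Z v)) D.h)
            t := Function.update D.t v D.ℓ } := by
        rw [SketchParams.query, if_pos hu]
      have hinv := h.inv.query hT hS v
      rw [hD] at hinv ⊢
      have n₃ : ∀ a ∈ [0, 1, 4, 5, 11, 12, 13, 14, 15, 16, 17, 18, 19, 20, 21, 23, 24],
          M3.nat a = M2.nat a := fun a ha => ha3.nat a (by revert a; decide)
      have r₃ : ∀ a ∈ [0, 1, 2, 3, 7, 8, 9, 10], M3.real a = M1.real a := fun a ha => by
        rw [ha3.real a (by revert a; decide)]; rfl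
      have e7 : M3.real 7 = M1.real 7 := r₃ 7 (by decide)
      refine ⟨hinv, tab2.of_agree ha3, ?_, ?_, ?_, ?_, ?_, ?_, ?_, ?_, hw₃⟩
      · rw [r₃ 0 (by decide), ha1.real 0]
        exact r₀.x
      · rw [Mem.vec_congr (ha3.real 1)]
        exact h1₂
      · rw [n₃ 24 (by decide)]
        simpa [hM2] using h24₁
      · rw [Mem.mat_congr (M := M0) (by rw [e7, hs₁ 7 (by simp) N (v.2).ne'])]
        exact r₀.L
      · intro v₁ q
        rw [Mem.row_congr (M := M0) (by rw [r₃ 8 (by decide), ha1.real 8])]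
        exact r₀.J v₁ q
      · intro v₁ hv₁
        rw [n₃ 23 (by decide)]
        by_cases he : v₁ = v
        · subst he
          simp [hM2]
        · have : (v₁ : ℕ) ≠ v := fun h => he (Fin.ext h)
          simp only [Function.update_of_ne he]
          rw [hM2, Mem.setNat_nat_self, if_neg fun h => this h.1, ha1.nat 23]
          exact r₀.t v₁ hv₁
      · intro v₁ hv₁
        refine NodeInv.congr (M := M1) ?_ (fun a ha => ?_) (r₃ 1 (by decide))
        · by_cases he : v₁ = v
          · exact he ▸ hn₁
          · exact (r₀.node v₁ hv₁).of_sameNodes hs₁ (fun h => he (Fin.ext h))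
              (ha1.real 1)
        · rcases ha with rfl | rfl | rfl | rfl <;> rw [r₃ _ (by decide)]
      · intro v₁ hv₁ u hu' a
        rw [e7]
        by_cases he : v₁ = v
        · subst he
          simp only [Function.update_self]
          exact hcol u hu' a
        · simp only [Function.update_of_ne he]
          rw [hs₁ 7 (by simp) v₁ fun h => he (Fin.ext h)]
          exact r₀.col v₁ hv₁ u hu' a
  · obtain ⟨w, hw17, hw⟩ := r₀.tables.hang v hu
    refine (cond_false (B := r * (Q.T.height * (Q.T.height * 200 + 600) + 100) + 100)
      (fun h => hu (hup.1 h)) ((Runs.outLower r₀.tables h31 hw17 r₀.work (r₀.good hT _)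
        fun q u hu' => ?_).mono le_rfl fun M1 ha1 ⟨hw₁, ho₁⟩ => ⟨houtput M1 fun q => ?_, ?_⟩)).le ?_
    · rw [r₀.J, h.inv.J_eq, SketchParams.jMatrix_apply]
      refine Finset.sum_eq_zero fun c _ => ?_
      by_cases hc : c ∈ Q.S.colLabel v
      · rw [hT.G_eq_zero D.x u c (by rw [hw c hc]; exact hu'), mul_zero]
      · rw [Set.indicator_of_notMem hc, mul_zero, zero_mul]
    · have : r * (Q.T.height * (Q.T.height * 200 + 600) + 100) ≤
          r * (Q.T.height * (Q.T.height * 200 + 600) + 200) := Nat.mul_le_mul_left _ (by omega)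
      simp only [BExp.cost, NExp.cost, NExp.var]
      omega
    · obtain ⟨z, hz, hz₁⟩ := ho₁ q
      refine ⟨z, ?_, ?_⟩
      · rw [← r₀.L, hz, r₀.J]
      · rw [hz₁, r₀.h]
    · have hD : (Q.query v D).2 = D := by rw [SketchParams.query, if_neg hu]
      rw [hD]
      exact r₀.congr (fun a ha => ha1.nat a (by revert a; decide))
        (fun a ha => ha1.real a (by revert a; decide)) hw₁

/-! ### Update: a block of `x` -/

/-- Exchanges the block of `x` in variable `33` with the argument in position `41`. -/
def Cmd.swap : Cmd :=
  .forLoop 34 (.get 1 (.var 33) (.const 0) (.const 0))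
    (.seq (.assignReal 19 (.get 0 (.var 33) (.var 34) (.const 0)))
      (.seq (.setReal 0 (.var 33) (.var 34) (.const 0) (.get 5 (.var 41) (.var 34) (.const 0)))
        (.setReal 5 (.var 41) (.var 34) (.const 0) (.var 19))))

/-- Replaces a block of `x` and changes the matrices `J_v` accordingly. -/
def Cmd.changeJ : Cmd :=
  .seq (.assignReal 14 (.minus (.const 0) (.const 1))) (.seq .blockTerm (.seq .swap
    (.seq (.assignReal 14 (.const 1)) .blockTerm)))

/-- Changes the current Cholesky factor after a block of `x` has been replaced. The new columns are
added first, so that the Gram matrix stays positive definite. -/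
def Cmd.changeL : Cmd :=
  .seq .cholTerm (.seq .swap (.seq (.assignReal 14 (.minus (.const 0) (.const 1)))
    (.seq .cholTerm .swap)))

/-- Brings the columns on the path of the row in variable `42` up to date at all nodes at which they
are kept so. -/
def Cmd.walk : Cmd :=
  .forTable 21 20 40 31 (.get 4 (.var 42) (.const 0) (.const 0))
    (.cond (.neg (.nlt (.get 12 (.var 31) (.var 42) (.const 0))
        (.get 13 (.var 42) (.const 0) (.const 0))))
      (.seq .refresh (.seq (.assign 30 (.var 42)) (.seq .pass
        (.setNat 23 (.var 31) (.const 0) (.const 0) (.var 24)))))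
      .skip)

/-- The loop body of Update for the block in position `41` of the list of changed blocks. -/
def Cmd.updBlock : Cmd :=
  .seq (.assign 33 (.get 9 (.var 41) (.const 0) (.const 0))) (.seq .changeJ (.seq .changeL
    (.seq (.seq (.assign 24 (.plus (.var 24) (.const 1)))
      (.assign 42 (.get 16 (.var 33) (.const 0) (.const 0)))) .walk)))

/-- The real array `0` holds the point `x`. -/
def HoldsPoint (M : Mem) (x : P.Point) : Prop := ∀ i (k : Fin (P.size i)), M.real 0 i k 0 = x i k

theorem Runs.swap (tab : InputTables Q M) {x : P.Point} (hx : HoldsPoint M x) {i : Fin m} {s K : ℕ}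
    (hK : P.size i ≤ K) (hi : M.nat 33 0 0 0 = i) (hs : M.nat 41 0 0 0 = s)
    {xi : Fin (P.size i) → ℝ} (hxi : ∀ k, M.real 5 s (k : Fin (P.size i)) 0 = xi k) :
    Runs O Cmd.swap M (K * 100 + 31) fun M1 => HoldsPoint M1 (Function.update x i xi) ∧
      (∀ k : Fin (P.size i), M1.real 5 s k 0 = x i k) ∧ ∀ s₁ ≠ s, M1.real 5 s₁ = M.real 5 s₁ := by
  refine (forCount (n := P.size i) (B := 60) (fun j M1 =>
    (∀ k : Fin (P.size i), (k : ℕ) < j → M1.real 0 i k 0 = xi k ∧ M1.real 5 s k 0 = x i k) ∧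
    (∀ k, j ≤ k → M1.real 0 i k = M.real 0 i k ∧ M1.real 5 s k = M.real 5 s k) ∧
    (∀ i₁ ≠ (i : ℕ), M1.real 0 i₁ = M.real 0 i₁) ∧ ∀ s₁ ≠ s, M1.real 5 s₁ = M.real 5 s₁)
    (by decide) (by decide) (fun M1 ha => ?_) ⟨fun k h => absurd h (Nat.not_lt_zero _),
      fun _ _ => ⟨rfl, rfl⟩, fun _ _ => rfl, fun _ _ => rfl⟩ (fun j M1 hj ha hj₁ hI => ?_)).mono
    (by omega) fun M1 _ h => ⟨fun i₁ k => ?_, fun k => (h.1 k k.2).2, h.2.2.2⟩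
  · rw [eval_get, ha.nat 1, eval_var, ha.nat 33, hi]
    exact tab.size i
  · have h33 : M1.nat 33 0 0 0 = i := ha.nat_eq hi
    have h41 : M1.nat 41 0 0 0 = s := ha.nat_eq hs
    have h0 : M1.real 0 i j 0 = x i ⟨j, hj⟩ := by
      rw [(hI.2.1 j le_rfl).1]; exact hx i ⟨j, hj⟩
    have h5 : M1.real 5 s j 0 = xi ⟨j, hj⟩ := by
      rw [(hI.2.1 j le_rfl).2]; exact hxi ⟨j, hj⟩
    refine block ?_
    have e₁ : (M1.setReal 19 0 0 0 (x i ⟨j, hj⟩)).real 5 s j 0 = xi ⟨j, hj⟩ := by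
      rw [Mem.setReal_real_ne _, h5]
    have e₂ : ∀ c, ((M1.setReal 19 0 0 0 (x i ⟨j, hj⟩)).setReal 0 i j 0 c).real 19 0 0 0 =
        x i ⟨j, hj⟩ := fun c => by simp
    simp only [Cmd.den_seq, Cmd.den_assignReal, Cmd.den_setReal, RExp.eval_get, RExp.eval_var,
      eval_var, eval_const, Mem.setReal_nat, h33, h41, hj₁, h0, e₁, e₂]
    have g0 : ∀ a b c, (((M1.setReal 19 0 0 0 (x i ⟨j, hj⟩)).setReal 0 i j 0
        (xi ⟨j, hj⟩)).setReal 5 s j 0 (x i ⟨j, hj⟩)).real 0 a b c =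
        if a = i ∧ b = j ∧ c = 0 then xi ⟨j, hj⟩ else M1.real 0 a b c := fun a b c => by
      rw [Mem.setReal_real_ne _, Mem.setReal_real_self,
        Mem.setReal_real_ne _]
    have g5 : ∀ a b c, (((M1.setReal 19 0 0 0 (x i ⟨j, hj⟩)).setReal 0 i j 0
        (xi ⟨j, hj⟩)).setReal 5 s j 0 (x i ⟨j, hj⟩)).real 5 a b c =
        if a = s ∧ b = j ∧ c = 0 then x i ⟨j, hj⟩ else M1.real 5 a b c := fun a b c => by
      rw [Mem.setReal_real_self, Mem.setReal_real_ne _,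
        Mem.setReal_real_ne _]
    refine ⟨fun k hk => ?_, fun k hk => ⟨?_, ?_⟩, fun i₁ hi₁ => ?_, fun s₁ hs₁ => ?_⟩
    · by_cases hkj : (k : ℕ) = j
      · have hk' : k = ⟨j, hj⟩ := Fin.ext hkj
        rw [g0, g5, if_pos ⟨rfl, hkj, rfl⟩, if_pos ⟨rfl, hkj, rfl⟩, hk']
        exact ⟨rfl, rfl⟩
      · rw [g0, g5, if_neg fun h => hkj h.2.1, if_neg fun h => hkj h.2.1]
        exact hI.1 k (by omega)
    · funext c
      rw [g0, if_neg (by omega), (hI.2.1 k (by omega)).1]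
    · funext c
      rw [g5, if_neg (by omega), (hI.2.1 k (by omega)).2]
    · funext b c
      rw [g0, if_neg fun h => hi₁ h.1, hI.2.2.1 i₁ hi₁]
    · funext b c
      rw [g5, if_neg fun h => hs₁ h.1, hI.2.2.2 s₁ hs₁]
  · by_cases hii : i₁ = i
    · subst hii
      rw [Function.update_self]
      exact (h.1 k k.2).1
    · rw [Function.update_of_ne hii, h.2.2.1 i₁ fun h => hii (Fin.ext h)]
      exact hx i₁ k

theorem ConvexData.G_congr {x x₁ : P.Point} {i : Fin m} (h : x₁ i = x i) (u : Fin d)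
    (k : Fin (P.size i)) : P.G x₁ u ⟨i, k⟩ = P.G x u ⟨i, k⟩ := by
  rw [P.G_apply, P.G_apply, h]

/-- A sum over all coordinates changes only in the terms of a block that is replaced. -/
theorem sum_coord_update (x : P.Point) (i : Fin m) (xi : Fin (P.size i) → ℝ)
    (f : P.Coord → P.Point → ℝ)
    (hf : ∀ i₁ ≠ i, ∀ k, f ⟨i₁, k⟩ (Function.update x i xi) = f ⟨i₁, k⟩ x) :
    ∑ c, f c (Function.update x i xi) =
      ∑ c, f c x - ∑ k, f ⟨i, k⟩ x + ∑ k, f ⟨i, k⟩ (Function.update x i xi) := by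
  rw [Fintype.sum_sigma, Fintype.sum_sigma, ← Finset.add_sum_erase _ _ (Finset.mem_univ i),
    ← Finset.add_sum_erase _ (fun i => ∑ k, f ⟨i, k⟩ x) (Finset.mem_univ i)]
  have : ∑ i₁ ∈ Finset.univ.erase i, ∑ k, f ⟨i₁, k⟩ (Function.update x i xi) =
      ∑ i₁ ∈ Finset.univ.erase i, ∑ k, f ⟨i₁, k⟩ x :=
    Finset.sum_congr rfl fun i₁ hi₁ => Finset.sum_congr rfl fun k _ =>
      hf i₁ (Finset.ne_of_mem_erase hi₁) k
  rw [this]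
  ring

theorem jMatrix_update (x : P.Point) (i : Fin m) (xi : Fin (P.size i) → ℝ) (v : Fin N) (q : Fin r)
    (u : Fin d) : Q.jMatrix (Function.update x i xi) v q u = Q.jMatrix x v q u
      - ∑ k, Q.Φ q ⟨i, k⟩ * (Q.S.colLabel v).indicator (fun _ => (1 : ℝ)) ⟨i, k⟩ *
        P.G x u ⟨i, k⟩
      + ∑ k, Q.Φ q ⟨i, k⟩ * (Q.S.colLabel v).indicator (fun _ => (1 : ℝ)) ⟨i, k⟩ *
        P.G (Function.update x i xi) u ⟨i, k⟩ := by
  rw [SketchParams.jMatrix_apply, SketchParams.jMatrix_apply]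
  refine sum_coord_update x i xi (fun c y => Q.Φ q c *
    (Q.S.colLabel v).indicator (fun _ => (1 : ℝ)) c * P.G y u c) fun i₁ hi₁ k => ?_
  rw [ConvexData.G_congr (Function.update_of_ne hi₁ _ _)]

theorem gram_update (x : P.Point) (i : Fin m) (xi : Fin (P.size i) → ℝ) (a e : Fin d) :
    (P.G (Function.update x i xi) * (P.G (Function.update x i xi))ᵀ) a e =
      (P.G x * (P.G x)ᵀ) a e - ∑ k, P.G x a ⟨i, k⟩ * P.G x e ⟨i, k⟩
      + ∑ k, P.G (Function.update x i xi) a ⟨i, k⟩ * P.G (Function.update x i xi) e ⟨i, k⟩ := by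
  rw [ConvexData.gram_apply, ConvexData.gram_apply]
  refine sum_coord_update x i xi (fun c y => P.G y a c * P.G y e c) fun i₁ hi₁ k => ?_
  rw [ConvexData.G_congr (Function.update_of_ne hi₁ _ _),
    ConvexData.G_congr (Function.update_of_ne hi₁ _ _)]

theorem HoldsPoint.congr {x : P.Point} {M1 : Mem} (h : HoldsPoint M x) (h0 : M1.real 0 = M.real 0) :
    HoldsPoint M1 x := fun i k => by rw [h0]; exact h i k

/-- The number of steps of `blockTerm` for blocks of size at most `K`. -/
noncomputable def blockCost (Q : SketchParams P r N) (K : ℕ) : ℕ :=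
  K * (Q.T.height * (K * 100 + 150) + 36 + Q.S.tree.height *
    (r * (Q.T.height * (Q.T.height * 200 + 1000)) + 131)) + 51

/-- The number of steps of `cholTerm` for blocks of size at most `K`. -/
noncomputable def cholCost (Q : SketchParams P r N) (K : ℕ) : ℕ :=
  K * (Q.T.height * (Q.T.height * 300 + K * 100 + 700)) + 100

theorem Runs.changeJ (hT : P.IsEliminationTree Q.T) (hS : Q.S.IsBalanced Q.T) (tab : Tables Q M)
    {x : P.Point} (hx : HoldsPoint M x) {i : Fin m} {s K : ℕ}
    (hK : P.size i ≤ K) (hi : M.nat 33 0 0 0 = i) (hs : M.nat 41 0 0 0 = s)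
    {xi : Fin (P.size i) → ℝ} (hxi : ∀ k, M.real 5 s (k : Fin (P.size i)) 0 = xi k)
    (hb : (M.vec 11 : Fin d → ℝ) = 0) (hrow : ∀ v ∈ Q.S.upper, NodeInv Q M v) :
    Runs P.oracle Cmd.changeJ M (2 * blockCost Q K + (K * 100 + 100)) fun M1 =>
      HoldsPoint M1 (Function.update x i xi) ∧ (∀ k : Fin (P.size i), M1.real 5 s k 0 = x i k) ∧
      (∀ s₁ ≠ s, M1.real 5 s₁ = M.real 5 s₁) ∧ (M1.vec 11 : Fin d → ℝ) = 0 ∧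
      (∀ v ∈ Q.S.upper, NodeInv Q M1 v) ∧ M1.real 14 0 0 0 = 1 ∧
      ∀ (v : Fin N) (q : Fin r) (u : Fin d), M1.real 8 v q u = M.real 8 v q u -
        Q.jMatrix x v q u + Q.jMatrix (Function.update x i xi) v q u := by
  refine (seq (B₁ := 20) (B₂ := blockCost Q K + ((K * 100 + 31) + (20 + blockCost Q K)))
    (block fun ha0 => ?_)).le (by omega)
  rw [Cmd.den_assignReal, RExp.eval_minus, RExp.eval_const, RExp.eval_const] at ha0 ⊢
  set M0 := M.setReal 14 0 0 0 (((0 : ℕ) : ℝ) - ((1 : ℕ) : ℝ)) with hM0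
  have tab0 := tab.of_agree ha0
  have hx₀ : HoldsPoint M0 x := hx.congr (ha0.real 0)
  refine seq ((Runs.blockTerm (σ := -1) hT hS tab0 hK (hx₀ i) hi (by simp [hM0])
    (by rw [Mem.vec_congr (ha0.real 11)]; exact hb)
    fun v hv => (hrow v hv).congr (fun a ha => ?_) (ha0.real 1)).mono le_rfl
    fun M1 ha1 ⟨hb₁, hn₁, hJ₁⟩ _ => ?_)
  · rcases ha with rfl | rfl | rfl | rfl <;> rw [ha0.real _]
  have tab1 := tab0.of_agree ha1
  refine seq ((Runs.swap tab1.toInputTables (hx₀.congr (ha1.real 0)) hK (s := s) (xi := xi)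
    (ha1.nat_eq hi) (ha1.nat_eq hs)
    (by rw [ha1.real 5, ha0.real 5]; exact hxi)).mono le_rfl
    fun M2 ha2 ⟨hx₂, hs₂, ho₂⟩ _ => ?_)
  have tab2 := tab1.of_agree ha2
  refine seq (B₁ := 20) (block fun ha3 => ?_)
  rw [Cmd.den_assignReal, RExp.eval_const, Nat.cast_one] at ha3 ⊢
  set M3 := M2.setReal 14 0 0 0 1 with hM3
  have tab3 := tab2.of_agree ha3
  have hx₃ := hx₂.congr (ha3.real 0)
  refine (Runs.blockTerm (σ := 1) hT hS tab3 hK (hx₃ i)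
    (by rw [hM3, Mem.setReal_nat, ha2.nat 33, ha1.nat 33]; exact hi)
    (by simp [hM3])
    (by rw [Mem.vec_congr (ha3.real 11), Mem.vec_congr (ha2.real 11)]
        exact hb₁)
    fun v hv => (hn₁ v hv).congr (fun a ha => ?_) ?_).mono le_rfl
    fun M4 ha4 ⟨hb₄, hn₄, hJ₄⟩ => ⟨hx₃.congr (ha4.real 0), fun k => ?_,
      fun s₁ hs₁ => ?_, hb₄, hn₄, ?_, fun v q u => ?_⟩
  · rcases ha with rfl | rfl | rfl | rfl <;> rw [ha3.real _, ha2.real _]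
  · rw [ha3.real 1, ha2.real 1]
  · rw [ha4.real 5, ha3.real 5, hs₂]
  · rw [ha4.real 5, ha3.real 5, ho₂ s₁ hs₁, ha1.real 5,
      ha0.real 5]
  · rw [ha4.real 14]
    simp [hM3]
  · rw [hJ₄, ha3.real 8, ha2.real 8, hJ₁, ha0.real 8,
      jMatrix_update]
    ring

theorem Runs.changeL (hT : P.IsEliminationTree Q.T) (tab : Tables Q M)
    {x : P.Point} {i : Fin m} {s K : ℕ} {xi : Fin (P.size i) → ℝ} (hfx : P.Feasible x)
    (hfx₁ : P.Feasible (Function.update x i xi))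
    (hx : HoldsPoint M (Function.update x i xi))
    (hK : P.size i ≤ K) (hi : M.nat 33 0 0 0 = i) (hs : M.nat 41 0 0 0 = s)
    (hxi : ∀ k, M.real 5 s (k : Fin (P.size i)) 0 = x i k) (hσ : M.real 14 0 0 0 = 1)
    (hb : (M.vec 11 : Fin d → ℝ) = 0) (hL : M.mat 7 N = P.chol x) :
    Runs P.oracle Cmd.changeL M (2 * cholCost Q K + (K * 200 + 100)) fun M1 =>
      HoldsPoint M1 (Function.update x i xi) ∧ (∀ s₁ ≠ s, M1.real 5 s₁ = M.real 5 s₁) ∧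
      (M1.vec 11 : Fin d → ℝ) = 0 ∧ M1.mat 7 N = P.chol (Function.update x i xi) ∧
      ∀ v ≠ N, M1.real 7 v = M.real 7 v := by
  set x₁ := Function.update x i xi with hx₁
  have hspec := hT.chol_spec hfx
  refine (seq (B₁ := cholCost Q K) (B₂ := (K * 100 + 31) + (20 + (cholCost Q K + (K * 100 + 31))))
    ((Runs.cholTerm (σ := 1) hT tab hK (hx i) hi hσ hL hb hspec.1 (fun i => (hspec.2.1 i).le) rfl
      (Or.inl rfl)).mono le_rfl fun M1 ha1 ⟨hp₁, hd₁, hg₁, hb₁, ho₁⟩ _ => ?_)).le (by omega)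
  have tab1 := tab.of_agree ha1
  refine seq ((Runs.swap tab1.toInputTables (hx.congr (ha1.real 0)) hK (s := s) (xi := x i)
    (ha1.nat_eq hi) (ha1.nat_eq hs)
    (by rw [ha1.real 5]; exact hxi)).mono le_rfl
    fun M2 ha2 ⟨hx₂, hs₂, ho₂⟩ _ => ?_)
  have tab2 := tab1.of_agree ha2
  have hxx : Function.update x₁ i (x i) = x := by
    rw [hx₁, Function.update_idem, Function.update_eq_self]
  rw [hxx] at hx₂
  refine seq (B₁ := 20) (block fun ha3 => ?_)
  rw [Cmd.den_assignReal, RExp.eval_minus, RExp.eval_const, RExp.eval_const] at ha3 ⊢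
  set M3 := M2.setReal 14 0 0 0 (((0 : ℕ) : ℝ) - ((1 : ℕ) : ℝ)) with hM3
  have tab3 := tab2.of_agree ha3
  have hx₃ := hx₂.congr (ha3.real 0)
  have e7 : M3.real 7 = M1.real 7 := by rw [ha3.real 7, ha2.real 7]
  have h33 : M3.nat 33 0 0 0 = i := by
    rw [hM3, Mem.setReal_nat, ha2.nat 33, ha1.nat 33]; exact hi
  refine seq ((Runs.cholTerm (σ := -1) (S := P.G x₁ * (P.G x₁)ᵀ) hT tab3 hK (hx₃ i) h33
    (by simp [hM3]) (L := M1.mat 7 N)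
    (Mem.mat_congr (by rw [e7]))
    (by rw [Mem.vec_congr (ha3.real 11), Mem.vec_congr (ha2.real 11)]
        exact hb₁) hp₁ hd₁ ?_ (Or.inr ⟨rfl, ConvexData.gram_posDef hfx₁⟩)).mono le_rfl
    fun M4 ha4 ⟨hp₄, hd₄, hg₄, hb₄, ho₄⟩ _ => ?_)
  · rw [hg₁]
    ext a e
    rw [hx₁, gram_update, ← hx₁, hspec.2.2]
    simp only [Matrix.add_apply, Matrix.smul_apply, Matrix.sum_apply, Matrix.vecMulVec_apply,
      smul_eq_mul]
    ring
  have tab4 := tab3.of_agree ha4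
  refine (Runs.swap tab4.toInputTables (hx₃.congr (ha4.real 0)) hK (s := s) (xi := xi)
    (ha4.nat_eq h33)
    (by rw [ha4.nat 41, hM3, Mem.setReal_nat, ha2.nat 41,
          ha1.nat 41]
        exact hs) (fun k => ?_)).mono le_rfl
    fun M5 ha5 ⟨hx₅, hs₅, ho₅⟩ => ⟨hx₅, fun s₁ hs₁ => ?_, ?_, ?_, fun v hv => ?_⟩
  · rw [ha4.real 5, ha3.real 5, hs₂, hx₁, Function.update_self]
  · rw [ho₅ s₁ hs₁, ha4.real 5, ha3.real 5, ho₂ s₁ hs₁,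
      ha1.real 5]
  · rw [Mem.vec_congr (ha5.real 11), hb₄]
  · rw [Mem.mat_congr (M := M4) (by rw [ha5.real 7])]
    exact (hT.eq_chol hfx₁ hp₄ hd₄ hg₄).1
  · rw [ha5.real 7, ho₄ v hv, e7, ho₁ v hv]

/-- The number of steps spent at one node when a block of `x` changes. -/
noncomputable def nodeCost (Q : SketchParams P r N) : ℕ :=
  (r + 1) * (Q.T.height * (Q.T.height * 2100 + 2100)) +
    (r * (Q.T.height * (Q.T.height * 1000 + 1000)) + Q.T.height * (Q.T.height * 1000 + 1000)) + 100

theorem Runs.walk (tab : Tables Q M) {j : Fin d} (hj : M.nat 42 0 0 0 = j)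
    (hL : GoodColumns Q.T Set.univ (M.mat 7 N))
    (hb : (M.vec 11 : Fin d → ℝ) = 0) (hrow : ∀ v ∈ Q.S.upper, NodeInv Q M v) :
    Runs O Cmd.walk M (Q.S.tree.height * (nodeCost Q + 100)) fun M1 =>
      (M1.vec 11 : Fin d → ℝ) = 0 ∧ (∀ v ∈ Q.S.upper, NodeInv Q M1 v) ∧
      M1.real 7 N = M.real 7 N ∧
      (∀ v ∈ Q.S.upper, ¬ Q.T.below j ⊆ Q.S.rowLabel v → M1.nat 23 v = M.nat 23 v ∧
        M1.real 7 v = M.real 7 v) ∧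
      ∀ v ∈ Q.S.upper, Q.T.below j ⊆ Q.S.rowLabel v → M1.nat 23 v 0 0 = M.nat 24 0 0 0 ∧
        ∀ u ∈ Q.S.support Q.T v, (∀ a : Fin d, M1.real 7 v a u = M.real 7 N a u) ∨
          u ∉ Q.S.Lam Q.T v ∧ u ∉ Q.T.path j ∧ ∀ a : Fin d, M1.real 7 v a u = M.real 7 v a u := by
  set leaf := Q.S.rowLeaf j with hleaf
  refine (forLeaf (Q := Q) (leaf := leaf) (B := nodeCost Q) (tab.depth_row j) (tab.path_row j)
    (fun k M1 => (M1.vec 11 : Fin d → ℝ) = 0 ∧ (∀ v ∈ Q.S.upper, NodeInv Q M1 v) ∧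
      M1.real 7 N = M.real 7 N ∧
      (∀ v ∈ Q.S.upper, ¬ ((∃ l < k, Q.S.tree.parent^[l] leaf = v) ∧
        Q.T.below j ⊆ Q.S.rowLabel v) → M1.nat 23 v = M.nat 23 v ∧ M1.real 7 v = M.real 7 v) ∧
      ∀ v ∈ Q.S.upper, (∃ l < k, Q.S.tree.parent^[l] leaf = v) → Q.T.below j ⊆ Q.S.rowLabel v →
        M1.nat 23 v 0 0 = M.nat 24 0 0 0 ∧
        ∀ u ∈ Q.S.support Q.T v, (∀ a : Fin d, M1.real 7 v a u = M.real 7 N a u) ∨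
          u ∉ Q.S.Lam Q.T v ∧ u ∉ Q.T.path j ∧ ∀ a : Fin d, M1.real 7 v a u = M.real 7 v a u)
    (by decide) (by decide) (fun M1 ha => ?_)
    ⟨hb, hrow, rfl, fun _ _ _ => ⟨rfl, rfl⟩, ?_⟩ (fun k M1 hk ha hv hI => ?_)
    (fun k M1 l h => ⟨h.1, fun v hv => (h.2.1 v hv).congr (fun _ _ => rfl) rfl, by simpa using h.2.2⟩)
    (fun k M1 l h => ⟨h.1, fun v hv => (h.2.1 v hv).congr (fun _ _ => rfl) rfl,
      by simpa using h.2.2⟩)).mono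
    le_rfl fun M1 _ ⟨h₁, h₂, h₃, h₄, h₅⟩ => ⟨h₁, h₂, h₃, fun v hv hn => h₄ v hv fun h => hn h.2,
      fun v hv hsub => h₅ v hv ?_ hsub⟩
  · rw [eval_get, ha.nat 4, eval_var, ha.nat 42, hj]
    exact tab.rowLeaf j
  · rintro v - ⟨l, hl, -⟩
    omega
  · set v := Q.S.tree.parent^[k] leaf with hv'
    obtain ⟨hb₁, hn₁, hN₁, hold, hnew⟩ := hI
    have tab1 := tab.of_agree ha
    have hvu : v ∈ Q.S.upper := ⟨j, Q.S.tree.iterate_mem_path _ k⟩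
    have h42 : M1.nat 42 0 0 0 = j := ha.nat_eq hj
    have hcond : (BExp.neg (.nlt (.get 12 (.var 31) (.var 42) (.const 0))
        (.get 13 (.var 42) (.const 0) (.const 0)))).eval O M1 ↔ Q.T.below j ⊆ Q.S.rowLabel v := by
      rw [tab1.below_subset_iff, BExp.eval_neg, BExp.eval_nlt, eval_get, eval_get,
        eval_var, eval_var, hv, h42]
      rfl
    have hnv : ¬ ∃ l < k, Q.S.tree.parent^[l] leaf = v := Q.S.tree.not_exists_lt_iterate hk
    by_cases hsub : Q.T.below j ⊆ Q.S.rowLabel v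
    · refine (cond_true (B := (r + 1) * (Q.T.height * (Q.T.height * 2100 + 2100)) + (20 +
        ((r * (Q.T.height * (Q.T.height * 1000 + 1000)) +
          Q.T.height * (Q.T.height * 1000 + 1000)) + 20))) (hcond.2 hsub) ?_).le
        (by simp only [BExp.cost, NExp.cost, NExp.var, nodeCost]; omega)
      have hgood : GoodColumns Q.T Set.univ (M1.mat 7 N) := by
        rw [Mem.mat_congr (M := M) hN₁]; exact hL
      refine seq ((Runs.refresh tab1 hvu hv hgood hb₁ (hn₁ v hvu)).mono le_rfl
        fun M2 ha2 ⟨hb₂, hn₂, hs₂, hc₂⟩ _ => ?_)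
      have tab2 := tab1.of_agree ha2
      refine seq (B₁ := 20) (block fun ha3 => ?_)
      have h42₂ : M2.nat 42 0 0 0 = j := ha2.nat_eq h42
      have h31₂ : M2.nat 31 0 0 0 = v := ha2.nat_eq hv
      rw [Cmd.den_assign, eval_var, h42₂] at ha3 ⊢
      set M3 := M2.setNat 30 0 0 0 j with hM3
      have tab3 := tab2.of_agree ha3
      have e7N : M3.real 7 N = M.real 7 N := by
        rw [hM3, Mem.setNat_real, hs₂ 7 (by simp) N (v.2).ne', hN₁]
      have hjv : j ∈ Q.S.rowLabel v := hsub (Q.T.mem_path_self j)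
      refine seq ((Runs.pass tab3 (w := j) (v := v) (by simp [hM3]) (by simpa [hM3] using h31₂)
        (by rw [Mem.mat_congr (M := M) e7N]; exact fun u _ => hL u trivial) hb₂
        (fun u hu => ⟨j, hjv, hu⟩) (hn₂.congr (fun _ _ => rfl) rfl)).mono le_rfl
        fun M4 ha4 ⟨hb₄, hn₄, hs₄, hc₄⟩ _ => ?_)
      have h31₄ : M4.nat 31 0 0 0 = v := by
        rw [ha4.nat 31]; simpa [hM3] using h31₂
      have h24₄ : M4.nat 24 0 0 0 = M.nat 24 0 0 0 := by
        rw [ha4.nat 24, ha3.nat 24, ha2.nat 24,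
          ha.nat 24]
      have h23 : M4.nat 23 = M1.nat 23 := by
        rw [ha4.nat 23, ha3.nat 23, ha2.nat 23]
      have hs : SameNodes v M1 M4 := hs₂.trans (fun a ha' v₁ hne => by
        rw [hs₄ a ha' v₁ hne]; rfl)
      refine block ?_
      rw [Cmd.den_setNat, eval_var, eval_var, eval_const, h31₄, h24₄]
      set M5 := M4.setNat 23 v 0 0 (M.nat 24 0 0 0) with hM5
      have g23 : ∀ v₁ : Fin N, v₁ ≠ v → M5.nat 23 v₁ = M1.nat 23 v₁ := fun v₁ hne => by
        funext b c
        rw [hM5, Mem.setNat_nat_self, if_neg fun h => hne (Fin.ext h.1), h23]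
      refine ⟨hb₄, fun v₁ hv₁ => ?_, ?_, fun v₁ hv₁ hn => ?_, fun v₁ hv₁ hvis hsub₁ => ?_⟩
      · refine NodeInv.congr (M := M4) ?_ (fun _ _ => rfl) rfl
        by_cases he : v₁ = v
        · exact he ▸ hn₄
        · refine (hn₁ v₁ hv₁).of_sameNodes hs (fun h => he (Fin.ext h)) ?_
          rw [ha4.real 1, ha3.real 1, ha2.real 1]
      · rw [hM5, Mem.setNat_real, hs 7 (by simp) N (v.2).ne', hN₁]
      · have hne : v₁ ≠ v := by
          rintro rfl
          exact hn ⟨⟨k, by omega, hv'.symm⟩, hsub⟩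
        have := hold v₁ hv₁ fun h => hn ⟨h.1.imp fun l hl => ⟨by omega, hl.2⟩, h.2⟩
        refine ⟨(g23 v₁ hne).trans this.1, ?_⟩
        rw [hM5, Mem.setNat_real, hs 7 (by simp) v₁ fun h => hne (Fin.ext h), this.2]
      · by_cases he : v₁ = v
        · rw [he]
          refine ⟨by simp [hM5], fun u hu => ?_⟩
          have hv7 := (hold v hvu fun h => hnv h.1).2
          by_cases huj : u ∈ Q.T.path j
          · left
            intro a
            refine (hc₄ u hu a).trans ?_
            rw [if_pos huj, e7N]
          · have h₄ : ∀ a : Fin d, M5.real 7 v a u = M2.real 7 v a u := fun a => by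
              refine (hc₄ u hu a).trans ?_
              rw [if_neg huj]
              rfl
            rcases hc₂ u hu with h | ⟨h, h'⟩
            · left
              intro a
              rw [h₄, h, hN₁]
            · right
              refine ⟨h, huj, fun a => ?_⟩
              rw [h₄, h', hv7]
        · rw [Q.S.tree.exists_lt_succ_iff] at hvis
          have := hnew v₁ hv₁ (hvis.resolve_right fun h => he (h.symm.trans hv'.symm)) hsub₁
          rw [g23 v₁ he, show M5.real 7 v₁ = M1.real 7 v₁ from
            hs 7 (by simp) v₁ fun h => he (Fin.ext h)]
          exact this
    · refine (cond_false (B := 1) (fun h => hsub (hcond.1 h)) (block ?_)).le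
        (by simp only [BExp.cost, NExp.cost, NExp.var, nodeCost]; omega)
      refine ⟨hb₁, hn₁, hN₁, fun v₁ hv₁ hn => hold v₁ hv₁ fun h => hn
        ⟨h.1.imp fun l hl => ⟨by omega, hl.2⟩, h.2⟩, fun v₁ hv₁ hvis hsub₁ => ?_⟩
      refine hnew v₁ hv₁ ?_ hsub₁
      rw [Q.S.tree.exists_lt_succ_iff] at hvis
      refine hvis.resolve_right fun h => hsub ?_
      rwa [← hv'.trans h] at hsub₁
  · exact (Q.S.tree.mem_path_iff).1 (hsub (Q.T.mem_path_self j))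

/-- The number of steps of `updBlock` for blocks of size at most `K`. -/
noncomputable def stepCost (Q : SketchParams P r N) (K : ℕ) : ℕ :=
  2 * blockCost Q K + 2 * cholCost Q K + K * 300 + 260 + Q.S.tree.height * (nodeCost Q + 100)

theorem Runs.updBlock (hT : P.IsEliminationTree Q.T) (hS : Q.S.IsBalanced Q.T) {D : Sketch P r N}
    (h : Represents Q M D) {i : Fin m} {s K : ℕ} (hK : P.size i ≤ K)
    (hs : M.nat 41 0 0 0 = s) (hi : M.nat 9 s 0 0 = i) {xi : Fin (P.size i) → ℝ}
    (hxi : ∀ k, M.real 5 s (k : Fin (P.size i)) 0 = xi k) (hdom : xi ∈ P.dom i) :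
    Runs P.oracle Cmd.updBlock M (stepCost Q K) fun M1 =>
      Represents Q M1 (Q.updateBlock i xi D) ∧ ∀ s₁ ≠ s, M1.real 5 s₁ = M.real 5 s₁ := by
  set E := Q.updateBlock i xi D with hE
  have hinv : Q.Inv E := h.inv.updateBlock hT hS hdom
  set x₁ := Function.update D.x i xi with hx₁
  set w := P.blockLow Q.T i with hw
  have hEL : E.L (D.ℓ + 1) = P.chol x₁ := Function.update_self _ _ _
  have hLold : ∀ t, t ≤ D.ℓ → E.L t = D.L t := fun t ht =>
    Function.update_of_ne (by omega) _ _
  have hEt : ∀ v ∈ Q.S.upper, E.t v = (open Classical in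
      if Q.T.below w ⊆ Q.S.rowLabel v then D.ℓ + 1 else D.t v) := fun v hv => by
    classical
    refine if_congr ?_ rfl rfl
    rw [TreeData.mem_path_club, and_iff_right hv]
  refine (seq (B₁ := 20) (B₂ := (2 * blockCost Q K + (K * 100 + 100)) +
    ((2 * cholCost Q K + (K * 200 + 100)) + (40 + Q.S.tree.height * (nodeCost Q + 100))))
    (block fun ha0 => ?_)).le (by rw [stepCost]; omega)
  rw [Cmd.den_assign, eval_get, eval_var, eval_const, hs, hi] at ha0 ⊢
  set M0 := M.setNat 33 0 0 0 i with hM0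
  have tab0 := h.tables.of_agree ha0
  refine seq ((Runs.changeJ (x := D.x) (i := i) (s := s) (xi := xi) hT hS tab0 h.x hK (by simp [hM0])
    (ha0.nat_eq hs) hxi h.work
    fun v hv => (h.node v hv).congr (fun _ _ => rfl) rfl).mono le_rfl
    fun M1 ha1 ⟨hp₁, hs₁, ho₁, hb₁, hn₁, hσ₁, hJ₁⟩ _ => ?_)
  have tab1 := tab0.of_agree ha1
  have h33 : M1.nat 33 0 0 0 = i := by rw [ha1.nat 33]; simp [hM0]
  refine seq ((Runs.changeL (x := D.x) (i := i) (s := s) (xi := xi) hT tab1 h.inv.feasible hinv.feasible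
    hp₁ hK h33 (by rw [ha1.nat 41, ha0.nat 41]; exact hs)
    hs₁ hσ₁ hb₁ (by rw [← h.inv.L_eq, ← h.L]; exact Mem.mat_congr (by rw [ha1.real 7]; rfl))).mono le_rfl
    fun M2 ha2 ⟨hp₂, ho₂, hb₂, hL₂, hv₂⟩ _ => ?_)
  have tab2 := tab1.of_agree ha2
  have h24 : M2.nat 24 0 0 0 = D.ℓ := by
    rw [ha2.nat 24, ha1.nat 24, ha0.nat 24]; exact h.ℓ
  refine seq (B₁ := 40) (block fun ha3 => ?_)
  have hden : (Cmd.seq (.assign 24 (.plus (.var 24) (.const 1)))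
      (.assign 42 (.get 16 (.var 33) (.const 0) (.const 0)))).den P.oracle M2 =
      (M2.setNat 24 0 0 0 (D.ℓ + 1)).setNat 42 0 0 0 w := by
    have : M2.nat 33 0 0 0 = i := ha2.nat_eq h33
    simp [h24, this, tab2.low, hw]
  rw [hden] at ha3 ⊢
  set M3 := (M2.setNat 24 0 0 0 (D.ℓ + 1)).setNat 42 0 0 0 w with hM3
  have tab3 := tab2.of_agree ha3
  have h24₃ : M3.nat 24 0 0 0 = D.ℓ + 1 := by simp [hM3]
  have hspec := hT.chol_spec hinv.feasible
  have hN₃ : M3.mat 7 N = P.chol x₁ := hL₂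
  have e7 : ∀ v : Fin N, M3.real 7 v = M.real 7 v := fun v =>
    (hv₂ v v.2.ne).trans (by rw [ha1.real 7]; rfl)
  have e23 : M3.nat 23 = M.nat 23 := by
    rw [ha3.nat 23, ha2.nat 23, ha1.nat 23,
      ha0.nat 23]
  refine (Runs.walk tab3 (j := w) (by simp [hM3]) ?_ hb₂ fun v hv => ?_).mono le_rfl
    fun M4 ha4 ⟨hb₄, hn₄, hN₄, hold, hnew⟩ => ⟨⟨hinv, tab3.of_agree ha4,
      ?_, ?_, ?_, ?_, fun v q => ?_, fun v hv => ?_, hn₄, fun v hv u hu a => ?_, hb₄⟩,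
      fun s₁ hne => ?_⟩
  · rw [hN₃]
    exact fun u _ => ⟨fun a ha => hspec.1.eq_zero ha, (hspec.2.1 u).ne'⟩
  · refine (hn₁ v hv).congr (fun a ha => ?_) ?_
    · rcases ha with rfl | ha
      · exact hv₂ v v.2.ne
      · rcases ha with rfl | rfl | rfl <;> rw [ha3.real _, ha2.real _]
    · rw [ha3.real 1, ha2.real 1]
  · rw [ha4.real 0]
    exact hp₂
  · rw [Mem.vec_congr (M := M)]
    · exact h.h
    · rw [ha4.real 1, ha3.real 1, ha2.real 1,
        ha1.real 1]
      rfl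
  · rw [ha4.nat 24, h24₃]
    rfl
  · rw [Mem.mat_congr hN₄, hN₃]
    exact hEL.symm
  · rw [Mem.row_congr (M := M1) (by rw [ha4.real 8, ha3.real 8,
      ha2.real 8]), hinv.J_eq]
    funext u
    have hJ := congrFun (h.J v q) u
    rw [h.inv.J_eq] at hJ
    refine (hJ₁ v q u).trans ?_
    rw [show M0.real 8 v q u = Q.jMatrix D.x v q u from hJ, sub_self, zero_add]
    rfl
  · rw [hEt v hv]
    split_ifs with hsub
    · rw [(hnew v hv hsub).1, h24₃]
    · rw [(hold v hv hsub).1, e23]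
      exact h.t v hv
  · rw [hEt v hv]
    have hcol := h.col v hv u hu a
    split_ifs with hsub
    · rw [hEL]
      rcases (hnew v hv hsub).2 u hu with h' | ⟨hu₁, hu₂, h'⟩
      · rw [h']
        exact congrFun (congrFun hN₃ a) u
      · rw [h', e7, hcol]
        rw [TreeData.mem_Lam, not_and, not_not] at hu₁
        rw [h.inv.col v hv u (hu₁ hu), h.inv.L_eq]
        exact (hT.chol_update h.inv.feasible hinv.feasible
          (fun i₁ hi₁ => Function.update_of_ne hi₁ _ _) hu₂ a).symm
    · rw [(hold v hv hsub).2, e7, hcol, hLold _ (h.inv.t_le v hv)]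
  · rw [ha4.real 5, ha3.real 5, ho₂ s₁ hne, ho₁ s₁ hne]
    rfl

/-! ### Update: the coordinates of `h` -/

/-- Adjusts the vectors `y_v` to the change of the coordinate of `h` in variable `42` and stores its
new value. -/
def Cmd.updCoord : Cmd :=
  .seq (.assign 42 (.get 10 (.var 41) (.const 0) (.const 0)))
    (.seq (.forTable 21 20 40 31 (.get 4 (.var 42) (.const 0) (.const 0))
      (.cond (.neg (.nlt (.get 12 (.var 31) (.var 42) (.const 0))
          (.get 13 (.var 42) (.const 0) (.const 0))))
        (.forLoop 32 (.get 0 (.const 2) (.const 0) (.const 0))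
          (.setReal 10 (.var 31) (.var 32) (.const 0)
            (.plus (.get 10 (.var 31) (.var 32) (.const 0))
              (.times (.get 9 (.var 31) (.var 32) (.var 42))
                (.minus (.get 6 (.var 41) (.const 0) (.const 0))
                  (.get 1 (.var 42) (.const 0) (.const 0)))))))
        .skip))
      (.setReal 1 (.var 42) (.const 0) (.const 0) (.get 6 (.var 41) (.const 0) (.const 0))))

theorem SketchParams.lamSum_update (Q : SketchParams P r N) (v : Fin N) (h z : Fin d → ℝ)
    (u : Fin d) (c : ℝ) : Q.lamSum v (Function.update h u c) z =
      Q.lamSum v h z + z u * (1 - (Q.S.Lam Q.T v).indicator (fun _ => (1 : ℝ)) u) * (c - h u) := by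
  unfold lamSum
  rw [← Finset.add_sum_erase _ _ (Finset.mem_univ u), ← Finset.add_sum_erase _
    (fun u => z u * (1 - (Q.S.Lam Q.T v).indicator (fun _ => (1 : ℝ)) u) * h u)
    (Finset.mem_univ u), Function.update_self, Finset.sum_congr rfl fun a ha => by
      rw [Function.update_of_ne (Finset.ne_of_mem_erase ha)]]
  ring

theorem Runs.updCoord (tab : Tables Q M) {j : Fin d} {s : ℕ} (hs : M.nat 41 0 0 0 = s)
    (hj : M.nat 10 s 0 0 = j) (hnode : ∀ v ∈ Q.S.upper, NodeInv Q M v) :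
    Runs O Cmd.updCoord M (Q.S.tree.height * (r * 86 + 200) + 40) fun M1 =>
      (∀ v ∈ Q.S.upper, NodeInv Q M1 v) ∧
      (M1.vec 1 : Fin d → ℝ) = Function.update (M.vec 1) j (M.real 6 s 0 0) := by
  classical
  set Δ := M.real 6 s 0 0 - M.real 1 j 0 0 with hΔ
  refine (seq (B₁ := 20) (B₂ := Q.S.tree.height * (r * 86 + 200) + 20)
    (block fun ha0 => ?_)).le (by omega)
  rw [Cmd.den_assign, eval_get, eval_var, eval_const, hs, hj] at ha0 ⊢
  set M0 := M.setNat 42 0 0 0 j with hM0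
  have tab0 := tab.of_agree ha0
  have h42 : M0.nat 42 0 0 0 = j := by simp [hM0]
  have h41 : M0.nat 41 0 0 0 = s := by simpa [hM0] using hs
  set leaf := Q.S.rowLeaf j with hleaf
  refine seq ((forLeaf (Q := Q) (leaf := leaf) (B := r * 86 + 100) (tab0.depth_row j)
    (tab0.path_row j)
    (fun k M1 => ∀ (v : Fin N) (q : Fin r), M1.real 10 v q 0 = M.real 10 v q 0 +
      if (∃ l < k, Q.S.tree.parent^[l] leaf = v) ∧ Q.T.below j ⊆ Q.S.rowLabel v
        then M.real 9 v q j * Δ else 0)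
    (by decide) (by decide) (fun M1 ha => ?_) (fun v q => ?_)
    (fun k M1 hk ha hv hI => ?_)).mono le_rfl fun M1 ha1 hI _ => ?_)
  · rw [eval_get, ha.nat 4, eval_var, ha.nat 42, h42]
    exact tab0.rowLeaf j
  · rw [if_neg (by rintro ⟨⟨l, hl, -⟩, -⟩; omega), add_zero]
    rfl
  · set v := Q.S.tree.parent^[k] leaf with hv'
    have tab1 := tab0.of_agree ha
    have n42 : M1.nat 42 0 0 0 = j := ha.nat_eq h42
    have hcond : (BExp.neg (.nlt (.get 12 (.var 31) (.var 42) (.const 0))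
        (.get 13 (.var 42) (.const 0) (.const 0)))).eval O M1 ↔ Q.T.below j ⊆ Q.S.rowLabel v := by
      rw [tab1.below_subset_iff, BExp.eval_neg, BExp.eval_nlt, eval_get, eval_get,
        eval_var, eval_var, hv, n42]
      rfl
    have hnv : ¬ ∃ l < k, Q.S.tree.parent^[l] leaf = v := Q.S.tree.not_exists_lt_iterate hk
    have hother : ∀ v₁ : Fin N, v₁ ≠ v → ((∃ l < k + 1, Q.S.tree.parent^[l] leaf = v₁) ↔
        ∃ l < k, Q.S.tree.parent^[l] leaf = v₁) := fun v₁ hne => by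
      rw [Q.S.tree.exists_lt_succ_iff, or_iff_left fun h => hne (h.symm.trans hv'.symm)]
    by_cases hsub : Q.T.below j ⊆ Q.S.rowLabel v
    · refine (cond_true (B := r * (50 + 36) + 31) (hcond.2 hsub) ?_).le
        (by simp only [BExp.cost, NExp.cost, NExp.var]; omega)
      refine (forCount (n := r) (B := 50) (fun l M2 => ∀ (v₁ : Fin N) (q : Fin r),
        M2.real 10 v₁ q 0 = M1.real 10 v₁ q 0 + if v₁ = v ∧ (q : ℕ) < l then
          M.real 9 v q j * Δ else 0) (by decide) (by decide) (fun M2 ha2 => ?_) (fun v₁ q => ?_)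
        (fun l M2 hl ha2 hl₂ hI₂ => ?_)).mono le_rfl fun M2 _ hI₂ v₁ q => ?_
      · rw [eval_get, ha2.nat 0]
        exact tab1.r_eq
      · rw [if_neg (by omega), add_zero]
      · refine block fun v₁ q => ?_
        have n31 : M2.nat 31 0 0 0 = v := ha2.nat_eq hv
        have n42₂ : M2.nat 42 0 0 0 = j := ha2.nat_eq n42
        have n41₂ : M2.nat 41 0 0 0 = s := by
          rw [ha2.nat 41, ha.nat 41]; exact h41
        have hval : M2.real 9 v l j * (M2.real 6 s 0 0 - M2.real 1 j 0 0) =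
            M.real 9 v l j * Δ := by
          rw [ha2.real 9, ha2.real 6, ha2.real 1,
            ha.real 9, ha.real 6, ha.real 1]
          rfl
        simp only [Cmd.den_setReal, RExp.eval_plus, RExp.eval_times, RExp.eval_minus,
          RExp.eval_get, eval_var, eval_const, n31, hl₂, n42₂, n41₂, hval]
        rw [Mem.setReal_real_self]
        have hold := hI₂ v₁ q
        by_cases he : v₁ = v ∧ (q : ℕ) = l
        · obtain ⟨rfl, rfl⟩ := he
          rw [if_pos ⟨rfl, rfl, rfl⟩, if_pos ⟨rfl, by omega⟩, hold, if_neg (by omega), add_zero]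
        · rw [if_neg fun h => he ⟨Fin.ext h.1, h.2.1⟩, hold]
          congr 1
          refine if_congr ⟨fun h => ⟨h.1, by omega⟩, fun h => ⟨h.1, ?_⟩⟩ rfl rfl
          have : (q : ℕ) ≠ l := fun h' => he ⟨h.1, h'⟩
          omega
      · by_cases he : v₁ = v
        · rw [he, hI₂, hI, if_neg fun h => hnv h.1, if_pos ⟨rfl, q.2⟩, add_zero,
            if_pos ⟨⟨k, by omega, hv'.symm⟩, hsub⟩]
        · rw [hI₂, if_neg fun h => he h.1, add_zero, hI]
          congr 1
          exact if_congr (and_congr_left fun _ => (hother v₁ he).symm) rfl rfl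
    · refine (cond_false (B := 1) (fun h => hsub (hcond.1 h)) (block ?_)).le
        (by simp only [BExp.cost, NExp.cost, NExp.var]; omega)
      intro v₁ q
      rw [Cmd.den_skip, hI]
      by_cases he : v₁ = v
      · rw [he, if_neg fun h => hsub h.2, if_neg fun h => hsub h.2]
      · congr 1
        exact if_congr (and_congr_left fun _ => (hother v₁ he).symm) rfl rfl
  · have n42 : M1.nat 42 0 0 0 = j := ha1.nat_eq h42
    have n41 : M1.nat 41 0 0 0 = s := ha1.nat_eq h41
    have e₁ : M1.real 1 = M.real 1 := by rw [ha1.real 1]; rfl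
    have e₉ : M1.real 9 = M.real 9 := by rw [ha1.real 9]; rfl
    refine block ?_
    rw [Cmd.den_setReal, eval_var, eval_const, RExp.eval_get, eval_var,
      eval_const, n42, n41, ha1.real 6, show M0.real 6 = M.real 6 from rfl]
    have hvec : ((M1.setReal 1 j 0 0 (M.real 6 s 0 0)).vec 1 : Fin d → ℝ) =
        Function.update (M.vec 1) j (M.real 6 s 0 0) := by
      rw [Mem.vec_setReal, Mem.vec_congr e₁]
    refine ⟨fun v hv => ⟨?_, fun q => ⟨?_, ?_, ?_⟩⟩, hvec⟩
    · rw [Mem.mat_congr (M := M)]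
      · exact (hnode v hv).good
      · rw [Mem.setReal_real_ne _, ha1.real 7]
        rfl
    all_goals
      have hrow := (hnode v hv).row q
      have r₉ : (Mem.row (M1.setReal 1 j 0 0 (M.real 6 s 0 0)) 9 v q : Fin d → ℝ) =
          M.row 9 v q := Mem.row_congr (by rw [Mem.setReal_real_ne _, e₉])
    · rw [r₉]
      exact hrow.supp
    · rw [r₉, Mem.mat_congr (M := M), Mem.row_congr (M := M) (a := 8)]
      · exact hrow.eq
      · rw [Mem.setReal_real_ne _, ha1.real 8]
        rfl
      · rw [Mem.setReal_real_ne _, ha1.real 7]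
        rfl
    · rw [r₉, hvec, SketchParams.lamSum_update, Mem.setReal_real_ne _, hI, hrow.y]
      congr 1
      by_cases hsub : Q.T.below j ⊆ Q.S.rowLabel v
      · rw [if_pos ⟨Q.S.tree.mem_path_iff.1 (hsub (Q.T.mem_path_self j)), hsub⟩,
          Set.indicator_of_notMem fun h => (TreeData.mem_Lam.1 h).2 hsub, sub_zero, mul_one]
        rfl
      · rw [if_neg fun h => hsub h.2]
        by_cases hsup : j ∈ Q.S.support Q.T v
        · rw [Set.indicator_of_mem (TreeData.mem_Lam.2 ⟨hsup, hsub⟩)]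
          ring
        · rw [hrow.supp j hsup]
          ring

/-! ### The program for Update -/

/-- The program for Update. -/
def Cmd.updateProg : Cmd :=
  .seq (.forLoop 41 (.get 8 (.const 0) (.const 0) (.const 0)) .updBlock)
    (.forLoop 41 (.get 8 (.const 1) (.const 0) (.const 0)) .updCoord)

theorem Runs.update (hT : P.IsEliminationTree Q.T) (hS : Q.S.IsBalanced Q.T) {D : Sketch P r N}
    (h : Represents Q M D) {K : ℕ} (hK : ∀ i, P.size i ≤ K) {xnew : P.Point} {hnew : Fin d → ℝ}
    {lx : List (Fin m)} {lh : List (Fin d)} (hx : P.Feasible xnew)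
    (hlx : ∀ i, i ∈ lx ↔ xnew i ≠ D.x i) (hnd : lh.Nodup) (hlh : ∀ j, j ∈ lh ↔ hnew j ≠ D.h j) :
    Runs P.oracle Cmd.updateProg (M.passUpdate xnew hnew lx lh)
      (lx.length * (stepCost Q K + 36) +
        lh.length * (Q.S.tree.height * (r * 86 + 200) + 76) + 62) fun M1 =>
      Represents Q M1 (Q.update xnew hnew lx lh D) := by
  set M0 := M.passUpdate xnew hnew lx lh with hM0
  have r₀ : Represents Q M0 D := h.congr
    (fun a ha => by
      simp only [List.mem_cons, List.not_mem_nil, or_false] at ha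
      rcases ha with rfl | rfl | rfl | rfl | rfl | rfl | rfl | rfl | rfl | rfl | rfl | rfl | rfl |
        rfl | rfl | rfl | rfl <;> rfl)
    (fun a ha => by
      simp only [List.mem_cons, List.not_mem_nil, or_false] at ha
      rcases ha with rfl | rfl | rfl | rfl | rfl | rfl | rfl | rfl <;> rfl) h.work
  have h8 : M0.nat 8 0 0 0 = lx.length ∧ M0.nat 8 1 0 0 = lh.length := ⟨rfl, rfl⟩
  have h9 : ∀ s (hs : s < lx.length), M0.nat 9 s 0 0 = (lx[s] : ℕ) := fun s hs =>
    pad_fin (fun s => (lx.get s : ℕ)) ⟨s, hs⟩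
  have h10 : ∀ s (hs : s < lh.length), M0.nat 10 s 0 0 = (lh[s] : ℕ) := fun s hs =>
    pad_fin (fun s => (lh.get s : ℕ)) ⟨s, hs⟩
  have h5 : ∀ s (hs : s < lx.length) (k : Fin (P.size lx[s])), M0.real 5 s k 0 = xnew lx[s] k :=
    fun s hs k => (pad_fin (fun s => pad (xnew (lx.get s)) k) ⟨s, hs⟩).trans (pad_fin _ k)
  have h6 : ∀ s (hs : s < lh.length), M0.real 6 s 0 0 = hnew lh[s] := fun s hs =>
    pad_fin (fun s => hnew (lh.get s)) ⟨s, hs⟩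
  clear_value M0
  refine (seq (B₁ := lx.length * (stepCost Q K + 36) + 31)
    (B₂ := lh.length * (Q.S.tree.height * (r * 86 + 200) + 76) + 31)
    ((forCount (n := lx.length) (B := stepCost Q K) (fun s M1 =>
      Represents Q M1 ((lx.take s).foldl (fun E i => Q.updateBlock i (xnew i) E) D) ∧
      ∀ s₁, s ≤ s₁ → M1.real 5 s₁ = M0.real 5 s₁) (by decide) (by decide) (fun M1 ha => ?_) ?_
      (fun s M1 hs ha hs₁ hI => ?_) (fun s M1 l h => ⟨h.1.congr (fun a ha => ?_) (fun _ _ => rfl)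
        h.1.work, h.2⟩)).mono le_rfl fun M1 ha1 hI _ => ?_)).le (by omega)
  · rw [eval_get, ha.nat 8]
    exact h8.1
  · exact ⟨by simpa using r₀, fun _ _ => rfl⟩
  · have hi : M1.nat 9 s 0 0 = (lx[s] : ℕ) := by rw [ha.nat 9, h9 s hs]
    refine (Runs.updBlock hT hS hI.1 (hK lx[s]) hs₁ hi (xi := xnew lx[s])
      (by rw [hI.2 s le_rfl]; exact h5 s hs) (hx _)).mono le_rfl fun M2 _ h₂ => ⟨?_, fun s₁ hs' => ?_⟩
    · rw [List.take_succ_eq_append_getElem hs, List.foldl_append]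
      exact h₂.1
    · rw [h₂.2 s₁ (by omega), hI.2 s₁ (by omega)]
  · exact Mem.setNat_nat_ne _ (by rintro rfl; revert ha; decide)
  obtain ⟨r₁, -⟩ := hI
  rw [List.take_length] at r₁
  obtain ⟨i₁, -, hh⟩ := h.inv.foldl_updateBlock hT hS hx lx
  set E := lx.foldl (fun E i => Q.updateBlock i (xnew i) E) D with hE
  obtain ⟨y, hy, -⟩ := i₁.foldl_updateCoord hT hS lh hnd (hnew := hnew)
  have hu : Q.update xnew hnew lx lh D = { E with y := y, h := hnew } := by
    show { (lh.foldl (fun E j => Q.updateCoord hnew j E) E) with h := hnew } = _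
    rw [hy]
  have hinv := (h.inv.update hT hS hx hlx hnd hlh).1
  rw [hu] at hinv ⊢
  refine (forCount (n := lh.length) (B := Q.S.tree.height * (r * 86 + 200) + 40) (fun s M2 =>
    (∀ v ∈ Q.S.upper, NodeInv Q M2 v) ∧
    (∀ s₁ (hs₁ : s₁ < lh.length), s₁ < s → (M2.vec 1 : Fin d → ℝ) lh[s₁] = hnew lh[s₁]) ∧
    ∀ u, (M2.vec 1 : Fin d → ℝ) u = hnew u ∨ (M2.vec 1 : Fin d → ℝ) u = D.h u)
    (by decide) (by decide) (fun M2 ha => ?_) ?_ (fun s M2 hs ha hs₂ hI => ?_)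
    (fun s M2 l h => ⟨fun v hv => (h.1 v hv).congr (fun _ _ => rfl) rfl, h.2⟩)).mono le_rfl
    fun M2 ha2 ⟨hn₂, hd₂, ho₂⟩ => ?_
  · rw [eval_get, ha.nat 8, ha1.nat 8]
    exact h8.2
  · exact ⟨r₁.node, fun _ _ hs => absurd hs (Nat.not_lt_zero _), fun u => Or.inr (by rw [r₁.h, hh])⟩
  · have h10₂ : M2.nat 10 s 0 0 = (lh[s] : ℕ) := by
      rw [ha.nat 10, ha1.nat 10, h10 s hs]
    have h6₂ : M2.real 6 s 0 0 = hnew lh[s] := by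
      rw [ha.real 6, ha1.real 6, h6 s hs]
    refine (Runs.updCoord (r₁.tables.of_agree ha) hs₂ h10₂ hI.1).mono le_rfl
      fun M3 _ h₃ => ⟨h₃.1, fun s₁ hs₁ hlt => ?_, fun u => ?_⟩
    · rw [h₃.2, h6₂]
      by_cases he : lh[s₁] = lh[s]
      · rw [he, Function.update_self]
      · rw [Function.update_of_ne he]
        refine hI.2.1 s₁ hs₁ (lt_of_le_of_ne (by omega) ?_)
        rintro rfl
        exact he rfl
    · rw [h₃.2, h6₂]
      by_cases he : u = lh[s]
      · rw [he, Function.update_self]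
        exact Or.inl rfl
      · rw [Function.update_of_ne he]
        exact hI.2.2 u
  · refine ⟨hinv, r₁.tables.of_agree ha2, ?_, ?_, ?_, ?_, ?_, ?_, hn₂, ?_,
      ?_⟩
    · rw [ha2.real 0]
      exact r₁.x
    · funext u
      by_cases hu : u ∈ lh
      · obtain ⟨s, hs, rfl⟩ := List.mem_iff_getElem.1 hu
        exact hd₂ s hs hs
      · rcases ho₂ u with h' | h'
        · exact h'
        · rw [hlh, not_not] at hu
          exact h'.trans hu.symm
    · rw [ha2.nat 24]
      exact r₁.ℓ
    · rw [Mem.mat_congr (M := M1) (by rw [ha2.real 7])]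
      exact r₁.L
    · intro v q
      rw [Mem.row_congr (M := M1) (by rw [ha2.real 8])]
      exact r₁.J v q
    · rw [ha2.nat 23]
      exact r₁.t
    · rw [ha2.real 7]
      exact r₁.col
    · rw [Mem.vec_congr (ha2.real 11)]
      exact r₁.work

/-! ### Initialize: the tables -/

theorem Mem.setNat_nat_row (M : Mem) {a i i₁ : ℕ} (j k c : ℕ) (h : i₁ ≠ i) :
    (M.setNat a i j k c).nat a i₁ = M.nat a i₁ := by
  funext j₁ k₁
  rw [Mem.setNat_nat_self, if_neg fun h' => h h'.1]

/-- The rule for loops that end after `n` rounds. -/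
theorem Runs.loop {b : BExp} {c : Cmd} {n B : ℕ} (I : ℕ → Mem → Prop) (h0 : I 0 M)
    (hs : ∀ k M1, k < n → I k M1 → b.eval O M1 ∧ Runs O c M1 B (I (k + 1)))
    (hn : ∀ M1, I n M1 → ¬ b.eval O M1) :
    Runs O (Cmd.loop b c) M (n * (B + b.cost + 1) + b.cost + 1) (I n) := by
  have key : ∀ (j k : ℕ) (M1 : Mem), j + k = n → I k M1 →
      Runs O (Cmd.loop b c) M1 (j * (B + b.cost + 1) + b.cost + 1) (I n) := by
    intro j
    induction j with
    | zero =>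
      intro k M1 hk h
      obtain rfl : k = n := by omega
      exact ⟨_, M1, Exec.loop_stop _ _ _ (hn _ h), by omega, h⟩
    | succ j ih =>
      intro k M1 hk h
      obtain ⟨hb, t, M2, e₂, ht, h₂⟩ := hs k M1 (by omega) h
      obtain ⟨t₃, M3, e₃, ht₃, h₃⟩ := ih (k + 1) M2 (by omega) h₂
      refine ⟨_, M3, Exec.loop_step _ _ _ _ _ _ _ hb e₂ e₃, ?_, h₃⟩
      rw [add_mul]
      omega
  exact key n 0 M rfl h0

/-- A counted loop whose round `l` establishes `R a` for `a` in `s l`, and never destroys it. -/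
theorem Runs.forAll {ι : Type} {x : ℕ} {e : NExp} {c : Cmd} {n B : ℕ} (s : ℕ → Set ι)
    (R : ι → Mem → Prop) (hx : x ∉ c.natWrites) (hc : e.cost ≤ 20)
    (he : ∀ M1, Agree (Cmd.forLoop x e c) M M1 → e.eval M1 = n)
    (hs : ∀ k M1, k < n → Agree (Cmd.forLoop x e c) M M1 → M1.nat x 0 0 0 = k →
      Runs O c M1 B fun M2 => (∀ a ∈ s k, R a M2) ∧ ∀ a, R a M1 → R a M2)
    (hR : ∀ a M1 l, R a M1 → R a (M1.setNat x 0 0 0 l)) :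
    Runs O (Cmd.forLoop x e c) M (n * (B + 36) + 31) fun M1 =>
      (∀ l < n, ∀ a ∈ s l, R a M1) ∧ ∀ a, R a M → R a M1 := by
  refine forCount (fun k M1 => (∀ l < k, ∀ a ∈ s l, R a M1) ∧ ∀ a, R a M → R a M1) hx hc he
    ⟨fun _ h => absurd h (Nat.not_lt_zero _), fun _ h => h⟩ (fun k M1 hk ha hk₁ hI => ?_)
    fun k M1 l h => ⟨fun l₁ h₁ a ha => hR _ _ _ (h.1 l₁ h₁ a ha), fun a ha => hR _ _ _ (h.2 a ha)⟩
  refine (hs k M1 hk ha hk₁).mono le_rfl fun M2 _ h => ⟨fun l hl a ha => ?_, fun a ha =>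
    h.2 a (hI.2 a ha)⟩
  rcases Nat.lt_succ_iff_lt_or_eq.1 hl with h' | rfl
  · exact h.2 a (hI.1 l h' a ha)
  · exact h.1 a ha

/-- `for j do c`, where `j` is a row. -/
def Cmd.forRow (c : Cmd) : Cmd :=
  .forLoop 32 (.get 0 (.const 0) (.const 0) (.const 0)) c

/-- Rule for loops over the rows: a round for `j` establishes `R (f j)` and preserves every `R a`. -/
theorem Runs.forRow (tab : InputTables Q M) {B : ℕ} {c : Cmd} {ι : Type} (f : Fin d → ι)
    (R : ι → Mem → Prop) (hc : 0 ∉ c.natWrites ∧ 32 ∉ c.natWrites)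
    (hs : ∀ j M1, Agree (Cmd.forRow c) M M1 → M1.nat 32 0 0 0 = (j : Fin d) →
      Runs O c M1 B fun M2 => R (f j) M2 ∧ ∀ a, R a M1 → R a M2)
    (hR : ∀ a M1 l, R a M1 → R a (M1.setNat 32 0 0 0 l)) :
    Runs O (Cmd.forRow c) M (d * (B + 36) + 31) fun M1 =>
      (∀ j, R (f j) M1) ∧ ∀ a, R a M → R a M1 := by
  refine (forAll (n := d) (B := B) (fun k => f '' {j : Fin d | (j : ℕ) = k}) R hc.2 (by decide)
    (fun M1 ha => ?_) (fun k M1 hk ha hk₁ => ?_) hR).mono le_rfl fun M1 _ h =>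
      ⟨fun j => h.1 j j.2 _ ⟨j, rfl, rfl⟩, h.2⟩
  · rw [eval_get, ha.nat 0 (by simp [hc.1])]
    exact tab.d_eq
  · refine (hs ⟨k, hk⟩ M1 ha hk₁).mono le_rfl fun M2 _ h => ⟨?_, h.2⟩
    rintro _ ⟨a, ha, rfl⟩
    obtain rfl : a = ⟨k, hk⟩ := Fin.ext ha
    exact h.1

/-- `for i, k do c`, where `(i, k)` are the coordinates. -/
def Cmd.forCoord (c : Cmd) : Cmd :=
  .forLoop 33 (.get 0 (.const 1) (.const 0) (.const 0))
    (.forLoop 34 (.get 1 (.var 33) (.const 0) (.const 0)) c)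

theorem Runs.forCoord (tab : InputTables Q M) {K B : ℕ} (hK : ∀ i, P.size i ≤ K) {c : Cmd}
    {ι : Type} (f : P.Coord → ι) (R : ι → Mem → Prop)
    (hc : 0 ∉ c.natWrites ∧ 1 ∉ c.natWrites ∧ 33 ∉ c.natWrites ∧ 34 ∉ c.natWrites)
    (hs : ∀ a M1, Agree (Cmd.forCoord c) M M1 → M1.nat 33 0 0 0 = (a : P.Coord).1 →
      M1.nat 34 0 0 0 = a.2 → Runs O c M1 B fun M2 => R (f a) M2 ∧ ∀ a₁, R a₁ M1 → R a₁ M2)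
    (hR : ∀ a M1 l, R a M1 → R a (M1.setNat 33 0 0 0 l) ∧ R a (M1.setNat 34 0 0 0 l)) :
    Runs O (Cmd.forCoord c) M (m * (K * (B + 36) + 67) + 31) fun M1 =>
      (∀ a, R (f a) M1) ∧ ∀ a, R a M → R a M1 := by
  refine (forAll (n := m) (B := K * (B + 36) + 31) (fun i => f '' {a : P.Coord | (a.1 : ℕ) = i}) R
    (by simp [hc]) (by decide) (fun M1 ha => ?_) (fun i M1 hi ha hi₁ => ?_)
    fun a M1 l h => (hR a _ _ h).1).mono le_rfl fun M1 _ h =>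
      ⟨fun a => h.1 a.1 a.1.2 _ ⟨a, rfl, rfl⟩, h.2⟩
  · rw [eval_get, ha.nat 0 (by simp [hc.1])]
    exact tab.m_eq
  · refine (forAll (n := P.size ⟨i, hi⟩) (B := B)
      (fun k => f '' {a : P.Coord | (a.1 : ℕ) = i ∧ (a.2 : ℕ) = k}) R hc.2.2.2 (by decide)
      (fun M2 ha2 => ?_) (fun k M2 hk ha2 hk₂ => ?_) fun a M1 l h => (hR a _ _ h).2).mono
      (Nat.add_le_add_right (Nat.mul_le_mul_right _ (hK _)) _) fun M2 _ h => ⟨?_, h.2⟩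
    · rw [eval_get, ha2.nat 1 (by simp [hc]), ha.nat 1 (by simp [hc]), eval_var,
        ha2.nat 33 (by simp [hc]), hi₁]
      exact tab.size ⟨i, hi⟩
    · refine (hs ⟨⟨i, hi⟩, ⟨k, hk⟩⟩ M2 (ha.trans (ha2.mono (fun a h => ?_) fun a h => ?_)) ?_
        hk₂).mono le_rfl fun M3 _ h => ⟨?_, h.2⟩
      · simp only [Cmd.natWrites_forLoop, List.mem_cons, List.mem_append] at h ⊢
        tauto
      · simpa using h
      · rw [ha2.nat 33 (by simp [hc])]
        exact hi₁
      · rintro _ ⟨⟨⟨i₁, hi₁⟩, ⟨k₁, hk₁⟩⟩, ⟨rfl, rfl⟩, rfl⟩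
        exact h.1
    · rintro _ ⟨a, ha', rfl⟩
      have : P.size a.1 = P.size ⟨i, hi⟩ := by rw [show a.1 = ⟨i, hi⟩ from Fin.ext ha']
      exact h.1 a.2 (this ▸ a.2.2) _ ⟨a, ⟨ha', rfl⟩, rfl⟩

/-- Stores the path and the depth of the vertex in variable `30` in the arrays `p` and `dd`; the
parents are taken from the array `par`. -/
def Cmd.storePath (par p dd : ℕ) : Cmd :=
  .seq (.seq (.assign 31 (.var 30)) (.seq (.setNat p (.var 30) (.const 0) (.const 0) (.var 30))
      (.setNat dd (.var 30) (.const 0) (.const 0) (.const 1))))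
    (.loop (.neg (.conj
        (.neg (.nlt (.var 31) (.get par (.var 31) (.const 0) (.const 0))))
        (.neg (.nlt (.get par (.var 31) (.const 0) (.const 0)) (.var 31)))))
      (.seq (.assign 31 (.get par (.var 31) (.const 0) (.const 0)))
        (.seq (.setNat p (.var 30) (.get dd (.var 30) (.const 0) (.const 0)) (.const 0) (.var 31))
          (.setNat dd (.var 30) (.const 0) (.const 0)
            (.plus (.get dd (.var 30) (.const 0) (.const 0)) (.const 1))))))

/-- The path and the depth of the vertex `s` are stored in the arrays `p` and `dd`. -/
def ParentTree.HasPath {n : ℕ} (T : ParentTree (Fin n)) (p dd : ℕ) (s : Fin n) (M : Mem) : Prop :=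
  M.nat dd s 0 0 = T.depth s ∧ ∀ k < T.depth s, M.nat p s k 0 = (T.parent^[k] s : ℕ)

theorem ParentTree.HasPath.congr {n p dd : ℕ} {T : ParentTree (Fin n)} {s : Fin n} {M1 : Mem}
    (h : T.HasPath p dd s M) (hp : M1.nat p s = M.nat p s) (hd : M1.nat dd s = M.nat dd s) :
    T.HasPath p dd s M1 := by
  unfold ParentTree.HasPath
  rw [hp, hd]
  exact h

theorem Runs.storePath {n : ℕ} (T : ParentTree (Fin n)) {par p dd : ℕ}
    (hn : par < p ∧ p < dd ∧ dd < 30) {s : Fin n}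
    (hpar : ∀ v : Fin n, M.nat par v 0 0 = (T.parent v : ℕ)) (hs : M.nat 30 0 0 0 = s) :
    Runs O (Cmd.storePath par p dd) M (T.depth s * 100 + 100) fun M1 =>
      T.HasPath p dd s M1 ∧ ∀ s₁, T.HasPath p dd s₁ M → T.HasPath p dd s₁ M1 := by
  obtain ⟨h₁, h₂, h₃⟩ := hn
  have hd := T.depth_pos s
  refine (seq (B₁ := 60) (B₂ := (T.depth s - 1) * (60 + 33 + 1) + 33 + 1) (block (fun _ => ?_)
    (by simp [Cmd.steps, Cmd.assign, NExp.cost, NExp.var]))).le (by omega)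
  refine (Runs.loop (n := T.depth s - 1) (B := 60) (fun k M1 =>
    M1.nat 31 0 0 0 = (T.parent^[k] s : ℕ) ∧ M1.nat 30 0 0 0 = s ∧ M1.nat par = M.nat par ∧
    M1.nat dd s 0 0 = k + 1 ∧ (∀ l ≤ k, M1.nat p s l 0 = (T.parent^[l] s : ℕ)) ∧
    ∀ s₁ : Fin n, s₁ ≠ s → M1.nat p s₁ = M.nat p s₁ ∧ M1.nat dd s₁ = M.nat dd s₁)
    ?_ (fun k M1 hk h => ?_) (fun M1 h => ?_)).mono ?_ fun M1 _ h => ⟨⟨?_, ?_⟩, fun s₁ h' => ?_⟩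
  · have e₁ : (M.setNat 31 0 0 0 s).nat 30 0 0 0 = s := by simp [hs]
    have e₂ : ((M.setNat 31 0 0 0 s).setNat p s 0 0 s).nat 30 0 0 0 = s := by
      rw [Mem.setNat_nat_ne _ (by omega), e₁]
    simp only [Cmd.den_seq, Cmd.den_assign, Cmd.den_setNat, eval_var, eval_const, hs, e₁,
      e₂]
    refine ⟨?_, ?_, ?_, by simp, fun l hl => ?_, fun s₁ hne => ⟨?_, ?_⟩⟩
    · rw [Mem.setNat_nat_ne _ (by omega), Mem.setNat_nat_ne _ (by omega)]
      simp
    · rw [Mem.setNat_nat_ne _ (by omega), e₂]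
    · rw [Mem.setNat_nat_ne _ (by omega), Mem.setNat_nat_ne _ (by omega),
        Mem.setNat_nat_ne _ (by omega)]
    · obtain rfl : l = 0 := by omega
      rw [Mem.setNat_nat_ne _ (by omega)]
      simp
    · rw [Mem.setNat_nat_ne _ (by omega), Mem.setNat_nat_row _ _ _ _ fun h => hne (Fin.ext h),
        Mem.setNat_nat_ne _ (by omega)]
    · rw [Mem.setNat_nat_row _ _ _ _ fun h => hne (Fin.ext h), Mem.setNat_nat_ne _ (by omega),
        Mem.setNat_nat_ne _ (by omega)]
  · obtain ⟨i₁, i₂, i₃, i₄, i₅, i₆⟩ := h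
    have hne : T.parent (T.parent^[k] s) ≠ T.parent^[k] s :=
      T.parent_ne (T.iterate_ne_root (by omega))
    have hv : M1.nat par (T.parent^[k] s : Fin n) 0 0 = (T.parent^[k + 1] s : ℕ) := by
      rw [i₃, hpar, Function.iterate_succ_apply']
    refine ⟨?_, block ?_ (by simp [Cmd.steps, Cmd.assign, NExp.cost, NExp.var])⟩
    · have : (T.parent^[k + 1] s : ℕ) ≠ (T.parent^[k] s : ℕ) := by
        rw [Function.iterate_succ_apply']
        exact fun h => hne (Fin.ext h)
      simp only [BExp.eval_neg, BExp.eval_conj, BExp.eval_nlt, eval_var, eval_get,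
        eval_const, i₁, hv]
      omega
    · simp only [Cmd.den_seq, Cmd.den_assign, Cmd.den_setNat, eval_var, eval_const,
        eval_get, eval_plus, i₁, hv]
      set w : ℕ := (T.parent^[k + 1] s : ℕ) with hw
      have e₁ : (M1.setNat 31 0 0 0 w).nat 30 0 0 0 = s := by simp [i₂]
      have e₂ : (M1.setNat 31 0 0 0 w).nat dd s 0 0 = k + 1 := by
        rw [Mem.setNat_nat_ne _ (by omega), i₄]
      have e₃ : (M1.setNat 31 0 0 0 w).nat 31 0 0 0 = w := by simp
      rw [e₁, e₂, e₃]
      have e₄ : ((M1.setNat 31 0 0 0 w).setNat p s (k + 1) 0 w).nat 30 0 0 0 = s := by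
        rw [Mem.setNat_nat_ne _ (by omega), e₁]
      have e₅ : ((M1.setNat 31 0 0 0 w).setNat p s (k + 1) 0 w).nat dd s 0 0 = k + 1 := by
        rw [Mem.setNat_nat_ne _ (by omega), e₂]
      rw [e₄, e₅]
      refine ⟨?_, ?_, ?_, by simp, fun l hl => ?_, fun s₁ hne => ⟨?_, ?_⟩⟩
      · rw [Mem.setNat_nat_ne _ (by omega), Mem.setNat_nat_ne _ (by omega), e₃]
      · rw [Mem.setNat_nat_ne _ (by omega), e₄]
      · rw [Mem.setNat_nat_ne _ (by omega), Mem.setNat_nat_ne _ (by omega),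
          Mem.setNat_nat_ne _ (by omega), i₃]
      · rw [Mem.setNat_nat_ne _ (by omega), Mem.setNat_nat_self, Mem.setNat_nat_ne _ (by omega)]
        split_ifs with h'
        · rw [h'.2.1]
        · exact i₅ l (by omega)
      · rw [Mem.setNat_nat_ne _ (by omega), Mem.setNat_nat_row _ _ _ _ fun h => hne (Fin.ext h),
          Mem.setNat_nat_ne _ (by omega), (i₆ s₁ hne).1]
      · rw [Mem.setNat_nat_row _ _ _ _ fun h => hne (Fin.ext h), Mem.setNat_nat_ne _ (by omega),
          Mem.setNat_nat_ne _ (by omega), (i₆ s₁ hne).2]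
  · obtain ⟨i₁, i₂, i₃, i₄, i₅, i₆⟩ := h
    rw [T.iterate_depth_pred] at i₁
    simp only [BExp.eval_neg, BExp.eval_conj, BExp.eval_nlt, eval_var, eval_get,
      eval_const, i₁, i₃, hpar, T.parent_root]
    omega
  · simp only [BExp.cost, NExp.cost, NExp.var]
    omega
  · rw [h.2.2.2.1]
    omega
  · exact fun k hk => h.2.2.2.2.1 k (by omega)
  · by_cases he : s₁ = s
    · rw [he]
      exact ⟨by rw [h.2.2.2.1]; omega, fun k hk => h.2.2.2.2.1 k (by omega)⟩
    · exact h'.congr (h.2.2.2.2.2 s₁ he).1 (h.2.2.2.2.2 s₁ he).2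

theorem ParentTree.HasPath.setNat {n p dd : ℕ} {T : ParentTree (Fin n)} {s : Fin n} {x l : ℕ}
    (h : T.HasPath p dd s M) (hp : p ≠ x) (hd : dd ≠ x) : T.HasPath p dd s (M.setNat x 0 0 0 l) :=
  h.congr (by rw [Mem.setNat_nat_ne _ hp]) (by rw [Mem.setNat_nat_ne _ hd])

/-- Stores the paths of the elimination tree and the paths of the leaves of the sampling tree. -/
def Cmd.storePaths : Cmd :=
  .seq (.forRow (.seq (.assign 30 (.var 32)) (.storePath 2 18 19)))
    (.seq (.forRow (.seq (.assign 30 (.get 4 (.var 32) (.const 0) (.const 0)))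
        (.storePath 3 20 21)))
      (.forCoord (.seq (.assign 30 (.get 5 (.var 33) (.var 34) (.const 0))) (.storePath 3 20 21))))

theorem Runs.storePaths (tab : InputTables Q M) {K : ℕ} (hK : ∀ i, P.size i ≤ K)
    (h2 : ∀ u : Fin d, M.nat 2 u 0 0 = (Q.T.parent u : ℕ))
    (h3 : ∀ v : Fin N, M.nat 3 v 0 0 = (Q.S.tree.parent v : ℕ)) :
    Runs O Cmd.storePaths M (d * (Q.T.height * 100 + 156) + d * (Q.S.tree.height * 100 + 156) +
        m * (K * (Q.S.tree.height * 100 + 156) + 67) + 93) fun M1 =>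
      PathTables Q M1 ∧ LeafTables Q M1 := by
  refine (seq (B₁ := d * (Q.T.height * 100 + 156) + 31) (B₂ := (d * (Q.S.tree.height * 100 + 156) +
    31) + (m * (K * (Q.S.tree.height * 100 + 156) + 67) + 31)) ((Runs.forRow tab
      (B := Q.T.height * 100 + 120) (c := .seq (.assign 30 (.var 32)) (.storePath 2 18 19))
      id (Q.T.HasPath 18 19) (by decide) (fun j M1 ha hj => ?_)
      fun a M1 l h => h.setNat (by decide) (by decide)).mono le_rfl fun M1 ha1 h₁ _ => ?_)).le
    (by omega)
  · refine (seq (B₁ := 20) (B₂ := Q.T.height * 100 + 100) (block fun ha0 => ?_)).le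
      (by omega)
    rw [Cmd.den_assign, eval_var, hj] at ha0 ⊢
    have := ParentTree.depth_le_height (T := Q.T) j
    refine (Runs.storePath Q.T (by decide) (s := j) (fun v => ?_) (by simp)).mono (by omega)
      fun M2 _ h => ⟨h.1, fun a h' => h.2 a (h'.setNat (by decide) (by decide))⟩
    rw [ha0.nat 2, ha.nat 2]
    exact h2 v
  have tab1 := tab.of_agree ha1
  have h3₁ : ∀ v : Fin N, M1.nat 3 v 0 0 = (Q.S.tree.parent v : ℕ) := by
    rw [ha1.nat 3]; exact h3
  refine seq ((Runs.forRow tab1 (B := Q.S.tree.height * 100 + 120)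
    (c := .seq (.assign 30 (.get 4 (.var 32) (.const 0) (.const 0))) (.storePath 3 20 21))
    Q.S.rowLeaf (Q.S.tree.HasPath 20 21) (by decide) (fun j M2 ha hj => ?_)
      fun a M1 l h => h.setNat (by decide) (by decide)).mono le_rfl fun M2 ha2 h₂ _ => ?_)
  · refine (seq (B₁ := 20) (B₂ := Q.S.tree.height * 100 + 100) (block
      fun ha0 => ?_)).le (by omega)
    rw [Cmd.den_assign, eval_get, eval_var, eval_const, hj, ha.nat 4,
      tab1.rowLeaf] at ha0 ⊢
    have := ParentTree.depth_le_height (T := Q.S.tree) (Q.S.rowLeaf j)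
    refine (Runs.storePath Q.S.tree (by decide) (s := Q.S.rowLeaf j) (fun v => ?_) (by simp)).mono
      (by omega) fun M2 _ h => ⟨h.1, fun a h' => h.2 a (h'.setNat (by decide) (by decide))⟩
    rw [ha0.nat 3, ha.nat 3]
    exact h3₁ v
  have tab2 := tab1.of_agree ha2
  refine (Runs.forCoord tab2 (B := Q.S.tree.height * 100 + 120) hK
    (c := .seq (.assign 30 (.get 5 (.var 33) (.var 34) (.const 0))) (.storePath 3 20 21))
    Q.S.colLeaf (Q.S.tree.HasPath 20 21) (by decide) (fun a M3 ha hi hk => ?_)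
      fun a M1 l h => ⟨h.setNat (by decide) (by decide), h.setNat (by decide) (by decide)⟩).mono
      le_rfl fun M3 ha3 h₃ => ⟨(PathTables.of_agree (M := M1) ⟨fun u => (h₁.1 u).1, fun u => (h₁.1 u).2⟩
        ha2 (by decide)).of_agree ha3, ⟨fun j => (h₃.2 _ (h₂.1 j)).1, fun j => (h₃.2 _ (h₂.1 j)).2,
          fun c => (h₃.1 c).1, fun c => (h₃.1 c).2⟩⟩
  · refine (seq (B₁ := 20) (B₂ := Q.S.tree.height * 100 + 100) (block
      fun ha0 => ?_)).le (by omega)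
    rw [Cmd.den_assign, eval_get, eval_var, eval_var, eval_const, hi, hk,
      ha.nat 5, tab2.colLeaf] at ha0 ⊢
    have := ParentTree.depth_le_height (T := Q.S.tree) (Q.S.colLeaf a)
    refine (Runs.storePath Q.S.tree (by decide) (s := Q.S.colLeaf a) (fun v => ?_) (by simp)).mono
      (by omega) fun M2 _ h => ⟨h.1, fun a h' => h.2 a (h'.setNat (by decide) (by decide))⟩
    rw [ha0.nat 3, ha.nat 3, ha2.nat 3]
    exact h3₁ v

/-- Records at the node in variable `31` that the row in variable `32` lies below it. -/
def Cmd.visit : Cmd :=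
  .seq
    (.seq (.cond (.nlt (.const 0) (.get 11 (.var 31) (.const 0) (.const 0))) .skip
        (.seq (.setNat 11 (.var 31) (.const 0) (.const 0) (.const 1))
          (.setNat 14 (.var 31) (.const 0) (.const 0) (.var 32))))
      (.setNat 15 (.var 31) (.const 0) (.const 0) (.var 32)))
    (.forTable 19 18 36 37 (.var 32) (.setNat 12 (.var 31) (.var 37) (.const 0)
      (.plus (.get 12 (.var 31) (.var 37) (.const 0)) (.const 1))))

/-- Visits the nodes above all rows, in heavy-light order. -/
def Cmd.visitAll : Cmd :=
  .forLoop 41 (.get 0 (.const 0) (.const 0) (.const 0))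
    (.seq (.assign 32 (.get 6 (.var 41) (.const 0) (.const 0)))
      (.forTable 21 20 40 31 (.get 4 (.var 32) (.const 0) (.const 0)) .visit))

/-- The tables at the node `v` after the first `k` rows in heavy-light order. -/
structure NodeStat (Q : SketchParams P r N) (M : Mem) (k : ℕ) (v : Fin N) : Prop where
  upper : 0 < M.nat 11 v 0 0 ↔ ∃ j ∈ Q.S.rowLabel v, (Q.S.order.symm j : ℕ) < k
  cnt : ∀ u : Fin d, M.nat 12 v u 0 =
    (Q.S.rowLabel v ∩ Q.T.below u ∩ {j | (Q.S.order.symm j : ℕ) < k}).ncard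
  ends : (∃ j ∈ Q.S.rowLabel v, (Q.S.order.symm j : ℕ) < k) →
    ∃ j ∈ Q.S.rowLabel v, M.nat 14 v 0 0 = (j : ℕ) ∧
      (∀ i ∈ Q.S.rowLabel v, Q.S.order.symm j ≤ Q.S.order.symm i) ∧
      ∃ l ∈ Q.S.rowLabel v, M.nat 15 v 0 0 = (l : ℕ) ∧
        ∀ i ∈ Q.S.rowLabel v, (Q.S.order.symm i : ℕ) < k → Q.S.order.symm i ≤ Q.S.order.symm l

theorem NodeStat.congr {M1 : Mem} {k : ℕ} {v : Fin N} (h : NodeStat Q M k v)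
    (hr : ∀ a, (a = 11 ∨ a = 12 ∨ a = 14 ∨ a = 15) → M1.nat a v = M.nat a v) :
    NodeStat Q M1 k v where
  upper := by rw [hr 11 (by simp)]; exact h.upper
  cnt := by rw [hr 12 (by simp)]; exact h.cnt
  ends := by rw [hr 14 (by simp), hr 15 (by simp)]; exact h.ends

theorem NodeStat.succ_of_notMem {k : ℕ} (hk : k < d) {v : Fin N} (h : NodeStat Q M k v)
    (hv : Q.S.order ⟨k, hk⟩ ∉ Q.S.rowLabel v) : NodeStat Q M (k + 1) v := by
  have key : ∀ j ∈ Q.S.rowLabel v, (Q.S.order.symm j : ℕ) < k + 1 ↔ (Q.S.order.symm j : ℕ) < k := by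
    intro j hj
    refine ⟨fun h' => lt_of_le_of_ne (by omega) fun h'' => hv ?_, fun h' => by omega⟩
    rwa [show (⟨k, hk⟩ : Fin d) = Q.S.order.symm j from Fin.ext h''.symm, Equiv.apply_symm_apply]
  have hex : (∃ j ∈ Q.S.rowLabel v, (Q.S.order.symm j : ℕ) < k + 1) ↔
      ∃ j ∈ Q.S.rowLabel v, (Q.S.order.symm j : ℕ) < k :=
    exists_congr fun j => and_congr_right (key j)
  refine ⟨h.upper.trans hex.symm, fun u => ?_, fun h' => ?_⟩
  · rw [h.cnt u]
    congr 1
    ext j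
    exact and_congr_right fun hj => (key j hj.1).symm
  · obtain ⟨j, hj, h₁, h₂, l, hl, h₃, h₄⟩ := h.ends (hex.1 h')
    exact ⟨j, hj, h₁, h₂, l, hl, h₃, fun i hi hik => h₄ i hi ((key i hi).1 hik)⟩

open Classical in
theorem Runs.visit (tab : PathTables Q M) {j : Fin d} {v : Fin N} (hj : M.nat 32 0 0 0 = j)
    (hv : M.nat 31 0 0 0 = v) :
    Runs O Cmd.visit M (Q.T.height * 112 + 60) fun M1 =>
      (∀ v₁ ≠ v, ∀ a, (a = 11 ∨ a = 12 ∨ a = 14 ∨ a = 15) → M1.nat a v₁ = M.nat a v₁) ∧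
      0 < M1.nat 11 v 0 0 ∧
      M1.nat 14 v 0 0 = (if 0 < M.nat 11 v 0 0 then M.nat 14 v 0 0 else j) ∧
      M1.nat 15 v 0 0 = j ∧
      ∀ u : Fin d, M1.nat 12 v u 0 = M.nat 12 v u 0 + if u ∈ Q.T.path j then 1 else 0 := by
  refine (seq (B₁ := 60) (B₂ := Q.T.height * 112) (block fun ha0 => ?_)).le
    (by omega)
  set M0 := Cmd.den O _ M with hM0
  have tab0 := tab.of_agree ha0
  have n31 : M0.nat 31 0 0 0 = v := ha0.nat_eq hv
  have n32 : M0.nat 32 0 0 0 = j := ha0.nat_eq hj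
  have n12 : M0.nat 12 = M.nat 12 := ha0.nat 12
  have hrest : (∀ v₁ : Fin N, v₁ ≠ v → ∀ a, (a = 11 ∨ a = 14 ∨ a = 15) →
      M0.nat a v₁ = M.nat a v₁) ∧ 0 < M0.nat 11 v 0 0 ∧
      M0.nat 14 v 0 0 = (if 0 < M.nat 11 v 0 0 then M.nat 14 v 0 0 else j) ∧
      M0.nat 15 v 0 0 = j := by
    rw [hM0, Cmd.den_seq, Cmd.den_cond, BExp.eval_nlt, eval_get, eval_var,
      eval_const, hv]
    have hne : ∀ v₁ : Fin N, v₁ ≠ v → (v₁ : ℕ) ≠ v := fun v₁ h h' => h (Fin.ext h')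
    split_ifs with h'
    · simp only [Cmd.den_skip, Cmd.den_setNat, eval_var, eval_const, hv, hj]
      refine ⟨fun v₁ hv₁ a ha => ?_, by simpa using h', by simp, by simp⟩
      rcases ha with rfl | rfl | rfl
      · simp
      · simp
      · exact Mem.setNat_nat_row _ _ _ _ (hne v₁ hv₁)
    · simp only [Cmd.den_seq, Cmd.den_setNat, eval_var, eval_const, hv]
      have e₁ : (M.setNat 11 v 0 0 1).nat 31 0 0 0 = v := by simp [hv]
      have e₂ : (M.setNat 11 v 0 0 1).nat 32 0 0 0 = j := by simp [hj]
      rw [e₁, e₂]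
      have e₃ : ((M.setNat 11 v 0 0 1).setNat 14 v 0 0 j).nat 31 0 0 0 = v := by simp [hv]
      have e₄ : ((M.setNat 11 v 0 0 1).setNat 14 v 0 0 j).nat 32 0 0 0 = j := by simp [hj]
      rw [e₃, e₄]
      refine ⟨fun v₁ hv₁ a ha => ?_, by simp, by simp, by simp⟩
      rcases ha with rfl | rfl | rfl
      · rw [Mem.setNat_nat_ne _, Mem.setNat_nat_ne _]
        exact Mem.setNat_nat_row _ _ _ _ (hne v₁ hv₁)
      · rw [Mem.setNat_nat_ne _, Mem.setNat_nat_row _ _ _ _ (hne v₁ hv₁),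
          Mem.setNat_nat_ne _]
      · rw [Mem.setNat_nat_row _ _ _ _ (hne v₁ hv₁), Mem.setNat_nat_ne _,
          Mem.setNat_nat_ne _]
  clear_value M0
  refine (forPath (w := j) (B := 40) tab0 (fun k M1 =>
    (∀ v₁ : Fin N, v₁ ≠ v → M1.nat 12 v₁ = M.nat 12 v₁) ∧
    ∀ u : Fin d, M1.nat 12 v u 0 = M.nat 12 v u 0 +
      if ∃ i < k, Q.T.parent^[i] j = u then 1 else 0) (by decide) (by decide) n32 ?_
    (fun k M1 hk ha hu hI => ?_)).mono le_rfl fun M1 ha1 h => ⟨fun v₁ hv₁ a ha => ?_, ?_, ?_, ?_,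
      fun u => ?_⟩
  · refine ⟨fun v₁ _ => by rw [n12], fun u => ?_⟩
    rw [if_neg (by rintro ⟨i, hi, -⟩; omega), n12, add_zero]
  · have m31 : M1.nat 31 0 0 0 = v := ha.nat_eq n31
    refine block ?_
    simp only [Cmd.den_setNat, eval_plus, eval_get, eval_var, eval_const, m31,
      hu]
    refine ⟨fun v₁ hv₁ => ?_, fun u => ?_⟩
    · rw [Mem.setNat_nat_row _ _ _ _ fun h => hv₁ (Fin.ext h), hI.1 v₁ hv₁]
    · rw [Mem.setNat_nat_self]
      by_cases he : u = Q.T.parent^[k] j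
      · rw [if_pos ⟨rfl, congrArg _ he, rfl⟩, if_pos ⟨k, by omega, he.symm⟩, ← he, hI.2,
          if_neg, add_zero]
        rw [he]
        exact Q.T.not_exists_lt_iterate hk
      · rw [if_neg fun h => he (Fin.ext h.2.1), hI.2]
        congr 1
        refine if_congr ?_ rfl rfl
        rw [Q.T.exists_lt_succ_iff, or_iff_left (Ne.symm he)]
  · rcases ha with rfl | rfl | rfl | rfl
    · rw [ha1.nat 11, hrest.1 v₁ hv₁ _ (by simp)]
    · exact h.1 v₁ hv₁
    · rw [ha1.nat 14, hrest.1 v₁ hv₁ _ (by simp)]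
    · rw [ha1.nat 15, hrest.1 v₁ hv₁ _ (by simp)]
  · rw [ha1.nat 11]
    exact hrest.2.1
  · rw [ha1.nat 14]
    exact hrest.2.2.1
  · rw [ha1.nat 15]
    exact hrest.2.2.2
  · rw [h.2 u]
    congr 1
    exact if_congr Q.T.mem_path_iff.symm rfl rfl

theorem Runs.visitAll (tab : InputTables Q M) (pt : PathTables Q M) (lt : LeafTables Q M)
    (h6 : ∀ p : Fin d, M.nat 6 p 0 0 = (Q.S.order p : ℕ))
    (h0 : ∀ a, (a = 11 ∨ a = 12 ∨ a = 14 ∨ a = 15) → M.nat a = fun _ _ _ => 0) :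
    Runs O Cmd.visitAll M (d * (Q.S.tree.height * (Q.T.height * 112 + 160) + 56) + 31) fun M1 =>
      ∀ v, NodeStat Q M1 d v := by
  refine (forCount (n := d) (B := Q.S.tree.height * (Q.T.height * 112 + 160) + 20)
    (fun k M1 => ∀ v, NodeStat Q M1 k v) (by decide) (by decide) (fun M1 ha => ?_) (fun v => ?_)
    (fun k M1 hk ha hk₁ hI => ?_) fun k M1 l h v => (h v).congr fun a ha => ?_)
  · rw [eval_get, ha.nat 0]
    exact tab.d_eq
  · refine ⟨?_, fun u => ?_, ?_⟩
    · rw [h0 11 (by simp)]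
      simp
    · rw [h0 12 (by simp)]
      simp
    · rintro ⟨j, -, hj⟩
      omega
  · set j := Q.S.order ⟨k, hk⟩ with hj
    have hjk : ∀ i, (Q.S.order.symm i : ℕ) = k ↔ i = j := fun i => by
      rw [hj, ← Equiv.symm_apply_eq, Fin.ext_iff]
    refine (seq (B₁ := 20) (B₂ := Q.S.tree.height * (Q.T.height * 112 + 60 + 100)) (block
      fun ha0 => ?_)).le (Nat.add_comm _ _).le
    rw [Cmd.den_assign, eval_get, eval_var, eval_const, hk₁, ha.nat 6,
      show M.nat 6 k 0 0 = j from h6 ⟨k, hk⟩] at ha0 ⊢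
    set M2 := M1.setNat 32 0 0 0 j with hM2
    have pt₂ := (pt.of_agree ha).of_agree ha0
    have lt₂ : LeafTables Q M2 := lt.congr fun a h => by
      simp only [List.mem_cons, List.not_mem_nil, or_false] at h
      rcases h with rfl | rfl <;> rw [ha0.nat _, ha.nat _]
    refine (forLeaf (Q := Q) (leaf := Q.S.rowLeaf j) (B := Q.T.height * 112 + 60) (lt₂.depth_row j)
      (lt₂.path_row j) (fun l M3 => ∀ v, ((∃ i < l, Q.S.tree.parent^[i] (Q.S.rowLeaf j) = v) →
        NodeStat Q M3 (k + 1) v) ∧ ((¬ ∃ i < l, Q.S.tree.parent^[i] (Q.S.rowLeaf j) = v) →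
        NodeStat Q M3 k v)) (by decide) (by decide) (fun M3 ha3 => ?_) (fun v => ⟨?_, fun _ => ?_⟩)
      (fun l M3 hl ha3 hv hI₃ => ?_) ?_ ?_).mono le_rfl fun M3 _ h v => ?_
    · rw [eval_get, ha3.nat 4, eval_var, ha3.nat 32,
        ha0.nat 4, ha.nat 4, hM2]
      simpa using tab.rowLeaf j
    · rintro ⟨i, hi, -⟩
      omega
    · refine (hI v).congr fun a ha => ?_
      rcases ha with rfl | rfl | rfl | rfl <;> rw [ha0.nat _]
    · set v := Q.S.tree.parent^[l] (Q.S.rowLeaf j) with hv'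
      have hjv : j ∈ Q.S.rowLabel v := Q.S.tree.iterate_mem_path _ l
      have hold := (hI₃ v).2 (Q.S.tree.not_exists_lt_iterate hl)
      have h32 : M3.nat 32 0 0 0 = j := by rw [ha3.nat 32]; simp [hM2]
      refine (Runs.visit (pt₂.of_agree ha3) h32 hv).mono le_rfl
        fun M4 _ ⟨g₁, g₂, g₃, g₄, g₅⟩ v₁ => ?_
      by_cases he : v₁ = v
      · rw [he]
        refine ⟨fun _ => ⟨?_, fun u => ?_, fun _ => ?_⟩, fun h => absurd ⟨l, by omega, hv'.symm⟩ h⟩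
        · exact ⟨fun _ => ⟨j, hjv, by rw [(hjk j).2 rfl]; omega⟩, fun _ => g₂⟩
        · rw [g₅, hold.cnt]
          split_ifs with huj
          · rw [← Set.ncard_insert_of_notMem (a := j) _ (Set.toFinite _)]
            · congr 1
              ext i
              simp only [Set.mem_insert_iff, Set.mem_inter_iff, Set.mem_ofPred_eq,
                Nat.lt_succ_iff_lt_or_eq, hjk i]
              constructor
              · rintro (rfl | h)
                · exact ⟨⟨hjv, huj⟩, Or.inr rfl⟩
                · exact ⟨h.1, Or.inl h.2⟩
              · rintro ⟨h₁, h₂ | h₂⟩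
                · exact Or.inr ⟨h₁, h₂⟩
                · exact Or.inl h₂
            · intro h
              exact absurd ((hjk j).2 rfl) h.2.ne
          · rw [add_zero]
            congr 1
            ext i
            simp only [Set.mem_inter_iff, Set.mem_ofPred_eq, Nat.lt_succ_iff_lt_or_eq, hjk i]
            refine and_congr_right fun h => ⟨Or.inl, fun h' => h'.resolve_right ?_⟩
            rintro rfl
            exact huj h.2
        · have hlast : ∀ i ∈ Q.S.rowLabel v, (Q.S.order.symm i : ℕ) < k + 1 →
              Q.S.order.symm i ≤ Q.S.order.symm j := fun i _ hi => by
            rw [Fin.le_def, (hjk j).2 rfl]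
            omega
          by_cases hu : 0 < M3.nat 11 v 0 0
          · obtain ⟨f, hf, hf₁, hf₂, -⟩ := hold.ends (hold.upper.1 hu)
            exact ⟨f, hf, by rw [g₃, if_pos hu, hf₁], hf₂, j, hjv, g₄, hlast⟩
          · refine ⟨j, hjv, by rw [g₃, if_neg hu], fun i hi => ?_, j, hjv, g₄, hlast⟩
            rw [hold.upper] at hu
            rw [Fin.le_def, (hjk j).2 rfl]
            by_contra hlt
            exact hu ⟨i, hi, by omega⟩
      · have hc := fun a ha => g₁ v₁ he a ha
        rw [Q.S.tree.exists_lt_succ_iff, or_iff_left fun h => he (h.symm.trans hv'.symm)]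
        exact ⟨fun h => ((hI₃ v₁).1 h).congr hc, fun h => ((hI₃ v₁).2 h).congr hc⟩
    · intro l M3 c h v
      have hc : ∀ a, (a = 11 ∨ a = 12 ∨ a = 14 ∨ a = 15) →
          (M3.setNat 40 0 0 0 c).nat a v = M3.nat a v := by
        rintro a (rfl | rfl | rfl | rfl) <;> simp
      exact ⟨fun h' => ((h v).1 h').congr hc, fun h' => ((h v).2 h').congr hc⟩
    · intro l M3 c h v
      have hc : ∀ a, (a = 11 ∨ a = 12 ∨ a = 14 ∨ a = 15) →
          (M3.setNat 31 0 0 0 c).nat a v = M3.nat a v := by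
        rintro a (rfl | rfl | rfl | rfl) <;> simp
      exact ⟨fun h' => ((h v).1 h').congr hc, fun h' => ((h v).2 h').congr hc⟩
    · by_cases hv : v ∈ Q.S.tree.path (Q.S.rowLeaf j)
      · exact (h v).1 (Q.S.tree.mem_path_iff.1 hv)
      · exact ((h v).2 fun h' => hv (Q.S.tree.mem_path_iff.2 h')).succ_of_notMem hk hv
  · rcases ha with rfl | rfl | rfl | rfl <;> simp

/-- Stores the sizes of the subtrees of the elimination tree, and marks the leaves of the rows. -/
def Cmd.rowTables : Cmd :=
  .forRow (.seq
    (.setNat 13 (.var 32) (.const 0) (.const 0)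
      (.get 12 (.get 20 (.get 4 (.var 32) (.const 0) (.const 0))
        (.minus (.get 21 (.get 4 (.var 32) (.const 0) (.const 0)) (.const 0) (.const 0)) (.const 1))
        (.const 0)) (.var 32) (.const 0)))
    (.setNat 22 (.get 4 (.var 32) (.const 0) (.const 0)) (.const 0) (.const 0)
      (.plus (.var 32) (.const 1))))

/-- Finds the lowest rows of the blocks, and the rows below which the lower nodes hang. -/
def Cmd.colTables : Cmd :=
  .forCoord (.seq
    (.forTable 21 20 40 31 (.get 5 (.var 33) (.var 34) (.const 0))
      (.cond (.nlt (.const 0) (.get 22 (.var 31) (.const 0) (.const 0)))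
        (.setNat 16 (.var 33) (.const 0) (.const 0)
          (.minus (.get 22 (.var 31) (.const 0) (.const 0)) (.const 1))) .skip))
    (.forTable 21 20 40 31 (.get 5 (.var 33) (.var 34) (.const 0))
      (.cond (.nlt (.const 0) (.get 11 (.var 31) (.const 0) (.const 0))) .skip
        (.setNat 17 (.var 31) (.const 0) (.const 0) (.get 16 (.var 33) (.const 0) (.const 0))))))

/-- The leaf of row `j` is marked by `j + 1`. -/
def Marked (Q : SketchParams P r N) (M : Mem) : Prop :=
  (∀ j, M.nat 22 (Q.S.rowLeaf j) 0 0 = j + 1) ∧ ∀ v ∉ Set.range Q.S.rowLeaf, M.nat 22 v 0 0 = 0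

theorem Runs.rowTables (hS : Q.S.IsBalanced Q.T) (tab : InputTables Q M) (lt : LeafTables Q M)
    (hst : ∀ v, NodeStat Q M d v) (h22 : M.nat 22 = fun _ _ _ => 0) :
    Runs O Cmd.rowTables M (d * 96 + 31) fun M1 =>
      (∀ u : Fin d, M1.nat 13 u 0 0 = (Q.T.below u).ncard) ∧ Marked Q M1 := by
  refine (Runs.forRow tab (B := 60) (ι := Fin d ⊕ Fin N) Sum.inl (Sum.elim
    (fun (j : Fin d) (M1 : Mem) => M1.nat 13 j 0 0 = (Q.T.below j).ncard ∧
      M1.nat 22 (Q.S.rowLeaf j) 0 0 = j + 1)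
    (fun (v : Fin N) (M1 : Mem) => v ∉ Set.range Q.S.rowLeaf → M1.nat 22 v 0 0 = 0))
    (by decide) (fun j M1 ha hj => ?_) ?_).mono le_rfl
    fun M1 _ h => ⟨fun u => (h.1 u).1, fun u => (h.1 u).2, fun v hv => h.2 (.inr v) ?_ hv⟩
  · refine block ?_
    have hroot : M1.nat 20 (Q.S.rowLeaf j) (Q.S.tree.depth (Q.S.rowLeaf j) - 1) 0 =
        Q.S.tree.root := by
      rw [ha.nat 20, lt.path_row j _ (by
        have := Q.S.tree.depth_pos (Q.S.rowLeaf j); omega), Q.S.tree.iterate_depth_pred]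
    have hcard : M1.nat 12 Q.S.tree.root j 0 = (Q.T.below j).ncard := by
      rw [ha.nat 12, (hst _).cnt, TreeData.rowLabel_root, Set.univ_inter]
      congr 1
      ext i
      exact and_iff_left (Fin.is_lt _)
    have hleaf : M1.nat 4 j 0 0 = Q.S.rowLeaf j := by rw [ha.nat 4]; exact tab.rowLeaf j
    have hdep : M1.nat 21 (Q.S.rowLeaf j) 0 0 = Q.S.tree.depth (Q.S.rowLeaf j) := by
      rw [ha.nat 21]; exact lt.depth_row j
    have hden : Cmd.den O (.seq
        (.setNat 13 (.var 32) (.const 0) (.const 0)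
          (.get 12 (.get 20 (.get 4 (.var 32) (.const 0) (.const 0))
            (.minus (.get 21 (.get 4 (.var 32) (.const 0) (.const 0)) (.const 0) (.const 0))
              (.const 1)) (.const 0)) (.var 32) (.const 0)))
        (.setNat 22 (.get 4 (.var 32) (.const 0) (.const 0)) (.const 0) (.const 0)
          (.plus (.var 32) (.const 1)))) M1 =
        (M1.setNat 13 j 0 0 (Q.T.below j).ncard).setNat 22 (Q.S.rowLeaf j) 0 0 (j + 1) := by
      simp [hj, hleaf, hdep, hroot, hcard]
    rw [hden]
    refine ⟨⟨by simp, by simp⟩, ?_⟩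
    rintro (i | v) h
    · refine ⟨?_, ?_⟩
      · rw [Mem.setNat_nat_ne _, Mem.setNat_nat_self]
        split_ifs with h'
        · rw [show i = j from Fin.ext h'.1]
        · exact h.1
      · rw [Mem.setNat_nat_self]
        split_ifs with h'
        · rw [hS.rowLeaf_inj (Fin.ext h'.1)]
        · rw [Mem.setNat_nat_ne _]
          exact h.2
    · intro hv
      rw [Mem.setNat_nat_self, if_neg fun h' => hv ⟨j, (Fin.ext h'.1).symm⟩,
        Mem.setNat_nat_ne _]
      exact h hv
  · rintro (i | v) M1 l h
    · simpa using h
    · simpa using h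
  · exact fun _ => by rw [h22]

theorem Runs.colTables (hS : Q.S.IsBalanced Q.T) (tab : InputTables Q M) (lt : LeafTables Q M)
    {K : ℕ} (hK : ∀ i, P.size i ≤ K) (hup : ∀ v : Fin N, 0 < M.nat 11 v 0 0 ↔ v ∈ Q.S.upper)
    (hm : Marked Q M) :
    Runs O Cmd.colTables M (m * (K * (Q.S.tree.height * 300 + 36) + 67) + 31) fun M1 =>
      (∀ i : Fin m, M1.nat 16 i 0 0 = P.blockLow Q.T i) ∧
      ∀ v ∉ Q.S.upper, ∃ j : Fin d, M1.nat 17 v 0 0 = (j : ℕ) ∧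
        ∀ c ∈ Q.S.colLabel v, P.blockLow Q.T c.1 = j := by
  have huniq : ∀ v ∉ Q.S.upper, ∀ a ∈ Q.S.colLabel v, ∀ b ∈ Q.S.colLabel v,
      P.blockLow Q.T a.1 = P.blockLow Q.T b.1 := fun v hv a ha b hb =>
    hS.eq_of_rowLeaf_mem_path (hS.rowLeaf_mem_path_of_not_upper hv ha)
      (hS.rowLeaf_mem_path_of_not_upper hv hb)
  refine (Runs.forCoord tab (B := Q.S.tree.height * 300) hK id
    (fun (a : P.Coord) (M1 : Mem) => M1.nat 16 a.1 0 0 = P.blockLow Q.T a.1 ∧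
      ∀ v ∉ Q.S.upper, a ∈ Q.S.colLabel v → M1.nat 17 v 0 0 = P.blockLow Q.T a.1)
    (by decide) (fun a M1 ha hi hk => ?_) fun a M1 l h => ⟨by simpa using h, by simpa using h⟩).mono
    le_rfl fun M1 _ h => ⟨fun i => (h.1 ⟨i, ⟨0, P.size_pos i⟩⟩).1, fun v hv => ?_⟩
  · set w := P.blockLow Q.T a.1 with hw
    set leaf := Q.S.colLeaf a with hleaf
    have e5 : M1.nat 5 a.1 a.2 0 = leaf := by
      rw [ha.nat 5]; exact tab.colLeaf a.1 a.2
    have lt₁ : LeafTables Q M1 := lt.congr fun b h => by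
      simp only [List.mem_cons, List.not_mem_nil, or_false] at h
      rcases h with rfl | rfl <;> rw [ha.nat _]
    refine (seq (B₁ := Q.S.tree.height * (50 + 100)) (B₂ := Q.S.tree.height * (50 + 100))
      ((forLeaf (Q := Q) (leaf := leaf) (B := 50) (lt₁.depth_col a) (lt₁.path_col a)
      (fun k M2 => ((∃ l < k, Q.S.tree.parent^[l] leaf = Q.S.rowLeaf w) → M2.nat 16 a.1 0 0 = w) ∧
        ∀ i : Fin m, M2.nat 16 i 0 0 = M1.nat 16 i 0 0 ∨ M2.nat 16 i 0 0 = P.blockLow Q.T i)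
      (by decide) (by decide) (fun M2 ha2 => ?_) ?_ (fun k M2 hk ha2 hv hI => ?_)).mono le_rfl
      fun M2 ha2 h₂ _ => ?_)).le (by omega)
    · rw [eval_get, ha2.nat 5, eval_var, eval_var,
        ha2.nat 33, ha2.nat 34, hi, hk]
      exact e5
    · exact ⟨fun ⟨l, hl, _⟩ => absurd hl (Nat.not_lt_zero _), fun _ => Or.inl rfl⟩
    · set v := Q.S.tree.parent^[k] leaf with hv'
      have h33 : M2.nat 33 0 0 0 = a.1 := ha2.nat_eq hi
      have e22 : M2.nat 22 = M.nat 22 := by rw [ha2.nat 22, ha.nat 22]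
      have hcond : (BExp.nlt (.const 0) (.get 22 (.var 31) (.const 0) (.const 0))).eval O M2 ↔
          v = Q.S.rowLeaf w := by
        rw [BExp.eval_nlt, eval_get, eval_var, eval_const, hv, e22]
        constructor
        · intro hpos
          by_cases hr : v ∈ Set.range Q.S.rowLeaf
          · obtain ⟨j, hj⟩ := hr
            have hjw : j = w := hS.eq_of_rowLeaf_mem_path (v := leaf)
              (by rw [hj]; exact Q.S.tree.iterate_mem_path _ k) (hS.colLeaf_below a)
            rw [← hj, hjw]
          · rw [hm.2 v hr] at hpos
            exact absurd hpos (lt_irrefl _)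
        · intro h
          rw [h, hm.1]
          omega
      by_cases hvw : v = Q.S.rowLeaf w
      · refine (cond_true (B := 30) (hcond.2 hvw) (block ?_)).le (by decide)
        rw [Cmd.den_setNat, eval_minus, eval_get, eval_var, eval_var,
          eval_const, eval_const, h33, hv, e22, hvw, hm.1, Nat.add_sub_cancel]
        refine ⟨fun _ => by simp, fun i => ?_⟩
        rw [Mem.setNat_nat_self]
        split_ifs with h'
        · right
          rw [show i = a.1 from Fin.ext h'.1]
        · exact hI.2 i
      · refine (cond_false (B := 1) (fun h => hvw (hcond.1 h)) (block ?_)).le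
          (by decide)
        refine ⟨fun h => hI.1 ?_, hI.2⟩
        rw [Q.S.tree.exists_lt_succ_iff] at h
        exact h.resolve_right fun h' => hvw (hv'.trans h')
    · have hlow : M2.nat 16 a.1 0 0 = w := h₂.1 (Q.S.tree.mem_path_iff.1 (hS.colLeaf_below a))
      have lt₂ : LeafTables Q M2 := lt₁.congr fun b h => by
        simp only [List.mem_cons, List.not_mem_nil, or_false] at h
        rcases h with rfl | rfl <;> rw [ha2.nat _]
      refine (forLeaf (Q := Q) (leaf := leaf) (B := 50) (lt₂.depth_col a) (lt₂.path_col a)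
        (fun k M3 => (∀ v ∉ Q.S.upper, (∃ l < k, Q.S.tree.parent^[l] leaf = v) →
          M3.nat 17 v 0 0 = w) ∧ ∀ v ∉ Q.S.upper, ∀ b ∈ Q.S.colLabel v,
          M3.nat 17 v 0 0 = M1.nat 17 v 0 0 ∨ M3.nat 17 v 0 0 = P.blockLow Q.T b.1)
        (by decide) (by decide) (fun M3 ha3 => ?_) ?_ (fun k M3 hk ha3 hv hI => ?_)).mono le_rfl
        fun M3 ha3 h₃ => ⟨⟨?_, fun v hv hav => h₃.1 v hv (Q.S.tree.mem_path_iff.1 hav)⟩,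
          fun b hb => ⟨?_, fun v hv hbv => ?_⟩⟩
      · rw [eval_get, ha3.nat 5, eval_var, eval_var,
          ha3.nat 33, ha3.nat 34, ha2.nat 5,
          ha2.nat 33, ha2.nat 34, hi, hk]
        exact e5
      · refine ⟨fun v _ ⟨l, hl, _⟩ => absurd hl (Nat.not_lt_zero _), fun v _ b _ => Or.inl ?_⟩
        rw [ha2.nat 17]
      · set v := Q.S.tree.parent^[k] leaf with hv'
        have hcond : (BExp.nlt (.const 0) (.get 11 (.var 31) (.const 0) (.const 0))).eval O M3 ↔
            v ∈ Q.S.upper := by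
          rw [BExp.eval_nlt, eval_get, eval_var, eval_const, hv,
            ha3.nat 11, ha2.nat 11, ha.nat 11]
          exact hup v
        by_cases hvu : v ∈ Q.S.upper
        · refine (cond_true (B := 1) (hcond.2 hvu) (block ?_)).le (by decide)
          refine ⟨fun v₁ hv₁ h => hI.1 v₁ hv₁ ?_, hI.2⟩
          rw [Q.S.tree.exists_lt_succ_iff] at h
          refine h.resolve_right ?_
          rintro rfl
          exact hv₁ hvu
        · refine (cond_false (B := 30) (fun h => hvu (hcond.1 h)) (block ?_)).le
            (by decide)
          rw [Cmd.den_setNat, eval_get, eval_var, eval_var, eval_const, hv,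
            ha3.nat 33, ha2.nat 33, hi, ha3.nat 16, hlow]
          refine ⟨fun v₁ hv₁ h => ?_, fun v₁ hv₁ b hb => ?_⟩
          · rw [Mem.setNat_nat_self]
            split_ifs with h'
            · rfl
            · rw [Q.S.tree.exists_lt_succ_iff] at h
              refine hI.1 v₁ hv₁ (h.resolve_right fun h'' => h' ⟨?_, rfl, rfl⟩)
              rw [← h'']
          · rw [Mem.setNat_nat_self]
            split_ifs with h'
            · right
              rw [hw, huniq v₁ hv₁ a ?_ b hb]
              rw [show v₁ = v from Fin.ext h'.1]
              exact Q.S.tree.iterate_mem_path _ k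
            · exact hI.2 v₁ hv₁ b hb
      · rw [ha3.nat 16]
        exact hlow
      · rw [ha3.nat 16]
        rcases h₂.2 b.1 with h | h
        · rw [h]
          exact hb.1
        · exact h
      · rcases h₃.2 v hv b hbv with h | h
        · rw [h]
          exact hb.2 v hv hbv
        · exact h
  · obtain ⟨c, hc⟩ := hS.colLabel_nonempty hv
    exact ⟨P.blockLow Q.T c.1, (h.1 c).2 v hv hc, fun b hb => huniq v hv b hb c hc⟩

/-- Computes all tables from the input. -/
def Cmd.initTables : Cmd := .seq .storePaths (.seq .visitAll (.seq .rowTables .colTables))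

/-- The number of steps of `initTables` for blocks of size at most `K`. -/
noncomputable def tableCost (Q : SketchParams P r N) (K : ℕ) : ℕ :=
  (d * (Q.T.height * 100 + 156) + d * (Q.S.tree.height * 100 + 156) +
    m * (K * (Q.S.tree.height * 100 + 156) + 67) + 93) +
  ((d * (Q.S.tree.height * (Q.T.height * 112 + 160) + 56) + 31) + ((d * 96 + 31) +
    (m * (K * (Q.S.tree.height * 300 + 36) + 67) + 31)))

/-- The rows that lie both below `v` and above a row outside are on the paths of the first and the
last row below `v`, since the subtrees of the elimination tree are intervals of the order. -/
theorem Lam_subset (hS : Q.S.IsBalanced Q.T) {v : Fin N} {j l : Fin d}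
    (hj : j ∈ Q.S.rowLabel v) (hl : l ∈ Q.S.rowLabel v)
    (hj₁ : ∀ i ∈ Q.S.rowLabel v, Q.S.order.symm j ≤ Q.S.order.symm i)
    (hl₁ : ∀ i ∈ Q.S.rowLabel v, Q.S.order.symm i ≤ Q.S.order.symm l) (hv : v ∈ Q.S.upper) :
    Q.S.Lam Q.T v ⊆ Q.T.path j ∪ Q.T.path l := by
  intro u hu
  rw [TreeData.mem_Lam] at hu
  obtain ⟨⟨i, hi, hiu⟩, hnot⟩ := hu
  obtain ⟨o, ho, hov⟩ := Set.not_subset.1 hnot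
  have hcon := hS.heavyLight.contiguous u
  have hlab := hS.upper_ordered v hv
  have key : ∀ w, (Q.S.order.symm w ∈ Set.uIcc (Q.S.order.symm i) (Q.S.order.symm o)) →
      u ∈ Q.T.path w := fun w hw => by
    have := hcon.uIcc_subset (x := Q.S.order.symm i) (y := Q.S.order.symm o)
      (show u ∈ Q.T.path (Q.S.order _) by rwa [Equiv.apply_symm_apply])
      (show u ∈ Q.T.path (Q.S.order _) by rwa [Equiv.apply_symm_apply]) hw
    change u ∈ Q.T.path (Q.S.order _) at this
    rwa [Equiv.apply_symm_apply] at this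
  rcases le_total (Q.S.order.symm o) (Q.S.order.symm j) with h | h
  · exact Or.inl (key j (by rw [Set.uIcc_comm]; exact Set.Icc_subset_uIcc ⟨h, hj₁ i hi⟩))
  · rcases le_total (Q.S.order.symm l) (Q.S.order.symm o) with h' | h'
    · exact Or.inr (key l (Set.Icc_subset_uIcc ⟨hl₁ i hi, h'⟩))
    · refine absurd ?_ hov
      have := hlab.out (x := Q.S.order.symm j) (by simpa using hj) (y := Q.S.order.symm l)
        (by simpa using hl) ⟨h, h'⟩
      simpa using this

theorem Runs.initTables (hS : Q.S.IsBalanced Q.T) (tab : InputTables Q M) {K : ℕ}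
    (hK : ∀ i, P.size i ≤ K) (h2 : ∀ u : Fin d, M.nat 2 u 0 0 = (Q.T.parent u : ℕ))
    (h3 : ∀ v : Fin N, M.nat 3 v 0 0 = (Q.S.tree.parent v : ℕ))
    (h6 : ∀ p : Fin d, M.nat 6 p 0 0 = (Q.S.order p : ℕ))
    (h0 : ∀ a, 7 ≤ a → M.nat a = fun _ _ _ => 0) :
    Runs O Cmd.initTables M (tableCost Q K) fun M1 => Tables Q M1 := by
  rw [tableCost]
  refine seq ((Runs.storePaths tab hK h2 h3).mono le_rfl fun M1 ha1 ⟨pt₁, lt₁⟩ _ => ?_)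
  have tab1 := tab.of_agree ha1
  refine seq ((Runs.visitAll tab1 pt₁ lt₁ (by rw [ha1.nat 6]; exact h6)
    fun a ha => ?_).mono le_rfl fun M2 ha2 hst _ => ?_)
  · rcases ha with rfl | rfl | rfl | rfl <;>
      rw [ha1.nat _, h0 _ (by decide)]
  have tab2 := tab1.of_agree ha2
  have pt₂ := pt₁.of_agree ha2
  have lt₂ : LeafTables Q M2 := lt₁.congr fun b h => by
    simp only [List.mem_cons, List.not_mem_nil, or_false] at h
    rcases h with rfl | rfl <;> rw [ha2.nat _]
  refine seq ((Runs.rowTables hS tab2 lt₂ hst (by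
    rw [ha2.nat 22, ha1.nat 22, h0 22 (by decide)])).mono le_rfl
    fun M3 ha3 ⟨h13, hm⟩ _ => ?_)
  have tab3 := tab2.of_agree ha3
  have pt₃ := pt₂.of_agree ha3
  have lt₃ : LeafTables Q M3 := lt₂.congr fun b h => by
    simp only [List.mem_cons, List.not_mem_nil, or_false] at h
    rcases h with rfl | rfl <;> rw [ha3.nat _]
  have hst₃ : ∀ v, NodeStat Q M3 d v := fun v => (hst v).congr fun a ha => by
    rcases ha with rfl | rfl | rfl | rfl <;> rw [ha3.nat _]
  have hup : ∀ v : Fin N, 0 < M3.nat 11 v 0 0 ↔ v ∈ Q.S.upper := fun v => by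
    rw [(hst₃ v).upper]
    exact exists_congr fun j => and_iff_left (Fin.is_lt _)
  refine (Runs.colTables hS tab3 lt₃ hK hup hm).mono le_rfl fun M4 ha4 ⟨hlow, hhang⟩ => ?_
  have lt₄ : LeafTables Q M4 := lt₃.congr fun b h => by
    simp only [List.mem_cons, List.not_mem_nil, or_false] at h
    rcases h with rfl | rfl <;> rw [ha4.nat _]
  refine { tab3.of_agree ha4, pt₃.of_agree ha4, lt₄ with
    upper := by rw [ha4.nat 11]; exact hup
    cnt := fun v u => ?_
    belowCard := by rw [ha4.nat 13]; exact h13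
    first := fun v hv => ?_
    low := hlow
    hang := hhang }
  · rw [ha4.nat 12, (hst₃ v).cnt]
    congr 1
    ext i
    exact and_iff_left (Fin.is_lt _)
  · obtain ⟨j, hj⟩ := hv
    obtain ⟨f, hf, hf₁, hf₂, l, hl, hl₁, hl₂⟩ := (hst₃ v).ends ⟨j, hj, Fin.is_lt _⟩
    rw [ha4.nat 14, ha4.nat 15]
    exact ⟨f, hf, hf₁, l, hl, hl₁, Lam_subset hS hf hl hf₂ (fun i hi => hl₂ i hi (Fin.is_lt _))
      ⟨j, hj⟩⟩

/-! ### Initialize: the matrices -/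

/-- Builds the Cholesky factor from the zero matrix, block by block. -/
def Cmd.initFactor : Cmd := .forLoop 33 (.get 0 (.const 1) (.const 0) (.const 0)) .cholTerm

/-- Copies the columns of the Cholesky factor to the nodes of the upper tree that use them. -/
def Cmd.spread : Cmd :=
  .seq (.assign 35 (.get 0 (.const 3) (.const 0) (.const 0))) (.forRow (.seq (.assign 30 (.var 32))
    (.forTable 21 20 40 31 (.get 4 (.var 32) (.const 0) (.const 0)) .copyColumns)))

/-- Builds the matrices `J_v`, `Z_v` and the vectors `y_v` from zero, block by block. -/
def Cmd.initJ : Cmd := .forLoop 33 (.get 0 (.const 1) (.const 0) (.const 0)) .blockTerm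

/-- The program for Initialize. -/
def Cmd.initProg : Cmd :=
  .seq .initTables (.seq (.assignReal 14 (.const 1)) (.seq .initFactor (.seq .spread .initJ)))

theorem sum_range_pad {α : Type} [AddCommMonoid α] {k : ℕ} (f : Fin k → α) :
    ∑ l ∈ Finset.range k, pad f l = ∑ i, f i := by
  rw [Finset.sum_range]
  exact Finset.sum_congr rfl fun i _ => pad_fin f i

theorem Runs.initFactor (hT : P.IsEliminationTree Q.T) (tab : Tables Q M) {K : ℕ}
    (hK : ∀ i, P.size i ≤ K) {x : P.Point} (hx : HoldsPoint M x) (hfx : P.Feasible x)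
    (hσ : M.real 14 0 0 0 = 1) (hL : M.mat 7 N = (0 : Matrix (Fin d) (Fin d) ℝ))
    (hb : (M.vec 11 : Fin d → ℝ) = 0) :
    Runs P.oracle Cmd.initFactor M (m * (cholCost Q K + 36) + 31) fun M1 =>
      (M1.vec 11 : Fin d → ℝ) = 0 ∧ M1.mat 7 N = P.chol x ∧
        ∀ v ≠ N, M1.real 7 v = M.real 7 v := by
  refine (forCount (n := m) (B := cholCost Q K) (fun k M1 => PathSupported Q.T (M1.mat 7 N) ∧
    (∀ i : Fin d, 0 ≤ M1.real 7 N i i) ∧ (M1.mat 7 N : Matrix (Fin d) (Fin d) ℝ) * (M1.mat 7 N)ᵀ =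
      ∑ l ∈ Finset.range k, pad (fun i => ∑ k, Matrix.vecMulVec (fun u => P.G x u ⟨i, k⟩)
        (fun u => P.G x u ⟨i, k⟩)) l ∧
    (M1.vec 11 : Fin d → ℝ) = 0 ∧ ∀ v ≠ N, M1.real 7 v = M.real 7 v) (by decide) (by decide)
    (fun M1 ha => ?_) ?_ fun k M1 hk ha hk₁ ⟨hp, hd, hg, hb₁, ho⟩ => ?_).mono le_rfl
    fun M1 ha ⟨hp, hd, hg, hb₁, ho⟩ => ⟨hb₁, (hT.eq_chol hfx hp hd ?_).1, ho⟩
  · rw [eval_get, ha.nat 0]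
    exact tab.m_eq
  · refine ⟨fun a u h => absurd ?_ h, fun i => (congrFun (congrFun hL i) i).ge, ?_, hb,
      fun _ _ => rfl⟩
    · rw [hL, Matrix.zero_apply]
    · rw [hL, Matrix.zero_mul, Finset.sum_range_zero]
  · refine (Runs.cholTerm (i := ⟨k, hk⟩) (σ := 1) hT (tab.of_agree ha) (hK _)
      ((hx.congr (ha.real 0)) _) hk₁ (ha.real_eq hσ) rfl hb₁
      hp hd rfl (Or.inl rfl)).mono le_rfl fun M2 ha2 ⟨hp₂, hd₂, hg₂, hb₂, ho₂⟩ =>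
      ⟨hp₂, hd₂, ?_, hb₂, fun v hv => (ho₂ v hv).trans (ho v hv)⟩
    rw [hg₂, hg, one_smul, Finset.sum_range_succ,
      show pad _ k = _ from pad_fin (k := m) _ ⟨k, hk⟩]
  · rw [hg, sum_range_pad]
    ext a e
    rw [ConvexData.gram_apply, Fintype.sum_sigma, Matrix.sum_apply]
    refine Finset.sum_congr rfl fun i _ => ?_
    rw [Matrix.sum_apply]
    rfl

/-- Entries outside the support of the factor are zero from the start and need no copying. -/
theorem Runs.spread (tab : Tables Q M) (hp : PathSupported Q.T (M.mat 7 N))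
    (h0 : ∀ v : Fin N, M.real 7 v = fun _ _ => 0) :
    Runs O Cmd.spread M (20 + (d * (20 + Q.S.tree.height *
      (Q.T.height * (Q.T.height * 200 + 72) + 100) + 36) + 31)) fun M1 =>
      (M1.mat 7 N : Matrix (Fin d) (Fin d) ℝ) = M.mat 7 N ∧
      ∀ v : Fin N, ∀ u ∈ Q.S.support Q.T v, ∀ a : Fin d, M1.real 7 v a u = M.real 7 N a u := by
  refine seq (block fun ha0 => ?_)
  rw [Cmd.den_assign, eval_get, eval_const, eval_const, tab.N_eq] at ha0 ⊢
  set M0 := M.setNat 35 0 0 0 N with hM0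
  have tab0 := tab.of_agree ha0
  -- An entry is in place if it agrees with the entry of the current factor, which is kept.
  set R : Option (Fin N × Fin d × Fin d) → Mem → Prop := fun c M1 => match c with
    | none => (M1.mat 7 N : Matrix (Fin d) (Fin d) ℝ) = M.mat 7 N
    | some (v, a, u) => M1.real 7 v a u = M1.real 7 N a u with hR
  refine (forAll (n := d) (fun k => {c | ∃ j : Fin d, (j : ℕ) = k ∧ ∃ v a u, c = some (v, a, u) ∧
    j ∈ Q.S.rowLabel v ∧ u ∈ Q.T.path j ∧ a ∈ Q.T.path u}) R (by decide) (by decide)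
    (fun M1 ha => ?_) (fun k M1 hk ha hk₁ => ?_) fun c M1 l h => ?_).mono le_rfl
    fun M1 _ h => ?_
  · rw [eval_get, ha.nat 0]
    exact tab0.d_eq
  · refine seq (block fun ha1 => ?_)
    rw [Cmd.den_assign, eval_var, hk₁] at ha1 ⊢
    set M2 := M1.setNat 30 0 0 0 k with hM2
    have tab2 := (tab0.of_agree ha).of_agree ha1
    obtain ⟨j, rfl⟩ : ∃ j : Fin d, (j : ℕ) = k := ⟨⟨k, hk⟩, rfl⟩
    refine (forLeaf (Q := Q) (leaf := Q.S.rowLeaf j) (tab2.depth_row j) (tab2.path_row j)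
      (fun k M3 => (∀ v : Fin N, (∃ l < k, Q.S.tree.parent^[l] (Q.S.rowLeaf j) = v) →
        ∀ u ∈ Q.T.path j, ∀ a ∈ Q.T.path u, R (some (v, a, u)) M3) ∧ ∀ c, R c M1 → R c M3)
      (by decide) (by decide) (fun M3 ha3 => ?_) ?_ (fun k M3 hk ha3 hv hI => ?_)
      (fun k M3 l hI => ?_)).mono le_rfl fun M3 _ h => ⟨?_, h.2⟩
    · rw [eval_get, eval_var, ha3.nat 32, ha3.nat 4,
        ha1.nat 32, hk₁]
      exact tab2.rowLeaf j
    · exact ⟨fun v ⟨l, hl, _⟩ => absurd hl (Nat.not_lt_zero _), fun c h => by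
        rcases c with _ | ⟨v, a, u⟩ <;> exact h⟩
    · have hne : N ≠ Q.S.tree.parent^[k] (Q.S.rowLeaf j) := (Fin.is_lt _).ne'
      refine (Runs.copyColumns ((tab2.of_agree ha3).toPathTables) hne
        (w := j) (by rw [ha3.nat 30]; simp [hM2]) hv (by
          rw [ha3.nat 35, hM2, Mem.setNat_nat_ne _, ha.nat 35]
          simp [hM0])).mono le_rfl fun M4 _ ⟨hc, ho⟩ => ?_
      have hN := ho N hne
      have hkeep : ∀ c, R c M3 → R c M4 := by
        rintro (_ | ⟨v, a, u⟩) h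
        · exact (Mem.mat_congr hN).trans h
        · show M4.real 7 v a u = M4.real 7 N a u
          rw [hN]
          by_cases hv' : (v : ℕ) = Q.S.tree.parent^[k] (Q.S.rowLeaf j)
          · change M3.real 7 v a u = M3.real 7 N a u at h
            rw [hv'] at h ⊢
            by_cases hu : u ∈ Q.T.path j
            · by_cases ha' : a ∈ Q.T.path u
              · exact (hc u).1 hu a ha'
              · exact ((hc u).2.1 hu a ha').trans h
            · exact ((hc u).2.2 hu a).trans h
          · rw [ho v hv']
            exact h
      refine ⟨fun v h u hu a ha' => ?_, fun c h => hkeep c (hI.2 c h)⟩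
      rw [Q.S.tree.exists_lt_succ_iff] at h
      rcases h with h | rfl
      · exact hkeep (some (v, a, u)) (hI.1 v h u hu a ha')
      · show M4.real 7 _ a u = M4.real 7 N a u
        rw [hN]
        exact (hc u).1 hu a ha'
    · exact ⟨fun v h u hu a ha' => hI.1 v h u hu a ha', fun c h => by
        have := hI.2 c h
        rcases c with _ | ⟨v, a, u⟩ <;> exact this⟩
    · rintro _ ⟨j₁, hj₁, v, a, u, rfl, hv, hu, ha'⟩
      obtain rfl := Fin.ext hj₁
      exact h.1 v (Q.S.tree.mem_path_iff.1 hv) u hu a ha'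
  · rcases c with _ | ⟨v, a, u⟩ <;> exact h
  · have hN : (M1.mat 7 N : Matrix (Fin d) (Fin d) ℝ) = M.mat 7 N := h.2 none rfl
    refine ⟨hN, ?_⟩
    rintro v u ⟨j, hj, hu⟩ a
    refine Eq.trans ?_ (congrFun (congrFun hN a) u)
    by_cases ha : a ∈ Q.T.path u
    · exact h.1 j j.2 (some (v, a, u)) ⟨j, rfl, v, a, u, rfl, hj, hu, ha⟩
    · refine h.2 (some (v, a, u)) ?_
      show M.real 7 v a u = M.real 7 N a u
      rw [h0]
      exact (not_not.1 fun h => ha (hp a u h)).symm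

theorem Runs.initJ (hT : P.IsEliminationTree Q.T) (hS : Q.S.IsBalanced Q.T) (tab : Tables Q M)
    {K : ℕ} (hK : ∀ i, P.size i ≤ K) {x : P.Point} (hx : HoldsPoint M x)
    (hσ : M.real 14 0 0 0 = 1) (hb : (M.vec 11 : Fin d → ℝ) = 0) (h8 : M.real 8 = fun _ _ _ => 0)
    (hrow : ∀ v ∈ Q.S.upper, NodeInv Q M v) :
    Runs P.oracle Cmd.initJ M (m * (blockCost Q K + 36) + 31) fun M1 =>
      (M1.vec 11 : Fin d → ℝ) = 0 ∧ (∀ v ∈ Q.S.upper, NodeInv Q M1 v) ∧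
      ∀ (v : Fin N) (q : Fin r) (u : Fin d), M1.real 8 v q u = Q.jMatrix x v q u := by
  refine (forCount (n := m) (B := blockCost Q K) (fun n M1 => (M1.vec 11 : Fin d → ℝ) = 0 ∧
    (∀ v ∈ Q.S.upper, NodeInv Q M1 v) ∧ ∀ (v : Fin N) (q : Fin r) (u : Fin d), M1.real 8 v q u =
      ∑ l ∈ Finset.range n, pad (fun i => ∑ k, Q.Φ q ⟨i, k⟩ *
        (Q.S.colLabel v).indicator (fun _ => (1 : ℝ)) ⟨i, k⟩ * P.G x u ⟨i, k⟩) l) (by decide)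
    (by decide) (fun M1 ha => ?_) ?_ (fun n M1 hn ha hn₁ ⟨hb₁, hN, hJ⟩ => ?_)
    fun n M1 l ⟨hb₁, hN, hJ⟩ => ⟨hb₁, fun v hv => (hN v hv).congr (fun _ _ => rfl) rfl, hJ⟩).mono
    le_rfl fun M1 ha ⟨hb₁, hN, hJ⟩ => ⟨hb₁, hN, fun v q u => ?_⟩
  · rw [eval_get, ha.nat 0]
    exact tab.m_eq
  · refine ⟨hb, fun v hv => (hrow v hv).congr (fun _ _ => rfl) rfl, fun v q u => ?_⟩
    rw [Finset.sum_range_zero]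
    exact congrFun (congrFun (congrFun h8 v) q) u
  · refine (Runs.blockTerm (i := ⟨n, hn⟩) (σ := 1) hT hS (tab.of_agree ha)
      (hK _) ((hx.congr (ha.real 0)) _) hn₁
      (ha.real_eq hσ) hb₁ hN).mono le_rfl fun M2 _ ⟨hb₂, hN₂, hJ₂⟩ =>
      ⟨hb₂, hN₂, fun v q u => ?_⟩
    rw [hJ₂, hJ, one_mul, Finset.sum_range_succ,
      show pad _ n = _ from pad_fin (k := m) _ ⟨n, hn⟩]
  · rw [hJ, sum_range_pad, SketchParams.jMatrix_apply, Fintype.sum_sigma]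

/-- The number of steps of `initProg` for blocks of size at most `K`. -/
noncomputable def initCost (Q : SketchParams P r N) (K : ℕ) : ℕ :=
  tableCost Q K + (20 + ((m * (cholCost Q K + 36) + 31) +
    ((20 + (d * (20 + Q.S.tree.height * (Q.T.height * (Q.T.height * 200 + 72) + 100) + 36) + 31)) +
      (m * (blockCost Q K + 36) + 31))))

theorem SketchParams.inputTables_inputMem (Q : SketchParams P r N) (x : P.Point) (h : Fin d → ℝ) :
    InputTables Q (Q.inputMem x h) where
  d_eq := rfl
  m_eq := rfl
  r_eq := rfl
  N_eq := rfl
  size := pad_fin P.size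
  rowLeaf := pad_fin fun u => (Q.S.rowLeaf u : ℕ)
  colLeaf i k := by simp only [inputMem, pad_fin]
  A u i k := by simp only [inputMem, pad_fin]
  Φ q i k := by simp only [inputMem, pad_fin]

/-- The initial `J`, `Z` and `y` are zero, which is consistent with any factor. -/
theorem Runs.init (hT : P.IsEliminationTree Q.T) (hS : Q.S.IsBalanced Q.T) {K : ℕ}
    (hK : ∀ i, P.size i ≤ K) {x : P.Point} (hx : P.Feasible x) (h : Fin d → ℝ) :
    Runs P.oracle Cmd.initProg (Q.inputMem x h) (initCost Q K) fun M1 =>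
      Represents Q M1 (Q.start x h) := by
  have hspec := hT.chol_spec hx
  have hn : ∀ a, 7 ≤ a → (Q.inputMem x h).nat a = fun _ _ _ => 0 := fun a ha => by
    obtain ⟨b, rfl⟩ := Nat.exists_eq_add_of_le' ha
    rfl
  refine seq ((Runs.initTables (K := K) hS (Q.inputTables_inputMem x h) hK
    (pad_fin fun u => (Q.T.parent u : ℕ)) (pad_fin fun v => (Q.S.tree.parent v : ℕ))
    (pad_fin fun p => (Q.S.order p : ℕ)) hn).mono le_rfl fun M1 ha1 tab1 _ => ?_)
  have hx₁ : HoldsPoint M1 x := fun i k => by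
    rw [ha1.real 0]
    simp only [SketchParams.inputMem, pad_fin]
  refine seq (block fun ha2 => ?_)
  have hσ : (Cmd.den P.oracle (Cmd.assignReal 14 (.const 1)) M1).real 14 0 0 0 = 1 := by simp
  generalize Cmd.den P.oracle (Cmd.assignReal 14 (.const 1)) M1 = M2 at ha2 hσ ⊢
  have tab2 := tab1.of_agree ha2
  have hz : ∀ a ∈ [7, 8, 9, 10, 11], M2.real a = fun _ _ _ => 0 := fun a ha => by
    simp only [List.mem_cons, List.not_mem_nil, or_false] at ha
    rcases ha with rfl | rfl | rfl | rfl | rfl <;>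
      rw [ha2.real _, ha1.real _] <;> rfl
  refine seq ((Runs.initFactor hT tab2 hK (hx₁.congr (ha2.real 0)) hx hσ
    (by ext a u; show M2.real 7 N a u = 0; rw [hz 7 (by decide)])
    (by ext u; show M2.real 11 u 0 0 = 0; rw [hz 11 (by decide)])).mono le_rfl
    fun M3 ha3 ⟨hb₃, hL₃, ho₃⟩ _ => ?_)
  have tab3 := tab2.of_agree ha3
  refine seq ((Runs.spread tab3 (hL₃ ▸ hspec.1) fun v => by
    rw [ho₃ v v.2.ne, hz 7 (by decide)]).mono le_rfl fun M4 ha4 ⟨hN₄, hc₄⟩ _ => ?_)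
  have tab4 := tab3.of_agree ha4
  have hx₄ : HoldsPoint M4 x := ((hx₁.congr (ha2.real 0)).congr
    (ha3.real 0)).congr (ha4.real 0)
  have hc : ∀ v : Fin N, ∀ u ∈ Q.S.support Q.T v, ∀ a : Fin d, M4.real 7 v a u = P.chol x a u :=
    fun v u hu a => (hc₄ v u hu a).trans (congrFun (congrFun hL₃ a) u)
  have hz₄ : ∀ a, a = 8 ∨ a = 9 ∨ a = 10 → M4.real a = fun _ _ _ => 0 := fun a ha => by
    rcases ha with rfl | rfl | rfl <;>
      rw [ha4.real _, ha3.real _, hz _ (by decide)]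
  have hrow₀ : ∀ a, a = 8 ∨ a = 9 ∨ a = 10 → ∀ v q, (M4.row a v q : Fin d → ℝ) = 0 :=
    fun a ha v q => by ext u; show M4.real a v q u = 0; rw [hz₄ a ha]
  refine (Runs.initJ hT hS tab4 hK hx₄ (by
      rw [ha4.real 14, ha3.real 14]; exact hσ)
    (by rw [Mem.vec_congr (ha4.real 11)]; exact hb₃) (hz₄ 8 (by simp)) fun v hv =>
    ⟨fun u hu => ⟨fun a ha => (hc v u hu a).trans (hspec.1.eq_zero ha), ?_⟩, fun q =>
      ⟨fun u hu => ?_, ?_, ?_⟩⟩).mono le_rfl fun M5 ha5 ⟨hb₅, hN₅, hJ₅⟩ => ?_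
  · rw [show M4.mat 7 v u u = P.chol x u u from hc v u hu u]
    exact (hspec.2.1 u).ne'
  · rw [hrow₀ 9 (by simp)]
    rfl
  · rw [hrow₀ 9 (by simp), hrow₀ 8 (by simp), Matrix.mulVec_zero]
  · rw [hrow₀ 9 (by simp), hz₄ 10 (by simp)]
    simp [SketchParams.lamSum]
  · have e7 : M5.real 7 = M4.real 7 := ha5.real 7
    have en : ∀ a, a = 23 ∨ a = 24 → M5.nat a = fun _ _ _ => 0 := fun a ha => by
      rcases ha with rfl | rfl <;> rw [ha5.nat _, ha4.nat _,
        ha3.nat _, ha2.nat _, ha1.nat _, hn _ (by decide)]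
    refine { inv := SketchParams.Inv.start hT hx h
             tables := tab4.of_agree ha5
             x := hx₄.congr (ha5.real 0)
             h := by
              ext u
              show M5.real 1 u 0 0 = h u
              rw [ha5.real 1, ha4.real 1, ha3.real 1,
                ha2.real 1, ha1.real 1]
              exact pad_fin h u
             ℓ := by rw [en 24 (by simp)]; rfl
             L := by rw [Mem.mat_congr (congrFun e7 N), hN₄, hL₃]; rfl
             J := fun v q => funext fun u => hJ₅ v q u
             t := fun v _ => by rw [en 23 (by simp)]; rfl
             node := hN₅
             col := fun v _ u hu a => by rw [e7]; exact hc v u hu a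
             work := hb₅ }

/-! ### The numbers of steps -/

variable {K : ℕ}

/-- Every monomial in the number of steps divides `K² τ² r η`, where `η` is the height of the sampling
tree. -/
theorem stepCost_le (hr : 1 ≤ r) (hK : 1 ≤ K) : stepCost Q K + 36 ≤
    20000 * (K ^ 2 * Q.T.height ^ 2 * r * Q.S.tree.height) := by
  have hτ := Q.T.height_pos
  have hη := Q.S.tree.height_pos
  unfold stepCost blockCost cholCost nodeCost
  generalize Q.T.height = τ at *
  generalize Q.S.tree.height = η at *
  have hX : 0 < K ^ 2 * τ ^ 2 * r * η := by positivity
  have dvd : ∀ a b : ℕ, K ^ 2 * τ ^ 2 * r * η = a * b → a ≤ K ^ 2 * τ ^ 2 * r * η :=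
    fun a b h => Nat.le_of_dvd hX ⟨b, h⟩
  linarith [dvd (K * τ * K) (τ * r * η) (by ring), dvd (K * τ) (K * τ * r * η) (by ring),
    dvd K (K * τ ^ 2 * r * η) (by ring), dvd (K * η * r * τ ^ 2) K (by ring),
    dvd (K * η * r * τ) (K * τ) (by ring), dvd (K * η) (K * τ ^ 2 * r) (by ring),
    dvd (K * τ ^ 2) (K * r * η) (by ring), dvd (η * r * τ ^ 2) (K ^ 2) (by ring),
    dvd (η * r * τ) (K ^ 2 * τ) (by ring), dvd (η * τ ^ 2) (K ^ 2 * r) (by ring),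
    dvd (η * τ) (K ^ 2 * τ * r) (by ring), dvd η (K ^ 2 * τ ^ 2 * r) (by ring)]

theorem initCost_le (hr : 1 ≤ r) (hK : 1 ≤ K) (hn : 0 < P.n) (hm : m ≤ P.n) : initCost Q K ≤
    20000 * (P.n * (K ^ 2 * Q.T.height ^ 2 * r * Q.S.tree.height)) := by
  have hτ := Q.T.height_pos
  have hη := Q.S.tree.height_pos
  have hd := P.d_le_n
  unfold initCost tableCost blockCost cholCost
  generalize Q.T.height = τ at *
  generalize Q.S.tree.height = η at *
  generalize P.n = n at *
  have hX : 0 < n * (K ^ 2 * τ ^ 2 * r * η) := by positivity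
  have dvd : ∀ e ≤ n, ∀ a b : ℕ, K ^ 2 * τ ^ 2 * r * η = a * b →
      e * a ≤ n * (K ^ 2 * τ ^ 2 * r * η) := fun e he a b h =>
    Nat.mul_le_mul he (Nat.le_of_dvd (Nat.pos_of_mul_pos_left hX) ⟨b, h⟩)
  linarith [dvd d hd τ (K ^ 2 * τ * r * η) (by ring), dvd d hd η (K ^ 2 * τ ^ 2 * r) (by ring),
    dvd d hd 1 _ (one_mul _).symm, dvd d hd (η * τ) (K ^ 2 * τ * r) (by ring),
    dvd d hd (η * τ ^ 2) (K ^ 2 * r) (by ring),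
    dvd m hm (K * η) (K * τ ^ 2 * r) (by ring), dvd m hm K (K * τ ^ 2 * r * η) (by ring),
    dvd m hm 1 _ (one_mul _).symm, dvd m hm (K * τ * K) (τ * r * η) (by ring),
    dvd m hm (K * τ) (K * τ * r * η) (by ring), dvd m hm (K * η * r * τ ^ 2) K (by ring),
    dvd m hm (K * η * r * τ) (K * τ) (by ring), dvd m hm (K * τ ^ 2) (K * r * η) (by ring)]

/-- A list of changed blocks is no longer than the number of changed coordinates. -/
theorem ConvexData.length_le_diffCount (P : ConvexData d m) {x x₁ : P.Point} {l : List (Fin m)}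
    (hl : l.Nodup) (h : ∀ i ∈ l, x₁ i ≠ x i) : l.length ≤ P.diffCount x x₁ := by
  classical
  rw [← List.toFinset_card_of_nodup hl, ← Set.ncard_coe_finset]
  refine (Set.ncard_le_ncard (fun i hi => ?_) ((Set.toFinite _).image _)).trans
    (Set.ncard_image_le (f := Sigma.fst) (Set.toFinite {c : P.Coord | x₁ c.1 c.2 ≠ x c.1 c.2}))
  obtain ⟨k, hk⟩ := Function.ne_iff.1 (h i (List.mem_toFinset.1 hi))
  exact ⟨⟨i, k⟩, hk, rfl⟩

end Programs

theorem mainTheorem9 :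
    -- Balanced sampling trees exist, are sampling trees (their nodes with an empty label aside),
    -- and have logarithmic height.
    (∃ C : ℝ, ∀ (d m : ℕ) (P : ConvexData d m) (T : ParentTree (Fin d)),
      P.IsEliminationTree T → 2 ≤ P.n →
        (∃ (N : ℕ) (S : TreeData P N), S.IsBalanced T) ∧
        ∀ (N : ℕ) (S : TreeData P N), S.IsBalanced T →
          IsSamplingTree S.tree {v | (S.colLabel v).Nonempty} S.colLabel 2 ∧
          (S.tree.height : ℝ) ≤ C * Real.log P.n) ∧
    -- Three fixed programs implement BalancedSketch within the stated numbers of steps.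
    ∃ initProg updateProg queryProg : Cmd, ∀ K : ℕ, ∃ C : ℝ,
      ∀ (d m r N : ℕ) (P : ConvexData d m) (Q : SketchParams P r N),
        (∀ i, P.size i ≤ K) → P.IsEliminationTree Q.T → Q.S.IsBalanced Q.T → 2 ≤ P.n → 1 ≤ r →
        ∃ (lay : Layout d m r N) (Rep : Mem → Sketch P r N → Prop),
          (∀ M D, Rep M D → lay.Holds Q.S M D) ∧
          -- Initialize
          (∀ (x : P.Point) (h : Fin d → ℝ), P.Feasible x →
            ∃ (t : ℕ) (M : Mem),
              Exec P.oracle initProg (Q.inputMem x h) t M ∧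
              (t : ℝ) ≤ C * (P.n * Q.T.height ^ 2 * r * Real.log P.n) ∧
              Rep M (Q.start x h)) ∧
          -- Update
          (∀ (M : Mem) (D : Sketch P r N) (x : P.Point) (h : Fin d → ℝ)
            (lx : List (Fin m)) (lh : List (Fin d)),
            Rep M D → P.Feasible x →
            lx.Nodup → (∀ i, i ∈ lx ↔ x i ≠ D.x i) →
            lh.Nodup → (∀ j, j ∈ lh ↔ h j ≠ D.h j) →
            ∃ (t : ℕ) (M1 : Mem),
              Exec P.oracle updateProg (M.passUpdate x h lx lh) t M1 ∧
              (t : ℝ) ≤ C * (P.diffCount D.x x * Q.T.height ^ 2 * r * Real.log P.n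
                + {j | h j ≠ D.h j}.ncard * r * Real.log P.n + 1) ∧
              (Q.update x h lx lh D).x = x ∧ (Q.update x h lx lh D).h = h ∧
              Rep M1 (Q.update x h lx lh D)) ∧
          -- Query
          (∀ (M : Mem) (D : Sketch P r N) (v : Fin N), Rep M D →
            ∃ (t : ℕ) (M1 : Mem),
              Exec P.oracle queryProg (M.passQuery v) t M1 ∧
              (t : ℝ) ≤ C * (Q.T.height ^ 2 * r) ∧
              M1.output = (Q.query v D).1 ∧
              M1.output = Q.sketchAt D.x D.h v ∧
              Rep M1 (Q.query v D).2) := by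
  refine ⟨⟨12, fun d m P T _ hn => ⟨exists_isBalanced P T, fun N S hS =>
    ⟨hS.isSamplingTree (by omega), hS.height_le_log hn⟩⟩⟩, Cmd.initProg, Cmd.updateProg,
    Cmd.queryProg, fun K => ⟨240000 * (K ^ 2 + 1), fun d m r N P Q hK hT hS hn hr => ?_⟩⟩
  have hlog : (Q.S.tree.height : ℝ) ≤ 12 * Real.log P.n := hS.height_le_log hn
  have hlog₀ : 0 ≤ Real.log P.n := by positivity
  have hτ : (1 : ℝ) ≤ Q.T.height := by exact_mod_cast Q.T.height_pos
  have hr₁ : (1 : ℝ) ≤ r := by exact_mod_cast hr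
  have hm : m ≤ P.n := by
    simpa [ConvexData.n] using Finset.card_nsmul_le_sum Finset.univ P.size 1 fun i _ => P.size_pos i
  have hK₁ : 1 ≤ K := by
    rcases Nat.eq_zero_or_pos K with rfl | h
    · have : P.n = 0 := Finset.sum_eq_zero fun i _ => Nat.le_zero.1 (hK i)
      omega
    · exact h
  refine ⟨sketchLayout d m r N, Represents Q, fun M D h => h.holds hT, fun x h hx => ?_,
    fun M D x h lx lh hD hx hnx hlx hnh hlh => ?_, fun M D v hD => ?_⟩
  -- `12 log n` bounds the height of the tree, and `20000 = 240000 / 12` is from the counts of steps.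
  · obtain ⟨t, M, he, ht, hR⟩ := Runs.init hT hS hK hx h
    refine ⟨t, M, he, ?_, hR⟩
    have h₁ : (t : ℝ) ≤ 20000 * (P.n * (K ^ 2 * Q.T.height ^ 2 * r * Q.S.tree.height)) := by
      exact_mod_cast ht.trans (initCost_le hr hK₁ (by omega) hm)
    calc (t : ℝ) ≤ _ := h₁
      _ ≤ 20000 * (P.n * (K ^ 2 * Q.T.height ^ 2 * r * (12 * Real.log P.n))) := by gcongr
      _ = 240000 * K ^ 2 * (P.n * Q.T.height ^ 2 * r * Real.log P.n) := by ring
      _ ≤ _ := by gcongr; linarith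
  · obtain ⟨t, M1, he, ht, hR⟩ := Runs.update hT hS hD hK hx hlx hnh hlh
    obtain ⟨-, hx₁⟩ := hD.inv.update hT hS hx hlx hnh hlh
    refine ⟨t, M1, he, ?_, hx₁, rfl, hR⟩
    have hη := Q.S.tree.height_pos
    have hs := stepCost_le (Q := Q) hr hK₁
    have hc : Q.S.tree.height * (r * 86 + 200) + 76 ≤ 20000 * (r * Q.S.tree.height) := by
      nlinarith [Nat.mul_le_mul hr hη, Nat.mul_le_mul_right Q.S.tree.height hr]
    have hlx₁ := P.length_le_diffCount hnx fun i hi => (hlx i).1 hi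
    have hlh₁ : lh.length ≤ {j | h j ≠ D.h j}.ncard := by
      rw [← List.toFinset_card_of_nodup hnh, ← Set.ncard_coe_finset]
      exact Set.ncard_le_ncard (fun j hj => (hlh j).1 (List.mem_toFinset.1 hj)) (Set.toFinite _)
    have h₁ : (t : ℝ) ≤ P.diffCount D.x x * (20000 * (K ^ 2 * Q.T.height ^ 2 * r *
        Q.S.tree.height)) + {j | h j ≠ D.h j}.ncard * (20000 * (r * Q.S.tree.height)) + 62 := by
      exact_mod_cast ht.trans (Nat.add_le_add_right (Nat.add_le_add (Nat.mul_le_mul hlx₁ hs)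
        (Nat.mul_le_mul hlh₁ hc)) _)
    calc (t : ℝ) ≤ _ := h₁
      _ ≤ P.diffCount D.x x * (20000 * (K ^ 2 * Q.T.height ^ 2 * r * (12 * Real.log P.n))) +
          {j | h j ≠ D.h j}.ncard * (20000 * (r * (12 * Real.log P.n))) + 62 := by gcongr
      _ = 240000 * K ^ 2 * (P.diffCount D.x x * Q.T.height ^ 2 * r * Real.log P.n) +
          240000 * ({j | h j ≠ D.h j}.ncard * r * Real.log P.n) + 62 := by ring
      _ ≤ 240000 * (K ^ 2 + 1) * (P.diffCount D.x x * Q.T.height ^ 2 * r * Real.log P.n) +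
          240000 * (K ^ 2 + 1) * ({j | h j ≠ D.h j}.ncard * r * Real.log P.n) +
          240000 * (K ^ 2 + 1) * 1 := by
        have hK₀ : (0 : ℝ) ≤ K ^ 2 := by positivity
        gcongr <;> linarith
      _ = _ := by ring
  · obtain ⟨t, M1, he, ht, ho, hR⟩ := Runs.query (O := P.oracle) hT hS hD v
    refine ⟨t, M1, he, ?_, ho.trans (hD.inv.query_fst hT hS v).symm, ho, hR⟩
    have h₁ : (t : ℝ) ≤ (r + 1) * (Q.T.height * (Q.T.height * 4000 + 4000)) := by
      exact_mod_cast ht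
    calc (t : ℝ) ≤ _ := h₁
      _ ≤ (r + r) * (Q.T.height * (Q.T.height * 4000 + Q.T.height * 4000)) := by
        gcongr
        linarith
      _ = 16000 * (Q.T.height ^ 2 * r) := by ring
      _ ≤ _ := by
        gcongr
        nlinarith [sq_nonneg (K : ℝ)]
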